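/- **Setting.** Let $\alpha\in\mathbb R$, $0<T\le\infty$, and let $I=[0,T]$ if $T<\infty$, $I=[0,\infty)$ if $T=\infty$. Let $u(x,t)$ be a complex function on $x\ge 0$, $t\in I$, smooth up to the boundary (the restriction of a smooth function on $\mathbb R^2$), all of whose derivatives decay faster than any power of $x$ as $x\to\infty$, locally uniformly in $t\in I$. Suppose that $$u_{tx}+u-2iu_x-u_{xx}+i|u|^2u_x=0\qquad (x>0,\ 0<t<T),$$ $$u(x,0)=u_0(x)\ (x>0),\qquad u_x(0,t)=e^{i\alpha}u(0,t)\ (0\le t<T).$$ **Spectral functions.** For $\zeta$ in the closed first and third quadrants let $(b(\zeta),a(\zeta))^{T}=f(0)$, where $f=(f_1,f_2)^T$ is the unique bounded continuous solution on $[0,\infty)$ of $$f_1(x)=-\int_x^\infty e^{2i\zeta^2(y-x)}(V f)_1(y)\,dy,\qquad f_2(x)=1-\int_x^\infty (Vf)_2(y)\,dy,$$ $$V(y)=\begin{pmatrix}-\frac i2|u_0'|^2&\zeta u_0'e^{-i\int_0^y|u_0'|^2}\\ \zeta \overline{u_0'}e^{i\int_0^y|u_0'|^2}&\frac i2|u_0'|^2\end{pmatrix}.$$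 Put $$n(\zeta)=\frac{e^{i\alpha}+2i\zeta^2}{i+2e^{i\alpha}\zeta^2},\qquad \mathcal D(\zeta)=a(\zeta)\overline{a\big(\tfrac1{2\bar\zeta}\big)}-b(\zeta)\overline{b\big(\tfrac1{2\bar\zeta}\big)}\,n(\zeta),\qquad \tilde\Gamma(\zeta)=\frac{n(\zeta)\overline{b(\frac1{2\bar\zeta})}}{a(\zeta)\mathcal D(\zeta)},$$ where for $e^{i\alpha}=\pm i$ the function $n$ is the constant $\pm1$ (removable singularities filled in). Let $D_1,D_2$ be the parts of the open first and third quadrants where $|\zeta|>1/\sqrt2$, respectively $|\zeta|<1/\sqrt2$, and $D_4,D_3$ the corresponding parts of the open second and fourth quadrants. Let $P$ be the set of the zeros and poles of $n$; it is empty if $e^{i\alpha}=\pm i$, and otherwise it consists of four points on $|\zeta|=1/\sqrt2$ off the axes. **Assumptions.** (i) The zeros of $a$ in $D_1\cup D_2$ are simple. (ii) The zeros of $\mathcal D$ in $D_2$ are simple. (iii) $a$ and $\mathcal D$ have no common zero in $D_2$. (iv) On the part of the contour $\mathbb R\cup i\mathbb R\cup\{|\zeta|=1/\sqrt2\}$ in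 the closed first and third quadrants, $a$ has no zero, and $\mathcal D$ has no zero except possibly at $\zeta=0$ and at points of $P$, where no condition is imposed on it. **Deformed regions.** For $\varepsilon>0$ let $\Omega_1,\Omega_4$ be obtained from $D_1,D_4$ by adding the points of the open first and third, respectively second and fourth, quadrants at distance $<\varepsilon$ from $P$, and $\Omega_2,\Omega_3$ from $D_2,D_3$ by removing the points at distance $\le\varepsilon$ from $P$. (If $e^{i\alpha}=\pm i$, then $\Omega_j=D_j$.) **Riemann–Hilbert problem** at $(x,t)$. Let $\theta=\zeta^2x+\eta^2t$, $\eta=\zeta-\frac1{2\zeta}$, and $$\tilde J_1=\begin{pmatrix}1&0\\ \tilde\Gamma(\zeta)e^{2i\theta}&1\end{pmatrix},\quad \tilde J_3=\begin{pmatrix}1&-\overline{\tilde\Gamma(\bar\zeta)}e^{-2i\theta}\\0&1\end{pmatrix},\quad \tilde J_4=\begin{pmatrix}1&-\frac{b(\zeta)}{\overline{a(\bar\zeta)}}e^{-2i\theta}\\ \frac{\overline{b(\bar\zeta)}}{a(\zeta)}e^{2i\theta}&\frac1{a(\zeta)\overline{a(\bar\zeta)}}\end{pmatrix},\quad \tilde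 J_2=\tilde J_3\tilde J_4^{-1}\tilde J_1 .$$ Let $\zeta_j$ be the zeros of $a$ in $\Omega_1$ and $\lambda_j$ the zeros of $\mathcal D$ in $\Omega_2$. Find $2\times2$ matrix functions $\tilde M_k$ on $\Omega_k$ ($k=1,\dots,4$) such that: * the first column of $\tilde M_1$ (of $\tilde M_2$) is holomorphic off the points $\zeta_j$ (off $\lambda_j$), the second column of $\tilde M_4$ (of $\tilde M_3$) is holomorphic off $\bar\zeta_j$ (off $\bar\lambda_j$), the other columns are holomorphic, and all of them extend continuously to $\overline{\Omega_k}$ without these points; * $\tilde M_2=\tilde M_1\tilde J_1$ on $\overline{\Omega_1}\cap\overline{\Omega_2}$, $\tilde M_2=\tilde M_3\tilde J_2$ on $\overline{\Omega_2}\cap\overline{\Omega_3}\setminus\{0\}$, $\tilde M_4=\tilde M_3\tilde J_3$ on $\overline{\Omega_3}\cap\overline{\Omega_4}$, $\tilde M_4=\tilde M_1\tilde J_4$ on $\overline{\Omega_4}\cap\overline{\Omega_1}$; * $\tilde M_k=I+O(1/\zeta)$ as $\zeta\to\infty$ in $\Omega_k$; * at the points $\zeta_j,\bar\zeta_j,\lambda_j,\bar\lambda_j$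 the poles are at most simple, and with $[\,\cdot\,]_i$ denoting the $i$-th column $$\operatorname*{Res}_{\zeta_j}[\tilde M_1]_1=\frac{e^{2i\theta(\zeta_j)}}{\dot a(\zeta_j)b(\zeta_j)}[\tilde M_1(\zeta_j)]_2,\qquad \operatorname*{Res}_{\bar\zeta_j}[\tilde M_4]_2=\frac{e^{-2i\theta(\bar\zeta_j)}}{\overline{\dot a(\zeta_j)b(\zeta_j)}}[\tilde M_4(\bar\zeta_j)]_1,$$ $$\operatorname*{Res}_{\lambda_j}[\tilde M_2]_1=\operatorname*{Res}_{\lambda_j}\tilde\Gamma\; e^{2i\theta(\lambda_j)}[\tilde M_2(\lambda_j)]_2,\qquad \operatorname*{Res}_{\bar\lambda_j}[\tilde M_3]_2=\operatorname*{Res}_{\zeta=\bar\lambda_j}\overline{\tilde\Gamma(\bar\zeta)}\; e^{-2i\theta(\bar\lambda_j)}[\tilde M_3(\bar\lambda_j)]_1 .$$ **Theorem.** There is $\varepsilon_0>0$ such that for every $0<\varepsilon<\varepsilon_0$ and all $x\ge0$, $t\in I$ this problem, which involves only $a$, $b$ and $\alpha$, has a unique solution $\tilde M(x,t,\cdot)$.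 The limit $$m(x,t)=\lim_{\zeta\to\infty}\big(\zeta\tilde M(x,t,\zeta)\big)_{12}$$ exists for $\zeta\in\overline{\Omega_1}$, and, if $x>0$, with the same value along every closed sector with vertex $0$ (without its vertex) inside the open second and fourth quadrants. The function $|m|^2$ is differentiable in $t$, with $(|m|^2)_t(\cdot,t)$ integrable on $(x,\infty)$, there is a function $\varphi$ with $\varphi(0,0)=0$ and $$d\varphi=\Delta:=2|m|^2dx-2\Big(\int_x^\infty(|m|^2)_t\,dx'\Big)dt ,$$ and $u$ is recovered by $$u(x,t)=-\int_x^\infty 2i\,m(x',t)\,e^{2i\varphi(x',t)}\,dx'\qquad(x\ge0,\ t\in I),\qquad \varphi(x,t)=\int_{(0,0)}^{(x,t)}\Delta ,$$ with an absolutely convergent integral. -/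

import Mathlib

namespace GNLS

open Complex Filter Topology MeasureTheory Set Bornology
open scoped ComplexConjugate ContDiff Matrix

/-- Partial derivative in the first (space) variable. -/
noncomputable def dx (u : ℝ → ℝ → ℂ) (x t : ℝ) : ℂ := deriv (fun y => u y t) x

/-- Partial derivative in the second (time) variable. -/
noncomputable def dt (u : ℝ → ℝ → ℂ) (x t : ℝ) : ℂ := deriv (fun s => u x s) t

/-- The closed time interval: `[0, T]` if `T` is finite and `[0, ∞)` if `T = ∞`. -/
def timeInterval (T : EReal) : Set ℝ := {t | 0 ≤ t ∧ (t : EReal) ≤ T}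

/-- Smoothness up to the boundary of the half-strip `x ≥ 0`, `t ∈ timeInterval T` (in the form: `u`
is the restriction of a smooth function on the plane; its values off the half-strip play no role),
and Schwartz decay of all derivatives as `x → ∞`, locally uniformly in `t`. No decay in `t` is
required. -/
structure SmoothDecaying (T : EReal) (u : ℝ → ℝ → ℂ) : Prop where
  smooth : ContDiff ℝ ∞ (fun p : ℝ × ℝ => u p.1 p.2)
  decay : ∀ (i j k : ℕ) (T' : ℝ), ∃ C : ℝ, ∀ x t : ℝ, 0 ≤ x → t ∈ timeInterval T → t ≤ T' →
    x ^ k * ‖dt^[j] (dx^[i] u) x t‖ ≤ C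

/-- The equation `u_tx + u - 2 i u_x - u_xx + i |u|² u_x = 0` for `0 < x`, `0 < t < T`. -/
def SolvesEquation (T : EReal) (u : ℝ → ℝ → ℂ) : Prop :=
  ∀ x t : ℝ, 0 < x → 0 < t → (t : EReal) < T →
    dt (dx u) x t + u x t - 2 * I * dx u x t - dx (dx u) x t
      + I * (‖u x t‖ : ℂ) ^ 2 * dx u x t = 0

/-! ### The spectral functions of the initial datum -/

/-- The coefficient matrix of the `x`-part of the Lax pair at time zero. -/
noncomputable def V1 (u₀ : ℝ → ℂ) (ζ : ℂ) (x : ℝ) : Matrix (Fin 2) (Fin 2) ℂ :=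
  let p : ℂ := deriv u₀ x
  let φ : ℂ := ((∫ y in (0 : ℝ)..x, ‖deriv u₀ y‖ ^ 2 : ℝ) : ℂ)
  !![-(I / 2) * (‖p‖ : ℂ) ^ 2, ζ * p * exp (-I * φ);
     ζ * conj p * exp (I * φ), (I / 2) * (‖p‖ : ℂ) ^ 2]

/-- `f` is the second column of the bounded solution `μ₃(x, ζ)` of the Volterra equation
`μ₃(x) = 1 + ∫_∞^x exp(i ζ² (y - x) σ₃) V₁(y) μ₃(y) exp(-i ζ² (y - x) σ₃) dy`, `x ≥ 0`.
In this column the conjugation multiplies the first entry by `exp(2 i ζ² (y - x))` and leaves the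
second entry unchanged. -/
structure IsMu3Column (u₀ : ℝ → ℂ) (ζ : ℂ) (f : ℝ → Fin 2 → ℂ) : Prop where
  cont : ContinuousOn f (Ici 0)
  bdd : ∃ C : ℝ, ∀ x : ℝ, 0 ≤ x → ‖f x‖ ≤ C
  eq_fst : ∀ x : ℝ, 0 ≤ x →
    f x 0 = -∫ y in Ioi x, exp (2 * I * ζ ^ 2 * ((y : ℂ) - x)) * (V1 u₀ ζ y *ᵥ f y) 0
  eq_snd : ∀ x : ℝ, 0 ≤ x → f x 1 = 1 - ∫ y in Ioi x, (V1 u₀ ζ y *ᵥ f y) 1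

/-- The second column of `μ₃(x, ζ)`, for `ζ` in the closed first and third quadrants. On `x ≥ 0` it
is determined by `IsMu3Column`. -/
noncomputable def mu3 (u₀ : ℝ → ℂ) (ζ : ℂ) : ℝ → Fin 2 → ℂ :=
  Classical.epsilon (IsMu3Column u₀ ζ)

/-- The spectral function `a`. -/
noncomputable def specA (u₀ : ℝ → ℂ) (ζ : ℂ) : ℂ := mu3 u₀ ζ 0 1

/-- The spectral function `b`. -/
noncomputable def specB (u₀ : ℝ → ℂ) (ζ : ℂ) : ℂ := mu3 u₀ ζ 0 0

/-! ### The data of the Riemann-Hilbert problem -/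

/-- The point `1 / (2 ζ̄)`. -/
noncomputable def refl (ζ : ℂ) : ℂ := 1 / (2 * conj ζ)

/-- `n(ζ) = (e^{iα} + 2 i ζ²) / (i + 2 e^{iα} ζ²)`. If `e^{iα} = ± i`, that is `cos α = 0`, numerator
and denominator are proportional and `n` is the constant `± 1 = sin α`; in this case the removable
singularities are filled in. -/
noncomputable def nFun (α : ℝ) (ζ : ℂ) : ℂ :=
  open Classical in
  if Real.cos α = 0 then (Real.sin α : ℂ)
  else (exp (I * α) + 2 * I * ζ ^ 2) / (I + 2 * exp (I * α) * ζ ^ 2)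

/-- `𝒟(ζ) = a(ζ) conj(a(1/(2ζ̄))) - b(ζ) conj(b(1/(2ζ̄))) n(ζ)`. -/
noncomputable def calD (α : ℝ) (a b : ℂ → ℂ) (ζ : ℂ) : ℂ :=
  a ζ * conj (a (refl ζ)) - b ζ * conj (b (refl ζ)) * nFun α ζ

/-- `Γ̃(ζ) = n(ζ) conj(b(1/(2ζ̄))) / (a(ζ) 𝒟(ζ))`. -/
noncomputable def gammaTilde (α : ℝ) (a b : ℂ → ℂ) (ζ : ℂ) : ℂ :=
  nFun α ζ * conj (b (refl ζ)) / (a ζ * calD α a b ζ)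

noncomputable def eta (ζ : ℂ) : ℂ := ζ - 1 / (2 * ζ)

noncomputable def theta (x t : ℝ) (ζ : ℂ) : ℂ := ζ ^ 2 * x + eta ζ ^ 2 * t

noncomputable def J1 (Γ : ℂ → ℂ) (x t : ℝ) (ζ : ℂ) : Matrix (Fin 2) (Fin 2) ℂ :=
  !![1, 0; Γ ζ * exp (2 * I * theta x t ζ), 1]

noncomputable def J3 (Γ : ℂ → ℂ) (x t : ℝ) (ζ : ℂ) : Matrix (Fin 2) (Fin 2) ℂ :=
  !![1, -conj (Γ (conj ζ)) * exp (-2 * I * theta x t ζ); 0, 1]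

noncomputable def J4 (a b : ℂ → ℂ) (x t : ℝ) (ζ : ℂ) : Matrix (Fin 2) (Fin 2) ℂ :=
  !![1, -(b ζ / conj (a (conj ζ))) * exp (-2 * I * theta x t ζ);
     conj (b (conj ζ)) / a ζ * exp (2 * I * theta x t ζ), 1 / (a ζ * conj (a (conj ζ)))]

noncomputable def J2 (a b Γ : ℂ → ℂ) (x t : ℝ) (ζ : ℂ) : Matrix (Fin 2) (Fin 2) ℂ :=
  J3 Γ x t ζ * (J4 a b x t ζ)⁻¹ * J1 Γ x t ζ

/-- The open sets `D₁, D₂, D₃, D₄` (with indices `0, 1, 2, 3`). The first and third quadrants,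
`arg ζ ∈ (0, π/2) ∪ (π, 3π/2)`, are described by `re ζ * im ζ > 0`. -/
noncomputable def D : Fin 4 → Set ℂ
  | 0 => {ζ | 0 < ζ.re * ζ.im ∧ 1 / √2 < ‖ζ‖}
  | 1 => {ζ | 0 < ζ.re * ζ.im ∧ ‖ζ‖ < 1 / √2}
  | 2 => {ζ | ζ.re * ζ.im < 0 ∧ ‖ζ‖ < 1 / √2}
  | 3 => {ζ | ζ.re * ζ.im < 0 ∧ 1 / √2 < ‖ζ‖}

/-- The zeros and poles of `n`; there are none if `e^{iα} = ± i`. -/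
def zerosPoles (α : ℝ) : Set ℂ :=
  {p | Real.cos α ≠ 0 ∧ (exp (I * α) + 2 * I * p ^ 2 = 0 ∨ I + 2 * exp (I * α) * p ^ 2 = 0)}

/-- The regions bounded by the deformed contour. The closed `ε`-discs around the zeros and poles of
`n` are taken away from `D₂ ∪ D₃` and the open discs are added to `D₁ ∪ D₄`. If `e^{iα} = ± i`, these
are the sets `D j`. -/
noncomputable def region (α ε : ℝ) : Fin 4 → Set ℂ
  | 0 => {ζ | 0 < ζ.re * ζ.im ∧ (1 / √2 < ‖ζ‖ ∨ ∃ p ∈ zerosPoles α, dist ζ p < ε)}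
  | 1 => {ζ | 0 < ζ.re * ζ.im ∧ ‖ζ‖ < 1 / √2 ∧ ∀ p ∈ zerosPoles α, ε < dist ζ p}
  | 2 => {ζ | ζ.re * ζ.im < 0 ∧ ‖ζ‖ < 1 / √2 ∧ ∀ p ∈ zerosPoles α, ε < dist ζ p}
  | 3 => {ζ | ζ.re * ζ.im < 0 ∧ (1 / √2 < ‖ζ‖ ∨ ∃ p ∈ zerosPoles α, dist ζ p < ε)}

/-- The part of the undeformed contour (both axes and the circle `|ζ| = 1/√2`) that lies in the
closed first and third quadrants, where `a` and `b` are defined. -/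
def contour : Set ℂ :=
  {ζ | 0 ≤ ζ.re * ζ.im ∧ (ζ.re * ζ.im = 0 ∨ ‖ζ‖ = 1 / √2)}

/-! ### The Riemann-Hilbert problem -/

/-- `f` has at `p` at most a simple pole, with residue `r` (for `f` holomorphic near `p` except
at `p`). -/
def HasSimpleResidue (f : ℂ → ℂ) (p r : ℂ) : Prop :=
  Tendsto (fun ζ => (ζ - p) * f ζ) (𝓝[≠] p) (𝓝 r)

/-- The points at which column `c` of the restriction of the solution to region `j` may have a pole:
the first column at the zeros of `a` in region `0` and of `d` in region `1`, the second column at the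
complex conjugates of these points. -/
def poles (Ω : Fin 4 → Set ℂ) (a d : ℂ → ℂ) : Fin 4 → Fin 2 → Set ℂ
  | 0, 0 => {ζ | ζ ∈ Ω 0 ∧ a ζ = 0}
  | 1, 0 => {ζ | ζ ∈ Ω 1 ∧ d ζ = 0}
  | 2, 1 => {ζ | conj ζ ∈ Ω 1 ∧ d (conj ζ) = 0}
  | 3, 1 => {ζ | conj ζ ∈ Ω 0 ∧ a (conj ζ) = 0}
  | _, _ => ∅

/-- The Riemann-Hilbert problem at `(x, t)` with regions `Ω` and data `a`, `b`, `d`, `Γ`. A sectionally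
meromorphic function is given by its restrictions `M j` to the regions, together with their
continuous boundary values. -/
structure IsRHSolution (Ω : Fin 4 → Set ℂ) (a b d Γ : ℂ → ℂ) (x t : ℝ)
    (M : Fin 4 → ℂ → Matrix (Fin 2) (Fin 2) ℂ) : Prop where
  holomorphic : ∀ j i c, DifferentiableOn ℂ (fun ζ => M j ζ i c) (Ω j \ poles Ω a d j c)
  continuous : ∀ j i c, ContinuousOn (fun ζ => M j ζ i c) (closure (Ω j) \ poles Ω a d j c)
  jump1 : ∀ ζ ∈ closure (Ω 0) ∩ closure (Ω 1), M 1 ζ = M 0 ζ * J1 Γ x t ζ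
  jump2 : ∀ ζ ∈ closure (Ω 1) ∩ closure (Ω 2), ζ ≠ 0 → M 1 ζ = M 2 ζ * J2 a b Γ x t ζ
  jump3 : ∀ ζ ∈ closure (Ω 2) ∩ closure (Ω 3), M 3 ζ = M 2 ζ * J3 Γ x t ζ
  jump4 : ∀ ζ ∈ closure (Ω 3) ∩ closure (Ω 0), M 3 ζ = M 0 ζ * J4 a b x t ζ
  normalization : ∀ j i c,
    (fun ζ => M j ζ i c - (1 : Matrix (Fin 2) (Fin 2) ℂ) i c)
      =O[cobounded ℂ ⊓ 𝓟 (Ω j)] (fun ζ => ζ⁻¹)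
  residue1 : ∀ p ∈ Ω 0, a p = 0 → ∀ i, HasSimpleResidue (fun ζ => M 0 ζ i 0) p
    (1 / (deriv a p * b p) * exp (2 * I * theta x t p) * M 0 p i 1)
  residue2 : ∀ p ∈ Ω 0, a p = 0 → ∀ i, HasSimpleResidue (fun ζ => M 3 ζ i 1) (conj p)
    (1 / conj (deriv a p * b p) * exp (-2 * I * theta x t (conj p)) * M 3 (conj p) i 0)
  residue3 : ∀ p ∈ Ω 1, d p = 0 → ∃ r : ℂ, HasSimpleResidue Γ p r ∧
    ∀ i, HasSimpleResidue (fun ζ => M 1 ζ i 0) p (r * exp (2 * I * theta x t p) * M 1 p i 1)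
  residue4 : ∀ p ∈ Ω 1, d p = 0 →
    ∃ r : ℂ, HasSimpleResidue (fun ζ => conj (Γ (conj ζ))) (conj p) r ∧
    ∀ i, HasSimpleResidue (fun ζ => M 2 ζ i 1) (conj p)
      (r * exp (-2 * I * theta x t (conj p)) * M 2 (conj p) i 0)

/-- `M` is the unique solution of the Riemann-Hilbert problem; the values of a column at its possible
poles are irrelevant. -/
def IsUniqueRHSolution (Ω : Fin 4 → Set ℂ) (a b d Γ : ℂ → ℂ) (x t : ℝ)
    (M : Fin 4 → ℂ → Matrix (Fin 2) (Fin 2) ℂ) : Prop :=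
  IsRHSolution Ω a b d Γ x t M ∧
    ∀ N, IsRHSolution Ω a b d Γ x t N →
      ∀ j i c, ∀ ζ ∈ closure (Ω j) \ poles Ω a d j c, N j ζ i c = M j ζ i c

/-- `m = lim (ζ M(ζ))₁₂` as `ζ → ∞`: in the closure of the region containing `D₁` without
restriction, and, if `x > 0`, also in every closed sector inside the open second and fourth
quadrants. -/
def IsCoefficientAtInfinity (Ω : Fin 4 → Set ℂ) (x : ℝ)
    (M : Fin 4 → ℂ → Matrix (Fin 2) (Fin 2) ℂ) (m : ℂ) : Prop :=
  Tendsto (fun ζ => ζ * M 0 ζ 0 1) (cobounded ℂ ⊓ 𝓟 (closure (Ω 0))) (𝓝 m) ∧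
    (0 < x → ∀ δ : ℝ, 0 < δ →
      Tendsto (fun ζ => ζ * M 3 ζ 0 1)
        (cobounded ℂ ⊓ 𝓟 {ζ | ζ ∈ Ω 3 ∧ δ * ‖ζ‖ ^ 2 ≤ -(ζ.re * ζ.im)}) (𝓝 m))

/-- The reconstruction formula
`u(x,t) = -∫_x^∞ 2 i m(x',t) exp(2 i φ(x',t)) dx'`, where `φ(x,t)` is the integral from `(0,0)` to
`(x,t)` of the one-form `Δ = 2 |m|² dx - 2 (∫_x^∞ (|m|²)_t dx') dt`. That `φ` is this integral, along
any path, is expressed by `φ(0,0) = 0` and `dφ = Δ`; `q` stands for `(|m|²)_t`. -/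
def Reconstructs (T : EReal) (m u : ℝ → ℝ → ℂ) : Prop :=
  ∃ φ q : ℝ → ℝ → ℝ, φ 0 0 = 0 ∧ ∀ x t : ℝ, 0 ≤ x → t ∈ timeInterval T →
    HasDerivWithinAt (fun s => ‖m x s‖ ^ 2) (q x t) (timeInterval T) t ∧
    IntegrableOn (fun y => q y t) (Ioi x) ∧
    HasDerivWithinAt (fun y => φ y t) (2 * ‖m x t‖ ^ 2) (Ici 0) x ∧
    HasDerivWithinAt (fun s => φ x s) (-2 * ∫ y in Ioi x, q y t) (timeInterval T) t ∧
    IntegrableOn (fun y => 2 * I * m y t * exp (2 * I * φ y t)) (Ioi x) ∧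
    u x t = -∫ y in Ioi x, 2 * I * m y t * exp (2 * I * φ y t)

end GNLS

namespace GNLS

open Complex Filter Topology MeasureTheory Set Bornology
open scoped ComplexConjugate ContDiff Matrix

/-! ### Energy estimates for linear systems of two equations -/

/-! The equation is the compatibility condition of a Lax pair. After a diagonal gauge by the phase
`½ ∫₀ˣ |u_x|²`, the space part has the coefficients `offDiag - 2 i ζ² diag(1, 0)`. Its solution
tending to `(0, 1)` as `x → ∞` is `jost`; up to a unimodular constant it is `column`. It exists for
`ζ` in the closed first and third quadrants, is holomorphic inside, and equals `(b, a)` at the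
origin `(0, 0)` (`spec_eq_jost`). Because it is normalised at infinity, where `u` and `u_x` vanish,
it satisfies the time part as well (`hasDerivWithinAt_jost`). It serves as the second column of the
solution everywhere in the first and third quadrants.

Two first columns are needed, and both are transported from `(0, 0)` to `(x, t)` by the Lax pair
(`exists_transport`). The outer one starts from `(1, 0)`; it is holomorphic off `ζ = 0` and behaves
well at infinity. The inner one starts from `boundaryColumn`, and here the boundary condition
enters. At `x = 0` the map `ζ ↦ 1/(2ζ)` sends `η` to `-η` and multiplies the off-diagonal entry of
the time part by `n(ζ)` (`nFun_mul`). Hence, if the column at `1/(2ζ̄)` is conjugated, its entries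
are exchanged and one of them is multiplied by `n`, the result again solves the time part
(`boundaryColumn_isSol`). It is known at every time without reference to a final time, so neither
decay in `t` nor finiteness of `T` matters. At each time it tends to `(1, 0)` as `ζ → 0`, where the
transport matrix itself is in general singular.

The determinants of the two starting vectors with `(b, a)` are `a` and `𝒟`. Dividing by them gives
`outerSol` and `innerSol`. All jumps reduce to linear relations between vectors in the plane
(`jump_one`, `jump_four`, `jump_two`), and the residues reflect that at a zero of `a` or `𝒟` the two
columns are parallel. The second and fourth quadrants follow by the symmetry `conjSwap`. Inside the
small discs around the points of `P` only the outer column is used, so the poles of `n` never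
appear.

Uniqueness: for two solutions `N`, `M`, the antisymmetric pairing of a row of `N` with a row of `M`
is unchanged by jumps of determinant one, and equal residue conditions cancel in it. Continuous
functions that are holomorphic off lines and circles are holomorphic, so Liouville's theorem makes
the pairing constant (`eq_const_of_glue`), and its values determine `N` from `M`
(`eq_of_wronskian`).

Reconstruction: the expansions at infinity (`jost_asymptotics`, `IsLargeSystem.asymptotics`) give `m
= -(i/2) u_x exp(-2iφ)` with `φ` the phase. The conservation law `(|u_x|²)_t = (|u_x|² - |u|²)_x`
identifies `dφ` with `Δ`, and integrating `u_x` from infinity recovers `u`. -/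

lemma abs_inner_linear_sub_le (y z m n r : ℂ) :
    |inner ℝ y (m * y + n * z + r) - m.re * ‖y‖ ^ 2| ≤ ‖n‖ * ‖y‖ * ‖z‖ + ‖r‖ * ‖y‖ := by
  have h : inner ℝ y (m * y + n * z + r) - m.re * ‖y‖ ^ 2 = ((n * z + r) * conj y).re := by
    rw [Complex.inner, ← Complex.normSq_eq_norm_sq, Complex.normSq_apply]
    simp only [mul_re, mul_im, add_re, add_im, conj_re, conj_im]
    ring
  rw [h]
  refine (abs_re_le_norm _).trans ?_
  rw [norm_mul, RCLike.norm_conj]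
  have := norm_add_le (n * z) r
  rw [norm_mul] at this
  nlinarith [norm_nonneg y]

/-- Forward energy estimate on `[0, X]`. -/
lemma energy_forward {X C ρ : ℝ} (hC : 0 ≤ C)
    {y₁ y₂ m₁₁ m₁₂ m₂₁ m₂₂ r₁ r₂ : ℝ → ℂ}
    (hc₁ : ContinuousOn y₁ (Icc 0 X)) (hc₂ : ContinuousOn y₂ (Icc 0 X))
    (hd₁ : ∀ s ∈ Ioo 0 X, HasDerivAt y₁ (m₁₁ s * y₁ s + m₁₂ s * y₂ s + r₁ s) s)
    (hd₂ : ∀ s ∈ Ioo 0 X, HasDerivAt y₂ (m₂₂ s * y₂ s + m₂₁ s * y₁ s + r₂ s) s)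
    (h₁₁ : ∀ s ∈ Ioo 0 X, (m₁₁ s).re ≤ C) (h₂₂ : ∀ s ∈ Ioo 0 X, (m₂₂ s).re ≤ C)
    (h₁₂ : ∀ s ∈ Ioo 0 X, ‖m₁₂ s‖ ≤ C) (h₂₁ : ∀ s ∈ Ioo 0 X, ‖m₂₁ s‖ ≤ C)
    (hr₁ : ∀ s ∈ Ioo 0 X, ‖r₁ s‖ ≤ ρ) (hr₂ : ∀ s ∈ Ioo 0 X, ‖r₂ s‖ ≤ ρ) {x : ℝ}
    (hx : x ∈ Icc 0 X) :
    ‖y₁ x‖ ^ 2 + ‖y₂ x‖ ^ 2 ≤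
      (‖y₁ 0‖ ^ 2 + ‖y₂ 0‖ ^ 2 + ρ ^ 2) * Real.exp ((4 * C + 2) * X) := by
  -- Adding `ρ ^ 2` absorbs the inhomogeneity, since `2 ρ (|y₁| + |y₂|) ≤ |y₁|² + |y₂|² + 2 ρ²`.
  -- Diagonal and off-diagonal entries contribute `2 C` each, whence the rate `4 C + 2`. Only the
  -- real parts of the diagonal entries enter, so a large damping or oscillating term costs nothing.
  set N : ℝ → ℝ := fun s => (‖y₁ s‖ ^ 2 + ‖y₂ s‖ ^ 2 + ρ ^ 2) * Real.exp (-((4 * C + 2) * s)) with hN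
  have hanti : AntitoneOn N (Icc 0 X) := by
    refine antitoneOn_of_hasDerivWithinAt_nonpos (f' := fun s =>
      (2 * inner ℝ (y₁ s) (m₁₁ s * y₁ s + m₁₂ s * y₂ s + r₁ s) +
        2 * inner ℝ (y₂ s) (m₂₂ s * y₂ s + m₂₁ s * y₁ s + r₂ s)) *
          Real.exp (-((4 * C + 2) * s)) +
        (‖y₁ s‖ ^ 2 + ‖y₂ s‖ ^ 2 + ρ ^ 2) *
          (Real.exp (-((4 * C + 2) * s)) * (-((4 * C + 2) * 1)))) (convex_Icc _ _) ?_ ?_ ?_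
    · fun_prop
    · intro s hs
      rw [interior_Icc] at hs
      exact (((((hd₁ s hs).norm_sq).add ((hd₂ s hs).norm_sq)).add_const (ρ ^ 2)).mul
        (((hasDerivAt_id s).const_mul (4 * C + 2)).neg.exp)).hasDerivWithinAt
    · intro s hs
      rw [interior_Icc] at hs
      have e₁ := (abs_le.1 (abs_inner_linear_sub_le (y₁ s) (y₂ s) (m₁₁ s) (m₁₂ s) (r₁ s))).2
      have e₂ := (abs_le.1 (abs_inner_linear_sub_le (y₂ s) (y₁ s) (m₂₂ s) (m₂₁ s) (r₂ s))).2
      have n₁ := norm_nonneg (y₁ s)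
      have n₂ := norm_nonneg (y₂ s)
      have f₁ : ‖m₁₂ s‖ * ‖y₁ s‖ * ‖y₂ s‖ ≤ C * (‖y₁ s‖ * ‖y₂ s‖) := by
        rw [mul_assoc]; exact mul_le_mul_of_nonneg_right (h₁₂ s hs) (by positivity)
      have f₂ : ‖m₂₁ s‖ * ‖y₂ s‖ * ‖y₁ s‖ ≤ C * (‖y₂ s‖ * ‖y₁ s‖) := by
        rw [mul_assoc]; exact mul_le_mul_of_nonneg_right (h₂₁ s hs) (by positivity)
      have g₁ : ‖r₁ s‖ * ‖y₁ s‖ ≤ ρ * ‖y₁ s‖ := mul_le_mul_of_nonneg_right (hr₁ s hs) n₁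
      have g₂ : ‖r₂ s‖ * ‖y₂ s‖ ≤ ρ * ‖y₂ s‖ := mul_le_mul_of_nonneg_right (hr₂ s hs) n₂
      have k₁ : (m₁₁ s).re * ‖y₁ s‖ ^ 2 ≤ C * ‖y₁ s‖ ^ 2 :=
        mul_le_mul_of_nonneg_right (h₁₁ s hs) (by positivity)
      have k₂ : (m₂₂ s).re * ‖y₂ s‖ ^ 2 ≤ C * ‖y₂ s‖ ^ 2 :=
        mul_le_mul_of_nonneg_right (h₂₂ s hs) (by positivity)
      have hE := Real.exp_pos (-((4 * C + 2) * s))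
      have key : 2 * inner ℝ (y₁ s) (m₁₁ s * y₁ s + m₁₂ s * y₂ s + r₁ s) +
        2 * inner ℝ (y₂ s) (m₂₂ s * y₂ s + m₂₁ s * y₁ s + r₂ s) ≤
          (4 * C + 2) * (‖y₁ s‖ ^ 2 + ‖y₂ s‖ ^ 2 + ρ ^ 2) := by
        nlinarith [sq_nonneg (‖y₁ s‖ - ‖y₂ s‖), sq_nonneg (‖y₁ s‖ - ρ), sq_nonneg (‖y₂ s‖ - ρ),
          mul_nonneg hC (sq_nonneg (‖y₁ s‖ - ‖y₂ s‖)), mul_nonneg hC (sq_nonneg ρ)]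
      nlinarith
  have h0 : N x ≤ N 0 := hanti ⟨le_rfl, hx.1.trans hx.2⟩ hx hx.1
  simp only [hN, mul_zero, neg_zero, Real.exp_zero, mul_one] at h0
  rw [Real.exp_neg, ← div_eq_mul_inv, div_le_iff₀ (Real.exp_pos _)] at h0
  have h1 : Real.exp ((4 * C + 2) * x) ≤ Real.exp ((4 * C + 2) * X) :=
    Real.exp_le_exp.2 (mul_le_mul_of_nonneg_left hx.2 (by positivity))
  have h2 : 0 ≤ ‖y₁ 0‖ ^ 2 + ‖y₂ 0‖ ^ 2 + ρ ^ 2 := by positivity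
  nlinarith [sq_nonneg ρ, mul_le_mul_of_nonneg_left h1 h2]

/-- Backward energy estimate from infinity, with coefficients of size `1 / (1 + x²)`. -/
lemma energy_backward {C ρ : ℝ} (hC : 0 ≤ C)
    {y₁ y₂ m₁₁ m₁₂ m₂₁ m₂₂ r₁ r₂ : ℝ → ℂ}
    (hc₁ : ContinuousOn y₁ (Ici 0)) (hc₂ : ContinuousOn y₂ (Ici 0))
    (hd₁ : ∀ s ∈ Ioi 0, HasDerivAt y₁ (m₁₁ s * y₁ s + m₁₂ s * y₂ s + r₁ s) s)
    (hd₂ : ∀ s ∈ Ioi 0, HasDerivAt y₂ (m₂₂ s * y₂ s + m₂₁ s * y₁ s + r₂ s) s)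
    (h₁₁ : ∀ s ∈ Ioi 0, 0 ≤ (m₁₁ s).re) (h₂₂ : ∀ s ∈ Ioi 0, 0 ≤ (m₂₂ s).re)
    (h₁₂ : ∀ s ∈ Ioi 0, ‖m₁₂ s‖ ≤ C * (1 + s ^ 2)⁻¹)
    (h₂₁ : ∀ s ∈ Ioi 0, ‖m₂₁ s‖ ≤ C * (1 + s ^ 2)⁻¹)
    (hr₁ : ∀ s ∈ Ioi 0, ‖r₁ s‖ ≤ ρ * (1 + s ^ 2)⁻¹)
    (hr₂ : ∀ s ∈ Ioi 0, ‖r₂ s‖ ≤ ρ * (1 + s ^ 2)⁻¹)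
    (ht₁ : Tendsto y₁ atTop (𝓝 0)) (ht₂ : Tendsto y₂ atTop (𝓝 0)) {x : ℝ} (hx : 0 ≤ x) :
    ‖y₁ x‖ ^ 2 + ‖y₂ x‖ ^ 2 ≤ ρ ^ 2 * Real.exp ((2 * C + 2) * Real.pi) := by
  -- The derivative of `arctan` is the decay rate `1 / (1 + s²)` of the coefficients, so this
  -- integrating factor is bounded on the half-line and the estimate can start at infinity. The
  -- diagonal entries need only a sign, not a bound, which makes the estimate uniform in the
  -- spectral parameter.
  set N : ℝ → ℝ := fun s => (‖y₁ s‖ ^ 2 + ‖y₂ s‖ ^ 2 + ρ ^ 2) *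
    Real.exp ((2 * C + 2) * Real.arctan s) with hN
  have hmono : MonotoneOn N (Ici 0) := by
    refine monotoneOn_of_hasDerivWithinAt_nonneg (f' := fun s =>
      (2 * inner ℝ (y₁ s) (m₁₁ s * y₁ s + m₁₂ s * y₂ s + r₁ s) +
        2 * inner ℝ (y₂ s) (m₂₂ s * y₂ s + m₂₁ s * y₁ s + r₂ s)) *
          Real.exp ((2 * C + 2) * Real.arctan s) +
        (‖y₁ s‖ ^ 2 + ‖y₂ s‖ ^ 2 + ρ ^ 2) *
          (Real.exp ((2 * C + 2) * Real.arctan s) * ((2 * C + 2) * (1 / (1 + s ^ 2)))))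
          (convex_Ici _) ?_ ?_ ?_
    · exact (((hc₁.norm.pow 2).add (hc₂.norm.pow 2)).add continuousOn_const).mul
        (Real.continuous_exp.comp (continuous_const.mul Real.continuous_arctan)).continuousOn
    · intro s hs
      rw [interior_Ici] at hs
      exact (((((hd₁ s hs).norm_sq).add ((hd₂ s hs).norm_sq)).add_const (ρ ^ 2)).mul
        (((Real.hasDerivAt_arctan s).const_mul (2 * C + 2)).exp)).hasDerivWithinAt
    · intro s hs
      rw [interior_Ici] at hs
      have e₁ := (abs_le.1 (abs_inner_linear_sub_le (y₁ s) (y₂ s) (m₁₁ s) (m₁₂ s) (r₁ s))).1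
      have e₂ := (abs_le.1 (abs_inner_linear_sub_le (y₂ s) (y₁ s) (m₂₂ s) (m₂₁ s) (r₂ s))).1
      have n₁ := norm_nonneg (y₁ s)
      have n₂ := norm_nonneg (y₂ s)
      rw [one_div]
      set v := (1 + s ^ 2)⁻¹ with hv
      have hv0 : 0 < v := by positivity
      have f₁ : ‖m₁₂ s‖ * ‖y₁ s‖ * ‖y₂ s‖ ≤ C * v * (‖y₁ s‖ * ‖y₂ s‖) := by
        rw [mul_assoc]; exact mul_le_mul_of_nonneg_right (h₁₂ s hs) (by positivity)
      have f₂ : ‖m₂₁ s‖ * ‖y₂ s‖ * ‖y₁ s‖ ≤ C * v * (‖y₂ s‖ * ‖y₁ s‖) := by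
        rw [mul_assoc]; exact mul_le_mul_of_nonneg_right (h₂₁ s hs) (by positivity)
      have g₁ : ‖r₁ s‖ * ‖y₁ s‖ ≤ ρ * v * ‖y₁ s‖ := mul_le_mul_of_nonneg_right (hr₁ s hs) n₁
      have g₂ : ‖r₂ s‖ * ‖y₂ s‖ ≤ ρ * v * ‖y₂ s‖ := mul_le_mul_of_nonneg_right (hr₂ s hs) n₂
      have k₁ : 0 ≤ (m₁₁ s).re * ‖y₁ s‖ ^ 2 := mul_nonneg (h₁₁ s hs) (by positivity)
      have k₂ : 0 ≤ (m₂₂ s).re * ‖y₂ s‖ ^ 2 := mul_nonneg (h₂₂ s hs) (by positivity)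
      have hE := Real.exp_pos ((2 * C + 2) * Real.arctan s)
      have key : 0 ≤ 2 * inner ℝ (y₁ s) (m₁₁ s * y₁ s + m₁₂ s * y₂ s + r₁ s) +
        2 * inner ℝ (y₂ s) (m₂₂ s * y₂ s + m₂₁ s * y₁ s + r₂ s) +
          (2 * C + 2) * v * (‖y₁ s‖ ^ 2 + ‖y₂ s‖ ^ 2 + ρ ^ 2) := by
        have q₁ : 0 ≤ C * v * (‖y₁ s‖ - ‖y₂ s‖) ^ 2 := by positivity
        have q₂ : 0 ≤ v * (‖y₁ s‖ - ρ) ^ 2 := by positivity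
        have q₃ : 0 ≤ v * (‖y₂ s‖ - ρ) ^ 2 := by positivity
        have q₄ : 0 ≤ C * v * ρ ^ 2 := by positivity
        have q₅ : 0 ≤ v * (‖y₁ s‖ ^ 2 + ‖y₂ s‖ ^ 2) := by positivity
        linarith
      have := mul_nonneg key hE.le
      linarith
  have hlim : Tendsto N atTop (𝓝 ((‖(0 : ℂ)‖ ^ 2 + ‖(0 : ℂ)‖ ^ 2 + ρ ^ 2) *
      Real.exp ((2 * C + 2) * (Real.pi / 2)))) := by
    refine (((ht₁.norm.pow 2).add (ht₂.norm.pow 2)).add_const _).mul ?_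
    refine (Real.continuous_exp.tendsto _).comp (Tendsto.const_mul _ ?_)
    exact Real.tendsto_arctan_atTop.mono_right nhdsWithin_le_nhds
  have h0 : N x ≤ _ := ge_of_tendsto hlim (by
    filter_upwards [eventually_ge_atTop x] with z hz using hmono hx (hx.trans hz) hz)
  simp only [hN, norm_zero] at h0
  have h1 : 1 ≤ Real.exp ((2 * C + 2) * Real.arctan x) :=
    Real.one_le_exp (mul_nonneg (by positivity) (Real.arctan_nonneg.2 hx))
  have h2 : Real.exp ((2 * C + 2) * (Real.pi / 2)) ≤ Real.exp ((2 * C + 2) * Real.pi) :=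
    Real.exp_le_exp.2 (mul_le_mul_of_nonneg_left (by linarith [Real.pi_pos]) (by positivity))
  have h3 : 0 ≤ ‖y₁ x‖ ^ 2 + ‖y₂ x‖ ^ 2 := by positivity
  have h4 := mul_le_mul_of_nonneg_left h2 (sq_nonneg ρ)
  nlinarith [sq_nonneg ρ]

/-- `y` solves the linear system with coefficient matrix `A` on `[0, X]`. -/
structure IsSol (A : ℝ → Matrix (Fin 2) (Fin 2) ℂ) (X : ℝ) (y : ℝ → Fin 2 → ℂ) : Prop where
  cont : ContinuousOn y (Icc 0 X)
  deriv : ∀ s ∈ Ioo 0 X, HasDerivAt y (A s *ᵥ y s) s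

lemma mulVec_zero_apply (A : Matrix (Fin 2) (Fin 2) ℂ) (v : Fin 2 → ℂ) :
    (A *ᵥ v) 0 = A 0 0 * v 0 + A 0 1 * v 1 := by
  simp [Matrix.mulVec, dotProduct, Fin.sum_univ_two]

lemma mulVec_one_apply (A : Matrix (Fin 2) (Fin 2) ℂ) (v : Fin 2 → ℂ) :
    (A *ᵥ v) 1 = A 1 0 * v 0 + A 1 1 * v 1 := by
  simp [Matrix.mulVec, dotProduct, Fin.sum_univ_two]

lemma hasDerivAt_fin_two {y : ℝ → Fin 2 → ℂ} {y' : Fin 2 → ℂ} {s : ℝ} :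
    HasDerivAt y y' s ↔
      HasDerivAt (fun s => y s 0) (y' 0) s ∧ HasDerivAt (fun s => y s 1) (y' 1) s := by
  rw [hasDerivAt_pi, Fin.forall_fin_two]

namespace IsSol

variable {A : ℝ → Matrix (Fin 2) (Fin 2) ℂ} {X : ℝ} {y z : ℝ → Fin 2 → ℂ}

lemma add (hy : IsSol A X y) (hz : IsSol A X z) : IsSol A X (fun s => y s + z s) :=
  ⟨hy.cont.add hz.cont, fun s hs => by
    rw [Matrix.mulVec_add]; exact (hy.deriv s hs).add (hz.deriv s hs)⟩

lemma sub (hy : IsSol A X y) (hz : IsSol A X z) : IsSol A X (fun s => y s - z s) :=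
  ⟨hy.cont.sub hz.cont, fun s hs => by
    rw [Matrix.mulVec_sub]; exact (hy.deriv s hs).sub (hz.deriv s hs)⟩

lemma smul (c : ℂ) (hy : IsSol A X y) : IsSol A X (fun s => c • y s) :=
  ⟨hy.cont.const_smul c, fun s hs => by
    rw [Matrix.mulVec_smul]; exact (hy.deriv s hs).const_smul c⟩

/-- A solution with zero initial value vanishes. -/
lemma eq_zero (hA : ∃ C, ∀ s ∈ Ioo 0 X, ∀ i j, ‖A s i j‖ ≤ C) (hy : IsSol A X y)
    (h0 : y 0 = 0) {x : ℝ} (hx : x ∈ Icc 0 X) : y x = 0 := by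
  obtain ⟨C, hC⟩ := hA
  have h := energy_forward (X := X) (C := max C 0) (ρ := 0) (le_max_right _ _)
    (y₁ := fun s => y s 0) (y₂ := fun s => y s 1)
    (m₁₁ := fun s => A s 0 0) (m₁₂ := fun s => A s 0 1) (m₂₁ := fun s => A s 1 0)
    (m₂₂ := fun s => A s 1 1) (r₁ := fun _ => 0) (r₂ := fun _ => 0)
    ((continuous_apply 0).comp_continuousOn hy.cont)
    ((continuous_apply 1).comp_continuousOn hy.cont)
    (fun s hs => by
      have := (hasDerivAt_fin_two.1 (hy.deriv s hs)).1
      rw [mulVec_zero_apply] at this; simpa using this)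
    (fun s hs => by
      have := (hasDerivAt_fin_two.1 (hy.deriv s hs)).2
      rw [mulVec_one_apply, add_comm] at this; simpa using this)
    (fun s hs => (re_le_norm _).trans ((hC s hs 0 0).trans (le_max_left _ _)))
    (fun s hs => (re_le_norm _).trans ((hC s hs 1 1).trans (le_max_left _ _)))
    (fun s hs => (hC s hs 0 1).trans (le_max_left _ _))
    (fun s hs => (hC s hs 1 0).trans (le_max_left _ _)) (by simp) (by simp) hx
  simp only [h0, Pi.zero_apply, norm_zero] at h
  have h' : ‖y x 0‖ ^ 2 + ‖y x 1‖ ^ 2 ≤ 0 := by simpa using h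
  have a0 : ‖y x 0‖ = 0 := by nlinarith [sq_nonneg ‖y x 0‖, sq_nonneg ‖y x 1‖]
  have a1 : ‖y x 1‖ = 0 := by nlinarith [sq_nonneg ‖y x 0‖, sq_nonneg ‖y x 1‖]
  ext i
  fin_cases i
  · exact norm_eq_zero.1 a0
  · exact norm_eq_zero.1 a1

lemma unique (hA : ∃ C, ∀ s ∈ Ioo 0 X, ∀ i j, ‖A s i j‖ ≤ C) (hy : IsSol A X y)
    (hz : IsSol A X z) (h0 : y 0 = z 0) {x : ℝ} (hx : x ∈ Icc 0 X) : y x = z x :=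
  sub_eq_zero.1 ((hy.sub hz).eq_zero hA (by simp [h0]) hx)

end IsSol

/-! ### Volterra equations with a holomorphic parameter -/

/-- Integrals of dominated families depending holomorphically on a parameter are holomorphic. -/
lemma differentiableOn_integral_of_dominated {E : Type*} [NormedAddCommGroup E] [NormedSpace ℂ E]
    [CompleteSpace E] {α : Type*} [MeasurableSpace α] {μ : Measure α} {U : Set ℂ} (hU : IsOpen U)
    {F : ℂ → α → E} {g : α → ℝ} (hmeas : ∀ ζ ∈ U, AEStronglyMeasurable (F ζ) μ)
    (hdiff : ∀ᵐ y ∂μ, DifferentiableOn ℂ (fun ζ => F ζ y) U)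
    (hbd : ∀ᵐ y ∂μ, ∀ ζ ∈ U, ‖F ζ y‖ ≤ g y) (hg : Integrable g μ) :
    DifferentiableOn ℂ (fun ζ => ∫ y, F ζ y ∂μ) U := by
  intro ζ₀ h₀
  obtain ⟨r, hr, hrU⟩ := Metric.isOpen_iff.1 hU ζ₀ h₀
  have hsub : ∀ ζ ∈ Metric.ball ζ₀ (r / 2), Metric.closedBall ζ (r / 4) ⊆ U := by
    intro ζ hζ z hz
    apply hrU
    rw [Metric.mem_ball] at hζ ⊢
    rw [Metric.mem_closedBall] at hz
    linarith [dist_triangle z ζ ζ₀]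
  have hbU : Metric.ball ζ₀ (r / 2) ⊆ U := fun z hz =>
    hsub z hz (Metric.mem_closedBall_self (by positivity))
  -- Measurability is assumed of `F ζ` only; the derivative inherits it as a limit of difference
  -- quotients along a sequence.
  have hF' : AEStronglyMeasurable (fun y => deriv (fun ζ => F ζ y) ζ₀) μ := by
    obtain ⟨h, hh⟩ : ∃ h : ℕ → ℂ, Tendsto h atTop (𝓝[≠] 0) ∧ ∀ n, ζ₀ + h n ∈ U := by
      refine ⟨fun n => ((r / 2 / (n + 2) : ℝ) : ℂ), ?_, ?_⟩
      · refine tendsto_nhdsWithin_iff.2 ⟨?_, Eventually.of_forall fun n => ?_⟩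
        · have : Tendsto (fun n : ℕ => (r / 2 / ((n : ℝ) + 2) : ℝ)) atTop (𝓝 0) := by
            refine Tendsto.div_atTop tendsto_const_nhds ?_
            exact tendsto_atTop_add_const_right _ _ tendsto_natCast_atTop_atTop
          exact_mod_cast (continuous_ofReal.tendsto 0).comp this
        · have : (r / 2 / ((n : ℝ) + 2)) ≠ 0 := by positivity
          simpa only [mem_compl_iff, mem_singleton_iff, ofReal_eq_zero] using this
      · intro n
        apply hbU
        have : (0 : ℝ) < r / 2 / ((n : ℝ) + 2) := by positivity
        rw [Metric.mem_ball, dist_self_add_left, norm_real, Real.norm_of_nonneg this.le]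
        exact div_lt_self (by positivity) (by linarith [(Nat.cast_nonneg n : (0 : ℝ) ≤ n)])
    refine aestronglyMeasurable_of_tendsto_ae atTop
      (f := fun n y => (h n)⁻¹ • (F (ζ₀ + h n) y - F ζ₀ y)) (fun n => ?_) ?_
    · exact ((hmeas _ (hh.2 n)).sub (hmeas _ h₀)).const_smul _
    · filter_upwards [hdiff] with y hy
      exact (hasDerivAt_iff_tendsto_slope_zero.1
        ((hy.differentiableAt (hU.mem_nhds h₀)).hasDerivAt)).comp hh.1
  -- Cauchy's estimate on circles of radius `r / 4`, which stay in `U` when the centre is within `r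
  -- / 2` of `ζ₀`, turns the bound `g` for the functions into a bound for their derivatives.
  have key := hasDerivAt_integral_of_dominated_loc_of_deriv_le (μ := μ) (F := F) (x₀ := ζ₀)
    (F' := fun ζ y => deriv (fun ζ => F ζ y) ζ) (bound := fun y => g y / (r / 4))
    (Metric.ball_mem_nhds ζ₀ (by positivity : 0 < r / 2))
    (by filter_upwards [hU.mem_nhds h₀] with ζ hζ using hmeas ζ hζ)
    (Integrable.mono' hg (hmeas _ h₀) (by filter_upwards [hbd] with y hy using hy _ h₀)) hF'
    (by
      filter_upwards [hdiff, hbd] with y hy hy' ζ hζ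
      refine norm_deriv_le_of_forall_mem_sphere_norm_le (by positivity) ?_
        (fun z hz => hy' z (hsub ζ hζ (Metric.sphere_subset_closedBall hz)))
      exact ((hy.mono (hsub ζ hζ)).mono Metric.closure_ball_subset_closedBall).diffContOnCl)
    (hg.div_const _)
    (by
      filter_upwards [hdiff] with y hy ζ hζ
      exact (hy.differentiableAt (hU.mem_nhds (hbU hζ))).hasDerivAt)
  exact key.2.differentiableAt.differentiableWithinAt

lemma norm_mulVec_le_of_entries {A : Matrix (Fin 2) (Fin 2) ℂ} {c : ℝ} (hA : ∀ i j, ‖A i j‖ ≤ c)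
    (v : Fin 2 → ℂ) : ‖A *ᵥ v‖ ≤ 2 * c * ‖v‖ := by
  have hc : 0 ≤ c := (norm_nonneg _).trans (hA 0 0)
  refine (pi_norm_le_iff_of_nonneg (by positivity)).2 fun i => ?_
  rw [Matrix.mulVec, dotProduct, Fin.sum_univ_two]
  refine (norm_add_le _ _).trans ?_
  rw [norm_mul, norm_mul]
  have h0 := mul_le_mul (hA i 0) (norm_le_pi_norm v 0) (norm_nonneg _) hc
  have h1 := mul_le_mul (hA i 1) (norm_le_pi_norm v 1) (norm_nonneg _) hc
  linarith

lemma aestronglyMeasurable_mulVec {μ : Measure ℝ} {A : ℝ → Matrix (Fin 2) (Fin 2) ℂ}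
    {v : ℝ → Fin 2 → ℂ} (hA : ∀ i j, AEStronglyMeasurable (fun y => A y i j) μ)
    (hv : AEStronglyMeasurable v μ) : AEStronglyMeasurable (fun y => A y *ᵥ v y) μ := by
  refine AEMeasurable.aestronglyMeasurable (aemeasurable_pi_iff.2 fun i => ?_)
  simp only [Matrix.mulVec, dotProduct, Fin.sum_univ_two]
  have hv' : ∀ j, AEMeasurable (fun y => v y j) μ := fun j => aemeasurable_pi_iff.1 hv.aemeasurable j
  exact ((hA i 0).aemeasurable.mul (hv' 0)).add ((hA i 1).aemeasurable.mul (hv' 1))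

/-- The weight in the convergence proof of the Neumann series. -/
noncomputable def volterraWeight (C s : ℝ) : ℝ := Real.exp (4 * C * (Real.pi / 2 - Real.arctan s))

lemma one_le_volterraWeight {C : ℝ} (hC : 0 ≤ C) (s : ℝ) : 1 ≤ volterraWeight C s :=
  Real.one_le_exp (mul_nonneg (by positivity) (sub_nonneg.2 (Real.arctan_lt_pi_div_two s).le))

lemma volterraWeight_le {C : ℝ} (hC : 0 ≤ C) {s : ℝ} (hs : 0 ≤ s) :
    volterraWeight C s ≤ volterraWeight C 0 := by
  refine Real.exp_le_exp.2 (mul_le_mul_of_nonneg_left ?_ (by positivity))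
  simpa using Real.arctan_nonneg.2 hs

/-- The integrand is the derivative of `-volterraWeight C / 2`, so the integral equals
`(volterraWeight C s - 1) / 2`. In the norm with this weight the Volterra operator is a contraction
with factor `1 / 2`, and no factorials are needed. -/
lemma integral_volterraWeight {C : ℝ} (hC : 0 ≤ C) (s : ℝ) :
    IntegrableOn (fun y => 2 * C * (1 + y ^ 2)⁻¹ * volterraWeight C y) (Ioi s) ∧
      ∫ y in Ioi s, 2 * C * (1 + y ^ 2)⁻¹ * volterraWeight C y ≤ volterraWeight C s / 2 := by
  have hd : ∀ y ∈ Ici s, HasDerivAt (fun y => -(volterraWeight C y / 2))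
      (2 * C * (1 + y ^ 2)⁻¹ * volterraWeight C y) y := by
    intro y _
    have := (((((Real.hasDerivAt_arctan y).const_sub (Real.pi / 2)).const_mul (4 * C)).exp).div_const
      2).neg
    refine this.congr_deriv ?_
    rw [volterraWeight]; ring
  have hlim : Tendsto (fun y => -(volterraWeight C y / 2)) atTop (𝓝 (-(1 / 2))) := by
    have h1 : Tendsto Real.arctan atTop (𝓝 (Real.pi / 2)) :=
      Real.tendsto_arctan_atTop.mono_right nhdsWithin_le_nhds
    have h2 := ((Real.continuous_exp.tendsto _).comp
      ((h1.const_sub (Real.pi / 2)).const_mul (4 * C))).div_const 2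
    simpa [volterraWeight] using h2.neg
  have hpos : ∀ y ∈ Ioi s, 0 ≤ 2 * C * (1 + y ^ 2)⁻¹ * volterraWeight C y := fun y _ =>
    mul_nonneg (by positivity) (zero_le_one.trans (one_le_volterraWeight hC y))
  refine ⟨integrableOn_Ioi_deriv_of_nonneg' hd hpos hlim, ?_⟩
  rw [integral_Ioi_of_hasDerivAt_of_nonneg' hd hpos hlim]
  linarith

/-- The iterates of the Volterra operator with kernel `K` on `(s, ∞)`. -/
noncomputable def volterraIter (K : ℂ → ℝ → ℝ → Matrix (Fin 2) (Fin 2) ℂ) (c : Fin 2 → ℂ) :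
    ℕ → ℂ → ℝ → Fin 2 → ℂ
  | 0 => fun _ _ => c
  | n + 1 => fun ζ s => ∫ y in Ioi s, K ζ s y *ᵥ volterraIter K c n ζ y

/-- Kernels of Volterra equations on the half-line. -/
structure IsVolterraKernel (K : ℂ → ℝ → ℝ → Matrix (Fin 2) (Fin 2) ℂ) (Z U : Set ℂ) (C : ℝ) :
    Prop where
  nonneg : 0 ≤ C
  isOpen : IsOpen U
  subset : U ⊆ Z
  bound : ∀ ζ ∈ Z, ∀ s y, 0 ≤ s → s < y → ∀ i j, ‖K ζ s y i j‖ ≤ C * (1 + y ^ 2)⁻¹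
  meas : ∀ ζ ∈ Z, ∀ s, 0 ≤ s → ∀ i j,
    AEStronglyMeasurable (fun y => K ζ s y i j) (volume.restrict (Ioi s))
  cont_left : ∀ ζ ∈ Z, ∀ y i j, ContinuousOn (fun s => K ζ s y i j) (Ico 0 y)
  cont_param : ∀ s y, 0 ≤ s → s < y → ∀ i j, ContinuousOn (fun ζ => K ζ s y i j) Z
  diff_param : ∀ s y, 0 ≤ s → s < y → ∀ i j, DifferentiableOn ℂ (fun ζ => K ζ s y i j) U

namespace IsVolterraKernel

variable {K : ℂ → ℝ → ℝ → Matrix (Fin 2) (Fin 2) ℂ} {Z U : Set ℂ} {C : ℝ}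

lemma norm_mulVec_le (hK : IsVolterraKernel K Z U C) {ζ : ℂ} (hζ : ζ ∈ Z) {s y : ℝ} (hs : 0 ≤ s)
    (hy : s < y) (v : Fin 2 → ℂ) : ‖K ζ s y *ᵥ v‖ ≤ 2 * C * (1 + y ^ 2)⁻¹ * ‖v‖ := by
  have := norm_mulVec_le_of_entries (hK.bound ζ hζ s y hs hy) v
  linarith

/-- The factor `1 / 2` per step is `integral_volterraWeight`. The regularity statements belong to
the same induction: each passes through the integral by domination, and the dominating function
comes from the bound. -/
lemma iter_props (hK : IsVolterraKernel K Z U C) (c : Fin 2 → ℂ) (n : ℕ) :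
    (∀ ζ ∈ Z, ∀ s, 0 ≤ s →
      ‖volterraIter K c n ζ s‖ ≤ ‖c‖ * (1 / 2) ^ n * volterraWeight C s) ∧
    (∀ ζ ∈ Z, ContinuousOn (volterraIter K c n ζ) (Ici 0)) ∧
    (∀ s, 0 ≤ s → ContinuousOn (fun ζ => volterraIter K c n ζ s) Z) ∧
    (∀ s, 0 ≤ s → DifferentiableOn ℂ (fun ζ => volterraIter K c n ζ s) U) := by
  induction n with
  | zero =>
    refine ⟨fun ζ _ s _ => ?_, fun _ _ => continuousOn_const, fun _ _ => continuousOn_const,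
      fun _ _ => differentiableOn_const _⟩
    simpa [volterraIter] using le_mul_of_one_le_right (norm_nonneg c) (one_le_volterraWeight hK.nonneg s)
  | succ n ih =>
    obtain ⟨ihb, ihc, ihp, ihd⟩ := ih
    set B : ℝ := ‖c‖ * (1 / 2) ^ n with hB
    have hB0 : 0 ≤ B := by positivity
    have hbd : ∀ ζ ∈ Z, ∀ s y, 0 ≤ s → s < y → ‖K ζ s y *ᵥ volterraIter K c n ζ y‖ ≤
        B * (2 * C * (1 + y ^ 2)⁻¹ * volterraWeight C y) := by
      intro ζ hζ s y hs hy
      refine (hK.norm_mulVec_le hζ hs hy _).trans ?_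
      have h1 := ihb ζ hζ y (hs.trans hy.le)
      have h2 : 0 ≤ 2 * C * (1 + y ^ 2)⁻¹ := by have := hK.nonneg; positivity
      calc _ ≤ 2 * C * (1 + y ^ 2)⁻¹ * (B * volterraWeight C y) := mul_le_mul_of_nonneg_left h1 h2
        _ = _ := by ring
    have hint : ∀ s, IntegrableOn (fun y => B * (2 * C * (1 + y ^ 2)⁻¹ * volterraWeight C y))
        (Ioi s) := fun s => (integral_volterraWeight hK.nonneg s).1.const_mul B
    have hmeas : ∀ ζ ∈ Z, ∀ s, 0 ≤ s → AEStronglyMeasurable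
        (fun y => K ζ s y *ᵥ volterraIter K c n ζ y) (volume.restrict (Ioi s)) := by
      intro ζ hζ s hs
      refine aestronglyMeasurable_mulVec (hK.meas ζ hζ s hs) ?_
      exact ((ihc ζ hζ).mono fun y hy => hs.trans (le_of_lt hy)).aestronglyMeasurable
        measurableSet_Ioi
    refine ⟨?_, ?_, ?_, ?_⟩
    · intro ζ hζ s hs
      have h1 : ‖∫ y in Ioi s, K ζ s y *ᵥ volterraIter K c n ζ y‖ ≤
          ∫ y in Ioi s, B * (2 * C * (1 + y ^ 2)⁻¹ * volterraWeight C y) := by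
        refine norm_integral_le_of_norm_le (hint s) ?_
        filter_upwards [ae_restrict_mem measurableSet_Ioi] with y hy using hbd ζ hζ s y hs hy
      refine h1.trans ?_
      rw [integral_const_mul]
      have := mul_le_mul_of_nonneg_left (integral_volterraWeight hK.nonneg s).2 hB0
      refine this.trans (le_of_eq ?_)
      rw [hB, pow_succ]; ring
    · intro ζ hζ
      -- Dominated convergence needs a fixed domain, so the lower limit is moved into an indicator.
      -- That indicator is discontinuous at `s₀` only for the single value `y = s₀`.
      have hrew : EqOn (volterraIter K c (n + 1) ζ) (fun s => ∫ y in Ioi (0 : ℝ),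
          (Ioi s).indicator (fun y => K ζ s y *ᵥ volterraIter K c n ζ y) y) (Ici 0) := by
        intro s hs
        simp only [volterraIter]
        rw [setIntegral_indicator measurableSet_Ioi,
          inter_eq_self_of_subset_right (Ioi_subset_Ioi hs)]
      refine ContinuousOn.congr ?_ hrew
      intro s₀ hs₀
      refine continuousWithinAt_of_dominated
        (bound := fun y => B * (2 * C * (1 + y ^ 2)⁻¹ * volterraWeight C y)) ?_ ?_ (hint 0) ?_
      · filter_upwards [self_mem_nhdsWithin] with s hs
        rw [aestronglyMeasurable_indicator_iff measurableSet_Ioi,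
          Measure.restrict_restrict measurableSet_Ioi,
          inter_eq_self_of_subset_left (Ioi_subset_Ioi hs)]
        exact hmeas ζ hζ s hs
      · filter_upwards [self_mem_nhdsWithin] with s hs
        filter_upwards with y
        by_cases hy : y ∈ Ioi s
        · rw [indicator_of_mem hy]; exact hbd ζ hζ s y hs hy
        · rw [indicator_of_notMem hy, norm_zero]
          have := zero_le_one.trans (one_le_volterraWeight hK.nonneg y)
          have := hK.nonneg
          positivity
      · have hne : ∀ᵐ y ∂(volume.restrict (Ioi (0 : ℝ))), y ≠ s₀ :=
          ae_restrict_of_ae (Measure.ae_ne volume s₀)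
        filter_upwards [hne] with y hy
        rcases lt_or_gt_of_ne hy with hlt | hgt
        · have : (fun s => (Ioi s).indicator (fun y => K ζ s y *ᵥ volterraIter K c n ζ y) y)
              =ᶠ[𝓝[Ici 0] s₀] fun _ => 0 := by
            filter_upwards [mem_nhdsWithin_of_mem_nhds (Ioi_mem_nhds hlt)] with s hs
            exact indicator_of_notMem (fun h => lt_asymm hs h) _
          refine (continuousWithinAt_const (b := 0)).congr_of_eventuallyEq this ?_
          exact indicator_of_notMem (fun h => lt_asymm hlt h) _
        · have : (fun s => (Ioi s).indicator (fun y => K ζ s y *ᵥ volterraIter K c n ζ y) y)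
              =ᶠ[𝓝[Ici 0] s₀] fun s => K ζ s y *ᵥ volterraIter K c n ζ y := by
            filter_upwards [mem_nhdsWithin_of_mem_nhds (Iio_mem_nhds hgt)] with s hs
            exact indicator_of_mem (show y ∈ Ioi s from hs) _
          refine ContinuousWithinAt.congr_of_eventuallyEq ?_ this
            (indicator_of_mem (show y ∈ Ioi s₀ from hgt) _)
          have hk : ∀ i j, ContinuousWithinAt (fun s => K ζ s y i j) (Ici 0) s₀ := by
            intro i j
            have := hK.cont_left ζ hζ y i j s₀ ⟨hs₀, hgt⟩
            refine this.mono_of_mem_nhdsWithin ?_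
            filter_upwards [self_mem_nhdsWithin,
              mem_nhdsWithin_of_mem_nhds (Iio_mem_nhds hgt)] with s h1 h2 using ⟨h1, h2⟩
          refine continuousWithinAt_pi.2 fun i => ?_
          simp only [Matrix.mulVec, dotProduct, Fin.sum_univ_two]
          exact ((hk i 0).mul continuousWithinAt_const).add ((hk i 1).mul continuousWithinAt_const)
    · intro s hs
      refine continuousOn_of_dominated
        (bound := fun y => B * (2 * C * (1 + y ^ 2)⁻¹ * volterraWeight C y))
        (fun ζ hζ => hmeas ζ hζ s hs) ?_ (hint s) ?_
      · intro ζ hζ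
        filter_upwards [ae_restrict_mem measurableSet_Ioi] with y hy using hbd ζ hζ s y hs hy
      · filter_upwards [ae_restrict_mem measurableSet_Ioi] with y hy
        refine continuousOn_pi.2 fun i => ?_
        simp only [Matrix.mulVec, dotProduct, Fin.sum_univ_two]
        have h := continuousOn_pi.1 (ihp y (hs.trans (le_of_lt hy)))
        exact ((hK.cont_param s y hs hy i 0).mul (h 0)).add ((hK.cont_param s y hs hy i 1).mul (h 1))
    · intro s hs
      refine differentiableOn_integral_of_dominated hK.isOpen
        (g := fun y => B * (2 * C * (1 + y ^ 2)⁻¹ * volterraWeight C y))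
        (fun ζ hζ => hmeas ζ (hK.subset hζ) s hs) ?_ ?_ (hint s)
      · filter_upwards [ae_restrict_mem measurableSet_Ioi] with y hy
        refine differentiableOn_pi.2 fun i => ?_
        simp only [Matrix.mulVec, dotProduct, Fin.sum_univ_two]
        have h := differentiableOn_pi.1 (ihd y (hs.trans (le_of_lt hy)))
        exact ((hK.diff_param s y hs hy i 0).mul (h 0)).add ((hK.diff_param s y hs hy i 1).mul (h 1))
      · filter_upwards [ae_restrict_mem measurableSet_Ioi] with y hy ζ hζ
        exact hbd ζ (hK.subset hζ) s y hs hy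

/-- Existence of bounded solutions of Volterra equations, with their dependence on the parameter. -/
theorem exists_solution (hK : IsVolterraKernel K Z U C) (c : Fin 2 → ℂ) :
    ∃ f : ℂ → ℝ → Fin 2 → ℂ,
      (∀ ζ ∈ Z, ∀ s, 0 ≤ s → ‖f ζ s‖ ≤ 2 * ‖c‖ * volterraWeight C 0) ∧
      (∀ ζ ∈ Z, ContinuousOn (f ζ) (Ici 0)) ∧
      (∀ s, 0 ≤ s → ContinuousOn (fun ζ => f ζ s) Z) ∧
      (∀ s, 0 ≤ s → DifferentiableOn ℂ (fun ζ => f ζ s) U) ∧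
      ∀ ζ ∈ Z, ∀ s, 0 ≤ s → f ζ s = c + ∫ y in Ioi s, K ζ s y *ᵥ f ζ y := by
  set W := volterraWeight C 0
  have hW : 0 ≤ W := zero_le_one.trans (one_le_volterraWeight hK.nonneg 0)
  set b : ℕ → ℝ := fun n => ‖c‖ * W * (1 / 2) ^ n
  have hb : Summable b := (summable_geometric_of_lt_one (by norm_num) (by norm_num)).mul_left _
  have hbs : ∑' n, b n = 2 * ‖c‖ * W := by
    rw [tsum_mul_left, tsum_geometric_of_lt_one (by norm_num) (by norm_num)]; ring
  have hle : ∀ n, ∀ ζ ∈ Z, ∀ s, 0 ≤ s → ‖volterraIter K c n ζ s‖ ≤ b n := by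
    intro n ζ hζ s hs
    refine ((hK.iter_props c n).1 ζ hζ s hs).trans ?_
    have := mul_le_mul_of_nonneg_left (volterraWeight_le hK.nonneg hs)
      (by positivity : 0 ≤ ‖c‖ * (1 / 2 : ℝ) ^ n)
    refine this.trans (le_of_eq ?_)
    simp only [b, W]; ring
  refine ⟨fun ζ s => ∑' n, volterraIter K c n ζ s, ?_, ?_, ?_, ?_, ?_⟩
  · intro ζ hζ s hs
    rw [← hbs]
    exact tsum_of_norm_bounded hb.hasSum (fun n => hle n ζ hζ s hs)
  · intro ζ hζ
    exact continuousOn_tsum (fun n => (hK.iter_props c n).2.1 ζ hζ) hb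
      (fun n s hs => hle n ζ hζ s hs)
  · intro s hs
    exact continuousOn_tsum (fun n => (hK.iter_props c n).2.2.1 s hs) hb
      (fun n ζ hζ => hle n ζ hζ s hs)
  · intro s hs
    exact differentiableOn_tsum_of_summable_norm hb (fun n => (hK.iter_props c n).2.2.2 s hs)
      hK.isOpen (fun n ζ hζ => hle n ζ (hK.subset hζ) s hs)
  · intro ζ hζ s hs
    have hsum : ∀ y, 0 ≤ y → Summable fun n => volterraIter K c n ζ y := fun y hy =>
      Summable.of_norm_bounded hb (fun n => hle n ζ hζ y hy)
    have hvi : IntegrableOn (fun y : ℝ => 2 * C * (1 + y ^ 2)⁻¹) (Ioi s) :=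
      (integrable_inv_one_add_sq.const_mul _).integrableOn
    have hbd : ∀ n, ∀ y ∈ Ioi s, ‖K ζ s y *ᵥ volterraIter K c n ζ y‖ ≤
        b n * (2 * C * (1 + y ^ 2)⁻¹) := by
      intro n y hy
      refine (hK.norm_mulVec_le hζ hs hy _).trans ?_
      rw [mul_comm (b n)]
      have := hK.nonneg
      exact mul_le_mul_of_nonneg_left (hle n ζ hζ y (hs.trans (le_of_lt hy))) (by positivity)
    have hint : ∀ n, Integrable (fun y => K ζ s y *ᵥ volterraIter K c n ζ y)
        (volume.restrict (Ioi s)) := by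
      intro n
      refine Integrable.mono' (hvi.const_mul (b n)) ?_ ?_
      · refine aestronglyMeasurable_mulVec (hK.meas ζ hζ s hs) ?_
        exact (((hK.iter_props c n).2.1 ζ hζ).mono
          fun y hy => hs.trans (le_of_lt hy)).aestronglyMeasurable measurableSet_Ioi
      · filter_upwards [ae_restrict_mem measurableSet_Ioi] with y hy using hbd n y hy
    have hs2 : Summable fun n => ∫ y in Ioi s, ‖K ζ s y *ᵥ volterraIter K c n ζ y‖ := by
      refine Summable.of_nonneg_of_le (fun n => integral_nonneg fun _ => norm_nonneg _) (fun n => ?_)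
        (hb.mul_right (∫ y in Ioi s, 2 * C * (1 + y ^ 2)⁻¹))
      rw [← integral_const_mul]
      refine setIntegral_mono_on (hint n).norm (hvi.const_mul _) measurableSet_Ioi ?_
      exact fun y hy => hbd n y hy
    have h1 := (hasSum_integral_of_summable_integral_norm hint hs2).tsum_eq
    have h2 : ∫ y in Ioi s, K ζ s y *ᵥ ∑' n, volterraIter K c n ζ y =
        ∫ y in Ioi s, ∑' n, K ζ s y *ᵥ volterraIter K c n ζ y := by
      refine setIntegral_congr_fun measurableSet_Ioi fun y hy => ?_
      have hh := (hsum y (hs.trans (le_of_lt hy))).hasSum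
      have := hh.mapL (Matrix.mulVecLin (K ζ s y)).toContinuousLinearMap
      exact this.tsum_eq.symm
    simp only
    rw [h2, ← h1, (hsum s hs).tsum_eq_zero_add]
    rfl

end IsVolterraKernel

/-! ### Linear systems with a holomorphic parameter -/

lemma bounded_coeff_of_continuousOn {A : ℝ → Matrix (Fin 2) (Fin 2) ℂ} {X : ℝ}
    (hA : ∀ i j, ContinuousOn (fun s => A s i j) (Icc 0 X)) :
    ∃ C, ∀ s ∈ Ioo 0 X, ∀ i j, ‖A s i j‖ ≤ C := by
  choose C hC using fun i j => isCompact_Icc.exists_bound_of_continuousOn (hA i j)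
  refine ⟨∑ i, ∑ j, |C i j|, fun s hs i j => (hC i j s (Ioo_subset_Icc_self hs)).trans ?_⟩
  refine (le_abs_self _).trans ?_
  refine (Finset.single_le_sum (f := fun j => |C i j|) (fun _ _ => abs_nonneg _)
    (Finset.mem_univ j)).trans ?_
  exact Finset.single_le_sum (f := fun i => ∑ j, |C i j|)
    (fun _ _ => Finset.sum_nonneg fun _ _ => abs_nonneg _) (Finset.mem_univ i)

section Flow

variable {A : ℂ → ℝ → Matrix (Fin 2) (Fin 2) ℂ} {U : Set ℂ} {X : ℝ}

/-- The reflection `s ↦ X - s` turns the initial value problem into a Volterra equation on a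
half-line whose kernel is cut off beyond `X`, so `exists_solution` gives both the solution and its
holomorphy in the parameter. -/
lemma exists_flow_local (hX : 0 ≤ X) {ζ₀ : ℂ} {r : ℝ} (hrU : Metric.closedBall ζ₀ r ⊆ U)
    (hcont : ∀ i j, ContinuousOn (fun q : ℂ × ℝ => A q.1 q.2 i j) (U ×ˢ Icc 0 X))
    (hdiff : ∀ s ∈ Icc 0 X, ∀ i j, DifferentiableOn ℂ (fun ζ => A ζ s i j) U) (c : Fin 2 → ℂ) :
    ∃ Y : ℂ → ℝ → Fin 2 → ℂ,
      (∀ ζ ∈ Metric.ball ζ₀ r, IsSol (A ζ) X (Y ζ) ∧ Y ζ 0 = c) ∧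
      ∀ s ∈ Icc 0 X, DifferentiableOn ℂ (fun ζ => Y ζ s) (Metric.ball ζ₀ r) := by
  have hbU : Metric.ball ζ₀ r ⊆ U := Metric.ball_subset_closedBall.trans hrU
  obtain ⟨C, hC0, hC⟩ : ∃ C, 0 ≤ C ∧ ∀ ζ ∈ Metric.ball ζ₀ r, ∀ s ∈ Icc 0 X, ∀ i j,
      ‖A ζ s i j‖ ≤ C := by
    have hcomp : IsCompact (Metric.closedBall ζ₀ r ×ˢ Icc (0 : ℝ) X) :=
      (isCompact_closedBall _ _).prod isCompact_Icc
    choose C hC using fun i j => hcomp.exists_bound_of_continuousOn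
      ((hcont i j).mono (prod_mono hrU Subset.rfl))
    refine ⟨∑ i, ∑ j, |C i j|, Finset.sum_nonneg fun _ _ => Finset.sum_nonneg fun _ _ =>
      abs_nonneg _, fun ζ hζ s hs i j =>
      (hC i j (ζ, s) ⟨Metric.ball_subset_closedBall hζ, hs⟩).trans ?_⟩
    refine (le_abs_self _).trans ?_
    refine (Finset.single_le_sum (f := fun j => |C i j|) (fun _ _ => abs_nonneg _)
      (Finset.mem_univ j)).trans ?_
    exact Finset.single_le_sum (f := fun i => ∑ j, |C i j|)
      (fun _ _ => Finset.sum_nonneg fun _ _ => abs_nonneg _) (Finset.mem_univ i)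
  classical
  set K : ℂ → ℝ → ℝ → Matrix (Fin 2) (Fin 2) ℂ := fun ζ _ y =>
    if y ≤ X then A ζ (X - y) else 0 with hKdef
  have hslice : ∀ ζ ∈ U, ∀ i j, ContinuousOn (fun s => A ζ s i j) (Icc 0 X) := fun ζ hζ i j =>
    (hcont i j).comp (f := fun s : ℝ => (ζ, s)) (by fun_prop) fun s hs => ⟨hζ, hs⟩
  have hrefl : ∀ ζ ∈ U, ∀ i j, ContinuousOn (fun y => A ζ (X - y) i j) (Icc 0 X) := fun ζ hζ i j =>
    (hslice ζ hζ i j).comp (f := fun y : ℝ => X - y) (by fun_prop)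
      fun y hy => ⟨by linarith [hy.2], by linarith [hy.1]⟩
  -- The factor `1 + X ^ 2` makes the constant bound `C` on `[0, X]` fit the decay `1 / (1 + y²)`
  -- required of kernels.
  have hK : IsVolterraKernel K (Metric.ball ζ₀ r) (Metric.ball ζ₀ r) (C * (1 + X ^ 2)) := by
    refine ⟨by positivity, Metric.isOpen_ball, Subset.rfl, ?_, ?_, ?_, ?_, ?_⟩
    · intro ζ hζ s y hs hy i j
      simp only [hKdef]
      split_ifs with h
      · refine (hC ζ hζ (X - y) ⟨by linarith, by linarith⟩ i j).trans ?_
        have h1 : (1 + y ^ 2) ≤ (1 + X ^ 2) := by nlinarith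
        rw [mul_assoc]
        refine le_mul_of_one_le_right hC0 ?_
        rw [← div_eq_mul_inv, one_le_div (by positivity)]
        exact h1
      · simp only [Matrix.zero_apply, norm_zero]; positivity
    · intro ζ hζ s hs i j
      have : (fun y => K ζ s y i j) = (Iic X).indicator fun y => A ζ (X - y) i j := by
        ext y
        simp only [hKdef, indicator, mem_Iic]
        split_ifs <;> rfl
      rw [this, aestronglyMeasurable_indicator_iff measurableSet_Iic,
        Measure.restrict_restrict measurableSet_Iic]
      exact ((hrefl ζ (hbU hζ) i j).mono fun y hy =>
        ⟨hs.trans (le_of_lt hy.2), hy.1⟩).aestronglyMeasurable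
        (measurableSet_Iic.inter measurableSet_Ioi)
    · exact fun _ _ _ _ _ => continuousOn_const
    · intro s y hs hy i j
      by_cases h : y ≤ X
      · simp only [hKdef, h, if_true]
        exact ((hdiff (X - y) ⟨by linarith, by linarith⟩ i j).continuousOn).mono hbU
      · simp only [hKdef, h, if_false]; exact continuousOn_const
    · intro s y hs hy i j
      by_cases h : y ≤ X
      · simp only [hKdef, h, if_true]
        exact (hdiff (X - y) ⟨by linarith, by linarith⟩ i j).mono hbU
      · simp only [hKdef, h, if_false]; exact differentiableOn_const _
  obtain ⟨g, -, hgc, -, hgd, hgeq⟩ := hK.exists_solution c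
  refine ⟨fun ζ s => g ζ (X - s), fun ζ hζ => ⟨⟨?_, ?_⟩, ?_⟩, fun s hs =>
    hgd (X - s) (by linarith [hs.2])⟩
  · exact (hgc ζ hζ).comp (f := fun s : ℝ => X - s) (by fun_prop)
      fun s hs => by simpa using hs.2
  · have hcv : ContinuousOn (fun y => A ζ (X - y) *ᵥ g ζ y) (Icc 0 X) := by
      refine continuousOn_pi.2 fun i => ?_
      simp only [Matrix.mulVec, dotProduct, Fin.sum_univ_two]
      have h := continuousOn_pi.1 ((hgc ζ hζ).mono (show Icc 0 X ⊆ Ici 0 from fun _ h => h.1))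
      exact ((hrefl ζ (hbU hζ) i 0).mul (h 0)).add ((hrefl ζ (hbU hζ) i 1).mul (h 1))
    have heq : ∀ s ∈ Icc 0 X, g ζ s = c + ∫ y in s..X, A ζ (X - y) *ᵥ g ζ y := by
      intro s hs
      rw [hgeq ζ hζ s hs.1]
      congr 1
      have : (fun y => K ζ s y *ᵥ g ζ y) =
          (Iic X).indicator fun y => A ζ (X - y) *ᵥ g ζ y := by
        ext1 y
        simp only [hKdef, indicator, mem_Iic]
        split_ifs with h
        · rfl
        · simp
      rw [this, setIntegral_indicator measurableSet_Iic, intervalIntegral.integral_of_le hs.2]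
      rfl
    intro s hs
    have hs' : X - s ∈ Ioo 0 X := ⟨by linarith [hs.2], by linarith [hs.1]⟩
    have h1 : HasDerivAt (fun s => ∫ y in s..X, A ζ (X - y) *ᵥ g ζ y)
        (-(A ζ (X - (X - s)) *ᵥ g ζ (X - s))) (X - s) := by
      refine intervalIntegral.integral_hasDerivAt_left ?_ ?_ ?_
      · refine (hcv.mono ?_).intervalIntegrable
        rw [uIcc_of_le hs'.2.le]
        exact Icc_subset_Icc_left hs'.1.le
      · exact (hcv.mono Ioo_subset_Icc_self).stronglyMeasurableAtFilter isOpen_Ioo _ hs'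
      · exact hcv.continuousAt (Icc_mem_nhds hs'.1 hs'.2)
    have h2 : HasDerivAt (g ζ) (-(A ζ s *ᵥ g ζ (X - s))) (X - s) := by
      have := (h1.const_add c).congr_of_eventuallyEq (f₁ := g ζ) (by
        filter_upwards [Ioo_mem_nhds hs'.1 hs'.2] with y hy
        exact heq y (Ioo_subset_Icc_self hy))
      rwa [sub_sub_cancel] at this
    have h3 := h2.scomp s ((hasDerivAt_id s).const_sub X)
    simpa [Function.comp_def] using h3
  · simp only [sub_zero]
    rw [hgeq ζ hζ X hX, setIntegral_eq_zero_of_forall_eq_zero, add_zero]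
    intro y hy
    have : ¬ y ≤ X := not_le.2 hy
    simp [hKdef, this]

/-- Solutions of a linear system whose coefficients depend holomorphically on a parameter depend
holomorphically on it. -/
theorem exists_flow (hX : 0 ≤ X) (hU : IsOpen U)
    (hcont : ∀ i j, ContinuousOn (fun q : ℂ × ℝ => A q.1 q.2 i j) (U ×ˢ Icc 0 X))
    (hdiff : ∀ s ∈ Icc 0 X, ∀ i j, DifferentiableOn ℂ (fun ζ => A ζ s i j) U) (c : Fin 2 → ℂ) :
    ∃ Y : ℂ → ℝ → Fin 2 → ℂ,
      (∀ ζ ∈ U, IsSol (A ζ) X (Y ζ) ∧ Y ζ 0 = c) ∧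
      ∀ s ∈ Icc 0 X, DifferentiableOn ℂ (fun ζ => Y ζ s) U := by
  have hloc : ∀ ζ₀ : ℂ, ∃ r > 0, ∃ Y : ℂ → ℝ → Fin 2 → ℂ, ζ₀ ∈ U →
      (∀ ζ ∈ Metric.ball ζ₀ r, IsSol (A ζ) X (Y ζ) ∧ Y ζ 0 = c) ∧
      ∀ s ∈ Icc 0 X, DifferentiableOn ℂ (fun ζ => Y ζ s) (Metric.ball ζ₀ r) := by
    intro ζ₀
    by_cases h : ζ₀ ∈ U
    · obtain ⟨r, hr, hrU⟩ := Metric.nhds_basis_closedBall.mem_iff.1 (hU.mem_nhds h)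
      obtain ⟨Y, hY⟩ := exists_flow_local hX hrU hcont hdiff c
      exact ⟨r, hr, Y, fun _ => hY⟩
    · exact ⟨1, one_pos, fun _ _ => 0, fun h' => absurd h' h⟩
  choose r hr Y hY using hloc
  have hslice : ∀ ζ ∈ U, ∃ C, ∀ s ∈ Ioo 0 X, ∀ i j, ‖A ζ s i j‖ ≤ C := fun ζ hζ =>
    bounded_coeff_of_continuousOn fun i j =>
      (hcont i j).comp (f := fun s : ℝ => (ζ, s)) (by fun_prop) fun s hs => ⟨hζ, hs⟩
  refine ⟨fun ζ => Y ζ ζ, fun ζ hζ => (hY ζ hζ).1 ζ (Metric.mem_ball_self (hr ζ)), ?_⟩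
  intro s hs ζ₀ h₀
  have hd := ((hY ζ₀ h₀).2 s hs).differentiableAt (Metric.ball_mem_nhds ζ₀ (hr ζ₀))
  refine (hd.congr_of_eventuallyEq ?_).differentiableWithinAt
  filter_upwards [hU.mem_nhds h₀, Metric.ball_mem_nhds ζ₀ (hr ζ₀)] with ζ hζ hb
  have h1 := (hY ζ hζ).1 ζ (Metric.mem_ball_self (hr ζ))
  have h2 := (hY ζ₀ h₀).1 ζ hb
  exact h1.1.unique (hslice ζ hζ) h2.1 (h1.2.trans h2.2.symm) hs

end Flow

/-! ### The closed first and third quadrants -/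

/-- The closed first and third quadrants. -/
def closedQuadrants : Set ℂ := {ζ | 0 ≤ ζ.re * ζ.im}

/-- The open first and third quadrants. -/
def openQuadrants : Set ℂ := {ζ | 0 < ζ.re * ζ.im}

lemma isOpen_openQuadrants : IsOpen openQuadrants :=
  isOpen_lt continuous_const (continuous_re.mul continuous_im)

lemma isClosed_closedQuadrants : IsClosed closedQuadrants :=
  isClosed_le continuous_const (continuous_re.mul continuous_im)

lemma openQuadrants_subset : openQuadrants ⊆ closedQuadrants := fun ζ (h : 0 < ζ.re * ζ.im) => h.le

lemma re_two_I_mul_sq (ζ : ℂ) : (2 * I * ζ ^ 2).re = -4 * (ζ.re * ζ.im) := by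
  simp [pow_two]; ring

lemma norm_exp_two_I_sq_le {ζ : ℂ} (hζ : ζ ∈ closedQuadrants) {s : ℝ} (hs : 0 ≤ s) :
    ‖exp (2 * I * ζ ^ 2 * s)‖ ≤ 1 := by
  rw [norm_exp, re_mul_ofReal, re_two_I_mul_sq]
  refine Real.exp_le_one_iff.2 ?_
  have : 0 ≤ ζ.re * ζ.im := hζ
  nlinarith [mul_nonneg this hs]

/-! ### Tails of integrals -/

lemma hasDerivAt_exp_mul (c : ℂ) (s : ℝ) :
    HasDerivAt (fun s : ℝ => exp (c * s)) (exp (c * s) * c) s := by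
  simpa using ((hasDerivAt_id s).ofReal_comp.const_mul c).cexp

lemma integral_tail {h : ℝ → ℂ} (hi : IntegrableOn h (Ioi 0)) (hc : ContinuousOn h (Ici 0)) :
    ContinuousOn (fun s => ∫ y in Ioi s, h y) (Ici 0) ∧
      (∀ s ∈ Ioi (0 : ℝ), HasDerivAt (fun s => ∫ y in Ioi s, h y) (-h s) s) ∧
      Tendsto (fun s => ∫ y in Ioi s, h y) atTop (𝓝 0) := by
  have heq : ∀ s ∈ Ici (0 : ℝ), ∫ y in Ioi s, h y =
      (∫ y in Ioi (0 : ℝ), h y) - ∫ y in (0 : ℝ)..s, h y := by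
    intro s hs
    rw [eq_sub_iff_add_eq', intervalIntegral.integral_interval_add_Ioi hi
      (hi.mono_set (Ioi_subset_Ioi hs))]
  have hder : ∀ s ∈ Ioi (0 : ℝ), HasDerivAt (fun s => ∫ y in Ioi s, h y) (-h s) s := by
    intro s hs
    have h1 : HasDerivAt (fun s => ∫ y in (0 : ℝ)..s, h y) (h s) s := by
      refine intervalIntegral.integral_hasDerivAt_right ?_ ?_ ?_
      · refine (hc.mono ?_).intervalIntegrable
        rw [uIcc_of_le (le_of_lt hs)]
        exact Icc_subset_Ici_self
      · exact (hc.mono Ioi_subset_Ici_self).stronglyMeasurableAtFilter isOpen_Ioi _ hs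
      · exact hc.continuousAt (Ici_mem_nhds hs)
    refine (h1.const_sub (∫ y in Ioi (0 : ℝ), h y)).congr_of_eventuallyEq ?_
    filter_upwards [Ioi_mem_nhds (show (0 : ℝ) < s from hs)] with z hz
    exact heq z (show (0 : ℝ) < z from hz).le
  refine ⟨?_, hder, ?_⟩
  · refine ContinuousOn.congr ?_ heq
    refine continuousOn_const.sub ?_
    intro s hs
    have h1 : ContinuousOn (fun s => ∫ y in (0 : ℝ)..s, h y) (Icc 0 (s + 1)) :=
      intervalIntegral.continuousOn_primitive_interval' (hc.mono (by
        rw [uIcc_of_le (show (0 : ℝ) ≤ s + 1 by linarith [show (0 : ℝ) ≤ s from hs])]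
        exact Icc_subset_Ici_self)).intervalIntegrable left_mem_uIcc |>.mono (by
          rw [uIcc_of_le (show (0 : ℝ) ≤ s + 1 by linarith [show (0 : ℝ) ≤ s from hs])])
    refine (h1 s ⟨hs, by linarith⟩).mono_of_mem_nhdsWithin ?_
    filter_upwards [self_mem_nhdsWithin,
      mem_nhdsWithin_of_mem_nhds (Iio_mem_nhds (by linarith : s < s + 1))] with z h1 h2
    exact ⟨h1, le_of_lt h2⟩
  · have h1 := (intervalIntegral_tendsto_integral_Ioi 0 hi tendsto_id).const_sub
      (∫ y in Ioi (0 : ℝ), h y)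
    rw [sub_self] at h1
    refine h1.congr' ?_
    filter_upwards [eventually_ge_atTop 0] with s hs
    exact (heq s hs).symm

/-! ### Volterra equations at infinity and differential equations -/

/-- The coefficient matrix `V` decays like `1 / (1 + x²)` on `x ≥ 0`. -/
structure IsDecayingCoeff (V : ℝ → Matrix (Fin 2) (Fin 2) ℂ) (C : ℝ) : Prop where
  cont : ∀ i j, ContinuousOn (fun y => V y i j) (Ici 0)
  bound : ∀ y, 0 ≤ y → ∀ i j, ‖V y i j‖ ≤ C * (1 + y ^ 2)⁻¹

/-- `f` is a bounded solution of the Volterra equation with coefficient matrix `V`. -/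
structure IsVolterraSol (V : ℝ → Matrix (Fin 2) (Fin 2) ℂ) (ζ : ℂ) (f : ℝ → Fin 2 → ℂ) : Prop where
  cont : ContinuousOn f (Ici 0)
  bdd : ∃ C : ℝ, ∀ x : ℝ, 0 ≤ x → ‖f x‖ ≤ C
  eq_fst : ∀ x : ℝ, 0 ≤ x →
    f x 0 = -∫ y in Ioi x, exp (2 * I * ζ ^ 2 * ((y : ℂ) - x)) * (V y *ᵥ f y) 0
  eq_snd : ∀ x : ℝ, 0 ≤ x → f x 1 = 1 - ∫ y in Ioi x, (V y *ᵥ f y) 1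

/-- `f` solves the differential equation with coefficient matrix `V - 2 i ζ² diag(1, 0)` and tends
to `(0, 1)` at infinity. -/
structure IsDecayingSol (V : ℝ → Matrix (Fin 2) (Fin 2) ℂ) (ζ : ℂ) (f : ℝ → Fin 2 → ℂ) : Prop where
  cont : ContinuousOn f (Ici 0)
  deriv_fst : ∀ s ∈ Ioi (0 : ℝ),
    HasDerivAt (fun s => f s 0) (-2 * I * ζ ^ 2 * f s 0 + (V s *ᵥ f s) 0) s
  deriv_snd : ∀ s ∈ Ioi (0 : ℝ), HasDerivAt (fun s => f s 1) ((V s *ᵥ f s) 1) s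
  tendsto_fst : Tendsto (fun s => f s 0) atTop (𝓝 0)
  tendsto_snd : Tendsto (fun s => f s 1) atTop (𝓝 1)

section

variable {V : ℝ → Matrix (Fin 2) (Fin 2) ℂ} {C : ℝ} {ζ : ℂ} {f : ℝ → Fin 2 → ℂ}

lemma IsDecayingCoeff.mulVec_props (hV : IsDecayingCoeff V C) (hf : ContinuousOn f (Ici 0))
    {B : ℝ} (hB : ∀ x, 0 ≤ x → ‖f x‖ ≤ B) (i : Fin 2) :
    ContinuousOn (fun y => (V y *ᵥ f y) i) (Ici 0) ∧
      (∀ y, 0 ≤ y → ‖(V y *ᵥ f y) i‖ ≤ 2 * C * B * (1 + y ^ 2)⁻¹) ∧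
      IntegrableOn (fun y => (V y *ᵥ f y) i) (Ioi 0) := by
  have h1 : ContinuousOn (fun y => (V y *ᵥ f y) i) (Ici 0) := by
    simp only [Matrix.mulVec, dotProduct, Fin.sum_univ_two]
    have h := continuousOn_pi.1 hf
    exact ((hV.cont i 0).mul (h 0)).add ((hV.cont i 1).mul (h 1))
  have hC : 0 ≤ C := by
    have := (norm_nonneg _).trans (hV.bound 0 le_rfl 0 0); simpa using this
  have h2 : ∀ y, 0 ≤ y → ‖(V y *ᵥ f y) i‖ ≤ 2 * C * B * (1 + y ^ 2)⁻¹ := by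
    intro y hy
    refine (norm_le_pi_norm _ i).trans ((norm_mulVec_le_of_entries (hV.bound y hy) _).trans ?_)
    have := mul_le_mul_of_nonneg_left (hB y hy) (by positivity : 0 ≤ 2 * (C * (1 + y ^ 2)⁻¹))
    linarith
  refine ⟨h1, h2, Integrable.mono' ((integrable_inv_one_add_sq.const_mul (2 * C * B)).integrableOn)
    ((h1.mono Ioi_subset_Ici_self).aestronglyMeasurable measurableSet_Ioi) ?_⟩
  filter_upwards [ae_restrict_mem measurableSet_Ioi] with y hy using h2 y (le_of_lt hy)

lemma continuousOn_exp_mul {ζ : ℂ} {h : ℝ → ℂ} (hc : ContinuousOn h (Ici 0)) :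
    ContinuousOn (fun y : ℝ => exp (2 * I * ζ ^ 2 * y) * h y) (Ici 0) :=
  (Continuous.continuousOn (by fun_prop)).mul hc

lemma integrableOn_exp_mul {ζ : ℂ} (hζ : ζ ∈ closedQuadrants) {h : ℝ → ℂ}
    (hc : ContinuousOn h (Ici 0)) (hi : IntegrableOn h (Ioi 0)) :
    IntegrableOn (fun y : ℝ => exp (2 * I * ζ ^ 2 * y) * h y) (Ioi 0) := by
  refine Integrable.mono hi (((continuousOn_exp_mul hc).mono
    Ioi_subset_Ici_self).aestronglyMeasurable measurableSet_Ioi) ?_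
  filter_upwards [ae_restrict_mem measurableSet_Ioi] with y hy
  rw [norm_mul]
  exact mul_le_of_le_one_left (norm_nonneg _) (norm_exp_two_I_sq_le hζ (le_of_lt hy))

lemma integral_exp_shift (ζ : ℂ) (h : ℝ → ℂ) (x : ℝ) :
    ∫ y in Ioi x, exp (2 * I * ζ ^ 2 * ((y : ℂ) - x)) * h y =
      exp (-2 * I * ζ ^ 2 * x) * ∫ y in Ioi x, exp (2 * I * ζ ^ 2 * y) * h y := by
  rw [← integral_const_mul]
  congr 1 with y
  rw [← mul_assoc, ← exp_add]
  congr 2; ring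

/-- In the closed quadrants the exponential in the first equation has modulus at most one for `y ≥
x`, so tails of integrable functions control both components at infinity. Differentiation in the
lower limit gives the system. -/
theorem IsVolterraSol.isDecayingSol (hζ : ζ ∈ closedQuadrants) (hV : IsDecayingCoeff V C)
    (hf : IsVolterraSol V ζ f) : IsDecayingSol V ζ f := by
  obtain ⟨B, hB⟩ := hf.bdd
  obtain ⟨c0, -, i0⟩ := hV.mulVec_props hf.cont hB 0
  obtain ⟨c1, -, i1⟩ := hV.mulVec_props hf.cont hB 1
  obtain ⟨-, d0, -⟩ := integral_tail (integrableOn_exp_mul hζ c0 i0) (continuousOn_exp_mul c0)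
  obtain ⟨-, d1, t1⟩ := integral_tail i1 c1
  refine ⟨hf.cont, fun s hs => ?_, fun s hs => ?_, ?_, ?_⟩
  · have e1 : HasDerivAt (fun s : ℝ => exp (-2 * I * ζ ^ 2 * s))
        (exp (-2 * I * ζ ^ 2 * s) * (-2 * I * ζ ^ 2)) s := by
      exact hasDerivAt_exp_mul _ s
    have := (e1.mul (d0 s hs)).neg
    refine (this.congr_of_eventuallyEq ?_).congr_deriv ?_
    · filter_upwards [Ioi_mem_nhds (show (0 : ℝ) < s from hs)] with z hz
      rw [hf.eq_fst z (le_of_lt hz), integral_exp_shift]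
      rfl
    · rw [hf.eq_fst s (le_of_lt hs), integral_exp_shift]
      have : exp (-2 * I * ζ ^ 2 * s) * exp (2 * I * ζ ^ 2 * s) = 1 := by
        rw [← exp_add, ← exp_zero]; congr 1; ring
      linear_combination (V s *ᵥ f s) 0 * this
  · have := (d1 s hs).const_sub 1
    rw [neg_neg] at this
    refine this.congr_of_eventuallyEq ?_
    filter_upwards [Ioi_mem_nhds (show (0 : ℝ) < s from hs)] with z hz
    exact hf.eq_snd z (le_of_lt hz)
  · have hn : IntegrableOn (fun y => ((‖(V y *ᵥ f y) 0‖ : ℝ) : ℂ)) (Ioi 0) := i0.norm.ofReal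
    have t0 := (integral_tail hn (continuous_ofReal.comp_continuousOn c0.norm)).2.2
    refine squeeze_zero_norm' (a := fun s => ‖∫ y in Ioi s, ((‖(V y *ᵥ f y) 0‖ : ℝ) : ℂ)‖) ?_
      (by simpa using t0.norm)
    filter_upwards [eventually_ge_atTop 0] with s hs
    rw [hf.eq_fst s hs, norm_neg, integral_complex_ofReal, norm_real,
      Real.norm_of_nonneg (integral_nonneg fun _ => norm_nonneg _)]
    refine norm_integral_le_of_norm_le (i0.mono_set (Ioi_subset_Ioi hs)).norm ?_
    filter_upwards [ae_restrict_mem measurableSet_Ioi] with y hy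
    rw [norm_mul]
    refine mul_le_of_le_one_left (norm_nonneg _) ?_
    have := norm_exp_two_I_sq_le hζ (sub_nonneg.2 (le_of_lt hy))
    simpa using this
  · have := t1.const_sub 1
    rw [sub_zero] at this
    refine this.congr' ?_
    filter_upwards [eventually_ge_atTop 0] with s hs using (hf.eq_snd s hs).symm

lemma IsDecayingSol.bdd (hf : IsDecayingSol V ζ f) : ∃ B, ∀ x, 0 ≤ x → ‖f x‖ ≤ B := by
  have ht : Tendsto f atTop (𝓝 ![0, 1]) := tendsto_pi_nhds.2 fun i => by
    fin_cases i
    · exact hf.tendsto_fst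
    · exact hf.tendsto_snd
  obtain ⟨B₁, hB₁⟩ := (ht.norm.isBoundedUnder_le)
  obtain ⟨R, hR⟩ := eventually_atTop.1 (eventually_map.1 hB₁)
  obtain ⟨B₂, hB₂⟩ := isCompact_Icc.exists_bound_of_continuousOn
    (hf.cont.mono (show Icc 0 R ⊆ Ici 0 from fun _ h => h.1))
  refine ⟨max B₁ B₂, fun x hx => ?_⟩
  rcases le_total R x with h | h
  · exact (hR x h).trans (le_max_left _ _)
  · exact (hB₂ x ⟨hx, h⟩).trans (le_max_right _ _)

/-- The derivatives of `exp(2iζ²s) f₀` and `f₁` are integrated up to infinity. Together with the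
converse, this replaces the integral equations that define `a` and `b` by a boundary value problem
at infinity, for which gauge transformations and uniqueness are simple. -/
theorem IsDecayingSol.isVolterraSol (hζ : ζ ∈ closedQuadrants) (hV : IsDecayingCoeff V C)
    (hf : IsDecayingSol V ζ f) : IsVolterraSol V ζ f := by
  obtain ⟨B, hB⟩ := hf.bdd
  obtain ⟨c0, -, i0⟩ := hV.mulVec_props hf.cont hB 0
  obtain ⟨c1, -, i1⟩ := hV.mulVec_props hf.cont hB 1
  refine ⟨hf.cont, ⟨B, hB⟩, fun x hx => ?_, fun x hx => ?_⟩
  · have hd : ∀ s ∈ Ioi x, HasDerivAt (fun s : ℝ => exp (2 * I * ζ ^ 2 * s) * f s 0)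
        (exp (2 * I * ζ ^ 2 * s) * (V s *ᵥ f s) 0) s := by
      intro s hs
      have e1 : HasDerivAt (fun s : ℝ => exp (2 * I * ζ ^ 2 * s))
          (exp (2 * I * ζ ^ 2 * s) * (2 * I * ζ ^ 2)) s := by
        exact hasDerivAt_exp_mul _ s
      refine (e1.mul (hf.deriv_fst s (lt_of_le_of_lt hx hs))).congr_deriv ?_
      ring
    have hl : Tendsto (fun s : ℝ => exp (2 * I * ζ ^ 2 * s) * f s 0) atTop (𝓝 0) := by
      refine squeeze_zero_norm' ?_ (by simpa using hf.tendsto_fst.norm)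
      filter_upwards [eventually_ge_atTop 0] with s hs
      rw [norm_mul]
      exact mul_le_of_le_one_left (norm_nonneg _) (norm_exp_two_I_sq_le hζ hs)
    have hcx : ContinuousWithinAt (fun s : ℝ => exp (2 * I * ζ ^ 2 * s) * f s 0) (Ici x) x :=
      ((continuousOn_exp_mul ((continuous_apply 0).comp_continuousOn hf.cont)) x hx).mono
        (Ici_subset_Ici.2 hx)
    have := integral_Ioi_of_hasDerivAt_of_tendsto hcx hd
      ((integrableOn_exp_mul hζ c0 i0).mono_set (Ioi_subset_Ioi hx)) hl
    rw [integral_exp_shift, this]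
    have : exp (-2 * I * ζ ^ 2 * x) * exp (2 * I * ζ ^ 2 * x) = 1 := by
      rw [← exp_add, ← exp_zero]; congr 1; ring
    linear_combination -f x 0 * this
  · have hcx : ContinuousWithinAt (fun s : ℝ => f s 1) (Ici x) x :=
      (((continuous_apply 1).comp_continuousOn hf.cont) x hx).mono (Ici_subset_Ici.2 hx)
    rw [integral_Ioi_of_hasDerivAt_of_tendsto hcx
      (fun s hs => hf.deriv_snd s (lt_of_le_of_lt hx hs)) (i1.mono_set (Ioi_subset_Ioi hx))
      hf.tendsto_snd]
    ring

end

/-! ### Jost solutions -/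

/-- Continuous potentials decaying like `1 / (1 + x²)` on `x ≥ 0`. -/
structure IsPotential (w : ℝ → ℂ) (C : ℝ) : Prop where
  cont : Continuous w
  bound : ∀ s, 0 ≤ s → ‖w s‖ ≤ C * (1 + s ^ 2)⁻¹

/-- The off-diagonal coefficient matrix with potential `w`. -/
noncomputable def offDiag (w : ℝ → ℂ) (ζ : ℂ) (s : ℝ) : Matrix (Fin 2) (Fin 2) ℂ :=
  !![0, ζ * w s; ζ * conj (w s), 0]

/-- The Jost solution with asymptotics `(0, 1)` at infinity. -/
noncomputable def jost (w : ℝ → ℂ) (ζ : ℂ) : ℝ → Fin 2 → ℂ :=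
  Classical.epsilon (IsDecayingSol (offDiag w ζ) ζ)

section

variable {w : ℝ → ℂ} {C : ℝ} {ζ : ℂ}

lemma IsPotential.nonneg (hw : IsPotential w C) : 0 ≤ C := by
  simpa using (norm_nonneg _).trans (hw.bound 0 le_rfl)

lemma IsPotential.bound' (hw : IsPotential w C) {s : ℝ} (hs : 0 ≤ s) : ‖w s‖ ≤ C := by
  refine (hw.bound s hs).trans (mul_le_of_le_one_right hw.nonneg (inv_le_one_of_one_le₀ ?_))
  nlinarith [sq_nonneg s]

lemma IsPotential.offDiag_coeff (hw : IsPotential w C) (ζ : ℂ) :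
    IsDecayingCoeff (offDiag w ζ) (‖ζ‖ * C) := by
  have h0 := hw.nonneg
  have hc := hw.cont
  refine ⟨fun i j => ?_, fun y hy i j => ?_⟩
  · refine Continuous.continuousOn ?_
    fin_cases i <;> fin_cases j <;> simp [offDiag] <;> fun_prop
  · have := mul_le_mul_of_nonneg_left (hw.bound y hy) (norm_nonneg ζ)
    have h2 : 0 ≤ ‖ζ‖ * C * (1 + y ^ 2)⁻¹ := by positivity
    fin_cases i <;> fin_cases j <;> simp [offDiag] <;> linarith

/-- The off-diagonal coefficients carry a factor `ζ`, so the kernel bound is uniform only on discs.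
Uniqueness later identifies the solutions on different discs. -/
lemma exists_jost_local (hw : IsPotential w C) (R : ℝ) : ∃ χ : ℂ → ℝ → Fin 2 → ℂ,
    (∀ ζ ∈ closedQuadrants ∩ Metric.ball 0 R, IsDecayingSol (offDiag w ζ) ζ (χ ζ)) ∧
    (∀ s, 0 ≤ s → ContinuousOn (fun ζ => χ ζ s) (closedQuadrants ∩ Metric.ball 0 R)) ∧
    ∀ s, 0 ≤ s → DifferentiableOn ℂ (fun ζ => χ ζ s) (openQuadrants ∩ Metric.ball 0 R) := by
  set K : ℂ → ℝ → ℝ → Matrix (Fin 2) (Fin 2) ℂ := fun ζ s y =>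
    !![0, -exp (2 * I * ζ ^ 2 * ((y : ℂ) - s)) * (ζ * w y); -(ζ * conj (w y)), 0] with hKdef
  have h0 := hw.nonneg
  have hc := hw.cont
  have hK : IsVolterraKernel K (closedQuadrants ∩ Metric.ball 0 R)
      (openQuadrants ∩ Metric.ball 0 R) (|R| * C) := by
    refine ⟨by positivity, isOpen_openQuadrants.inter Metric.isOpen_ball,
      inter_subset_inter_left _ openQuadrants_subset, ?_, ?_, ?_, ?_, ?_⟩
    · rintro ζ ⟨hζ, hR⟩ s y hs hy i j
      have hR' : ‖ζ‖ ≤ |R| := (mem_ball_zero_iff.1 hR).le.trans (le_abs_self R)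
      have h1 : ‖ζ‖ * ‖w y‖ ≤ |R| * C * (1 + y ^ 2)⁻¹ := by
        rw [mul_assoc]
        exact mul_le_mul hR' (hw.bound y (hs.trans hy.le)) (norm_nonneg _) (abs_nonneg _)
      have h2 : 0 ≤ |R| * C * (1 + y ^ 2)⁻¹ := by positivity
      have h3 : ‖exp (2 * I * ζ ^ 2 * ((y : ℂ) - s))‖ ≤ 1 := by
        simpa using norm_exp_two_I_sq_le hζ (sub_nonneg.2 hy.le)
      have h4 := mul_le_of_le_one_left (by positivity : 0 ≤ ‖ζ‖ * ‖w y‖) h3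
      fin_cases i <;> fin_cases j <;> simp [hKdef] <;> linarith
    · intro ζ _ s _ i j
      refine Continuous.aestronglyMeasurable ?_
      fin_cases i <;> fin_cases j <;> simp [hKdef] <;> fun_prop
    · intro ζ _ y i j
      refine Continuous.continuousOn ?_
      fin_cases i <;> fin_cases j <;> simp [hKdef] <;> fun_prop
    · intro s y _ _ i j
      refine Continuous.continuousOn ?_
      fin_cases i <;> fin_cases j <;> simp [hKdef] <;> fun_prop
    · intro s y _ _ i j
      refine Differentiable.differentiableOn ?_
      fin_cases i <;> fin_cases j <;> simp [hKdef] <;> fun_prop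
  obtain ⟨χ, hb, hcs, hcp, hd, heq⟩ := hK.exists_solution ![0, 1]
  refine ⟨χ, fun ζ hζ => ?_, hcp, hd⟩
  refine IsVolterraSol.isDecayingSol hζ.1 (hw.offDiag_coeff ζ) ⟨hcs ζ hζ, ⟨_, hb ζ hζ⟩, ?_, ?_⟩
  all_goals
    intro x hx
    have hint : IntegrableOn (fun y => K ζ x y *ᵥ χ ζ y) (Ioi x) := by
      set B := 2 * ‖(![0, 1] : Fin 2 → ℂ)‖ * volterraWeight (|R| * C) 0
      refine Integrable.mono' ((integrable_inv_one_add_sq.const_mul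
        (2 * (|R| * C) * B)).integrableOn) ?_ ?_
      · refine aestronglyMeasurable_mulVec (hK.meas ζ hζ x hx) ?_
        exact ((hcs ζ hζ).mono fun y hy => hx.trans (le_of_lt hy)).aestronglyMeasurable
          measurableSet_Ioi
      · filter_upwards [ae_restrict_mem measurableSet_Ioi] with y hy
        refine (hK.norm_mulVec_le hζ hx hy _).trans ?_
        have := mul_le_mul_of_nonneg_left (hb ζ hζ y (hx.trans (le_of_lt hy)))
          (by positivity : 0 ≤ 2 * (|R| * C) * (1 + y ^ 2)⁻¹)
        linarith
    have hcomp : ∀ i, (∫ y in Ioi x, K ζ x y *ᵥ χ ζ y) i =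
        ∫ y in Ioi x, (K ζ x y *ᵥ χ ζ y) i := fun i =>
      ((ContinuousLinearMap.proj (R := ℂ) (φ := fun _ : Fin 2 => ℂ) i).integral_comp_comm hint).symm
    rw [heq ζ hζ x hx, Pi.add_apply, hcomp]
  · simp only [Matrix.cons_val_zero, zero_add, ← integral_neg]
    congr 1 with y
    simp only [mulVec_zero_apply, hKdef, offDiag]
    simp
    ring
  · simp only [Matrix.cons_val_one, sub_eq_add_neg, ← integral_neg]
    congr 2 with y
    simp only [mulVec_one_apply, hKdef, offDiag]
    simp

/-- Uniqueness of the Jost solution. -/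
lemma IsDecayingSol.unique (hw : IsPotential w C) (hζ : ζ ∈ closedQuadrants)
    {f g : ℝ → Fin 2 → ℂ} (hf : IsDecayingSol (offDiag w ζ) ζ f)
    (hg : IsDecayingSol (offDiag w ζ) ζ g) {x : ℝ} (hx : 0 ≤ x) : f x = g x := by
  have hb := (hw.offDiag_coeff ζ).bound
  have hC := hw.nonneg
  have h := energy_backward (C := ‖ζ‖ * C) (ρ := 0) (by positivity)
    (y₁ := fun s => f s 0 - g s 0) (y₂ := fun s => f s 1 - g s 1)
    (m₁₁ := fun _ => -2 * I * ζ ^ 2) (m₁₂ := fun s => offDiag w ζ s 0 1)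
    (m₂₁ := fun s => offDiag w ζ s 1 0) (m₂₂ := fun _ => 0) (r₁ := fun _ => 0) (r₂ := fun _ => 0)
    ((continuousOn_pi.1 hf.cont 0).sub (continuousOn_pi.1 hg.cont 0))
    ((continuousOn_pi.1 hf.cont 1).sub (continuousOn_pi.1 hg.cont 1))
    (fun s hs => by
      refine ((hf.deriv_fst s hs).sub (hg.deriv_fst s hs)).congr_deriv ?_
      rw [mulVec_zero_apply, mulVec_zero_apply]
      simp [offDiag]; ring)
    (fun s hs => by
      refine ((hf.deriv_snd s hs).sub (hg.deriv_snd s hs)).congr_deriv ?_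
      rw [mulVec_one_apply, mulVec_one_apply]
      simp [offDiag]; ring)
    (fun s _ => by
      have := re_two_I_mul_sq ζ
      have h0 : 0 ≤ ζ.re * ζ.im := hζ
      have h1 : (-2 * I * ζ ^ 2) = -(2 * I * ζ ^ 2) := by ring
      rw [h1, neg_re, this]; linarith)
    (by simp) (fun s hs => hb s (le_of_lt hs) 0 1) (fun s hs => hb s (le_of_lt hs) 1 0)
    (by simp) (by simp)
    (by simpa using hf.tendsto_fst.sub hg.tendsto_fst)
    (by simpa using hf.tendsto_snd.sub hg.tendsto_snd) hx
  have h' : ‖f x 0 - g x 0‖ ^ 2 + ‖f x 1 - g x 1‖ ^ 2 ≤ 0 := by simpa using h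
  have a0 : ‖f x 0 - g x 0‖ = 0 := by
    nlinarith [sq_nonneg ‖f x 0 - g x 0‖, sq_nonneg ‖f x 1 - g x 1‖]
  have a1 : ‖f x 1 - g x 1‖ = 0 := by
    nlinarith [sq_nonneg ‖f x 0 - g x 0‖, sq_nonneg ‖f x 1 - g x 1‖]
  ext i
  fin_cases i
  · exact sub_eq_zero.1 (norm_eq_zero.1 a0)
  · exact sub_eq_zero.1 (norm_eq_zero.1 a1)

lemma jost_spec (hw : IsPotential w C) (hζ : ζ ∈ closedQuadrants) :
    IsDecayingSol (offDiag w ζ) ζ (jost w ζ) := by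
  obtain ⟨χ, h, -⟩ := exists_jost_local hw (‖ζ‖ + 1)
  exact Classical.epsilon_spec ⟨χ ζ, h ζ ⟨hζ, by simp⟩⟩

lemma jost_eq_local (hw : IsPotential w C) {R : ℝ} {χ : ℂ → ℝ → Fin 2 → ℂ}
    (h : ∀ ζ ∈ closedQuadrants ∩ Metric.ball 0 R, IsDecayingSol (offDiag w ζ) ζ (χ ζ)) {x : ℝ}
    (hx : 0 ≤ x) : EqOn (fun ζ => jost w ζ x) (fun ζ => χ ζ x)
      (closedQuadrants ∩ Metric.ball 0 R) := fun ζ hζ =>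
  (jost_spec hw hζ.1).unique hw hζ.1 (h ζ hζ) hx

lemma continuousOn_jost (hw : IsPotential w C) {x : ℝ} (hx : 0 ≤ x) :
    ContinuousOn (fun ζ => jost w ζ x) closedQuadrants := by
  intro ζ hζ
  obtain ⟨χ, h, hc, -⟩ := exists_jost_local hw (‖ζ‖ + 1)
  have := ((hc x hx).congr (jost_eq_local hw h hx)) ζ ⟨hζ, by simp⟩
  refine this.mono_of_mem_nhdsWithin ?_
  exact inter_mem self_mem_nhdsWithin (mem_nhdsWithin_of_mem_nhds
    (Metric.isOpen_ball.mem_nhds (by simp)))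

lemma differentiableOn_jost (hw : IsPotential w C) {x : ℝ} (hx : 0 ≤ x) :
    DifferentiableOn ℂ (fun ζ => jost w ζ x) openQuadrants := by
  intro ζ hζ
  obtain ⟨χ, h, -, hd⟩ := exists_jost_local hw (‖ζ‖ + 1)
  have h1 : EqOn (fun ζ => jost w ζ x) (fun ζ => χ ζ x)
      (openQuadrants ∩ Metric.ball 0 (‖ζ‖ + 1)) :=
    (jost_eq_local hw h hx).mono (inter_subset_inter_left _ openQuadrants_subset)
  have := ((hd x hx).congr h1) ζ ⟨hζ, by simp⟩
  refine this.mono_of_mem_nhdsWithin ?_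
  exact inter_mem self_mem_nhdsWithin (mem_nhdsWithin_of_mem_nhds
    (Metric.isOpen_ball.mem_nhds (by simp)))

end

/-! ### The spectral functions in terms of the Jost solution -/

/-- The phase `½ ∫₀ˣ |w|²`. -/
noncomputable def phase (w : ℝ → ℂ) (x : ℝ) : ℝ := (∫ y in (0 : ℝ)..x, ‖w y‖ ^ 2) / 2

/-- The limit of the phase at infinity. -/
noncomputable def phaseInf (w : ℝ → ℂ) : ℝ := (∫ y in Ioi (0 : ℝ), ‖w y‖ ^ 2) / 2

section

variable {w : ℝ → ℂ} {C : ℝ} {ζ : ℂ}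

lemma hasDerivAt_phase (hw : Continuous w) (x : ℝ) :
    HasDerivAt (phase w) (‖w x‖ ^ 2 / 2) x :=
  (((hw.norm.pow 2).integral_hasStrictDerivAt 0 x).hasDerivAt).div_const 2

@[simp] lemma phase_zero (w : ℝ → ℂ) : phase w 0 = 0 := by simp [phase]

lemma IsPotential.norm_sq_bound (hw : IsPotential w C) {s : ℝ} (hs : 0 ≤ s) :
    ‖w s‖ ^ 2 ≤ C ^ 2 * (1 + s ^ 2)⁻¹ := by
  have := mul_le_mul (hw.bound' hs) (hw.bound s hs) (norm_nonneg _) hw.nonneg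
  rw [pow_two, pow_two]; linarith

lemma IsPotential.integrable_norm_sq (hw : IsPotential w C) :
    IntegrableOn (fun y => ‖w y‖ ^ 2) (Ioi 0) := by
  refine Integrable.mono' ((integrable_inv_one_add_sq.const_mul (C ^ 2)).integrableOn)
    (hw.cont.norm.pow 2).aestronglyMeasurable ?_
  filter_upwards [ae_restrict_mem measurableSet_Ioi] with y hy
  rw [Real.norm_of_nonneg (by positivity)]
  exact hw.norm_sq_bound (le_of_lt hy)

lemma tendsto_phase (hw : IsPotential w C) : Tendsto (phase w) atTop (𝓝 (phaseInf w)) :=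
  (intervalIntegral_tendsto_integral_Ioi 0 hw.integrable_norm_sq tendsto_id).div_const 2

lemma conj_mul_eq_norm_sq (z : ℂ) : z * conj z = (‖z‖ : ℂ) ^ 2 := by
  rw [Complex.mul_conj, Complex.normSq_eq_norm_sq]; push_cast; rfl

/-- The coefficient matrix `V1` with `w` in place of the derivative of the datum. -/
noncomputable def gaugedCoeff (w : ℝ → ℂ) (ζ : ℂ) (x : ℝ) : Matrix (Fin 2) (Fin 2) ℂ :=
  !![-(I / 2) * (‖w x‖ : ℂ) ^ 2, ζ * w x * exp (-2 * I * phase w x);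
     ζ * conj (w x) * exp (2 * I * phase w x), (I / 2) * (‖w x‖ : ℂ) ^ 2]

lemma continuous_phase (hw : Continuous w) : Continuous (phase w) :=
  continuous_iff_continuousAt.2 fun x => (hasDerivAt_phase hw x).continuousAt

lemma IsPotential.gaugedCoeff_coeff (hw : IsPotential w C) (ζ : ℂ) :
    IsDecayingCoeff (gaugedCoeff w ζ) (‖ζ‖ * C + C ^ 2) := by
  have h0 := hw.nonneg
  have hc := hw.cont
  have hp := continuous_phase hc
  refine ⟨fun i j => ?_, fun y hy i j => ?_⟩
  · refine Continuous.continuousOn ?_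
    fin_cases i <;> fin_cases j <;> simp [gaugedCoeff] <;> fun_prop
  · have h1 := mul_le_mul_of_nonneg_left (hw.bound y hy) (norm_nonneg ζ)
    have h2 := hw.norm_sq_bound hy
    have h3 : 0 ≤ ‖ζ‖ * (C * (1 + y ^ 2)⁻¹) := by positivity
    have h4 : 0 ≤ ‖w y‖ ^ 2 := by positivity
    have h5 : ∀ r : ℝ, ‖exp (2 * I * r)‖ = 1 := fun r => by
      rw [norm_exp]; simp
    have h6 : ∀ r : ℝ, ‖exp (-(2 * I * r))‖ = 1 := fun r => by
      rw [norm_exp]; simp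
    fin_cases i <;> fin_cases j <;> simp [gaugedCoeff, h5, h6] <;> linarith

lemma V1_eq_gaugedCoeff {u₀ : ℝ → ℂ} (h : ∀ x, 0 < x → deriv u₀ x = w x) {x : ℝ} (hx : 0 < x) :
    V1 u₀ ζ x = gaugedCoeff w ζ x := by
  have hph : (∫ y in (0 : ℝ)..x, ‖deriv u₀ y‖ ^ 2 : ℝ) = 2 * phase w x := by
    rw [phase, mul_div_cancel₀ _ two_ne_zero]
    refine intervalIntegral.integral_congr_ae (Eventually.of_forall fun y hy => ?_)
    rw [uIoc_of_le hx.le] at hy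
    rw [h y hy.1]
  rw [V1, gaugedCoeff, h x hx]
  simp only [hph]
  push_cast
  congr 4 <;> ring_nf

/-- The integrals run over `(x, ∞)` with `x ≥ 0`, and the phase in `V1` is itself an integral, so
the behaviour of `u₀` at and below zero plays no role. -/
lemma isMu3Column_iff {u₀ : ℝ → ℂ} (h : ∀ x, 0 < x → deriv u₀ x = w x) {f : ℝ → Fin 2 → ℂ} :
    IsMu3Column u₀ ζ f ↔ IsVolterraSol (gaugedCoeff w ζ) ζ f := by
  have e : ∀ x, 0 ≤ x → ∀ y ∈ Ioi x, V1 u₀ ζ y = gaugedCoeff w ζ y := fun x hx y hy =>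
    V1_eq_gaugedCoeff h (lt_of_le_of_lt hx hy)
  have e0 : ∀ x : ℝ, 0 ≤ x → (∫ y in Ioi x, exp (2 * I * ζ ^ 2 * ((y : ℂ) - x)) * (V1 u₀ ζ y *ᵥ f y) 0) =
      ∫ y in Ioi x, exp (2 * I * ζ ^ 2 * ((y : ℂ) - x)) * (gaugedCoeff w ζ y *ᵥ f y) 0 :=
    fun x hx => setIntegral_congr_fun measurableSet_Ioi fun y hy => by
      simp only [e x hx y hy]
  have e1 : ∀ x, 0 ≤ x → (∫ y in Ioi x, (V1 u₀ ζ y *ᵥ f y) 1) =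
      ∫ y in Ioi x, (gaugedCoeff w ζ y *ᵥ f y) 1 :=
    fun x hx => setIntegral_congr_fun measurableSet_Ioi fun y hy => by
      simp only [e x hx y hy]
  constructor
  · rintro ⟨a, b, c, d⟩
    exact ⟨a, b, fun x hx => by rw [c x hx, e0 x hx], fun x hx => by rw [d x hx, e1 x hx]⟩
  · rintro ⟨a, b, c, d⟩
    exact ⟨a, b, fun x hx => by rw [c x hx, e0 x hx], fun x hx => by rw [d x hx, e1 x hx]⟩

lemma hasDerivAt_exp_I_phase (hw : Continuous w) (c s : ℂ) (x : ℝ) :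
    HasDerivAt (fun x => exp (c * (phase w x + s)))
      (exp (c * (phase w x + s)) * (c * ((‖w x‖ : ℂ) ^ 2 / 2))) x := by
  have h := (((hasDerivAt_phase hw x).ofReal_comp.add_const s).const_mul c).cexp
  refine h.congr_deriv ?_
  push_cast; ring

/-- The gauge transformation from the Jost system to the gauged system. -/
lemma IsDecayingSol.to_gauged (hw : IsPotential w C) {f : ℝ → Fin 2 → ℂ}
    (hf : IsDecayingSol (offDiag w ζ) ζ f) :
    IsDecayingSol (gaugedCoeff w ζ) ζ (fun x => ![exp (-I * (phase w x + phaseInf w)) * f x 0,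
      exp (I * (phase w x + -phaseInf w)) * f x 1]) := by
  have hc := hw.cont
  have hp := continuous_phase hc
  have hl : Tendsto (fun x => ((phase w x : ℝ) : ℂ)) atTop (𝓝 (phaseInf w : ℂ)) :=
    (continuous_ofReal.tendsto _).comp (tendsto_phase hw)
  refine ⟨?_, fun s hs => ?_, fun s hs => ?_, ?_, ?_⟩
  · refine continuousOn_pi.2 fun i => ?_
    have h0 := continuousOn_pi.1 hf.cont 0
    have h1 := continuousOn_pi.1 hf.cont 1
    fin_cases i <;> simp <;> fun_prop
  · have h := (hasDerivAt_exp_I_phase hc (-I) (phaseInf w) s).mul (hf.deriv_fst s hs)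
    refine h.congr_deriv ?_
    simp only [mulVec_zero_apply, offDiag, gaugedCoeff]
    simp only [Matrix.of_apply, Matrix.cons_val', Matrix.cons_val_zero, Matrix.cons_val_one,
      Matrix.cons_val_fin_one]
    have e : exp (-2 * I * phase w s) * exp (I * (phase w s + -phaseInf w)) =
        exp (-I * (phase w s + phaseInf w)) := by
      rw [← exp_add]; congr 1; ring
    linear_combination -(ζ * w s * f s 1) * e
  · have h := (hasDerivAt_exp_I_phase hc I (-phaseInf w) s).mul (hf.deriv_snd s hs)
    refine h.congr_deriv ?_
    simp only [mulVec_one_apply, offDiag, gaugedCoeff]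
    simp only [Matrix.of_apply, Matrix.cons_val', Matrix.cons_val_zero, Matrix.cons_val_one,
      Matrix.cons_val_fin_one]
    have e : exp (2 * I * phase w s) * exp (-I * (phase w s + phaseInf w)) =
        exp (I * (phase w s + -phaseInf w)) := by
      rw [← exp_add]; congr 1; ring
    linear_combination -(ζ * conj (w s) * f s 0) * e
  · have := (((hl.add_const (phaseInf w : ℂ)).const_mul (-I)).cexp).mul hf.tendsto_fst
    simpa using this
  · have := (((hl.add_const (-phaseInf w : ℂ)).const_mul I).cexp).mul hf.tendsto_snd
    simpa using this

lemma IsDecayingSol.of_gauged (hw : IsPotential w C) {f : ℝ → Fin 2 → ℂ}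
    (hf : IsDecayingSol (gaugedCoeff w ζ) ζ f) :
    IsDecayingSol (offDiag w ζ) ζ (fun x => ![exp (I * (phase w x + phaseInf w)) * f x 0,
      exp (-I * (phase w x + -phaseInf w)) * f x 1]) := by
  have hc := hw.cont
  have hp := continuous_phase hc
  have hl : Tendsto (fun x => ((phase w x : ℝ) : ℂ)) atTop (𝓝 (phaseInf w : ℂ)) :=
    (continuous_ofReal.tendsto _).comp (tendsto_phase hw)
  refine ⟨?_, fun s hs => ?_, fun s hs => ?_, ?_, ?_⟩
  · refine continuousOn_pi.2 fun i => ?_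
    have h0 := continuousOn_pi.1 hf.cont 0
    have h1 := continuousOn_pi.1 hf.cont 1
    fin_cases i <;> simp <;> fun_prop
  · have h := (hasDerivAt_exp_I_phase hc I (phaseInf w) s).mul (hf.deriv_fst s hs)
    refine h.congr_deriv ?_
    simp only [mulVec_zero_apply, offDiag, gaugedCoeff]
    simp only [Matrix.of_apply, Matrix.cons_val', Matrix.cons_val_zero, Matrix.cons_val_one,
      Matrix.cons_val_fin_one]
    have e : exp (I * (phase w s + phaseInf w)) * exp (-2 * I * phase w s) =
        exp (-I * (phase w s + -phaseInf w)) := by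
      rw [← exp_add]; congr 1; ring
    linear_combination (ζ * w s * f s 1) * e
  · have h := (hasDerivAt_exp_I_phase hc (-I) (-phaseInf w) s).mul (hf.deriv_snd s hs)
    refine h.congr_deriv ?_
    simp only [mulVec_one_apply, offDiag, gaugedCoeff]
    simp only [Matrix.of_apply, Matrix.cons_val', Matrix.cons_val_zero, Matrix.cons_val_one,
      Matrix.cons_val_fin_one]
    have e : exp (-I * (phase w s + -phaseInf w)) * exp (2 * I * phase w s) =
        exp (I * (phase w s + phaseInf w)) := by
      rw [← exp_add]; congr 1; ring
    linear_combination (ζ * conj (w s) * f s 0) * e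
  · have := (((hl.add_const (phaseInf w : ℂ)).const_mul I).cexp).mul hf.tendsto_fst
    simpa using this
  · have := (((hl.add_const (-phaseInf w : ℂ)).const_mul (-I)).cexp).mul hf.tendsto_snd
    simpa using this

/-- The spectral functions are the values of the Jost solution at `x = 0`, up to a phase. -/
theorem spec_eq_jost {u₀ : ℝ → ℂ} (hw : IsPotential w C) (h : ∀ x, 0 < x → deriv u₀ x = w x)
    (hζ : ζ ∈ closedQuadrants) :
    specB u₀ ζ = exp (-I * phaseInf w) * jost w ζ 0 0 ∧
      specA u₀ ζ = exp (-I * phaseInf w) * jost w ζ 0 1 := by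
  -- `mu3` is chosen by epsilon, so its equations are available only once some solution is known.
  -- The gauged Jost solution is one; conversely, `mu3` with the gauge undone is `jost` by
  -- uniqueness, and at `x = 0` both gauge factors reduce to the same constant phase.
  have hex : ∃ f, IsMu3Column u₀ ζ f := ⟨_, (isMu3Column_iff h).2
    (((jost_spec hw hζ).to_gauged hw).isVolterraSol hζ (hw.gaugedCoeff_coeff ζ))⟩
  have h1 : IsMu3Column u₀ ζ (mu3 u₀ ζ) := Classical.epsilon_spec hex
  have h2 := (((isMu3Column_iff h).1 h1).isDecayingSol hζ (hw.gaugedCoeff_coeff ζ)).of_gauged hw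
  have h3 := (jost_spec hw hζ).unique hw hζ h2 le_rfl
  rw [h3, specA, specB]
  simp [← mul_assoc, ← exp_add]

end

/-! ### Regularity of the solution -/

lemma contDiff_dx {u : ℝ → ℝ → ℂ} (h : ContDiff ℝ ∞ (fun p : ℝ × ℝ => u p.1 p.2)) :
    ContDiff ℝ ∞ (fun p : ℝ × ℝ => dx u p.1 p.2) ∧
      ∀ x t, HasDerivAt (fun y => u y t) (dx u x t) x := by
  have hd : ∀ x t, HasDerivAt (fun y => u y t)
      (fderiv ℝ (fun p : ℝ × ℝ => u p.1 p.2) (x, t) (1, 0)) x := by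
    intro x t
    have h1 := (h.differentiable (by simp) (x, t)).hasFDerivAt
    have h2 : HasDerivAt (fun y : ℝ => (y, t)) ((1 : ℝ), (0 : ℝ)) x :=
      (hasDerivAt_id x).prodMk (hasDerivAt_const x t)
    exact h1.comp_hasDerivAt x h2
  have he : ∀ x t, dx u x t = fderiv ℝ (fun p : ℝ × ℝ => u p.1 p.2) (x, t) (1, 0) :=
    fun x t => (hd x t).deriv
  refine ⟨?_, fun x t => by rw [he]; exact hd x t⟩
  simp_rw [he]
  exact (h.fderiv_right (m := ∞) (by simp)).clm_apply contDiff_const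

lemma contDiff_dt {u : ℝ → ℝ → ℂ} (h : ContDiff ℝ ∞ (fun p : ℝ × ℝ => u p.1 p.2)) :
    ContDiff ℝ ∞ (fun p : ℝ × ℝ => dt u p.1 p.2) ∧
      ∀ x t, HasDerivAt (fun s => u x s) (dt u x t) t := by
  have hd : ∀ x t, HasDerivAt (fun s => u x s)
      (fderiv ℝ (fun p : ℝ × ℝ => u p.1 p.2) (x, t) (0, 1)) t := by
    intro x t
    have h1 := (h.differentiable (by simp) (x, t)).hasFDerivAt
    have h2 : HasDerivAt (fun s : ℝ => (x, s)) ((0 : ℝ), (1 : ℝ)) t :=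
      (hasDerivAt_const t x).prodMk (hasDerivAt_id t)
    exact h1.comp_hasDerivAt t h2
  have he : ∀ x t, dt u x t = fderiv ℝ (fun p : ℝ × ℝ => u p.1 p.2) (x, t) (0, 1) :=
    fun x t => (hd x t).deriv
  refine ⟨?_, fun x t => by rw [he]; exact hd x t⟩
  simp_rw [he]
  exact (h.fderiv_right (m := ∞) (by simp)).clm_apply contDiff_const

lemma continuous_slice {g : ℝ → ℝ → ℂ} (h : ContDiff ℝ ∞ (fun p : ℝ × ℝ => g p.1 p.2)) (t : ℝ) :
    Continuous (fun x => g x t) := h.continuous.comp (f := fun x : ℝ => (x, t)) (by fun_prop)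

lemma convex_timeInterval (T : EReal) : Convex ℝ (timeInterval T) := by
  have : OrdConnected (timeInterval T) := ⟨fun a ha b hb c hc =>
    ⟨ha.1.trans hc.1, (EReal.coe_le_coe_iff.2 hc.2).trans hb.2⟩⟩
  exact this.convex

/-- The equation and the boundary condition are given without some of the end points; continuity
carries them to the closed interval through this density. -/
lemma mem_closure_Ioo_timeInterval {T : EReal} (hT : 0 < T) {t : ℝ} (ht : t ∈ timeInterval T) :
    t ∈ closure {s : ℝ | 0 < s ∧ (s : EReal) < T} := by
  rcases eq_or_ne T ⊤ with rfl | hT'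
  · have : {s : ℝ | 0 < s ∧ (s : EReal) < ⊤} = Ioi 0 := by
      ext s; simp
    rw [this, closure_Ioi]
    exact ht.1
  · lift T to ℝ using ⟨hT', (EReal.bot_lt_zero.trans hT).ne'⟩
    have h0 : 0 < T := by exact_mod_cast hT
    have : {s : ℝ | 0 < s ∧ (s : EReal) < T} = Ioo 0 T := by
      ext s; simp
    rw [this, closure_Ioo h0.ne]
    exact ⟨ht.1, by exact_mod_cast ht.2⟩

/-- The data of the problem: a smooth decaying solution with its boundary condition. -/
structure IsHalfLineSolution (α : ℝ) (T : EReal) (u : ℝ → ℝ → ℂ) : Prop where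
  pos : 0 < T
  reg : SmoothDecaying T u
  eq : ∀ x t : ℝ, 0 ≤ x → t ∈ timeInterval T →
    dt (dx u) x t = dx (dx u) x t + 2 * I * dx u x t - u x t - I * (u x t * conj (u x t)) * dx u x t
  bdry : ∀ t ∈ timeInterval T, dx u 0 t = exp (I * α) * u 0 t

lemma isHalfLineSolution {α : ℝ} {T : EReal} {u : ℝ → ℝ → ℂ} (hT : 0 < T)
    (hreg : SmoothDecaying T u) (heq : SolvesEquation T u)
    (hbdry : ∀ t : ℝ, 0 ≤ t → (t : EReal) < T → dx u 0 t = exp (I * α) * u 0 t) :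
    IsHalfLineSolution α T u := by
  have h1 := contDiff_dx hreg.smooth
  have c0 : Continuous (fun p : ℝ × ℝ => u p.1 p.2) := hreg.smooth.continuous
  have c1 : Continuous (fun p : ℝ × ℝ => dx u p.1 p.2) := h1.1.continuous
  have c2 : Continuous (fun p : ℝ × ℝ => dx (dx u) p.1 p.2) := (contDiff_dx h1.1).1.continuous
  have c3 : Continuous (fun p : ℝ × ℝ => dt (dx u) p.1 p.2) := (contDiff_dt h1.1).1.continuous
  refine ⟨hT, hreg, fun x t hx ht => ?_, fun t ht => ?_⟩
  · have hcl : IsClosed {p : ℝ × ℝ | dt (dx u) p.1 p.2 = dx (dx u) p.1 p.2 + 2 * I * dx u p.1 p.2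
        - u p.1 p.2 - I * (u p.1 p.2 * conj (u p.1 p.2)) * dx u p.1 p.2} :=
      isClosed_eq c3 (by fun_prop)
    have hsub : Ioi (0 : ℝ) ×ˢ {s : ℝ | 0 < s ∧ (s : EReal) < T} ⊆
        {p : ℝ × ℝ | dt (dx u) p.1 p.2 = dx (dx u) p.1 p.2 + 2 * I * dx u p.1 p.2
        - u p.1 p.2 - I * (u p.1 p.2 * conj (u p.1 p.2)) * dx u p.1 p.2} := by
      rintro ⟨y, s⟩ ⟨hy, hs⟩
      have := heq y s hy hs.1 hs.2
      simp only [mem_ofPred_eq]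
      rw [conj_mul_eq_norm_sq]
      linear_combination this
    have := closure_minimal hsub hcl
    rw [closure_prod_eq, closure_Ioi] at this
    exact @this (x, t) ⟨hx, mem_closure_Ioo_timeInterval hT ht⟩
  · have hcl : IsClosed {s : ℝ | dx u 0 s = exp (I * α) * u 0 s} := by
      refine isClosed_eq (c1.comp (f := fun s : ℝ => ((0 : ℝ), s)) (by fun_prop)) ?_
      exact continuous_const.mul (c0.comp (f := fun s : ℝ => ((0 : ℝ), s)) (by fun_prop))
    exact closure_minimal (fun s hs => hbdry s (le_of_lt hs.1) hs.2) hcl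
      (mem_closure_Ioo_timeInterval hT ht)

/-! ### Taylor estimates on convex sets of times. -/

lemma norm_sub_le_of_hasDerivAt {S : Set ℝ} (hS : Convex ℝ S) {g g' : ℝ → ℂ} {M : ℝ}
    (hg : ∀ s, HasDerivAt g (g' s) s) (hM : ∀ s ∈ S, ‖g' s‖ ≤ M) {s t : ℝ} (hs : s ∈ S)
    (ht : t ∈ S) : ‖g s - g t‖ ≤ M * |s - t| :=
  hS.norm_image_sub_le_of_norm_hasDerivWithin_le (fun σ _ => (hg σ).hasDerivWithinAt) hM ht hs

/-- The mean value inequality for `g - (· - t) g'(t)`, whose derivative between `t` and `s` is at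
most `M |s - t|`. The sharp factor `1 / 2` is not needed. -/
lemma norm_sub_sub_le_of_hasDerivAt {S : Set ℝ} (hS : Convex ℝ S) {g g' g'' : ℝ → ℂ} {M : ℝ}
    (hg : ∀ s, HasDerivAt g (g' s) s) (hg' : ∀ s, HasDerivAt g' (g'' s) s)
    (hM : ∀ s ∈ S, ‖g'' s‖ ≤ M) {s t : ℝ} (hs : s ∈ S) (ht : t ∈ S) :
    ‖g s - g t - (s - t) * g' t‖ ≤ M * |s - t| ^ 2 := by
  have hM0 : 0 ≤ M := (norm_nonneg _).trans (hM s hs)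
  have hsub : uIcc t s ⊆ S := by
    rw [← segment_eq_uIcc]; exact hS.segment_subset ht hs
  have h1 : ∀ σ, HasDerivAt (fun σ : ℝ => g σ - ((σ : ℂ) - t) * g' t) (g' σ - 1 * g' t) σ :=
    fun σ => (hg σ).sub (((hasDerivAt_id σ).ofReal_comp.sub_const (t : ℂ)).mul_const _)
  have h2 := norm_sub_le_of_hasDerivAt (convex_uIcc t s) h1 (M := M * |s - t|) (fun σ hσ => by
    rw [one_mul]
    refine (norm_sub_le_of_hasDerivAt hS hg' hM (hsub hσ) ht).trans
      (mul_le_mul_of_nonneg_left ?_ hM0)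
    exact abs_sub_left_of_mem_uIcc hσ) (right_mem_uIcc) (left_mem_uIcc)
  calc _ = ‖g s - (s - t) * g' t - (g t - ((t : ℂ) - t) * g' t)‖ := by
        congr 1; ring
    _ ≤ _ := h2.trans (le_of_eq (by ring))

/-! ### Decay, the conservation law and the evolution of the phase. -/

namespace IsHalfLineSolution

variable {α : ℝ} {T : EReal} {u : ℝ → ℝ → ℂ}

lemma decay (h : IsHalfLineSolution α T u) (i j : ℕ) (T' : ℝ) :
    ∃ C, 0 ≤ C ∧ ∀ x t, 0 ≤ x → t ∈ timeInterval T → t ≤ T' →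
      ‖dt^[j] (dx^[i] u) x t‖ ≤ C * (1 + x ^ 2)⁻¹ := by
  obtain ⟨C₀, h₀⟩ := h.reg.decay i j 0 T'
  obtain ⟨C₂, h₂⟩ := h.reg.decay i j 2 T'
  refine ⟨|C₀| + |C₂|, by positivity, fun x t hx ht htT => ?_⟩
  rw [← div_eq_mul_inv, le_div_iff₀ (by positivity)]
  have e₀ := h₀ x t hx ht htT
  have e₂ := h₂ x t hx ht htT
  rw [pow_zero, one_mul] at e₀
  linarith [le_abs_self C₀, le_abs_self C₂]

lemma smooth_dx (h : IsHalfLineSolution α T u) :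
    ContDiff ℝ ∞ (fun p : ℝ × ℝ => dx u p.1 p.2) := (contDiff_dx h.reg.smooth).1

lemma potential_uniform (h : IsHalfLineSolution α T u) (T' : ℝ) :
    ∃ C, ∀ t ∈ timeInterval T, t ≤ T' → IsPotential (fun x => dx u x t) C := by
  obtain ⟨C, -, hC⟩ := h.decay 1 0 T'
  exact ⟨C, fun t ht htT => ⟨continuous_slice h.smooth_dx t, fun x hx => hC x t hx ht htT⟩⟩

lemma potential (h : IsHalfLineSolution α T u) {t : ℝ} (ht : t ∈ timeInterval T) :
    ∃ C, IsPotential (fun x => dx u x t) C := by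
  obtain ⟨C, hC⟩ := h.potential_uniform t
  exact ⟨C, hC t ht le_rfl⟩

lemma zero_mem (h : IsHalfLineSolution α T u) : (0 : ℝ) ∈ timeInterval T :=
  ⟨le_rfl, by exact_mod_cast h.pos.le⟩

lemma mem_of_le {s t : ℝ} (ht : t ∈ timeInterval T) (hs : 0 ≤ s) (hst : s ≤ t) :
    s ∈ timeInterval T := ⟨hs, (EReal.coe_le_coe_iff.2 hst).trans ht.2⟩

/-- The local conservation law `(|u_x|²)_t = (|u_x|² - |u|²)_x`. -/
lemma conservation (h : IsHalfLineSolution α T u) {x t : ℝ} (hx : 0 ≤ x) (ht : t ∈ timeInterval T) :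
    HasDerivAt (fun y => ‖dx u y t‖ ^ 2 - ‖u y t‖ ^ 2)
      (2 * inner ℝ (dx u x t) (dt (dx u) x t)) x := by
  have h1 := ((contDiff_dx h.smooth_dx).2 x t).norm_sq
  have h2 := ((contDiff_dx h.reg.smooth).2 x t).norm_sq
  refine (h1.sub h2).congr_deriv ?_
  rw [h.eq x t hx ht]
  simp only [Complex.inner, mul_re, mul_im, add_re, add_im, sub_re, sub_im, conj_re, conj_im, I_re,
    I_im, re_ofNat, im_ofNat]
  ring

lemma hasDerivAt_norm_sq (h : IsHalfLineSolution α T u) (x t : ℝ) :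
    HasDerivAt (fun s => ‖dx u x s‖ ^ 2) (2 * inner ℝ (dx u x t) (dt (dx u) x t)) t :=
  ((contDiff_dt h.smooth_dx).2 x t).norm_sq

/-- It makes the flux of the conservation law vanish at `x = 0`, so that the phase has no boundary
contribution, and it removes the phase from the time evolution along `x = 0`. -/
lemma norm_bdry (h : IsHalfLineSolution α T u) {t : ℝ} (ht : t ∈ timeInterval T) :
    ‖dx u 0 t‖ = ‖u 0 t‖ := by
  rw [h.bdry t ht, norm_mul, norm_exp]
  simp

lemma continuous_flux (h : IsHalfLineSolution α T u) :
    Continuous (fun p : ℝ × ℝ => 2 * inner ℝ (dx u p.1 p.2) (dt (dx u) p.1 p.2)) := by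
  have c1 := h.smooth_dx.continuous
  have c3 := (contDiff_dt h.smooth_dx).1.continuous
  exact continuous_const.mul (c1.inner c3)

/-- Evolution of the phase in time. -/
lemma hasDerivAt_phase_time (h : IsHalfLineSolution α T u) {x t : ℝ} (hx : 0 ≤ x)
    (ht : t ∈ timeInterval T) :
    HasDerivAt (fun s => phase (fun y => dx u y s) x) ((‖dx u x t‖ ^ 2 - ‖u x t‖ ^ 2) / 2) t := by
  have hcont := h.continuous_flux
  obtain ⟨B, hB⟩ := ((isCompact_Icc (a := (0 : ℝ)) (b := x)).prod
    (isCompact_Icc (a := t - 1) (b := t + 1))).exists_bound_of_continuousOn hcont.continuousOn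
  have key := (intervalIntegral.hasDerivAt_integral_of_dominated_loc_of_deriv_le (𝕜 := ℝ)
    (μ := volume) (a := 0) (b := x)
    (F := fun s y => ‖dx u y s‖ ^ 2) (F' := fun s y => 2 * inner ℝ (dx u y s) (dt (dx u) y s))
    (x₀ := t) (s := Metric.ball t 1) (bound := fun _ => B) (Metric.ball_mem_nhds t one_pos)
    (Eventually.of_forall fun s =>
      ((continuous_slice h.smooth_dx s).norm.pow 2).aestronglyMeasurable)
    (((continuous_slice h.smooth_dx t).norm.pow 2).intervalIntegrable _ _)
    ((hcont.comp (f := fun y : ℝ => (y, t)) (by fun_prop)).aestronglyMeasurable)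
    (Eventually.of_forall fun y hy s hs => by
      rw [uIoc_of_le hx] at hy
      rw [Metric.mem_ball, Real.dist_eq, abs_lt] at hs
      exact hB (y, s) ⟨⟨hy.1.le, hy.2⟩, ⟨by linarith, by linarith⟩⟩)
    intervalIntegrable_const
    (Eventually.of_forall fun y hy s hs => h.hasDerivAt_norm_sq y s)).2
  refine (key.div_const 2).congr_deriv ?_
  congr 1
  rw [intervalIntegral.integral_eq_sub_of_hasDerivAt (f := fun y => ‖dx u y t‖ ^ 2 - ‖u y t‖ ^ 2)]
  · rw [h.norm_bdry ht]; ring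
  · intro y hy
    rw [uIcc_of_le hx] at hy
    exact h.conservation hy.1 ht
  · exact (hcont.comp (f := fun y : ℝ => (y, t)) (by fun_prop)).intervalIntegrable _ _

lemma flux_bound (h : IsHalfLineSolution α T u) {t : ℝ} (ht : t ∈ timeInterval T) :
    ∃ C, ∀ y, 0 ≤ y → |2 * inner ℝ (dx u y t) (dt (dx u) y t)| ≤ C * (1 + y ^ 2)⁻¹ := by
  obtain ⟨C₁, h₁, hC₁⟩ := h.decay 1 0 t
  obtain ⟨C₂, h₂, hC₂⟩ := h.decay 1 1 t
  refine ⟨2 * C₁ * C₂, fun y hy => ?_⟩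
  have e₁ : ‖dx u y t‖ ≤ C₁ := (hC₁ y t hy ht le_rfl).trans (mul_le_of_le_one_right h₁
    (inv_le_one_of_one_le₀ (by nlinarith)))
  have e₂ : ‖dt (dx u) y t‖ ≤ C₂ * (1 + y ^ 2)⁻¹ := hC₂ y t hy ht le_rfl
  have e₃ := mul_le_mul e₁ e₂ (norm_nonneg _) h₁
  have e₄ := abs_real_inner_le_norm (dx u y t) (dt (dx u) y t)
  rw [abs_mul, abs_two]
  linarith

lemma flux_integrable (h : IsHalfLineSolution α T u) {t : ℝ} (ht : t ∈ timeInterval T) :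
    IntegrableOn (fun y => 2 * inner ℝ (dx u y t) (dt (dx u) y t)) (Ioi 0) := by
  obtain ⟨C, hC⟩ := h.flux_bound ht
  refine Integrable.mono' ((integrable_inv_one_add_sq.const_mul C).integrableOn)
    (h.continuous_flux.comp (f := fun y : ℝ => (y, t)) (by fun_prop)).aestronglyMeasurable ?_
  filter_upwards [ae_restrict_mem measurableSet_Ioi] with y hy using hC y (le_of_lt hy)

lemma tendsto_of_decay {g : ℝ → ℂ} {C : ℝ} (hg : ∀ x, 0 ≤ x → ‖g x‖ ≤ C * (1 + x ^ 2)⁻¹) :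
    Tendsto g atTop (𝓝 0) := by
  refine squeeze_zero_norm' (a := fun x : ℝ => C * (1 + x ^ 2)⁻¹) ?_ ?_
  · filter_upwards [eventually_ge_atTop 0] with x hx using hg x hx
  · have : Tendsto (fun x : ℝ => 1 + x ^ 2) atTop atTop :=
      tendsto_atTop_add_const_left _ _ (tendsto_pow_atTop two_ne_zero)
    simpa using this.inv_tendsto_atTop.const_mul C

lemma tendsto_zero (h : IsHalfLineSolution α T u) {t : ℝ} (ht : t ∈ timeInterval T) :
    Tendsto (fun x => u x t) atTop (𝓝 0) ∧ Tendsto (fun x => dx u x t) atTop (𝓝 0) := by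
  obtain ⟨C₁, -, hC₁⟩ := h.decay 1 0 t
  obtain ⟨C₀, -, hC₀⟩ := h.decay 0 0 t
  exact ⟨tendsto_of_decay fun x hx => hC₀ x t hx ht le_rfl,
    tendsto_of_decay fun x hx => hC₁ x t hx ht le_rfl⟩

lemma integral_flux (h : IsHalfLineSolution α T u) {x t : ℝ} (hx : 0 ≤ x)
    (ht : t ∈ timeInterval T) :
    ∫ y in Ioi x, 2 * inner ℝ (dx u y t) (dt (dx u) y t) = -(‖dx u x t‖ ^ 2 - ‖u x t‖ ^ 2) := by
  have hl : Tendsto (fun y => ‖dx u y t‖ ^ 2 - ‖u y t‖ ^ 2) atTop (𝓝 0) := by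
    have := ((h.tendsto_zero ht).2.norm.pow 2).sub ((h.tendsto_zero ht).1.norm.pow 2)
    simpa using this
  rw [integral_Ioi_of_hasDerivAt_of_tendsto'
    (fun y hy => h.conservation (hx.trans hy) ht)
    ((h.flux_integrable ht).mono_set (Ioi_subset_Ioi hx)) hl, zero_sub]

end IsHalfLineSolution

/-! ### The time part of the Lax pair. -/

lemma hasDerivWithinAt_of_quadratic {g : ℝ → ℂ} {S : Set ℝ} {t K r : ℝ} {g' : ℂ} (hr : 0 < r)
    (h : ∀ s ∈ S, |s - t| < r → ‖g s - g t - (s - t) * g'‖ ≤ K * |s - t| ^ 2) :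
    HasDerivWithinAt g g' S t := by
  rw [hasDerivWithinAt_iff_isLittleO]
  have h1 : (fun s => g s - g t - (s - t) • g') =O[𝓝[S] t] fun s => (s - t) ^ 2 := by
    refine Asymptotics.IsBigO.of_bound K ?_
    filter_upwards [self_mem_nhdsWithin,
      mem_nhdsWithin_of_mem_nhds (Metric.ball_mem_nhds t hr)] with s hs hb
    rw [Metric.mem_ball, Real.dist_eq] at hb
    have := h s hs hb
    rw [norm_pow, Real.norm_eq_abs, real_smul]
    exact_mod_cast this
  refine h1.trans_isLittleO ?_
  have h2 : Tendsto (fun s : ℝ => s - t) (𝓝[S] t) (𝓝 0) := by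
    have : Tendsto (fun s : ℝ => s - t) (𝓝 t) (𝓝 (t - t)) := tendsto_id.sub_const t
    rw [sub_self] at this
    exact this.mono_left nhdsWithin_le_nhds
  have h3 : (fun s : ℝ => (s - t) * (s - t)) =o[𝓝[S] t] fun s => 1 * (s - t) :=
    ((Asymptotics.isLittleO_one_iff ℝ).2 h2).mul_isBigO (Asymptotics.isBigO_refl _ _)
  simpa [pow_two] using h3

/-- The coefficient matrix of the time part of the Lax pair, for the second column. -/
noncomputable def timeCoeff (w v : ℝ → ℂ) (ζ : ℂ) (s : ℝ) : Matrix (Fin 2) (Fin 2) ℂ :=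
  !![-2 * I * eta ζ ^ 2 - I / 2 * (v s * conj (v s)), ζ * w s + I * v s * (1 / (2 * ζ));
     ζ * conj (w s) - I * conj (v s) * (1 / (2 * ζ)), I / 2 * (v s * conj (v s))]

lemma _root_.HasDerivAt.conj_comp {g : ℝ → ℂ} {g' : ℂ} {y : ℝ} (h : HasDerivAt g g' y) :
    HasDerivAt (fun y => conj (g y)) (conj g') y := h.star

lemma norm_le_of_sq_add_sq_le {a b B : ℝ} (hB : 0 ≤ B) (h : a ^ 2 + b ^ 2 ≤ B ^ 2) :
    a ≤ B ∧ b ≤ B :=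
  ⟨abs_le_of_sq_le_sq (by nlinarith [sq_nonneg b]) hB |>.trans' (le_abs_self a),
    abs_le_of_sq_le_sq (by nlinarith [sq_nonneg a]) hB |>.trans' (le_abs_self b)⟩

lemma sq_mul_exp_eq (ρ K : ℝ) : ρ ^ 2 * Real.exp K = (ρ * Real.exp (K / 2)) ^ 2 := by
  rw [mul_pow, ← Real.exp_nat_mul]
  congr 2; push_cast; ring

/-- The backward estimate is applied to the Jost solution minus `(0, 1)`, which tends to zero; the
subtraction produces the source `ζ w`. The bound sees the potential only through `C` and is
therefore uniform on bounded sets of times. -/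
lemma jost_bound {w : ℝ → ℂ} {C : ℝ} {ζ : ℂ} (hw : IsPotential w C) (hζ : ζ ∈ closedQuadrants)
    {x : ℝ} (hx : 0 ≤ x) (i : Fin 2) :
    ‖jost w ζ x i‖ ≤ 1 + ‖ζ‖ * C * Real.exp ((2 * (‖ζ‖ * C) + 2) * Real.pi / 2) := by
  have hJ := jost_spec hw hζ
  have hb := (hw.offDiag_coeff ζ).bound
  have hC := hw.nonneg
  have h := energy_backward (C := ‖ζ‖ * C) (ρ := ‖ζ‖ * C) (by positivity)
    (y₁ := fun s => jost w ζ s 0) (y₂ := fun s => jost w ζ s 1 - 1)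
    (m₁₁ := fun _ => -2 * I * ζ ^ 2) (m₁₂ := fun s => offDiag w ζ s 0 1)
    (m₂₁ := fun s => offDiag w ζ s 1 0) (m₂₂ := fun _ => 0) (r₁ := fun s => offDiag w ζ s 0 1)
    (r₂ := fun _ => 0)
    (continuousOn_pi.1 hJ.cont 0) ((continuousOn_pi.1 hJ.cont 1).sub continuousOn_const)
    (fun s hs => by
      refine (hJ.deriv_fst s hs).congr_deriv ?_
      rw [mulVec_zero_apply]
      simp [offDiag]; ring)
    (fun s hs => by
      refine ((hJ.deriv_snd s hs).sub_const 1).congr_deriv ?_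
      rw [mulVec_one_apply]
      simp [offDiag])
    (fun s _ => by
      have := re_two_I_mul_sq ζ
      have h0 : 0 ≤ ζ.re * ζ.im := hζ
      have h1 : (-2 * I * ζ ^ 2) = -(2 * I * ζ ^ 2) := by ring
      rw [h1, neg_re, this]; linarith)
    (by simp) (fun s hs => hb s (le_of_lt hs) 0 1) (fun s hs => hb s (le_of_lt hs) 1 0)
    (fun s hs => hb s (le_of_lt hs) 0 1) (fun s hs => by simp; positivity)
    hJ.tendsto_fst (by simpa using hJ.tendsto_snd.sub_const 1) hx
  rw [sq_mul_exp_eq] at h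
  obtain ⟨h0, h1⟩ := norm_le_of_sq_add_sq_le (by positivity) h
  fin_cases i
  · exact h0.trans (by simp)
  · have := norm_sub_norm_le (jost w ζ x 1) 1
    rw [norm_one] at this
    simp only [Fin.mk_one]
    linarith

namespace IsHalfLineSolution

variable {α : ℝ} {T : EReal} {u : ℝ → ℝ → ℂ}

/-- The phase at `x` changes at the rate `(|u_x|² - |u|²) / 2`, which tends to zero as `x → ∞`
uniformly on `[0, t]`. The factor between `jost` and `column` is thus constant in time. -/
lemma phaseInf_eq (h : IsHalfLineSolution α T u) {t : ℝ} (ht : t ∈ timeInterval T) :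
    phaseInf (fun y => dx u y t) = phaseInf (fun y => dx u y 0) := by
  obtain ⟨C, hC⟩ := h.potential_uniform t
  obtain ⟨C₁, h₁, hC₁⟩ := h.decay 1 0 t
  obtain ⟨C₀, h₀, hC₀⟩ := h.decay 0 0 t
  have l₁ := tendsto_phase (hC t ht le_rfl)
  have l₂ := tendsto_phase (hC 0 h.zero_mem ht.1)
  have hb : ∀ x, 0 ≤ x → ‖phase (fun y => dx u y t) x - phase (fun y => dx u y 0) x‖ ≤
      (C₁ ^ 2 + C₀ ^ 2) * t * (1 + x ^ 2)⁻¹ := by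
    intro x hx
    have hv : (1 + x ^ 2)⁻¹ ≤ 1 := inv_le_one_of_one_le₀ (by nlinarith)
    have hv0 : 0 ≤ (1 + x ^ 2)⁻¹ := by positivity
    have hsq : ∀ {c C : ℝ}, 0 ≤ c → c ≤ C * (1 + x ^ 2)⁻¹ → c ^ 2 ≤ C ^ 2 * (1 + x ^ 2)⁻¹ := by
      intro c C hc hcC
      have := pow_le_pow_left₀ hc hcC 2
      rw [mul_pow] at this
      refine this.trans (mul_le_mul_of_nonneg_left ?_ (sq_nonneg C))
      rw [pow_two]; exact mul_le_of_le_one_right hv0 hv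
    have := (convex_Icc (0 : ℝ) t).norm_image_sub_le_of_norm_hasDerivWithin_le
      (f := fun s => phase (fun y => dx u y s) x)
      (f' := fun s => (‖dx u x s‖ ^ 2 - ‖u x s‖ ^ 2) / 2)
      (C := (C₁ ^ 2 + C₀ ^ 2) * (1 + x ^ 2)⁻¹)
      (fun s hs => (h.hasDerivAt_phase_time hx (mem_of_le ht hs.1 hs.2)).hasDerivWithinAt)
      (fun s hs => by
        have e₁ := hsq (norm_nonneg _) (hC₁ x s hx (mem_of_le ht hs.1 hs.2) hs.2)
        have e₀ := hsq (norm_nonneg _) (hC₀ x s hx (mem_of_le ht hs.1 hs.2) hs.2)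
        simp only [Function.iterate_zero, id_eq, Function.iterate_one] at e₁ e₀
        rw [Real.norm_eq_abs, abs_le]
        have := sq_nonneg ‖dx u x s‖
        have := sq_nonneg ‖u x s‖
        constructor <;> linarith)
      (left_mem_Icc.2 ht.1) (right_mem_Icc.2 ht.1)
    refine this.trans (le_of_eq ?_)
    rw [sub_zero, Real.norm_of_nonneg ht.1]; ring
  have l₃ : Tendsto (fun x => phase (fun y => dx u y t) x - phase (fun y => dx u y 0) x) atTop
      (𝓝 0) := by
    refine squeeze_zero_norm' (a := fun x : ℝ => (C₁ ^ 2 + C₀ ^ 2) * t * (1 + x ^ 2)⁻¹) ?_ ?_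
    · filter_upwards [eventually_ge_atTop 0] with x hx using hb x hx
    · have : Tendsto (fun x : ℝ => 1 + x ^ 2) atTop atTop :=
        tendsto_atTop_add_const_left _ _ (tendsto_pow_atTop two_ne_zero)
      simpa using this.inv_tendsto_atTop.const_mul ((C₁ ^ 2 + C₀ ^ 2) * t)
  exact sub_eq_zero.1 (tendsto_nhds_unique (l₁.sub l₂) l₃)

/-- The Jost solutions satisfy the time part of the Lax pair. -/
theorem hasDerivWithinAt_jost (h : IsHalfLineSolution α T u) {ζ : ℂ} (hζ : ζ ∈ closedQuadrants)
    (h0 : ζ ≠ 0) {x t : ℝ} (hx : 0 ≤ x) (ht : t ∈ timeInterval T) (i : Fin 2) :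
    HasDerivWithinAt (fun s => jost (fun y => dx u y s) ζ x i)
      ((timeCoeff (fun y => dx u y t) (fun y => u y t) ζ x *ᵥ jost (fun y => dx u y t) ζ x) i)
      (timeInterval T) t := by
  obtain ⟨C, hC⟩ := h.potential_uniform (t + 1)
  obtain ⟨C₁, hC₁0, hC₁⟩ := h.decay 1 1 (t + 1)
  obtain ⟨C₂, hC₂0, hC₂⟩ := h.decay 1 2 (t + 1)
  have hC0 : 0 ≤ C := (hC t ht (by linarith)).nonneg
  set S : Set ℝ := timeInterval T ∩ Iic (t + 1) with hS
  have hSc : Convex ℝ S := (convex_timeInterval T).inter (convex_Iic _)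
  have htS : t ∈ S := ⟨ht, by simp⟩
  have dt1 := (contDiff_dt h.smooth_dx)
  have dt2 := (contDiff_dt dt1.1)
  set B := 1 + ‖ζ‖ * C * Real.exp ((2 * (‖ζ‖ * C) + 2) * Real.pi / 2) with hB
  have hB0 : 0 ≤ B := by positivity
  set χ : ℝ → ℝ → Fin 2 → ℂ := fun s => jost (fun y => dx u y s) ζ with hχ
  have hJ : ∀ s ∈ S, IsDecayingSol (offDiag (fun y => dx u y s) ζ) ζ (χ s) := fun s hs =>
    jost_spec (hC s hs.1 hs.2) hζ
  have hχB : ∀ s ∈ S, ∀ y, 0 ≤ y → ∀ i, ‖χ s y i‖ ≤ B := fun s hs y hy i =>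
    jost_bound (hC s hs.1 hs.2) hζ hy i
  have hw : ∀ s ∈ S, ∀ y, 0 ≤ y → ‖dx u y s‖ ≤ C * (1 + y ^ 2)⁻¹ := fun s hs y hy =>
    (hC s hs.1 hs.2).bound y hy
  have hwt : ∀ y, 0 ≤ y → ∀ s ∈ S, ‖dt (dx u) y s‖ ≤ C₁ * (1 + y ^ 2)⁻¹ := fun y hy s hs =>
    hC₁ y s hy hs.1 hs.2
  have hw1 : ∀ s ∈ S, ∀ y, 0 ≤ y → ‖dx u y s - dx u y t‖ ≤ C₁ * |s - t| * (1 + y ^ 2)⁻¹ := by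
    intro s hs y hy
    have := norm_sub_le_of_hasDerivAt hSc (fun s => dt1.2 y s) (hwt y hy) hs htS
    linarith
  have hw2 : ∀ s ∈ S, ∀ y, 0 ≤ y → ‖dx u y s - dx u y t - (s - t) * dt (dx u) y t‖ ≤
      C₂ * |s - t| ^ 2 * (1 + y ^ 2)⁻¹ := by
    intro s hs y hy
    have := norm_sub_sub_le_of_hasDerivAt hSc (fun s => dt1.2 y s) (fun s => dt2.2 y s)
      (M := C₂ * (1 + y ^ 2)⁻¹) (fun s hs => hC₂ y s hy hs.1 hs.2) hs htS
    linarith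
  have hre : 0 ≤ (-2 * I * ζ ^ 2).re := by
    have := re_two_I_mul_sq ζ
    have h0 : 0 ≤ ζ.re * ζ.im := hζ
    have h1 : (-2 * I * ζ ^ 2) = -(2 * I * ζ ^ 2) := by ring
    rw [h1, neg_re, this]; linarith
  set E := Real.exp ((2 * (‖ζ‖ * C) + 2) * Real.pi / 2) with hE
  have hoff : ∀ y, 0 ≤ y → ‖ζ * dx u y t‖ ≤ ‖ζ‖ * C * (1 + y ^ 2)⁻¹ := by
    intro y hy
    rw [norm_mul, mul_assoc]
    exact mul_le_mul_of_nonneg_left (hw t htS y hy) (norm_nonneg _)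
  have hoff' : ∀ y, 0 ≤ y → ‖ζ * conj (dx u y t)‖ ≤ ‖ζ‖ * C * (1 + y ^ 2)⁻¹ := by
    intro y hy
    simpa using hoff y hy
  have hoffd : ∀ {s y : ℝ} {c d : ℂ} {K : ℝ}, ‖c‖ ≤ K → ‖d‖ ≤ B →
      ‖ζ * c * d‖ ≤ ‖ζ‖ * K * B := by
    intro s y c d K hc hd
    rw [norm_mul, norm_mul]
    have : 0 ≤ K := (norm_nonneg _).trans hc
    gcongr
  -- Lipschitz dependence on time
  set L := ‖ζ‖ * C₁ * B * E with hL
  have hLip : ∀ s ∈ S, ∀ y, 0 ≤ y → ‖χ s y 0 - χ t y 0‖ ≤ L * |s - t| ∧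
      ‖χ s y 1 - χ t y 1‖ ≤ L * |s - t| := by
    intro s hs y hy
    have hs' := hJ s hs
    have ht' := hJ t htS
    have hen := energy_backward (C := ‖ζ‖ * C) (ρ := ‖ζ‖ * C₁ * B * |s - t|) (by positivity)
      (y₁ := fun y => χ s y 0 - χ t y 0) (y₂ := fun y => χ s y 1 - χ t y 1)
      (m₁₁ := fun _ => -2 * I * ζ ^ 2) (m₁₂ := fun y => ζ * dx u y t)
      (m₂₁ := fun y => ζ * conj (dx u y t)) (m₂₂ := fun _ => 0)
      (r₁ := fun y => ζ * (dx u y s - dx u y t) * χ s y 1)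
      (r₂ := fun y => ζ * conj (dx u y s - dx u y t) * χ s y 0)
      ((continuousOn_pi.1 hs'.cont 0).sub (continuousOn_pi.1 ht'.cont 0))
      ((continuousOn_pi.1 hs'.cont 1).sub (continuousOn_pi.1 ht'.cont 1))
      (fun z hz => by
        refine ((hs'.deriv_fst z hz).sub (ht'.deriv_fst z hz)).congr_deriv ?_
        rw [mulVec_zero_apply, mulVec_zero_apply]
        simp [offDiag]; ring)
      (fun z hz => by
        refine ((hs'.deriv_snd z hz).sub (ht'.deriv_snd z hz)).congr_deriv ?_
        rw [mulVec_one_apply, mulVec_one_apply]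
        simp [offDiag]; ring)
      (fun _ _ => hre) (by simp)
      (fun z hz => hoff z (le_of_lt hz)) (fun z hz => hoff' z (le_of_lt hz))
      (fun z hz => (hoffd (s := s) (y := z) (hw1 s hs z (le_of_lt hz))
        (hχB s hs z (le_of_lt hz) 1)).trans (le_of_eq (by ring)))
      (fun z hz => (hoffd (s := s) (y := z) (K := C₁ * |s - t| * (1 + z ^ 2)⁻¹) (by
        rw [RCLike.norm_conj]; exact hw1 s hs z (le_of_lt hz))
        (hχB s hs z (le_of_lt hz) 0)).trans (le_of_eq (by ring)))
      (by simpa using hs'.tendsto_fst.sub ht'.tendsto_fst)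
      (by simpa using hs'.tendsto_snd.sub ht'.tendsto_snd) hy
    rw [sq_mul_exp_eq] at hen
    obtain ⟨e0, e1⟩ := norm_le_of_sq_add_sq_le (by positivity) hen
    exact ⟨e0.trans (le_of_eq (by rw [hL]; ring)), e1.trans (le_of_eq (by rw [hL]; ring))⟩
  have hL0 : 0 ≤ L := by positivity
  -- the difference quotients
  obtain ⟨z, hz⟩ : ∃ z : ℂ, z = 1 / (2 * ζ) := ⟨_, rfl⟩
  have hzζ : 2 * ζ * z = 1 := by rw [hz]; field_simp
  have heta : eta ζ = ζ - z := by rw [hz]; rfl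
  set ρ := ‖ζ‖ * (C₂ * B + C₁ * L) with hρ
  have hρ0 : 0 ≤ ρ := by positivity
  -- The remainder of the first-order expansion with the time part in the role of the derivative. By
  -- compatibility of the Lax pair it solves the space part up to a source quadratic in `s - t`. It
  -- tends to zero at infinity, because there the time coefficients become `diag(-2iη², 0)`, which
  -- annihilates `(0, 1)`. So the backward estimate applies with no correction of the normalisation.
  have hquad : ∀ s ∈ S, ∀ i, ‖χ s x i - χ t x i - (s - t) * (timeCoeff (fun y => dx u y t)
      (fun y => u y t) ζ x *ᵥ χ t x) i‖ ≤ ρ * E * |s - t| ^ 2 := by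
    intro s hs
    have hs' := hJ s hs
    have ht' := hJ t htS
    have hv := fun y => (contDiff_dx h.reg.smooth).2 y t
    have hwx := fun y => (contDiff_dx h.smooth_dx).2 y t
    have hvc := fun y => (hv y).conj_comp
    have hwxc := fun y => (hwx y).conj_comp
    have hcv : Continuous (fun y => u y t) := continuous_slice h.reg.smooth t
    have hcw : Continuous (fun y => dx u y t) := continuous_slice h.smooth_dx t
    have hc0 := continuousOn_pi.1 ht'.cont 0
    have hc1 := continuousOn_pi.1 ht'.cont 1
    have tv : Tendsto (fun y => u y t) atTop (𝓝 0) := (h.tendsto_zero ht).1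
    have tw : Tendsto (fun y => dx u y t) atTop (𝓝 0) := (h.tendsto_zero ht).2
    have tvc : Tendsto (fun y => conj (u y t)) atTop (𝓝 0) := by
      simpa [Function.comp_def] using (continuous_conj.tendsto _).comp tv
    have twc : Tendsto (fun y => conj (dx u y t)) atTop (𝓝 0) := by
      simpa [Function.comp_def] using (continuous_conj.tendsto _).comp tw
    have hgen : ∀ y ∈ Ioi (0 : ℝ), ∀ j, ∀ c d : ℂ, ‖c‖ ≤ C₂ * |s - t| ^ 2 * (1 + y ^ 2)⁻¹ →
        ‖d‖ ≤ |s - t| * (C₁ * (1 + y ^ 2)⁻¹) →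
        ‖ζ * c * χ s y j + ζ * d * (χ s y j - χ t y j)‖ ≤ ρ * |s - t| ^ 2 * (1 + y ^ 2)⁻¹ := by
      intro y hy j c d hc hd
      have hy' : 0 ≤ y := le_of_lt hy
      have a1 := hoffd (s := s) (y := y) hc (hχB s hs y hy' j)
      have a2 : ‖χ s y j - χ t y j‖ ≤ L * |s - t| := by
        fin_cases j
        · exact (hLip s hs y hy').1
        · exact (hLip s hs y hy').2
      have a3 : ‖ζ * d * (χ s y j - χ t y j)‖ ≤
          ‖ζ‖ * (|s - t| * (C₁ * (1 + y ^ 2)⁻¹)) * (L * |s - t|) := by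
        rw [norm_mul, norm_mul]
        gcongr
      refine (norm_add_le _ _).trans ((add_le_add a1 a3).trans (le_of_eq ?_))
      rw [hρ]; ring
    have hdn : ∀ y ∈ Ioi (0 : ℝ), ‖((s : ℂ) - t) * dt (dx u) y t‖ ≤
        |s - t| * (C₁ * (1 + y ^ 2)⁻¹) := by
      intro y hy
      have : ‖(s : ℂ) - t‖ = |s - t| := by rw [← ofReal_sub, norm_real, Real.norm_eq_abs]
      rw [norm_mul, this]
      exact mul_le_mul_of_nonneg_left (hwt y (le_of_lt hy) t htS) (abs_nonneg _)
    have hr := fun y hy j => hgen y hy j _ _ (hw2 s hs y (le_of_lt hy)) (hdn y hy)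
    have hr' := fun y hy j => hgen y hy j (conj (dx u y s - dx u y t - (s - t) * dt (dx u) y t))
      (conj (((s : ℂ) - t) * dt (dx u) y t))
      (by rw [RCLike.norm_conj]; exact hw2 s hs y (le_of_lt hy))
      (by rw [RCLike.norm_conj]; exact hdn y hy)
    have hen := energy_backward (C := ‖ζ‖ * C) (ρ := ρ * |s - t| ^ 2) (by positivity)
      (y₁ := fun y => χ s y 0 - χ t y 0 - (s - t) *
        ((-2 * I * eta ζ ^ 2 - I / 2 * (u y t * conj (u y t))) * χ t y 0 +
          (ζ * dx u y t + I * u y t * z) * χ t y 1))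
      (y₂ := fun y => χ s y 1 - χ t y 1 - (s - t) *
        ((ζ * conj (dx u y t) - I * conj (u y t) * z) * χ t y 0 +
          I / 2 * (u y t * conj (u y t)) * χ t y 1))
      (m₁₁ := fun _ => -2 * I * ζ ^ 2) (m₁₂ := fun y => ζ * dx u y t)
      (m₂₁ := fun y => ζ * conj (dx u y t)) (m₂₂ := fun _ => 0)
      (r₁ := fun y => ζ * (dx u y s - dx u y t - (s - t) * dt (dx u) y t) * χ s y 1 +
        ζ * ((s - t) * dt (dx u) y t) * (χ s y 1 - χ t y 1))
      (r₂ := fun y => ζ * conj (dx u y s - dx u y t - (s - t) * dt (dx u) y t) * χ s y 0 +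
        ζ * conj ((s - t) * dt (dx u) y t) * (χ s y 0 - χ t y 0))
      (((continuousOn_pi.1 hs'.cont 0).sub hc0).sub (by fun_prop))
      (((continuousOn_pi.1 hs'.cont 1).sub hc1).sub (by fun_prop))
      (fun y hy => by
        have d : HasDerivAt (fun y => ((s : ℂ) - t) *
            ((-2 * I * eta ζ ^ 2 - I / 2 * (u y t * conj (u y t))) * χ t y 0 +
            (ζ * dx u y t + I * u y t * z) * χ t y 1))
            (((s : ℂ) - t) * ((-(I / 2 * (dx u y t * conj (u y t) + u y t * conj (dx u y t)))) *
              χ t y 0 + (-2 * I * eta ζ ^ 2 - I / 2 * (u y t * conj (u y t))) *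
              (-2 * I * ζ ^ 2 * χ t y 0 + (offDiag (fun y => dx u y t) ζ y *ᵥ χ t y) 0) +
              ((ζ * dx (dx u) y t + I * dx u y t * z) * χ t y 1 +
              (ζ * dx u y t + I * u y t * z) * (offDiag (fun y => dx u y t) ζ y *ᵥ χ t y) 1))) y :=
          ((((((hv y).mul (hvc y)).const_mul (I / 2)).const_sub (-2 * I * eta ζ ^ 2)).mul
          (ht'.deriv_fst y hy)).add ((((hwx y).const_mul ζ).add
            (((hv y).const_mul I).mul_const z)).mul (ht'.deriv_snd y hy))).const_mul ((s : ℂ) - t)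
        refine (((hs'.deriv_fst y hy).sub (ht'.deriv_fst y hy)).sub d).congr_deriv ?_
        simp only [mulVec_zero_apply, mulVec_one_apply]
        simp only [offDiag, Matrix.of_apply, Matrix.cons_val', Matrix.cons_val_zero,
          Matrix.cons_val_one, Matrix.cons_val_fin_one]
        -- Here the nonlinear equation enters, as the zero-curvature condition that cancels all
        -- terms linear in `s - t`.
        rw [h.eq y t (le_of_lt hy) ht, heta]
        linear_combination -((s : ℂ) - t) * χ t y 1 * (-I * dx u y t * z + 2 * I * ζ * dx u y t -
          ζ * u y t) * hzζ - ((s : ℂ) - t) * χ t y 0 * (I / 2) * (dx u y t * conj (u y t) +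
          u y t * conj (dx u y t)) * hzζ - 2 * ζ ^ 2 * u y t * z * ((s : ℂ) - t) * χ t y 1 * I_sq)
      (fun y hy => by
        have d : HasDerivAt (fun y => ((s : ℂ) - t) *
            ((ζ * conj (dx u y t) - I * conj (u y t) * z) * χ t y 0 +
            I / 2 * (u y t * conj (u y t)) * χ t y 1))
            (((s : ℂ) - t) * ((ζ * conj (dx (dx u) y t) - I * conj (dx u y t) * z) * χ t y 0 +
              (ζ * conj (dx u y t) - I * conj (u y t) * z) *
              (-2 * I * ζ ^ 2 * χ t y 0 + (offDiag (fun y => dx u y t) ζ y *ᵥ χ t y) 0) +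
              (I / 2 * (dx u y t * conj (u y t) + u y t * conj (dx u y t)) * χ t y 1 +
              I / 2 * (u y t * conj (u y t)) * (offDiag (fun y => dx u y t) ζ y *ᵥ χ t y) 1))) y :=
          (((((hwxc y).const_mul ζ).sub (((hvc y).const_mul I).mul_const z)).mul
          (ht'.deriv_fst y hy)).add ((((hv y).mul (hvc y)).const_mul (I / 2)).mul
            (ht'.deriv_snd y hy))).const_mul ((s : ℂ) - t)
        refine (((hs'.deriv_snd y hy).sub (ht'.deriv_snd y hy)).sub d).congr_deriv ?_
        simp only [mulVec_zero_apply, mulVec_one_apply]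
        simp only [offDiag, Matrix.of_apply, Matrix.cons_val', Matrix.cons_val_zero,
          Matrix.cons_val_one, Matrix.cons_val_fin_one]
        rw [h.eq y t (le_of_lt hy) ht, heta]
        simp only [map_sub, map_add, map_mul, conj_ofReal, conj_I, Complex.conj_conj, map_ofNat]
        linear_combination -((s : ℂ) - t) * χ t y 0 * (I * conj (dx u y t) * z -
          2 * I * ζ * conj (dx u y t) - ζ * conj (u y t)) * hzζ + ((s : ℂ) - t) * χ t y 1 * (I / 2) *
          (dx u y t * conj (u y t) + u y t * conj (dx u y t)) * hzζ -
          2 * ζ ^ 2 * conj (u y t) * z * ((s : ℂ) - t) * χ t y 0 * I_sq)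
      (fun _ _ => hre) (by simp)
      (fun y hy => hoff y (le_of_lt hy)) (fun y hy => hoff' y (le_of_lt hy))
      (fun y hy => hr y hy 1)
      (fun y hy => hr' y hy 0)
      (by
        have := (hs'.tendsto_fst.sub ht'.tendsto_fst).sub
          ((((tv.mul tvc).const_mul (I / 2)).const_sub (-2 * I * eta ζ ^ 2)).mul ht'.tendsto_fst
            |>.add (((tw.const_mul ζ).add ((tv.const_mul I).mul_const z)).mul ht'.tendsto_snd)
            |>.const_mul ((s : ℂ) - t))
        simpa using this)
      (by
        have := (hs'.tendsto_snd.sub ht'.tendsto_snd).sub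
          ((((twc.const_mul ζ).sub ((tvc.const_mul I).mul_const z)).mul ht'.tendsto_fst).add
            (((tv.mul tvc).const_mul (I / 2)).mul ht'.tendsto_snd)
            |>.const_mul ((s : ℂ) - t))
        simpa using this) hx
    rw [sq_mul_exp_eq] at hen
    obtain ⟨e0, e1⟩ := norm_le_of_sq_add_sq_le (by positivity) hen
    intro i
    fin_cases i
    · refine le_trans (le_of_eq ?_) (e0.trans (le_of_eq (by ring)))
      simp [mulVec_zero_apply, timeCoeff, hz]
    · refine le_trans (le_of_eq ?_) (e1.trans (le_of_eq (by ring)))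
      simp [mulVec_one_apply, timeCoeff, hz]
  refine hasDerivWithinAt_of_quadratic (r := 1) one_pos (K := ρ * E) fun s hs hst => ?_
  exact hquad s ⟨hs, by
    have := (abs_lt.1 hst).2
    simp only [mem_Iic]; linarith⟩ i

end IsHalfLineSolution

/-! ### Asymptotics of the Jost solution -/

/-- Potentials with two continuous decaying derivatives. -/
structure IsSmoothPotential (w w₁ w₂ : ℝ → ℂ) (C : ℝ) : Prop where
  pot : IsPotential w C
  deriv₁ : ∀ s, HasDerivAt w (w₁ s) s
  deriv₂ : ∀ s, HasDerivAt w₁ (w₂ s) s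
  bound₁ : ∀ s, 0 ≤ s → ‖w₁ s‖ ≤ C * (1 + s ^ 2)⁻¹
  bound₂ : ∀ s, 0 ≤ s → ‖w₂ s‖ ≤ C * (1 + s ^ 2)⁻¹

lemma norm_exp_I_mul_real (r : ℝ) : ‖exp (I * r)‖ = 1 := by rw [norm_exp]; simp

lemma norm_exp_neg_I_mul_real (r : ℝ) : ‖exp (-I * r)‖ = 1 := by rw [norm_exp]; simp

/-- Decay of products of functions decaying like `1 / (1 + s²)`. -/
lemma norm_mul_le_decay {a b : ℂ} {A B s : ℝ} (ha : ‖a‖ ≤ A * (1 + s ^ 2)⁻¹) (hb : ‖b‖ ≤ B)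
    (hA : 0 ≤ A) : ‖a * b‖ ≤ A * B * (1 + s ^ 2)⁻¹ := by
  rw [norm_mul]
  have := mul_le_mul ha hb (norm_nonneg _) (by positivity)
  linarith

lemma le_of_le_decay {a A s : ℝ} (h : a ≤ A * (1 + s ^ 2)⁻¹) (hA : 0 ≤ A) : a ≤ A :=
  h.trans (mul_le_of_le_one_right hA (inv_le_one_of_one_le₀ (by nlinarith [sq_nonneg s])))

lemma tendsto_zero_of_decay {f : ℝ → ℂ} {A : ℝ} (h : ∀ s, 0 ≤ s → ‖f s‖ ≤ A * (1 + s ^ 2)⁻¹) :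
    Tendsto f atTop (𝓝 0) := by
  have h1 : Tendsto (fun s : ℝ => A * (1 + s ^ 2)⁻¹) atTop (𝓝 0) := by
    have : Tendsto (fun s : ℝ => 1 + s ^ 2) atTop atTop :=
      tendsto_atTop_add_const_left _ _ (tendsto_pow_atTop two_ne_zero)
    simpa using this.inv_tendsto_atTop.const_mul A
  refine squeeze_zero_norm' ?_ h1
  filter_upwards [eventually_ge_atTop 0] with s hs using h s hs

/-- For `F = f₁` and `H = ζ f₀ + (i/2) w f₁` the system becomes `F' = -(i/2)|w|² F + w̄ H` and `H' =
(-2iζ² + (i/2)|w|²) H + Q F`, with `Q = (i/2) w' + (1/4)|w|² w`. The large parameter is now confined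
to one diagonal entry, so `F` follows a pure phase and `H` is of order `ζ⁻²`. -/
theorem jost_asymptotics {w w₁ w₂ : ℝ → ℂ} {C : ℝ} (hw : IsSmoothPotential w w₁ w₂ C) :
    ∃ K, ∀ ζ ∈ closedQuadrants, 1 ≤ ‖ζ‖ → ∀ x, 0 ≤ x →
      ‖jost w ζ x 1 - exp (-I * (phase w x + -phaseInf w))‖ ≤ K / ‖ζ‖ ^ 2 ∧
      ‖ζ * jost w ζ x 0 + I / 2 * w x * jost w ζ x 1‖ ≤ K / ‖ζ‖ ^ 2 := by
  have hC := hw.pot.nonneg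
  set Q : ℝ → ℂ := fun s => I / 2 * w₁ s + 1 / 4 * (w s * conj (w s) * w s) with hQ
  set Q₁ : ℝ → ℂ := fun s => I / 2 * w₂ s + 1 / 4 * ((w₁ s * conj (w s) + w s * conj (w₁ s)) * w s +
    w s * conj (w s) * w₁ s) with hQ₁
  have hQd : ∀ s, HasDerivAt Q (Q₁ s) s := fun s =>
    ((hw.deriv₂ s).const_mul (I / 2)).add ((((hw.deriv₁ s).mul (hw.deriv₁ s).conj_comp).mul
      (hw.deriv₁ s)).const_mul (1 / 4))
  set CQ := C + C ^ 3 with hCQ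
  have hCQ0 : 0 ≤ CQ := by positivity
  have bw : ∀ s, 0 ≤ s → ‖w s‖ ≤ C := fun s hs => hw.pot.bound' hs
  have bv : ∀ s, 0 ≤ s → ‖w s‖ ≤ C * (1 + s ^ 2)⁻¹ := hw.pot.bound
  have cub : ∀ s, ∀ a b c : ℂ, ‖a‖ ≤ C * (1 + s ^ 2)⁻¹ → ‖b‖ ≤ C → ‖c‖ ≤ C →
      ‖a * b * c‖ ≤ C ^ 3 * (1 + s ^ 2)⁻¹ := by
    intro s a b c ha hb hc
    have := norm_mul_le_decay (norm_mul_le_decay ha hb hC) hc (by positivity)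
    linarith [this, show C * C * C * (1 + s ^ 2)⁻¹ = C ^ 3 * (1 + s ^ 2)⁻¹ by ring]
  have bQ : ∀ s, 0 ≤ s → ‖Q s‖ ≤ CQ * (1 + s ^ 2)⁻¹ := by
    intro s hs
    have h1 := cub s (w s) (conj (w s)) (w s) (bv s hs) (by simpa using bw s hs) (bw s hs)
    have h2 := hw.bound₁ s hs
    refine (norm_add_le _ _).trans ?_
    rw [norm_mul, norm_mul (1 / 4 : ℂ)]
    have e1 : ‖I / 2‖ = 1 / 2 := by simp
    have e2 : ‖(1 / 4 : ℂ)‖ = 1 / 4 := by simp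
    rw [e1, e2, hCQ]
    have := norm_nonneg (w₁ s)
    have := norm_nonneg (w s * conj (w s) * w s)
    linarith
  have bQ₁ : ∀ s, 0 ≤ s → ‖Q₁ s‖ ≤ CQ * (1 + s ^ 2)⁻¹ := by
    intro s hs
    have b1 := le_of_le_decay (hw.bound₁ s hs) hC
    have h1 := cub s (w₁ s) (conj (w s)) (w s) (hw.bound₁ s hs) (by simpa using bw s hs) (bw s hs)
    have h2 := cub s (w s) (conj (w₁ s)) (w s) (bv s hs) (by simpa using b1) (bw s hs)
    have h3 := cub s (w s) (conj (w s)) (w₁ s) (bv s hs) (by simpa using bw s hs) b1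
    have h4 := hw.bound₂ s hs
    refine (norm_add_le _ _).trans ?_
    rw [norm_mul, norm_mul (1 / 4 : ℂ), add_mul]
    have e1 : ‖I / 2‖ = 1 / 2 := by simp
    have e2 : ‖(1 / 4 : ℂ)‖ = 1 / 4 := by simp
    rw [e1, e2, hCQ]
    have := norm_nonneg (w₂ s)
    have h5 := (norm_add_le (w₁ s * conj (w s) * w s + w s * conj (w₁ s) * w s)
      (w s * conj (w s) * w₁ s)).trans (add_le_add_left (norm_add_le _ _) _)
    have : 0 ≤ C ^ 3 * (1 + s ^ 2)⁻¹ := by positivity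
    linarith
  set D := C + CQ with hD
  set ρ₀ := CQ * (C ^ 2 + C + 1) with hρ₀
  set G := Real.exp ((2 * D + 2) * Real.pi / 2) with hG
  refine ⟨ρ₀ * G + CQ, fun ζ hζ hζ1 x hx => ?_⟩
  have hζ0 : ζ ≠ 0 := norm_pos_iff.1 (by linarith)
  have hJ := jost_spec hw.pot hζ
  have hpc := continuous_phase hw.pot.cont
  set E : ℝ → ℂ := fun s => exp (-I * (phase w s + -phaseInf w)) with hE
  have hEd : ∀ s, HasDerivAt E (-(I / 2) * (w s * conj (w s)) * E s) s := by
    intro s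
    have := hasDerivAt_exp_I_phase hw.pot.cont (-I) (-phaseInf w : ℂ) s
    refine this.congr_deriv ?_
    rw [← conj_mul_eq_norm_sq]; ring
  have hEn : ∀ s, ‖E s‖ = 1 := fun s => by
    have := norm_exp_neg_I_mul_real (phase w s + -phaseInf w)
    simpa [hE] using this
  have hc0 := continuousOn_pi.1 hJ.cont 0
  have hc1 := continuousOn_pi.1 hJ.cont 1
  have hQc : Continuous Q := continuous_iff_continuousAt.2 fun s => (hQd s).continuousAt
  have hEc : Continuous E := continuous_iff_continuousAt.2 fun s => (hEd s).continuousAt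
  have hwc := hw.pot.cont
  have hElim : Tendsto E atTop (𝓝 1) := by
    have h := (((tendsto_phase hw.pot).ofReal.add_const (-phaseInf w : ℂ)).const_mul (-I)).cexp
    rw [add_neg_cancel, mul_zero, exp_zero] at h
    exact h
  -- Balancing `-2iζ² H + Q E = 0` gives the leading term `g Q E` of `H`. Once it is subtracted,
  -- every source has the factor `g`, hence size `|ζ|⁻²`, and the diagonal entries still have
  -- nonnegative real part.
  obtain ⟨g, hg⟩ : ∃ g : ℂ, g = 1 / (2 * I * ζ ^ 2) := ⟨_, rfl⟩
  have hgζ : 2 * I * ζ ^ 2 * g = 1 := by rw [hg]; field_simp [I_ne_zero]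
  have hgn : ‖g‖ = 1 / (2 * ‖ζ‖ ^ 2) := by rw [hg]; simp
  have hζ2 : 0 < ‖ζ‖ ^ 2 := by positivity
  have hgn' : ‖g‖ ≤ 1 / ‖ζ‖ ^ 2 := by
    rw [hgn]; exact one_div_le_one_div_of_le hζ2 (by linarith)
  have hen := energy_backward (C := D) (ρ := ρ₀ * (1 / ‖ζ‖ ^ 2)) (by positivity)
    (y₁ := fun s => ζ * jost w ζ s 0 + I / 2 * w s * jost w ζ s 1 - g * (Q s * E s))
    (y₂ := fun s => jost w ζ s 1 - E s)
    (m₁₁ := fun s => -2 * I * ζ ^ 2 + I / 2 * (w s * conj (w s))) (m₁₂ := Q)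
    (m₂₁ := fun s => conj (w s)) (m₂₂ := fun s => -(I / 2) * (w s * conj (w s)))
    (r₁ := fun s => g * ((I * (w s * conj (w s)) * Q s - Q₁ s) * E s))
    (r₂ := fun s => g * (conj (w s) * Q s * E s))
    (by fun_prop) (by fun_prop)
    (fun s hs => by
      refine ((((hJ.deriv_fst s hs).const_mul ζ).add (((hw.deriv₁ s).const_mul (I / 2)).mul
        (hJ.deriv_snd s hs))).sub (((hQd s).mul (hEd s)).const_mul g)).congr_deriv ?_
      simp only [mulVec_zero_apply, mulVec_one_apply]
      simp only [offDiag, Matrix.of_apply, Matrix.cons_val', Matrix.cons_val_zero,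
        Matrix.cons_val_one, Matrix.cons_val_fin_one, hQ]
      linear_combination (ζ ^ 2 * w s * jost w ζ s 1 -
        1 / 4 * w s ^ 2 * conj (w s) * jost w ζ s 1) * I_sq -
        (I / 2 * w₁ s + 1 / 4 * (w s * conj (w s) * w s)) * E s * hgζ)
    (fun s hs => by
      refine ((hJ.deriv_snd s hs).sub (hEd s)).congr_deriv ?_
      simp only [mulVec_one_apply]
      simp only [offDiag, Matrix.of_apply, Matrix.cons_val', Matrix.cons_val_zero,
        Matrix.cons_val_one, Matrix.cons_val_fin_one]
      ring)
    (fun s _ => by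
      have e := re_two_I_mul_sq ζ
      have h : 0 ≤ ζ.re * ζ.im := hζ
      rw [conj_mul_eq_norm_sq, show -2 * I * ζ ^ 2 + I / 2 * (‖w s‖ : ℂ) ^ 2 =
        -(2 * I * ζ ^ 2) + ((‖w s‖ ^ 2 / 2 : ℝ) : ℂ) * I by push_cast; ring, add_re, neg_re, e,
        re_ofReal_mul, I_re]
      linarith)
    (fun s _ => by
      rw [conj_mul_eq_norm_sq, show -(I / 2) * (‖w s‖ : ℂ) ^ 2 =
        ((-(‖w s‖ ^ 2 / 2) : ℝ) : ℂ) * I by push_cast; ring, re_ofReal_mul, I_re, mul_zero])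
    (fun s hs => (bQ s (le_of_lt hs)).trans (by
      have : 0 ≤ (1 + s ^ 2)⁻¹ := by positivity
      exact mul_le_mul_of_nonneg_right (by linarith) this))
    (fun s hs => by
      rw [RCLike.norm_conj]
      refine (bv s (le_of_lt hs)).trans ?_
      have : 0 ≤ (1 + s ^ 2)⁻¹ := by positivity
      exact mul_le_mul_of_nonneg_right (by linarith) this)
    (fun s hs => by
      have hs' := le_of_lt (show 0 < s from hs)
      have h0 : 0 ≤ (1 + s ^ 2)⁻¹ := by positivity
      have h1 := bQ s hs'
      have h2 := bQ₁ s hs'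
      have hb := bw s hs'
      rw [norm_mul, norm_mul, hEn, mul_one]
      have h3 : ‖I * (w s * conj (w s)) * Q s‖ ≤ C ^ 2 * (CQ * (1 + s ^ 2)⁻¹) := by
        rw [norm_mul, norm_mul, norm_mul, norm_I, one_mul, RCLike.norm_conj, ← pow_two]
        exact mul_le_mul (pow_le_pow_left₀ (norm_nonneg _) hb 2) h1 (norm_nonneg _) (by positivity)
      have h4 : ‖I * (w s * conj (w s)) * Q s - Q₁ s‖ ≤ ρ₀ * (1 + s ^ 2)⁻¹ := by
        refine (norm_sub_le _ _).trans ?_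
        have : 0 ≤ CQ * C * (1 + s ^ 2)⁻¹ := by positivity
        rw [hρ₀]; linarith
      refine (mul_le_mul hgn' h4 (norm_nonneg _) (by positivity)).trans (le_of_eq (by ring)))
    (fun s hs => by
      have hs' := le_of_lt (show 0 < s from hs)
      have h0 : 0 ≤ (1 + s ^ 2)⁻¹ := by positivity
      have h1 := bQ s hs'
      have hb := bw s hs'
      rw [norm_mul, norm_mul, hEn, mul_one]
      have h4 : ‖conj (w s) * Q s‖ ≤ ρ₀ * (1 + s ^ 2)⁻¹ := by
        rw [norm_mul, RCLike.norm_conj]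
        refine (mul_le_mul hb h1 (norm_nonneg _) hC).trans ?_
        have : 0 ≤ CQ * (C ^ 2 + 1) * (1 + s ^ 2)⁻¹ := by positivity
        rw [hρ₀]; linarith
      refine (mul_le_mul hgn' h4 (norm_nonneg _) (by positivity)).trans (le_of_eq (by ring)))
    (by
      have t1 := tendsto_zero_of_decay bv
      have t2 := tendsto_zero_of_decay bQ
      have := ((hJ.tendsto_fst.const_mul ζ).add ((t1.const_mul (I / 2)).mul hJ.tendsto_snd)).sub
        ((t2.mul hElim).const_mul g)
      simpa using this)
    (by simpa using hJ.tendsto_snd.sub hElim) hx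
  rw [sq_mul_exp_eq] at hen
  obtain ⟨h1, h2⟩ := norm_le_of_sq_add_sq_le (by positivity) hen
  rw [← hG] at h1 h2
  have e1 : ρ₀ * (1 / ‖ζ‖ ^ 2) * G = ρ₀ * G / ‖ζ‖ ^ 2 := by ring
  rw [e1] at h1 h2
  rw [add_div]
  have h3 : 0 ≤ CQ / ‖ζ‖ ^ 2 := by positivity
  refine ⟨h2.trans (by linarith), ?_⟩
  have h4 : ‖g * (Q x * E x)‖ ≤ CQ / ‖ζ‖ ^ 2 := by
    rw [norm_mul, norm_mul, hEn, mul_one]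
    refine (mul_le_mul hgn' (le_of_le_decay (bQ x hx) hCQ0) (norm_nonneg _) (by positivity)).trans
      (le_of_eq (by ring))
  calc _ = ‖(ζ * jost w ζ x 0 + I / 2 * w x * jost w ζ x 1 - g * (Q x * E x)) + g * (Q x * E x)‖ := by
        rw [sub_add_cancel]
    _ ≤ _ := (norm_add_le _ _).trans (by linarith)

/-! ### Asymptotics of solutions with prescribed initial values -/

/-- A linear system on `[0, X]` with a large parameter `κ` in one of the diagonal entries. The
functions `E`, `E'` solve `E' = iβE` and its conjugate. -/
structure IsLargeSystem (X M : ℝ) (κ : ℂ) (F H P P₁ R R₁ E E' e₁ e₂ e₃ e₄ : ℝ → ℂ) (β : ℝ → ℂ) :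
    Prop where
  contF : ContinuousOn F (Icc 0 X)
  contH : ContinuousOn H (Icc 0 X)
  derivF : ∀ s ∈ Ioo 0 X, HasDerivAt F ((P s + e₁ s) * H s + (I * β s + e₂ s) * F s) s
  derivH : ∀ s ∈ Ioo 0 X,
    HasDerivAt H ((2 * I * κ - I * β s + e₃ s) * H s + (R s + e₄ s) * F s) s
  derivP : ∀ s, HasDerivAt P (P₁ s) s
  derivR : ∀ s, HasDerivAt R (R₁ s) s
  derivE : ∀ s, HasDerivAt E (I * β s * E s) s
  derivE' : ∀ s, HasDerivAt E' (-(I * β s) * E' s) s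
  E_zero : E 0 = 1
  E'_zero : E' 0 = 1
  normE : ∀ s, ‖E s‖ = 1
  normE' : ∀ s, ‖E' s‖ = 1
  boundP : ∀ s ∈ Icc 0 X, ‖P s‖ ≤ M
  boundP₁ : ∀ s ∈ Icc 0 X, ‖P₁ s‖ ≤ M
  boundR : ∀ s ∈ Icc 0 X, ‖R s‖ ≤ M
  boundR₁ : ∀ s ∈ Icc 0 X, ‖R₁ s‖ ≤ M
  boundβ : ∀ s ∈ Icc 0 X, ‖β s‖ ≤ M
  bound₁ : ∀ s ∈ Icc 0 X, ‖e₁ s‖ ≤ M * (1 / ‖κ‖)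
  bound₂ : ∀ s ∈ Icc 0 X, ‖e₂ s‖ ≤ M * (1 / ‖κ‖)
  bound₃ : ∀ s ∈ Icc 0 X, ‖e₃ s‖ ≤ M * (1 / ‖κ‖)
  bound₄ : ∀ s ∈ Icc 0 X, ‖e₄ s‖ ≤ M * (1 / ‖κ‖)
  boundF : ‖F 0‖ ≤ M
  boundH : ‖H 0‖ ≤ M

/-- As `Im κ ≥ 0`, the large entry can only damp `H`, so the forward energy estimate is uniform in
`κ`. It is applied to the deviation from an approximate solution that is correct to first order in
`1 / κ`. -/
lemma IsLargeSystem.asymptotics {X M : ℝ} {κ : ℂ} {F H P P₁ R R₁ E E' e₁ e₂ e₃ e₄ : ℝ → ℂ}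
    {β : ℝ → ℂ} (h : IsLargeSystem X M κ F H P P₁ R R₁ E E' e₁ e₂ e₃ e₄ β) (hX : 0 ≤ X)
    (hκ : 1 ≤ ‖κ‖) (hκi : 0 ≤ κ.im) :
    ‖F X - E X * F 0‖ ≤
      ((5 * M ^ 3 + 5 * M ^ 2) * Real.exp ((8 * M + 2) * X / 2) + M ^ 2) * (1 / ‖κ‖) ∧
    ‖H X - exp (2 * I * κ * X) * E' X * H 0‖ ≤
      ((5 * M ^ 3 + 5 * M ^ 2) * Real.exp ((8 * M + 2) * X / 2) + M ^ 2) * (1 / ‖κ‖) := by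
  have hM : 0 ≤ M := (norm_nonneg _).trans h.boundF
  obtain ⟨δ, hδ⟩ : ∃ δ, δ = 1 / ‖κ‖ := ⟨_, rfl⟩
  have hδ0 : 0 ≤ δ := by rw [hδ]; positivity
  have hδ1 : δ ≤ 1 := by rw [hδ]; exact (div_le_one (by linarith)).2 hκ
  have hκ0 : κ ≠ 0 := norm_pos_iff.1 (by linarith)
  obtain ⟨g, hg⟩ : ∃ g : ℂ, g = 1 / (2 * I * κ) := ⟨_, rfl⟩
  have hgκ : 2 * I * κ * g = 1 := by rw [hg]; field_simp [I_ne_zero]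
  have hgn : ‖g‖ ≤ δ := by
    have e : ‖(2 * I * κ : ℂ)‖ = 2 * ‖κ‖ := by simp
    rw [hg, hδ, norm_div, norm_one, e]
    exact one_div_le_one_div_of_le (by linarith) (by linarith)
  have hen : ∀ s : ℝ, 0 ≤ s → ‖exp (2 * I * κ * s)‖ ≤ 1 := fun s hs => by
    have e : (2 * I * κ * s).re = -(2 * (κ.im * s)) := by simp; ring
    rw [norm_exp, Real.exp_le_one_iff, e]
    have := mul_nonneg hκi hs
    linarith
  have bI : ‖I‖ ≤ 1 := by simp
  have hMδ : M * δ ≤ M := mul_le_of_le_one_right hM hδ1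
  set Fa : ℝ → ℂ := fun s => E s * F 0 + g * (P s * (exp (2 * I * κ * s) * E' s * H 0)) with hFa
  set Ha : ℝ → ℂ := fun s => exp (2 * I * κ * s) * E' s * H 0 - g * (R s * (E s * F 0)) with hHa
  have hexp : ∀ s : ℝ, HasDerivAt (fun s : ℝ => exp (2 * I * κ * s))
      (2 * I * κ * exp (2 * I * κ * s)) s := fun s => by
    simpa [mul_comm] using hasDerivAt_exp_mul (2 * I * κ) s
  have dG : ∀ s : ℝ, HasDerivAt (fun s : ℝ => exp (2 * I * κ * s) * E' s * H 0)
      ((2 * I * κ * exp (2 * I * κ * s) * E' s + exp (2 * I * κ * s) * (-(I * β s) * E' s)) * H 0)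
      s := fun s => ((hexp s).mul (h.derivE' s)).mul_const _
  have dFa : ∀ s, HasDerivAt Fa _ s := fun s =>
    ((h.derivE s).mul_const (F 0)).add (((h.derivP s).mul (dG s)).const_mul g)
  have dHa : ∀ s, HasDerivAt Ha _ s := fun s =>
    (dG s).sub (((h.derivR s).mul ((h.derivE s).mul_const (F 0))).const_mul g)
  have bE : ∀ s, ‖E s * F 0‖ ≤ M := fun s => by rw [norm_mul, h.normE, one_mul]; exact h.boundF
  have bG : ∀ s : ℝ, 0 ≤ s → ‖exp (2 * I * κ * s) * E' s * H 0‖ ≤ M := fun s hs => by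
    rw [norm_mul, norm_mul, h.normE', mul_one]
    exact (mul_le_mul (hen s hs) h.boundH (norm_nonneg _) zero_le_one).trans (by simp)
  have bPG : ∀ s ∈ Icc 0 X, ‖g * (P s * (exp (2 * I * κ * s) * E' s * H 0))‖ ≤ δ * (M * M) :=
    fun s hs => norm_mul_le_of_le hgn (norm_mul_le_of_le (h.boundP s hs) (bG s hs.1))
  have bRE : ∀ s ∈ Icc 0 X, ‖g * (R s * (E s * F 0))‖ ≤ δ * (M * M) :=
    fun s hs => norm_mul_le_of_le hgn (norm_mul_le_of_le (h.boundR s hs) (bE s))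
  have hδM : δ * (M * M) ≤ M * M := mul_le_of_le_one_left (by positivity) hδ1
  have bFa : ∀ s ∈ Icc 0 X, ‖Fa s‖ ≤ M + M * M := fun s hs =>
    norm_add_le_of_le (bE s) ((bPG s hs).trans hδM)
  have bHa : ∀ s ∈ Icc 0 X, ‖Ha s‖ ≤ M + M * M := fun s hs =>
    norm_sub_le_of_le (bG s hs.1) ((bRE s hs).trans hδM)
  have cFa : Continuous Fa := continuous_iff_continuousAt.2 fun s => (dFa s).continuousAt
  have cHa : Continuous Ha := continuous_iff_continuousAt.2 fun s => (dHa s).continuousAt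
  -- In each source the terms with the `eᵢ` contribute `2 M (M + M ^ 2)` and those with `g`
  -- contribute `3 M ^ 3 + M ^ 2`, which add up to the coefficient in `ρ`. The bound `2 M` for the
  -- coefficients allows for the `eᵢ`, since `δ ≤ 1`.
  have hi := energy_forward (X := X) (C := 2 * M) (ρ := (5 * M ^ 3 + 3 * M ^ 2) * δ) (by positivity)
    (y₁ := fun s => F s - Fa s) (y₂ := fun s => H s - Ha s)
    (m₁₁ := fun s => I * β s + e₂ s) (m₁₂ := fun s => P s + e₁ s)
    (m₂₂ := fun s => 2 * I * κ - I * β s + e₃ s) (m₂₁ := fun s => R s + e₄ s)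
    (r₁ := fun s => e₁ s * Ha s + e₂ s * Fa s + g * (-(P s * (R s * (E s * F 0))) +
      I * (β s * (P s * (exp (2 * I * κ * s) * E' s * H 0))) +
      I * (β s * (P s * (exp (2 * I * κ * s) * E' s * H 0))) -
      P₁ s * (exp (2 * I * κ * s) * E' s * H 0)))
    (r₂ := fun s => e₃ s * Ha s + e₄ s * Fa s + g * (I * (β s * (R s * (E s * F 0))) +
      R s * (P s * (exp (2 * I * κ * s) * E' s * H 0)) +
      I * (β s * (R s * (E s * F 0))) + R₁ s * (E s * F 0)))
    (h.contF.sub cFa.continuousOn) (h.contH.sub cHa.continuousOn)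
    (fun s hs => by
      refine ((h.derivF s hs).sub (dFa s)).congr_deriv ?_
      simp only [hFa, hHa]
      linear_combination -(P s * exp (2 * I * κ * s) * E' s * H 0) * hgκ)
    (fun s hs => by
      refine ((h.derivH s hs).sub (dHa s)).congr_deriv ?_
      simp only [hFa, hHa]
      linear_combination -(R s * E s * F 0) * hgκ)
    (fun s hs => by
      have hs' := Ioo_subset_Icc_self hs
      refine (re_le_norm _).trans ((norm_add_le_of_le (norm_mul_le_of_le bI (h.boundβ s hs'))
        (h.bound₂ s hs')).trans ?_)
      rw [← hδ]; linarith)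
    (fun s hs => by
      have hs' := Ioo_subset_Icc_self hs
      have h1 := (re_le_norm _).trans (norm_sub_le_of_le (h.bound₃ s hs') (norm_mul_le_of_le bI (h.boundβ s hs')))
      have h2 : (2 * I * κ).re ≤ 0 := by simp; exact hκi
      have h3 : 2 * I * κ - I * β s + e₃ s = 2 * I * κ + (e₃ s - I * β s) := by ring
      rw [h3, add_re]
      rw [← hδ] at h1; linarith)
    (fun s hs => by
      have hs' := Ioo_subset_Icc_self hs
      refine (norm_add_le_of_le (h.boundP s hs') (h.bound₁ s hs')).trans ?_
      rw [← hδ]; linarith)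
    (fun s hs => by
      have hs' := Ioo_subset_Icc_self hs
      refine (norm_add_le_of_le (h.boundR s hs') (h.bound₄ s hs')).trans ?_
      rw [← hδ]; linarith)
    (fun s hs => by
      have hs' := Ioo_subset_Icc_self hs
      have b1 := norm_mul_le_of_le bI (norm_mul_le_of_le (h.boundβ s hs')
        (norm_mul_le_of_le (h.boundP s hs') (bG s hs'.1)))
      refine (norm_add_le_of_le (norm_add_le_of_le
        (norm_mul_le_of_le (h.bound₁ s hs') (bHa s hs'))
        (norm_mul_le_of_le (h.bound₂ s hs') (bFa s hs')))
        (norm_mul_le_of_le hgn (norm_sub_le_of_le (norm_add_le_of_le (norm_add_le_of_le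
          ((norm_neg _).trans_le (norm_mul_le_of_le (h.boundP s hs')
            (norm_mul_le_of_le (h.boundR s hs') (bE s)))) b1) b1)
          (norm_mul_le_of_le (h.boundP₁ s hs') (bG s hs'.1))))).trans (le_of_eq ?_)
      rw [← hδ]; ring)
    (fun s hs => by
      have hs' := Ioo_subset_Icc_self hs
      have b1 := norm_mul_le_of_le bI (norm_mul_le_of_le (h.boundβ s hs')
        (norm_mul_le_of_le (h.boundR s hs') (bE s)))
      refine (norm_add_le_of_le (norm_add_le_of_le
        (norm_mul_le_of_le (h.bound₃ s hs') (bHa s hs'))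
        (norm_mul_le_of_le (h.bound₄ s hs') (bFa s hs')))
        (norm_mul_le_of_le hgn (norm_add_le_of_le (norm_add_le_of_le (norm_add_le_of_le b1
          (norm_mul_le_of_le (h.boundR s hs') (norm_mul_le_of_le (h.boundP s hs') (bG s hs'.1))))
          b1) (norm_mul_le_of_le (h.boundR₁ s hs') (bE s))))).trans (le_of_eq ?_)
      rw [← hδ]; ring)
    (x := X) ⟨hX, le_rfl⟩
  have h0 : (0 : ℝ) ∈ Icc 0 X := ⟨le_rfl, hX⟩
  have i1 : ‖F 0 - Fa 0‖ ≤ δ * (M * M) := by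
    have : F 0 - Fa 0 = -(g * (P 0 * (exp (2 * I * κ * (0 : ℝ)) * E' 0 * H 0))) := by
      simp only [hFa, h.E_zero]; ring
    rw [this, norm_neg]; exact bPG 0 h0
  have i2 : ‖H 0 - Ha 0‖ ≤ δ * (M * M) := by
    have : H 0 - Ha 0 = g * (R 0 * (E 0 * F 0)) := by
      simp only [hHa, h.E'_zero]; simp
    rw [this]; exact bRE 0 h0
  have i3 : ‖F 0 - Fa 0‖ ^ 2 + ‖H 0 - Ha 0‖ ^ 2 + ((5 * M ^ 3 + 3 * M ^ 2) * δ) ^ 2 ≤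
      ((5 * M ^ 3 + 5 * M ^ 2) * δ) ^ 2 := by
    have j1 := pow_le_pow_left₀ (norm_nonneg _) i1 2
    have j2 := pow_le_pow_left₀ (norm_nonneg _) i2 2
    have : 0 ≤ δ ^ 2 * (20 * M ^ 5 + 14 * M ^ 4) := by positivity
    nlinarith
  have hi' := hi.trans (mul_le_mul_of_nonneg_right i3 (Real.exp_pos _).le)
  rw [sq_mul_exp_eq] at hi'
  obtain ⟨k1, k2⟩ := norm_le_of_sq_add_sq_le (by positivity) hi'
  have e8 : (4 * (2 * M) + 2) * X / 2 = (8 * M + 2) * X / 2 := by ring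
  rw [e8] at k1 k2
  have hXX : X ∈ Icc 0 X := ⟨hX, le_rfl⟩
  rw [← hδ]
  constructor
  · have : F X - E X * F 0 = (F X - Fa X) + g * (P X * (exp (2 * I * κ * X) * E' X * H 0)) := by
      simp only [hFa]; ring
    rw [this]
    refine (norm_add_le_of_le k1 (bPG X hXX)).trans (le_of_eq (by ring))
  · have : H X - exp (2 * I * κ * X) * E' X * H 0 = (H X - Ha X) - g * (R X * (E X * F 0)) := by
      simp only [hHa]; ring
    rw [this]
    refine (norm_sub_le_of_le k2 (bRE X hXX)).trans (le_of_eq (by ring))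

/-! ### Transition matrices -/

lemma IsSol.const_smul_exp {A : ℝ → Matrix (Fin 2) (Fin 2) ℂ} {X : ℝ} {y : ℝ → Fin 2 → ℂ} (c : ℂ)
    {B : ℝ → Matrix (Fin 2) (Fin 2) ℂ} (hB : ∀ s, B s = A s + c • 1)
    (hy : IsSol A X y) : IsSol B X (fun s => exp (c * s) • y s) := by
  refine ⟨(by fun_prop : Continuous fun s : ℝ => exp (c * s)).continuousOn.smul hy.cont,
    fun s hs => ?_⟩
  refine ((hasDerivAt_exp_mul c s).smul (hy.deriv s hs)).congr_deriv ?_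
  rw [hB, Matrix.add_mulVec, Matrix.smul_mulVec, Matrix.one_mulVec, Matrix.mulVec_smul,
    smul_smul, mul_comm (exp (c * s)) c]

/-- The Wronskian of two solutions. -/
lemma IsSol.wronskian {A : ℝ → Matrix (Fin 2) (Fin 2) ℂ} {X : ℝ} {y z : ℝ → Fin 2 → ℂ} {c : ℂ}
    (hc : ∀ s, A s 0 0 + A s 1 1 = c) (hX : 0 ≤ X) (hy : IsSol A X y) (hz : IsSol A X z) :
    y X 0 * z X 1 - y X 1 * z X 0 = exp (c * X) * (y 0 0 * z 0 1 - y 0 1 * z 0 0) := by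
  have hW : IsSol (fun _ => 0 + c • 1) X (fun s => ![y s 0 * z s 1 - y s 1 * z s 0, 0]) := by
    refine ⟨?_, fun s hs => ?_⟩
    · have c0 := continuousOn_pi.1 hy.cont 0
      have c1 := continuousOn_pi.1 hy.cont 1
      have d0 := continuousOn_pi.1 hz.cont 0
      have d1 := continuousOn_pi.1 hz.cont 1
      refine continuousOn_pi.2 fun i => ?_
      fin_cases i
      · exact (c0.mul d1).sub (c1.mul d0)
      · exact continuousOn_const
    · obtain ⟨y0, y1⟩ := hasDerivAt_fin_two.1 (hy.deriv s hs)
      obtain ⟨z0, z1⟩ := hasDerivAt_fin_two.1 (hz.deriv s hs)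
      refine hasDerivAt_fin_two.2 ⟨?_, ?_⟩
      · refine ((y0.mul z1).sub (y1.mul z0)).congr_deriv ?_
        simp only [mulVec_zero_apply, mulVec_one_apply, ← hc s]
        simp; ring
      · simpa [mulVec_one_apply] using hasDerivAt_const s (0 : ℂ)
  have hE : IsSol (fun _ => 0 + c • 1) X
      (fun s : ℝ => exp (c * s) • ![y 0 0 * z 0 1 - y 0 1 * z 0 0, 0]) :=
    IsSol.const_smul_exp (A := fun _ => 0) c (fun _ => rfl)
      ⟨continuousOn_const, fun s _ => by simpa using hasDerivAt_const s _⟩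
  have := hW.unique ⟨∑ i, ∑ j, ‖(0 + c • 1 : Matrix (Fin 2) (Fin 2) ℂ) i j‖, fun s _ i j =>
    (Finset.single_le_sum (f := fun j => ‖(0 + c • 1 : Matrix (Fin 2) (Fin 2) ℂ) i j‖)
      (fun _ _ => norm_nonneg _) (Finset.mem_univ j)).trans
      (Finset.single_le_sum (f := fun i => ∑ j, ‖(0 + c • 1 : Matrix (Fin 2) (Fin 2) ℂ) i j‖)
      (fun _ _ => Finset.sum_nonneg fun _ _ => norm_nonneg _) (Finset.mem_univ i))⟩ hE (by simp)
      ⟨hX, le_rfl⟩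
  simpa using congr_fun this 0

/-- A family of linear systems with the symmetries of the first columns of the Lax pair. -/
structure IsLaxFamily (A : ℂ → ℝ → Matrix (Fin 2) (Fin 2) ℂ) (U : Set ℂ) (X : ℝ) (κ : ℂ → ℂ) :
    Prop where
  isOpen : IsOpen U
  conj_mem : ∀ ζ ∈ U, conj ζ ∈ U
  cont : ∀ i j, ContinuousOn (fun q : ℂ × ℝ => A q.1 q.2 i j) (U ×ˢ Icc 0 X)
  diff : ∀ s ∈ Icc 0 X, ∀ i j, DifferentiableOn ℂ (fun ζ => A ζ s i j) U
  trace : ∀ ζ s, A ζ s 0 0 + A ζ s 1 1 = 2 * I * κ ζ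
  symm_diag : ∀ ζ s, A ζ s 0 0 = 2 * I * κ ζ + conj (A (conj ζ) s 1 1)
  symm_off : ∀ ζ s, A ζ s 0 1 = conj (A (conj ζ) s 1 0)
  conj_param : ∀ ζ, κ (conj ζ) = conj (κ ζ)

/-- `Φ` maps initial values of solutions on `[0, X]` to final values. -/
structure IsTransition (A : ℂ → ℝ → Matrix (Fin 2) (Fin 2) ℂ) (U : Set ℂ) (X : ℝ) (κ : ℂ → ℂ)
    (Φ : ℂ → Matrix (Fin 2) (Fin 2) ℂ) : Prop where
  exists_sol : ∀ ζ ∈ U, ∀ c, ∃ y, IsSol (A ζ) X y ∧ y 0 = c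
  map : ∀ ζ ∈ U, ∀ y, IsSol (A ζ) X y → y X = Φ ζ *ᵥ y 0
  diff : ∀ i j, DifferentiableOn ℂ (fun ζ => Φ ζ i j) U
  det : ∀ ζ ∈ U, Φ ζ 0 0 * Φ ζ 1 1 - Φ ζ 1 0 * Φ ζ 0 1 = exp (2 * I * κ ζ * X)
  symm : ∀ ζ ∈ U, ∀ c : Fin 2 → ℂ, ∀ i, conj ((Φ (conj ζ) *ᵥ c) (1 - i)) =
    exp (-(2 * I * κ ζ * X)) * (Φ ζ *ᵥ ![conj (c 1), conj (c 0)]) i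

/-- The columns of `Φ` are the final values of the two basic solutions, and the determinant is
Liouville's formula. The symmetry holds because conjugating a solution at `conj ζ`, exchanging its
entries and multiplying by `exp(2iκs)` yields a solution at `ζ`. -/
theorem IsLaxFamily.exists_transition {A : ℂ → ℝ → Matrix (Fin 2) (Fin 2) ℂ} {U : Set ℂ} {X : ℝ}
    {κ : ℂ → ℂ} (h : IsLaxFamily A U X κ) (hX : 0 ≤ X) : ∃ Φ, IsTransition A U X κ Φ := by
  choose Y hY hYd using exists_flow hX h.isOpen h.cont h.diff
  have hb : ∀ ζ ∈ U, ∃ C, ∀ s ∈ Ioo 0 X, ∀ i j, ‖A ζ s i j‖ ≤ C := fun ζ hζ =>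
    bounded_coeff_of_continuousOn fun i j =>
      (h.cont i j).comp (f := fun s : ℝ => (ζ, s)) (by fun_prop) fun s hs => ⟨hζ, hs⟩
  have hXm : X ∈ Icc 0 X := ⟨hX, le_rfl⟩
  set Φ : ℂ → Matrix (Fin 2) (Fin 2) ℂ := fun ζ => !![Y ![1, 0] ζ X 0, Y ![0, 1] ζ X 0;
    Y ![1, 0] ζ X 1, Y ![0, 1] ζ X 1] with hΦ
  have hmap : ∀ ζ ∈ U, ∀ y, IsSol (A ζ) X y → y X = Φ ζ *ᵥ y 0 := by
    intro ζ hζ y hy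
    have e := hy.unique (hb ζ hζ) (((hY ![1, 0] ζ hζ).1.smul (y 0 0)).add
      ((hY ![0, 1] ζ hζ).1.smul (y 0 1))) (by
        ext i; simp only [(hY _ ζ hζ).2]; fin_cases i <;> simp) hXm
    rw [e]
    ext i
    fin_cases i <;> simp [mulVec_zero_apply, mulVec_one_apply, hΦ] <;> ring
  refine ⟨Φ, fun ζ hζ c => ⟨Y c ζ, hY c ζ hζ⟩, hmap, fun i j => ?_, fun ζ hζ => ?_,
    fun ζ hζ c i => ?_⟩
  · have h1 := fun c i => differentiableOn_pi.1 (hYd c X hXm) i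
    fin_cases i <;> fin_cases j <;> simp only [hΦ]
    exacts [h1 _ 0, h1 _ 0, h1 _ 1, h1 _ 1]
  · have := (hY ![1, 0] ζ hζ).1.wronskian (h.trace ζ) hX (hY ![0, 1] ζ hζ).1
    simp only [(hY _ ζ hζ).2] at this
    simpa [hΦ] using this
  · have hy := hY c (conj ζ) (h.conj_mem ζ hζ)
    have hyX := hmap _ (h.conj_mem ζ hζ) _ hy.1
    have hz : IsSol (fun s => A ζ s + (-(2 * I * κ ζ)) • 1) X
        (fun s => ![conj (Y c (conj ζ) s 1), conj (Y c (conj ζ) s 0)]) := by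
      refine ⟨?_, fun s hs => ?_⟩
      · refine continuousOn_pi.2 fun i => ?_
        have := fun i => (continuousOn_pi.1 hy.1.cont i).star
        fin_cases i
        exacts [this 1, this 0]
      · obtain ⟨y0, y1⟩ := hasDerivAt_fin_two.1 (hy.1.deriv s hs)
        have k0 := h.symm_diag ζ s
        have k1 := h.symm_off ζ s
        have k2 := h.symm_off (conj ζ) s
        have k3 := h.trace ζ s
        have k4 := congr_arg conj (h.trace (conj ζ) s)
        rw [h.conj_param] at k4
        rw [Complex.conj_conj] at k2
        simp only [map_add, map_mul, map_ofNat, conj_I, Complex.conj_conj] at k4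
        refine hasDerivAt_fin_two.2 ⟨?_, ?_⟩
        · refine y1.conj_comp.congr_deriv ?_
          simp only [mulVec_zero_apply, mulVec_one_apply]
          simp
          linear_combination -conj (Y c (conj ζ) s 1) * k0 - conj (Y c (conj ζ) s 0) * k1
        · refine y0.conj_comp.congr_deriv ?_
          simp only [mulVec_zero_apply, mulVec_one_apply]
          simp [k2]
          linear_combination conj (Y c (conj ζ) s 0) * (k4 + k0 - k3)
    have hz' := hz.const_smul_exp (2 * I * κ ζ) (B := A ζ) (fun s => by
      rw [add_assoc, ← add_smul]; simp)
    have e := hmap ζ hζ _ hz'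
    simp only [ofReal_zero, mul_zero, exp_zero, one_smul, hy.2] at e
    rw [hy.2] at hyX
    rw [← hyX, ← e]
    rw [Pi.smul_apply, smul_eq_mul, ← mul_assoc, ← exp_add, neg_add_cancel, exp_zero, one_mul]
    fin_cases i <;> rfl

/-! ### The columns of the Lax pair -/

/-- Coefficients of the space part of the Lax pair, for the first column. -/
noncomputable def spaceFamily (w : ℝ → ℂ) (ζ : ℂ) (s : ℝ) : Matrix (Fin 2) (Fin 2) ℂ :=
  !![0, ζ * w s; ζ * conj (w s), 2 * I * ζ ^ 2]

/-- Coefficients of the time part of the Lax pair, for the first column. -/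
noncomputable def timeFamily (w v : ℝ → ℂ) (ζ : ℂ) (s : ℝ) : Matrix (Fin 2) (Fin 2) ℂ :=
  !![-(I / 2) * (v s * conj (v s)), ζ * w s + I * v s * (1 / (2 * ζ));
     ζ * conj (w s) - I * conj (v s) * (1 / (2 * ζ)),
     2 * I * eta ζ ^ 2 + I / 2 * (v s * conj (v s))]

lemma isLaxFamily_space {w : ℝ → ℂ} (hw : Continuous w) (X : ℝ) :
    IsLaxFamily (spaceFamily w) univ X (fun ζ => ζ ^ 2) where
  isOpen := isOpen_univ
  conj_mem _ _ := mem_univ _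
  cont i j := by
    refine Continuous.continuousOn ?_
    fin_cases i <;> fin_cases j <;> simp [spaceFamily] <;> fun_prop
  diff s _ i j := by
    refine Differentiable.differentiableOn ?_
    fin_cases i <;> fin_cases j <;> simp [spaceFamily]
  trace ζ s := by simp [spaceFamily]
  symm_diag ζ s := by simp [spaceFamily, map_ofNat]
  symm_off ζ s := by simp [spaceFamily]
  conj_param ζ := by simp

lemma conj_eta (ζ : ℂ) : eta (conj ζ) = conj (eta ζ) := by simp [eta, map_ofNat]

lemma isLaxFamily_time {w v : ℝ → ℂ} (hw : Continuous w) (hv : Continuous v) (X : ℝ) :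
    IsLaxFamily (timeFamily w v) {0}ᶜ X (fun ζ => eta ζ ^ 2) where
  isOpen := isOpen_compl_singleton
  conj_mem ζ hζ := by simpa using hζ
  cont i j := by
    have hc : ContinuousOn (fun q : ℂ × ℝ => 1 / (2 * q.1)) ({0}ᶜ ×ˢ Icc 0 X) :=
      ContinuousOn.div continuousOn_const (by fun_prop) fun q hq => by
        simpa using hq.1
    have he : ContinuousOn (fun q : ℂ × ℝ => eta q.1) ({0}ᶜ ×ˢ Icc 0 X) :=
      continuousOn_fst.sub hc
    have h1 : Continuous (fun q : ℂ × ℝ => w q.2) := by fun_prop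
    have h2 : Continuous (fun q : ℂ × ℝ => v q.2) := by fun_prop
    have h3 : Continuous (fun q : ℂ × ℝ => conj (w q.2)) := by fun_prop
    have h4 : Continuous (fun q : ℂ × ℝ => conj (v q.2)) := by fun_prop
    fin_cases i <;> fin_cases j <;>
      simp only [timeFamily, Matrix.of_apply, Matrix.cons_val', Matrix.cons_val_zero,
        Matrix.cons_val_one, Matrix.cons_val_fin_one, Fin.zero_eta, Fin.mk_one]
    · exact continuousOn_const.mul (h2.mul h4).continuousOn
    · exact (continuousOn_fst.mul h1.continuousOn).add
        ((continuousOn_const.mul h2.continuousOn).mul hc)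
    · exact (continuousOn_fst.mul h3.continuousOn).sub
        ((continuousOn_const.mul h4.continuousOn).mul hc)
    · exact (continuousOn_const.mul (he.pow 2)).add (continuousOn_const.mul (h2.mul h4).continuousOn)
  diff s _ i j := by
    have hc : DifferentiableOn ℂ (fun ζ : ℂ => 1 / (2 * ζ)) {0}ᶜ :=
      DifferentiableOn.div (differentiableOn_const _) (by fun_prop) fun q hq => by simpa using hq
    have he : DifferentiableOn ℂ eta {0}ᶜ := differentiableOn_id.sub hc
    fin_cases i <;> fin_cases j <;>
      simp only [timeFamily, Matrix.of_apply, Matrix.cons_val', Matrix.cons_val_zero,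
        Matrix.cons_val_one, Matrix.cons_val_fin_one, Fin.zero_eta, Fin.mk_one]
    · exact differentiableOn_const _
    · exact (differentiableOn_id.mul_const _).add (hc.const_mul _)
    · exact (differentiableOn_id.mul_const _).sub (hc.const_mul _)
    · exact ((he.pow 2).const_mul _).add (differentiableOn_const _)
  trace ζ s := by simp [timeFamily]
  symm_diag ζ s := by
    simp [timeFamily, conj_eta, map_ofNat]; ring
  symm_off ζ s := by simp [timeFamily, map_ofNat]
  conj_param ζ := by simp [conj_eta]

/-- The second column of the Lax eigenfunction. -/
noncomputable def column (u : ℝ → ℝ → ℂ) (x t : ℝ) (ζ : ℂ) : Fin 2 → ℂ :=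
  exp (-I * phaseInf (fun y => dx u y t)) • jost (fun y => dx u y t) ζ x

lemma column_apply (u : ℝ → ℝ → ℂ) (x t : ℝ) (ζ : ℂ) (i : Fin 2) : column u x t ζ i =
    exp (-I * phaseInf (fun y => dx u y t)) * jost (fun y => dx u y t) ζ x i := rfl

/-- This is where `n` comes from. When `u_x = e^{iα} u`, the off-diagonal entry of the time part is
`u (ζ e^{iα} + i/(2ζ))`, and `n(ζ)` is the factor by which the substitution `ζ ↦ 1/(2ζ)` changes it.
-/
lemma nFun_mul {α : ℝ} {ζ : ℂ} (h0 : ζ ≠ 0)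
    (h : Real.cos α = 0 ∨ I + 2 * exp (I * α) * ζ ^ 2 ≠ 0) :
    nFun α ζ * (ζ * exp (I * α) + I * (1 / (2 * ζ))) = exp (I * α) * (1 / (2 * ζ)) + I * ζ := by
  obtain ⟨z, hz⟩ : ∃ z : ℂ, z = 1 / (2 * ζ) := ⟨_, rfl⟩
  have hzζ : 2 * ζ * z = 1 := by rw [hz]; field_simp
  rw [← hz]
  by_cases hc : Real.cos α = 0
  · have hs : Real.sin α ^ 2 = 1 := by nlinarith [Real.sin_sq_add_cos_sq α]
    have hs' : (Real.sin α : ℂ) ^ 2 = 1 := by exact_mod_cast hs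
    have he : exp (I * α) = Real.sin α * I := by
      rw [mul_comm, exp_mul_I, ← ofReal_cos, ← ofReal_sin, hc]; simp
    rw [nFun, if_pos hc, he]
    linear_combination (I * ζ) * hs'
  · have hne := h.resolve_left hc
    rw [nFun, if_neg hc, div_mul_eq_mul_div, div_eq_iff hne]
    linear_combination (I ^ 2 * ζ - exp (I * α) ^ 2 * ζ) * hzζ

namespace IsHalfLineSolution

variable {α : ℝ} {T : EReal} {u : ℝ → ℝ → ℂ}

lemma column_eq (h : IsHalfLineSolution α T u) (x : ℝ) {t : ℝ} (ht : t ∈ timeInterval T) (ζ : ℂ) :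
    column u x t ζ =
      exp (-I * phaseInf (fun y => dx u y 0)) • jost (fun y => dx u y t) ζ x := by
  rw [column, h.phaseInf_eq ht]

lemma smoothPotential (h : IsHalfLineSolution α T u) {t : ℝ} (ht : t ∈ timeInterval T) :
    ∃ C, IsSmoothPotential (fun x => dx u x t) (fun x => dx (dx u) x t)
      (fun x => dx (dx (dx u)) x t) C := by
  obtain ⟨C₁, h₁, hC₁⟩ := h.decay 1 0 t
  obtain ⟨C₂, h₂, hC₂⟩ := h.decay 2 0 t
  obtain ⟨C₃, h₃, hC₃⟩ := h.decay 3 0 t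
  have key : ∀ x : ℝ, ∀ A B : ℝ, A ≤ B → A * (1 + x ^ 2)⁻¹ ≤ B * (1 + x ^ 2)⁻¹ := fun x A B hAB =>
    mul_le_mul_of_nonneg_right hAB (by positivity)
  have s1 := contDiff_dx h.smooth_dx
  have s2 := contDiff_dx s1.1
  refine ⟨C₁ + C₂ + C₃, ⟨continuous_slice h.smooth_dx t, fun x hx => ?_⟩, fun x => s1.2 x t,
    fun x => s2.2 x t, fun x hx => ?_, fun x hx => ?_⟩
  · exact (hC₁ x t hx ht le_rfl).trans (key x _ _ (by linarith))
  · exact (hC₂ x t hx ht le_rfl).trans (key x _ _ (by linarith))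
  · exact (hC₃ x t hx ht le_rfl).trans (key x _ _ (by linarith))

/-- Asymptotics of the second column. -/
lemma column_asymptotics (h : IsHalfLineSolution α T u) {t : ℝ} (ht : t ∈ timeInterval T) :
    ∃ K, ∀ ζ ∈ closedQuadrants, 1 ≤ ‖ζ‖ → ∀ x, 0 ≤ x →
      ‖column u x t ζ 1 - exp (-I * phase (fun y => dx u y t) x)‖ ≤ K / ‖ζ‖ ^ 2 ∧
      ‖ζ * column u x t ζ 0 + I / 2 * dx u x t * column u x t ζ 1‖ ≤ K / ‖ζ‖ ^ 2 := by
  obtain ⟨C, hC⟩ := h.smoothPotential ht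
  obtain ⟨K, hK⟩ := jost_asymptotics hC
  refine ⟨K, fun ζ hζ h1 x hx => ?_⟩
  obtain ⟨k1, k2⟩ := hK ζ hζ h1 x hx
  have hn : ‖exp (-I * phaseInf (fun y => dx u y t))‖ = 1 := norm_exp_neg_I_mul_real _
  simp only [column_apply]
  constructor
  · have e : exp (-I * phaseInf (fun y => dx u y t)) *
        exp (-I * (phase (fun y => dx u y t) x + -phaseInf (fun y => dx u y t))) =
        exp (-I * phase (fun y => dx u y t) x) := by
      rw [← exp_add]; congr 1; ring
    rw [← e, ← mul_sub, norm_mul, hn, one_mul]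
    exact k1
  · refine le_trans (le_of_eq ?_) k2
    rw [show ∀ E a b c d : ℂ, a * (E * b) + c * (E * d) = E * (a * b + c * d) by intros; ring,
      norm_mul, hn, one_mul]

lemma column_isSol_space (h : IsHalfLineSolution α T u) {t : ℝ} (ht : t ∈ timeInterval T) {ζ : ℂ}
    (hζ : ζ ∈ closedQuadrants) (X : ℝ) :
    IsSol (spaceFamily (fun y => dx u y t) ζ) X
      (fun s => exp (2 * I * ζ ^ 2 * s) • column u s t ζ) := by
  obtain ⟨C, hC⟩ := h.potential ht
  have hJ := jost_spec hC hζ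
  have hsol : IsSol (fun s => !![-2 * I * ζ ^ 2, ζ * dx u s t; ζ * conj (dx u s t), 0]) X
      (jost (fun y => dx u y t) ζ) := by
    refine ⟨?_, fun s hs => ?_⟩
    rotate_left
    · refine hasDerivAt_fin_two.2 ⟨(hJ.deriv_fst s hs.1).congr_deriv ?_,
        (hJ.deriv_snd s hs.1).congr_deriv ?_⟩
      · simp only [mulVec_zero_apply]; simp [offDiag]
      · simp only [mulVec_one_apply]; simp [offDiag]
    exact hJ.cont.mono Icc_subset_Ici_self
  refine (hsol.smul _).const_smul_exp (2 * I * ζ ^ 2) fun s => ?_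
  ext i j
  fin_cases i <;> fin_cases j <;> simp [spaceFamily]

/-- The normalising factor of `column` depends on time only in appearance, by `phaseInf_eq`, so the
equation for `jost` carries over unchanged. -/
lemma column_hasDerivAt_time (h : IsHalfLineSolution α T u) {t : ℝ} (ht : t ∈ timeInterval T) {ζ : ℂ}
    (hζ : ζ ∈ closedQuadrants) (h0 : ζ ≠ 0) {x : ℝ} (hx : 0 ≤ x) :
    IsSol (fun s => timeCoeff (fun y => dx u y s) (fun y => u y s) ζ x) t
      (fun s => column u x s ζ) := by
  have hsub : Icc 0 t ⊆ timeInterval T := fun s hs => mem_of_le ht hs.1 hs.2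
  have hsol : IsSol (fun s => timeCoeff (fun y => dx u y s) (fun y => u y s) ζ x) t
      (fun s => jost (fun y => dx u y s) ζ x) := by
    refine ⟨continuousOn_pi.2 fun i s hs => ?_, fun s hs => ?_⟩
    · exact ((h.hasDerivWithinAt_jost hζ h0 hx (hsub hs) i).continuousWithinAt).mono hsub
    · have hn : timeInterval T ∈ 𝓝 s := mem_of_superset (Icc_mem_nhds hs.1 hs.2) hsub
      exact hasDerivAt_fin_two.2
        ⟨(h.hasDerivWithinAt_jost hζ h0 hx (hsub (Ioo_subset_Icc_self hs)) 0).hasDerivAt hn,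
        (h.hasDerivWithinAt_jost hζ h0 hx (hsub (Ioo_subset_Icc_self hs)) 1).hasDerivAt hn⟩
  have h2 := hsol.smul (exp (-I * phaseInf (fun y => dx u y 0)))
  refine ⟨h2.cont.congr fun s hs => h.column_eq x (hsub hs) ζ, fun s hs => ?_⟩
  have h3 := h2.deriv s hs
  have e : column u x s ζ = exp (-I * phaseInf (fun y => dx u y 0)) • jost (fun y => dx u y s) ζ x :=
    h.column_eq x (hsub (Ioo_subset_Icc_self hs)) ζ
  rw [e]
  refine h3.congr_of_eventuallyEq ?_
  filter_upwards [Icc_mem_nhds hs.1 hs.2] with r hr using h.column_eq x (hsub hr) ζ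

lemma column_isSol_time (h : IsHalfLineSolution α T u) {t : ℝ} (ht : t ∈ timeInterval T) {ζ : ℂ}
    (hζ : ζ ∈ closedQuadrants) (h0 : ζ ≠ 0) :
    IsSol (timeFamily (fun s => dx u 0 s) (fun s => u 0 s) ζ) t
      (fun s => exp (2 * I * eta ζ ^ 2 * s) • column u 0 s ζ) :=
  (h.column_hasDerivAt_time ht hζ h0 le_rfl).const_smul_exp _ fun s => by
    ext i j
    fin_cases i <;> fin_cases j <;> simp [timeFamily, timeCoeff]
    all_goals ring

end IsHalfLineSolution

/-! ### Inversion in the circle `|ζ| = 1/√2` and the boundary column. -/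

lemma refl_eq (ζ : ℂ) : refl ζ = ((1 / (2 * normSq ζ) : ℝ) : ℂ) * ζ := by
  rw [refl, one_div, mul_inv, inv_def (conj ζ), Complex.conj_conj, normSq_conj]
  push_cast
  ring

lemma refl_mem_closedQuadrants {ζ : ℂ} (hζ : ζ ∈ closedQuadrants) : refl ζ ∈ closedQuadrants := by
  have h : 0 ≤ ζ.re * ζ.im := hζ
  have e := refl_eq ζ
  have : (refl ζ).re * (refl ζ).im = (1 / (2 * normSq ζ)) ^ 2 * (ζ.re * ζ.im) := by
    rw [e, re_ofReal_mul, im_ofReal_mul]; ring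
  change 0 ≤ (refl ζ).re * (refl ζ).im
  rw [this]; positivity

lemma refl_mem_openQuadrants {ζ : ℂ} (hζ : ζ ∈ openQuadrants) : refl ζ ∈ openQuadrants := by
  have h : 0 < ζ.re * ζ.im := hζ
  have h0 : 0 < normSq ζ := normSq_pos.2 fun h0 => by simp [h0] at h
  have e := refl_eq ζ
  have : (refl ζ).re * (refl ζ).im = (1 / (2 * normSq ζ)) ^ 2 * (ζ.re * ζ.im) := by
    rw [e, re_ofReal_mul, im_ofReal_mul]; ring
  change 0 < (refl ζ).re * (refl ζ).im
  rw [this]; positivity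

lemma refl_ne_zero {ζ : ℂ} (h0 : ζ ≠ 0) : refl ζ ≠ 0 := by
  simpa [refl] using h0

lemma norm_refl (ζ : ℂ) : ‖refl ζ‖ = 1 / (2 * ‖ζ‖) := by simp [refl]

/-- The first column satisfying the boundary condition at `x = 0`. -/
noncomputable def boundaryColumn (α : ℝ) (u : ℝ → ℝ → ℂ) (t : ℝ) (ζ : ℂ) : Fin 2 → ℂ :=
  ![conj (column u 0 t (refl ζ) 1), nFun α ζ * conj (column u 0 t (refl ζ) 0)]

namespace IsHalfLineSolution

variable {α : ℝ} {T : EReal} {u : ℝ → ℝ → ℂ}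

/-- The boundary condition in terms of the Lax pair. -/
lemma boundaryColumn_isSol (h : IsHalfLineSolution α T u) {t : ℝ} (ht : t ∈ timeInterval T) {ζ : ℂ}
    (hζ : ζ ∈ closedQuadrants) (h0 : ζ ≠ 0)
    (hn : Real.cos α = 0 ∨ I + 2 * exp (I * α) * ζ ^ 2 ≠ 0) :
    IsSol (timeFamily (fun s => dx u 0 s) (fun s => u 0 s) ζ) t
      (fun s => boundaryColumn α u s ζ) := by
  have hsol := h.column_hasDerivAt_time ht (refl_mem_closedQuadrants hζ) (refl_ne_zero h0) le_rfl
  have hN := nFun_mul h0 hn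
  obtain ⟨z, hz⟩ : ∃ z : ℂ, z = 1 / (2 * ζ) := ⟨_, rfl⟩
  rw [← hz] at hN
  have r1 : conj (refl ζ) = z := by rw [hz]; simp [refl, map_ofNat]
  have r2 : conj (1 / (2 * refl ζ)) = ζ := by simp [refl, map_ofNat]; ring
  -- Since `η` changes only its sign under `ζ ↦ 1/(2ζ)`, the diagonal of the time part is invariant;
  -- the off-diagonal entries are matched by `hN`.
  have r3 : conj (eta (refl ζ)) = -eta ζ := by
    rw [eta, map_sub, r1, r2, eta, ← hz]; ring
  refine ⟨continuousOn_pi.2 fun i => ?_, fun s hs => ?_⟩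
  · have c := fun i => (continuousOn_pi.1 hsol.cont i).star
    fin_cases i
    · exact c 1
    · exact (c 0).const_mul _
  · obtain ⟨d0, d1⟩ := hasDerivAt_fin_two.1 (hsol.deriv s hs)
    have hb : dx u 0 s = exp (I * α) * u 0 s := h.bdry s (mem_of_le ht hs.1.le hs.2.le)
    have he : exp (I * α) * conj (exp (I * α)) = 1 := by
      rw [conj_mul_eq_norm_sq, norm_exp_I_mul_real]; simp
    refine hasDerivAt_fin_two.2 ⟨d1.conj_comp.congr_deriv ?_,
      (d0.conj_comp.const_mul (nFun α ζ)).congr_deriv ?_⟩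
    · simp only [mulVec_zero_apply, mulVec_one_apply]
      simp only [timeFamily, timeCoeff, boundaryColumn, Matrix.of_apply, Matrix.cons_val',
        Matrix.cons_val_zero, Matrix.cons_val_one, Matrix.cons_val_fin_one, map_add, map_mul,
        map_sub, r1, r2, Complex.conj_conj, conj_I, ← hz, hb]
      simp [map_ofNat]
      linear_combination (-u 0 s * conj (column u 0 s (refl ζ) 0)) * hN
    · simp only [mulVec_zero_apply, mulVec_one_apply]
      simp only [timeFamily, timeCoeff, boundaryColumn, Matrix.of_apply, Matrix.cons_val',
        Matrix.cons_val_zero, Matrix.cons_val_one, Matrix.cons_val_fin_one, map_add, map_mul,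
        map_sub, map_neg, map_pow, r1, r2, r3, Complex.conj_conj, conj_I, ← hz, hb]
      simp [map_ofNat]
      linear_combination (-I * conj (exp (I * α)) * conj (u 0 s) *
        conj (column u 0 s (refl ζ) 1)) * hN + conj (column u 0 s (refl ζ) 1) * conj (u 0 s) *
        (I * (nFun α ζ * ζ - z) * he + conj (exp (I * α)) * (nFun α ζ * z - ζ) * I_sq)

end IsHalfLineSolution

/-! ### Asymptotics of the first column -/

lemma exists_bound_Icc {ι : Type*} [Finite ι] {f : ι → ℝ → ℂ} (hf : ∀ i, Continuous (f i)) (X : ℝ) :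
    ∃ B, 1 ≤ B ∧ ∀ i, ∀ s ∈ Icc 0 X, ‖f i s‖ ≤ B := by
  choose C hC using fun i => (isCompact_Icc (a := (0 : ℝ)) (b := X)).exists_bound_of_continuousOn
    (hf i).continuousOn
  obtain ⟨D, hD⟩ := Set.finite_range C |>.bddAbove
  exact ⟨max 1 D, le_max_left _ _, fun i s hs =>
    (hC i s hs).trans ((hD (mem_range_self i)).trans (le_max_right _ _))⟩

lemma eta_sq {ζ : ℂ} (h0 : ζ ≠ 0) : eta ζ ^ 2 = ζ ^ 2 - 1 + 1 / (4 * ζ ^ 2) := by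
  rw [eta]; field_simp; ring

/-- `η²` differs from `ζ²` by a real constant and by `1/(4ζ²)`, whose imaginary part is too small to
change the sign. This supplies the damping required by `IsLargeSystem.asymptotics` in the time
direction. -/
lemma im_eta_sq_nonneg {ζ : ℂ} (hζ : ζ ∈ closedQuadrants) (h1 : 1 ≤ ‖ζ‖) : 0 ≤ (eta ζ ^ 2).im := by
  have h0 : ζ ≠ 0 := norm_pos_iff.1 (by linarith)
  have him : 0 ≤ (ζ ^ 2).im := by
    have : 0 ≤ ζ.re * ζ.im := hζ
    simp [pow_two]; linarith
  have hn : 1 ≤ normSq (ζ ^ 2) := by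
    rw [normSq_eq_norm_sq, norm_pow]; exact one_le_pow₀ (one_le_pow₀ h1)
  have e : (1 / (4 * ζ ^ 2)).im = -((ζ ^ 2).im / normSq (ζ ^ 2)) / 4 := by
    have e1 : 1 / (4 * ζ ^ 2) = ((1 / 4 : ℝ) : ℂ) * (ζ ^ 2)⁻¹ := by push_cast; field_simp
    rw [e1, im_ofReal_mul, inv_im]; ring
  rw [eta_sq h0, add_im, sub_im, one_im, e]
  have : (ζ ^ 2).im / normSq (ζ ^ 2) ≤ (ζ ^ 2).im := div_le_self him hn
  linarith

lemma norm_eta_sq_bounds {ζ : ℂ} (h2 : 2 ≤ ‖ζ‖) :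
    ‖ζ‖ ^ 2 ≤ 2 * ‖eta ζ ^ 2‖ ∧ ‖eta ζ ^ 2‖ ≤ 2 * ‖ζ‖ ^ 2 := by
  have h0 : ζ ≠ 0 := norm_pos_iff.1 (by linarith)
  have h4 : 4 ≤ ‖ζ‖ ^ 2 := by nlinarith
  have e : ‖1 / (4 * ζ ^ 2)‖ ≤ 1 / 4 := by
    have e : ‖(4 * ζ ^ 2 : ℂ)‖ = 4 * ‖ζ‖ ^ 2 := by simp
    rw [norm_div, norm_one, e]
    exact one_div_le_one_div_of_le (by norm_num) (by linarith)
  have e2 : ‖1 / (4 * ζ ^ 2) - 1‖ ≤ 5 / 4 := (norm_sub_le _ _).trans (by rw [norm_one]; linarith)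
  have e3 : eta ζ ^ 2 = ζ ^ 2 + (1 / (4 * ζ ^ 2) - 1) := by rw [eta_sq h0]; ring
  have l1 := norm_add_le (ζ ^ 2) (1 / (4 * ζ ^ 2) - 1)
  have l2 := norm_sub_norm_le (ζ ^ 2) (-(1 / (4 * ζ ^ 2) - 1))
  rw [sub_neg_eq_add, norm_neg] at l2
  rw [← e3, norm_pow ζ] at l1 l2
  constructor <;> linarith

namespace IsHalfLineSolution

variable {α : ℝ} {T : EReal} {u : ℝ → ℝ → ℂ}

/-- With `H = ζ y₁ - (i/2) w̄ y₀` the first-column system is a large system with `κ = ζ²`, `β =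
|w|²/2` and no error terms. The term with `exp(2iζ²x)` is the initial value of `H` carried along. It
does not decay on the axes or for `x = 0`, which is why the limit in the second and fourth quadrants
is restricted to `x > 0` and to sectors. -/
lemma space_asymptotics (h : IsHalfLineSolution α T u) {x t : ℝ} (hx : 0 ≤ x)
    {Ψ : ℂ → Matrix (Fin 2) (Fin 2) ℂ}
    (hΨ : IsTransition (spaceFamily fun y => dx u y t) univ x (fun ζ => ζ ^ 2) Ψ) (B : ℝ) :
    ∃ K, ∀ ζ ∈ closedQuadrants, 1 ≤ ‖ζ‖ → ∀ c : Fin 2 → ℂ, ‖c 0‖ ≤ B →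
      ‖ζ * c 1 - I / 2 * conj (dx u 0 t) * c 0‖ ≤ B →
      ‖(Ψ ζ *ᵥ c) 0 - exp (I * phase (fun y => dx u y t) x) * c 0‖ ≤ K * (1 / ‖ζ‖ ^ 2) ∧
      ‖ζ * (Ψ ζ *ᵥ c) 1 - I / 2 * conj (dx u x t) * (Ψ ζ *ᵥ c) 0‖ ≤
        B * ‖exp (2 * I * ζ ^ 2 * x)‖ + K * (1 / ‖ζ‖ ^ 2) := by
  set w : ℝ → ℂ := fun y => dx u y t with hw
  set w₁ : ℝ → ℂ := fun y => dx (dx u) y t with hw₁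
  set w₂ : ℝ → ℂ := fun y => dx (dx (dx u)) y t with hw₂
  have s1 := contDiff_dx h.smooth_dx
  have s2 := contDiff_dx s1.1
  have s3 := contDiff_dx s2.1
  have d1 : ∀ y, HasDerivAt w (w₁ y) y := fun y => s1.2 y t
  have d2 : ∀ y, HasDerivAt w₁ (w₂ y) y := fun y => s2.2 y t
  have cw : Continuous w := continuous_slice h.smooth_dx t
  have cw₁ : Continuous w₁ := continuous_slice s1.1 t
  have cw₂ : Continuous w₂ := continuous_slice s2.1 t
  obtain ⟨R, hR⟩ : ∃ R : ℝ → ℂ, R = fun s => -(I / 2 * conj (w₁ s)) +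
    1 / 4 * (w s * conj (w s) * conj (w s)) := ⟨_, rfl⟩
  obtain ⟨R₁, hR₁⟩ : ∃ R₁ : ℝ → ℂ, R₁ = fun s => -(I / 2 * conj (w₂ s)) +
    1 / 4 * ((w₁ s * conj (w s) + w s * conj (w₁ s)) * conj (w s) +
      w s * conj (w s) * conj (w₁ s)) := ⟨_, rfl⟩
  have dR : ∀ s, HasDerivAt R (R₁ s) s := fun s => by
    rw [hR, hR₁]
    exact (((d2 s).conj_comp.const_mul (I / 2)).neg).add ((((d1 s).mul (d1 s).conj_comp).mul
      (d1 s).conj_comp).const_mul (1 / 4))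
  have cR : Continuous R := by rw [hR]; fun_prop
  have cR₁ : Continuous R₁ := by rw [hR₁]; fun_prop
  have cβ : Continuous fun s => 1 / 2 * (w s * conj (w s)) := by fun_prop
  obtain ⟨D, hD1, hD⟩ := exists_bound_Icc (ι := Fin 5)
    (f := ![w, w₁, R, R₁, fun s => 1 / 2 * (w s * conj (w s))])
    (by intro i; fin_cases i <;> assumption) x
  set M := max D B with hM
  refine ⟨(5 * M ^ 3 + 5 * M ^ 2) * Real.exp ((8 * M + 2) * x / 2) + M ^ 2,
    fun ζ hζ h1 c hc0 hc1 => ?_⟩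
  obtain ⟨y, hy, hy0⟩ := hΨ.exists_sol ζ (mem_univ _) c
  have e := hΨ.map ζ (mem_univ _) y hy
  rw [hy0] at e
  rw [← e]
  have hM0 : 0 ≤ M := zero_le_one.trans (hD1.trans (le_max_left _ _))
  have hB : ∀ i s, s ∈ Icc 0 x → ‖(![w, w₁, R, R₁, fun s => 1 / 2 * (w s * conj (w s))] :
    Fin 5 → ℝ → ℂ) i s‖ ≤ M := fun i s hs => (hD i s hs).trans (le_max_left _ _)
  have hE := fun s => hasDerivAt_exp_I_phase cw I 0 s
  have hE' := fun s => hasDerivAt_exp_I_phase cw (-I) 0 s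
  simp only [add_zero] at hE hE'
  have c0 := continuousOn_pi.1 hy.cont 0
  have c1 := continuousOn_pi.1 hy.cont 1
  have hz : ∀ s ∈ Icc 0 x, ‖(fun _ : ℝ => (0 : ℂ)) s‖ ≤ M * (1 / ‖ζ ^ 2‖) := fun s _ => by
    simp only [norm_zero]; positivity
  have hsys : IsLargeSystem x M (ζ ^ 2) (fun s => y s 0)
      (fun s => ζ * y s 1 - I / 2 * conj (w s) * y s 0) w w₁ R R₁
      (fun s => exp (I * phase w s)) (fun s => exp (-I * phase w s)) (fun _ => 0) (fun _ => 0)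
      (fun _ => 0) (fun _ => 0) (fun s => 1 / 2 * (w s * conj (w s))) := by
    refine ⟨c0, by fun_prop, fun s hs => ?_, fun s hs => ?_, d1, dR, fun s => ?_, fun s => ?_,
      by simp, by simp, fun s => norm_exp_I_mul_real _, fun s => norm_exp_neg_I_mul_real _,
      hB 0, hB 1, hB 2, hB 3, hB 4, hz, hz, hz, hz, ?_, ?_⟩
    · refine (hasDerivAt_fin_two.1 (hy.deriv s hs)).1.congr_deriv ?_
      rw [mulVec_zero_apply]
      simp [spaceFamily]; ring
    · obtain ⟨q0, q1⟩ := hasDerivAt_fin_two.1 (hy.deriv s hs)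
      refine ((q1.const_mul ζ).sub (((d1 s).conj_comp.const_mul (I / 2)).mul q0)).congr_deriv ?_
      rw [mulVec_zero_apply, mulVec_one_apply, hR]
      simp only [spaceFamily, Matrix.of_apply, Matrix.cons_val', Matrix.cons_val_zero,
        Matrix.cons_val_one, Matrix.cons_val_fin_one, hw]
      linear_combination (-(1 / 4) * conj (dx u s t) ^ 2 * dx u s t * y s 0 +
        ζ ^ 2 * conj (dx u s t) * y s 0) * I_sq
    · refine (hE s).congr_deriv ?_
      rw [← conj_mul_eq_norm_sq]; ring
    · refine (hE' s).congr_deriv ?_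
      rw [← conj_mul_eq_norm_sq]; ring
    · rw [hy0]; exact hc0.trans (le_max_right _ _)
    · rw [hy0]; exact hc1.trans (le_max_right _ _)
  have him : 0 ≤ (ζ ^ 2).im := by
    have : 0 ≤ ζ.re * ζ.im := hζ
    simp [pow_two]; linarith
  obtain ⟨r1, r2⟩ := hsys.asymptotics hx (by rw [norm_pow]; exact one_le_pow₀ h1) him
  rw [norm_pow, hy0] at r1 r2
  refine ⟨r1, ?_⟩
  refine (norm_le_norm_add_norm_sub' _ (exp (2 * I * ζ ^ 2 * x) * exp (-I * phase w x) *
    (ζ * c 1 - I / 2 * conj (w 0) * c 0))).trans (add_le_add ?_ r2)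
  rw [norm_mul, norm_mul, norm_exp_neg_I_mul_real, mul_one, mul_comm]
  exact mul_le_mul_of_nonneg_right hc1 (norm_nonneg _)

/-- The same substitution, now with `κ = η²`. Along `x = 0` the identity `|u_x| = |u|` cancels the
phase, so `β = 0` and the first entry tends to one. The contributions of the entries `1/(2ζ)` are of
order `1/|η²|`; those not already included in `R` go into the `eᵢ`. -/
lemma time_asymptotics (h : IsHalfLineSolution α T u) {t : ℝ} (ht : t ∈ timeInterval T)
    {Φ : ℂ → Matrix (Fin 2) (Fin 2) ℂ}
    (hΦ : IsTransition (timeFamily (fun s => dx u 0 s) (fun s => u 0 s)) {0}ᶜ t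
      (fun ζ => eta ζ ^ 2) Φ) :
    ∃ K, ∀ ζ ∈ closedQuadrants, 2 ≤ ‖ζ‖ →
      ‖Φ ζ 0 0 - 1‖ ≤ K * (1 / ‖ζ‖ ^ 2) ∧
      ‖ζ * Φ ζ 1 0 - I / 2 * conj (dx u 0 t) * Φ ζ 0 0‖ ≤ K := by
  set w : ℝ → ℂ := fun s => dx u 0 s with hw
  set w₁ : ℝ → ℂ := fun s => dt (dx u) 0 s with hw₁
  set w₂ : ℝ → ℂ := fun s => dt (dt (dx u)) 0 s with hw₂
  set v : ℝ → ℂ := fun s => u 0 s with hv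
  set v₁ : ℝ → ℂ := fun s => dt u 0 s with hv₁
  have s1 := contDiff_dt h.smooth_dx
  have s2 := contDiff_dt s1.1
  have s3 := contDiff_dt h.reg.smooth
  have d1 : ∀ y, HasDerivAt w (w₁ y) y := fun y => s1.2 0 y
  have d2 : ∀ y, HasDerivAt w₁ (w₂ y) y := fun y => s2.2 0 y
  have d3 : ∀ y, HasDerivAt v (v₁ y) y := fun y => s3.2 0 y
  have slice : ∀ {g : ℝ → ℝ → ℂ}, ContDiff ℝ ∞ (fun p : ℝ × ℝ => g p.1 p.2) →
      Continuous (fun s => g 0 s) := fun hg =>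
    hg.continuous.comp (f := fun s : ℝ => ((0 : ℝ), s)) (by fun_prop)
  have cw : Continuous w := slice h.smooth_dx
  have cw₁ : Continuous w₁ := slice s1.1
  have cw₂ : Continuous w₂ := slice s2.1
  have cv : Continuous v := slice h.reg.smooth
  have cv₁ : Continuous v₁ := slice s3.1
  obtain ⟨R, hR⟩ : ∃ R : ℝ → ℂ, R = fun s => conj (w s) - 1 / 4 * (v s * conj (v s) * conj (w s)) -
    I / 2 * (conj (v s) + conj (w₁ s)) := ⟨_, rfl⟩
  obtain ⟨R₁, hR₁⟩ : ∃ R₁ : ℝ → ℂ, R₁ = fun s => conj (w₁ s) -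
    1 / 4 * ((v₁ s * conj (v s) + v s * conj (v₁ s)) * conj (w s) +
      v s * conj (v s) * conj (w₁ s)) - I / 2 * (conj (v₁ s) + conj (w₂ s)) := ⟨_, rfl⟩
  have dR : ∀ s, HasDerivAt R (R₁ s) s := fun s => by
    rw [hR, hR₁]
    exact ((d1 s).conj_comp.sub ((((d3 s).mul (d3 s).conj_comp).mul
      (d1 s).conj_comp).const_mul (1 / 4))).sub
        (((d3 s).conj_comp.add (d2 s).conj_comp).const_mul (I / 2))
  have cR : Continuous R := by rw [hR]; fun_prop
  have cR₁ : Continuous R₁ := by rw [hR₁]; fun_prop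
  obtain ⟨B, hB1, hB⟩ := exists_bound_Icc (ι := Fin 5)
    (f := ![w, w₁, R, R₁, v]) (by intro i; fin_cases i <;> assumption) t
  set M := B + B ^ 2 + B ^ 3 with hM
  have hB2 : 0 ≤ B ^ 2 := by positivity
  have hB3 : 0 ≤ B ^ 3 := by positivity
  set K := (5 * M ^ 3 + 5 * M ^ 2) * Real.exp ((8 * M + 2) * t / 2) + M ^ 2 with hK
  have hM0 : 0 ≤ M := by positivity
  have hK0 : 0 ≤ K := by positivity
  refine ⟨2 * K + M, fun ζ hζ h2 => ?_⟩
  have h0 : ζ ≠ 0 := norm_pos_iff.1 (by linarith)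
  obtain ⟨b1, b2⟩ := norm_eta_sq_bounds h2
  have h4 : 4 ≤ ‖ζ‖ ^ 2 := by nlinarith
  have hκ1 : 1 ≤ ‖eta ζ ^ 2‖ := by linarith
  obtain ⟨y, hy, hy0⟩ := hΦ.exists_sol ζ h0 ![1, 0]
  have e := hΦ.map ζ h0 y hy
  rw [hy0] at e
  have e0 : Φ ζ 0 0 = y t 0 := by rw [e, mulVec_zero_apply]; simp
  have e1 : Φ ζ 1 0 = y t 1 := by rw [e, mulVec_one_apply]; simp
  rw [e0, e1]
  have hMB : ∀ i s, s ∈ Icc 0 t → ‖(![w, w₁, R, R₁, v] : Fin 5 → ℝ → ℂ) i s‖ ≤ M :=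
    fun i s hs => (hB i s hs).trans (by rw [hM]; linarith)
  have c0 := continuousOn_pi.1 hy.cont 0
  have c1 := continuousOn_pi.1 hy.cont 1
  obtain ⟨g, hg⟩ : ∃ g : ℂ, g = 1 / (2 * ζ ^ 2) := ⟨_, rfl⟩
  have hgζ : 2 * ζ ^ 2 * g = 1 := by rw [hg]; field_simp
  have hgn : ‖g‖ ≤ 1 / ‖eta ζ ^ 2‖ := by
    rw [hg]; simp only [norm_div, norm_one, norm_mul, norm_pow ζ]
    exact one_div_le_one_div_of_le (by linarith) (by simpa using b2)
  have hzg : 1 / (2 * ζ) = ζ * g := by rw [hg]; field_simp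
  have hη : eta ζ ^ 2 = ζ ^ 2 - 1 + g / 2 := by rw [eta_sq h0, hg]; field_simp; ring
  have hWV : ∀ s ∈ Icc 0 t, w s * conj (w s) = v s * conj (v s) := fun s hs => by
    rw [conj_mul_eq_norm_sq, conj_mul_eq_norm_sq, h.norm_bdry (mem_of_le ht hs.1 hs.2)]
  have nv : ∀ s ∈ Icc 0 t, ‖v s‖ ≤ B := hB 4
  have nw : ∀ s ∈ Icc 0 t, ‖conj (w s)‖ ≤ B := fun s hs => by
    rw [RCLike.norm_conj]; exact hB 0 s hs
  have bI : ‖I‖ ≤ 1 := by simp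
  have b12 : ‖(1 / 2 : ℂ)‖ ≤ 1 := by norm_num
  have b14 : ‖I / 4‖ ≤ 1 := by simp; norm_num
  have hMk : ∀ A : ℝ, A ≤ M → ∀ z : ℂ, ‖z‖ ≤ A → ‖z * g‖ ≤ M * (1 / ‖eta ζ ^ 2‖) := fun A hA z hz =>
    norm_mul_le_of_le (hz.trans hA) hgn
  have hsys : IsLargeSystem t M (eta ζ ^ 2) (fun s => y s 0)
      (fun s => ζ * y s 1 - I / 2 * conj (w s) * y s 0) w w₁ R R₁ (fun _ => 1) (fun _ => 1)
      (fun s => I * v s * g) (fun s => -(1 / 2 * (v s * conj (w s))) * g)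
      (fun s => 1 / 2 * (v s * conj (w s)) * g)
      (fun s => (-(1 / 2 * conj (w s)) + I / 4 * (v s * (conj (w s) * conj (w s)))) * g)
      (fun _ => 0) := by
    refine ⟨c0, by fun_prop, fun s hs => ?_, fun s hs => ?_, d1, dR, fun s => ?_, fun s => ?_,
      rfl, rfl, fun s => by simp, fun s => by simp,
      hMB 0, hMB 1, hMB 2, hMB 3, fun s _ => by simpa using hM0, fun s hs => ?_, fun s hs => ?_,
      fun s hs => ?_, fun s hs => ?_, ?_, ?_⟩
    · refine (hasDerivAt_fin_two.1 (hy.deriv s hs)).1.congr_deriv ?_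
      have k := hWV s (Ioo_subset_Icc_self hs)
      rw [mulVec_zero_apply]
      simp only [timeFamily, Matrix.of_apply, Matrix.cons_val', Matrix.cons_val_zero,
        Matrix.cons_val_one, Matrix.cons_val_fin_one, hzg]
      linear_combination I / 2 * y s 0 * k + v s * conj (w s) * y s 0 * g / 2 * I_sq
    · obtain ⟨q0, q1⟩ := hasDerivAt_fin_two.1 (hy.deriv s hs)
      refine ((q1.const_mul ζ).sub (((d1 s).conj_comp.const_mul (I / 2)).mul q0)).congr_deriv ?_
      have k := hWV s (Ioo_subset_Icc_self hs)
      rw [mulVec_zero_apply, mulVec_one_apply, hR]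
      simp only [timeFamily, Matrix.of_apply, Matrix.cons_val', Matrix.cons_val_zero,
        Matrix.cons_val_one, Matrix.cons_val_fin_one, hzg, hη]
      linear_combination -(1 / 2) * I * ζ * y s 1 * k - 1 / 2 * I * conj (v s) * y s 0 * hgζ +
        conj (w s) * (-(1 / 2) * ζ * g * v s * y s 1 + ζ ^ 2 * y s 0 +
          1 / 4 * conj (v s) * v s * y s 0 + 1 / 2 * g * y s 0 - y s 0) * I_sq
    · simpa using hasDerivAt_const s (1 : ℂ)
    · simpa using hasDerivAt_const s (1 : ℂ)
    · exact hMk B (by linarith) _ ((norm_mul_le_of_le bI (nv s hs)).trans (by simp))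
    · refine hMk (B ^ 2) (by linarith) _ ?_
      rw [norm_neg]
      exact (norm_mul_le_of_le b12 (norm_mul_le_of_le (nv s hs) (nw s hs))).trans
        (le_of_eq (by ring))
    · refine hMk (B ^ 2) (by linarith) _ ?_
      exact (norm_mul_le_of_le b12 (norm_mul_le_of_le (nv s hs) (nw s hs))).trans
        (le_of_eq (by ring))
    · refine hMk (B + B ^ 3) (by linarith) _ ?_
      refine (norm_add_le_of_le ((norm_neg _).trans_le (norm_mul_le_of_le b12 (nw s hs)))
        (norm_mul_le_of_le b14 (norm_mul_le_of_le (nv s hs)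
          (norm_mul_le_of_le (nw s hs) (nw s hs))))).trans (le_of_eq (by ring))
    · rw [hy0]; simp; linarith
    · rw [hy0]
      have := hB 0 0 ⟨le_rfl, ht.1⟩
      simp at this ⊢
      linarith
  obtain ⟨r1, r2⟩ := hsys.asymptotics ht.1 hκ1 (im_eta_sq_nonneg hζ (by linarith))
  rw [← hK] at r1 r2
  have hk : 1 / ‖eta ζ ^ 2‖ ≤ 2 * (1 / ‖ζ‖ ^ 2) := by
    rw [← div_eq_mul_one_div, div_le_div_iff₀ (by linarith) (by linarith)]; linarith
  simp only [hy0] at r1 r2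
  have hz2 : 0 ≤ 1 / ‖ζ‖ ^ 2 := by positivity
  constructor
  · have : ‖y t 0 - 1‖ ≤ K * (1 / ‖eta ζ ^ 2‖) := by simpa using r1
    refine this.trans ((mul_le_mul_of_nonneg_left hk hK0).trans ?_)
    have := mul_nonneg hM0 hz2
    linarith
  · have hexp : ‖exp (2 * I * eta ζ ^ 2 * t)‖ ≤ 1 := by
      have := mul_nonneg (im_eta_sq_nonneg hζ (by linarith : 1 ≤ ‖ζ‖)) ht.1
      have e : (2 * I * eta ζ ^ 2 * t).re = -(2 * ((eta ζ ^ 2).im * t)) := by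
        rw [re_mul_ofReal, mul_assoc, mul_re, mul_im]; simp; ring
      rw [norm_exp, Real.exp_le_one_iff, e]
      linarith
    have hH : ‖ζ * (![1, 0] : Fin 2 → ℂ) 1 - I / 2 * conj (w 0) * (![1, 0] : Fin 2 → ℂ) 0‖ ≤ M := by
      have := hsys.boundH
      simpa only [hy0] using this
    refine (norm_le_norm_add_norm_sub' _ _).trans ((add_le_add ?_ r2).trans
      (show M + K * (1 / ‖eta ζ ^ 2‖) ≤ _ from ?_))
    · rw [mul_one, norm_mul]
      exact (mul_le_mul hexp hH (norm_nonneg _) zero_le_one).trans (by simp)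
    · have : 1 / ‖eta ζ ^ 2‖ ≤ 1 := (div_le_one (by linarith)).2 hκ1
      have := mul_le_mul_of_nonneg_left this hK0
      linarith

end IsHalfLineSolution

/-! ### The zeros and poles of `n` -/

/-- The numerator of `nFun`. -/
noncomputable def nNum (α : ℝ) (ζ : ℂ) : ℂ := exp (I * α) + 2 * I * ζ ^ 2

/-- The denominator of `nFun`. -/
noncomputable def nDen (α : ℝ) (ζ : ℂ) : ℂ := I + 2 * exp (I * α) * ζ ^ 2

lemma exp_mul_conj (α : ℝ) : exp (I * α) * conj (exp (I * α)) = 1 := by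
  rw [conj_mul_eq_norm_sq, norm_exp_I_mul_real]; simp

lemma zerosPoles_sq {α : ℝ} {p : ℂ} (hp : p ∈ zerosPoles α) :
    p ^ 2 = I / 2 * exp (I * α) ∨ p ^ 2 = -(I / 2) * conj (exp (I * α)) := by
  rcases hp.2 with h | h
  · left; linear_combination -I / 2 * h + p ^ 2 * I_sq
  · right; linear_combination conj (exp (I * α)) / 2 * h - p ^ 2 * exp_mul_conj α

lemma finite_zerosPoles (α : ℝ) : (zerosPoles α).Finite := by
  have key : ∀ c : ℂ, {p : ℂ | p ^ 2 = c}.Finite := fun c => by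
    by_cases h : ∃ q : ℂ, q ^ 2 = c
    · obtain ⟨q, rfl⟩ := h
      refine (Set.toFinite {q, -q}).subset fun p hp => ?_
      exact sq_eq_sq_iff_eq_or_eq_neg.1 hp
    · exact Set.finite_empty.subset fun p hp => (h ⟨p, hp⟩).elim
  exact ((key _).union (key _)).subset fun p hp => zerosPoles_sq hp

lemma norm_of_mem_zerosPoles {α : ℝ} {p : ℂ} (hp : p ∈ zerosPoles α) : ‖p‖ = 1 / √2 := by
  have h : ‖p‖ ^ 2 = 1 / 2 := by
    rw [← norm_pow]
    rcases zerosPoles_sq hp with h | h <;> rw [h, norm_mul]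
    · rw [norm_exp_I_mul_real]; simp
    · rw [RCLike.norm_conj, norm_exp_I_mul_real]; simp
  have h2 : (1 / √2) ^ 2 = 1 / 2 := by rw [div_pow, Real.sq_sqrt (by norm_num)]; norm_num
  exact (pow_left_inj₀ (norm_nonneg _) (by positivity) two_ne_zero).1 (h.trans h2.symm)

lemma zerosPoles_off_axes {α : ℝ} {p : ℂ} (hp : p ∈ zerosPoles α) : p.re * p.im ≠ 0 := by
  intro h0
  have him : (p ^ 2).im = 0 := by rw [pow_two, mul_im]; linarith
  have he : exp (I * α) = Real.cos α + Real.sin α * I := by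
    rw [mul_comm, exp_mul_I]; push_cast; rfl
  apply hp.1
  rcases zerosPoles_sq hp with h | h
  · rw [h, he] at him; simpa [cos_ofReal_re] using him
  · rw [h, he] at him; simpa [cos_ofReal_re] using him

lemma conj_mem_zerosPoles {α : ℝ} {p : ℂ} (hp : p ∈ zerosPoles α) : conj p ∈ zerosPoles α := by
  refine ⟨hp.1, ?_⟩
  have he := exp_mul_conj α
  rcases hp.2 with h | h
  · right
    have := congr_arg conj h
    simp only [map_add, map_mul, map_pow, conj_I, map_zero, map_ofNat] at this
    linear_combination I * exp (I * α) * this - I * he + 2 * exp (I * α) * conj p ^ 2 * I_sq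
  · left
    have := congr_arg conj h
    simp only [map_add, map_mul, map_pow, conj_I, map_zero, map_ofNat] at this
    linear_combination I * exp (I * α) * this + exp (I * α) * I_sq - 2 * I * conj p ^ 2 * he

lemma nDen_ne_zero {α : ℝ} {ζ : ℂ} (h : ζ ∉ zerosPoles α) :
    Real.cos α = 0 ∨ nDen α ζ ≠ 0 := by
  by_contra hc
  rw [not_or, not_not] at hc
  exact h ⟨hc.1, Or.inr hc.2⟩

lemma differentiableAt_nFun {α : ℝ} {ζ : ℂ} (h : Real.cos α = 0 ∨ nDen α ζ ≠ 0) :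
    DifferentiableAt ℂ (nFun α) ζ := by
  by_cases hc : Real.cos α = 0
  · have : nFun α = fun _ => (Real.sin α : ℂ) := by ext; simp [nFun, hc]
    rw [this]; exact differentiableAt_const _
  · have : nFun α = fun ζ => (exp (I * α) + 2 * I * ζ ^ 2) / (I + 2 * exp (I * α) * ζ ^ 2) := by
      ext; simp [nFun, hc]
    rw [this]
    exact DifferentiableAt.div (by fun_prop) (by fun_prop) (h.resolve_left hc)

/-! ### Reflected functions -/

lemma refl_eq_conj (ζ : ℂ) : refl ζ = conj (1 / (2 * ζ)) := by simp [refl, map_ofNat]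

/-- The two conjugations cancel: the function is `conj ∘ f ∘ conj` composed with the holomorphic map
`ζ ↦ 1/(2ζ)`. -/
lemma differentiableAt_conj_refl {f : ℂ → ℂ} (hf : DifferentiableOn ℂ f openQuadrants) {ζ : ℂ}
    (hζ : ζ ∈ openQuadrants) : DifferentiableAt ℂ (fun ζ => conj (f (refl ζ))) ζ := by
  have h0 : ζ ≠ 0 := by rintro rfl; simp [openQuadrants] at hζ
  have h1 : DifferentiableAt ℂ f (refl ζ) :=
    hf.differentiableAt (isOpen_openQuadrants.mem_nhds (refl_mem_openQuadrants hζ))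
  have h2 : DifferentiableAt ℂ (conj ∘ f ∘ conj) (1 / (2 * ζ)) := by
    have := h1.conj_conj
    rwa [refl_eq_conj, Complex.conj_conj] at this
  have h3 : DifferentiableAt ℂ (fun ζ : ℂ => 1 / (2 * ζ)) ζ :=
    DifferentiableAt.div (by fun_prop) (by fun_prop) (by simpa using h0)
  have h4 := h2.comp ζ h3
  refine h4.congr_of_eventuallyEq (Eventually.of_forall fun ζ => ?_)
  simp only [Function.comp_apply, refl_eq_conj]

lemma differentiableAt_calD {α : ℝ} {a b : ℂ → ℂ} (ha : DifferentiableOn ℂ a openQuadrants)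
    (hb : DifferentiableOn ℂ b openQuadrants) {ζ : ℂ} (hζ : ζ ∈ openQuadrants)
    (h : Real.cos α = 0 ∨ nDen α ζ ≠ 0) : DifferentiableAt ℂ (calD α a b) ζ := by
  have hn := isOpen_openQuadrants.mem_nhds hζ
  exact ((ha.differentiableAt hn).mul (differentiableAt_conj_refl ha hζ)).sub
    (((hb.differentiableAt hn).mul (differentiableAt_conj_refl hb hζ)).mul
      (differentiableAt_nFun h))

/-! ### Admissible radii -/

/-- Radii of discs around the zeros and poles of `n` for which the deformation is harmless. -/
structure IsAdmissible (α ε : ℝ) (a b : ℂ → ℂ) : Prop where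
  pos : 0 < ε
  off_axes : ∀ p ∈ zerosPoles α, ∀ ζ, dist ζ p ≤ ε → ζ.re * ζ.im ≠ 0
  a_ne : ∀ p ∈ zerosPoles α, ∀ ζ, dist ζ p ≤ ε → ζ ∈ openQuadrants → a ζ ≠ 0
  d_ne : ∀ p ∈ zerosPoles α, ∀ ζ, dist ζ p ≤ ε → ζ ∈ openQuadrants → ζ ∉ zerosPoles α →
    calD α a b ζ ≠ 0

/-- Multiplied by the denominator of `n`, `𝒟` becomes holomorphic at `p`. If the product vanished
identically near `p`, then `𝒟` would vanish at nearby points of the circle outside `P`, against the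
assumption. So its zeros are isolated at `p`, although nothing is known at `p` itself. -/
lemma eventually_calD_ne_zero {α : ℝ} {a b : ℂ → ℂ} (ha : DifferentiableOn ℂ a openQuadrants)
    (hb : DifferentiableOn ℂ b openQuadrants)
    (hD : ∀ ζ ∈ contour, ζ ≠ 0 → ζ ∉ zerosPoles α → calD α a b ζ ≠ 0) {p : ℂ}
    (hp : p ∈ zerosPoles α) (hpQ : p ∈ openQuadrants) :
    ∀ᶠ ζ in 𝓝 p, ζ ∉ zerosPoles α → calD α a b ζ ≠ 0 := by
  have hc := hp.1
  set g : ℂ → ℂ := fun ζ => a ζ * conj (a (refl ζ)) * nDen α ζ -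
    b ζ * conj (b (refl ζ)) * nNum α ζ with hg
  have hgD : ∀ ζ ∉ zerosPoles α, g ζ = calD α a b ζ * nDen α ζ := by
    intro ζ hζ
    have h1 := (nDen_ne_zero hζ).resolve_left hc
    have h2 : nFun α ζ * nDen α ζ = nNum α ζ := by
      rw [nFun, if_neg hc]; exact div_mul_cancel₀ _ h1
    simp only [hg, calD]
    linear_combination b ζ * conj (b (refl ζ)) * h2
  have hdiff : DifferentiableOn ℂ g openQuadrants := fun ζ hζ => by
    have hn := isOpen_openQuadrants.mem_nhds hζ
    refine DifferentiableAt.differentiableWithinAt ?_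
    refine (((ha.differentiableAt hn).mul (differentiableAt_conj_refl ha hζ)).mul ?_).sub
      (((hb.differentiableAt hn).mul (differentiableAt_conj_refl hb hζ)).mul ?_)
    · unfold nDen; fun_prop
    · unfold nNum; fun_prop
  have han : AnalyticAt ℂ g p := hdiff.analyticAt (isOpen_openQuadrants.mem_nhds hpQ)
  have hfin : ∀ᶠ ζ in 𝓝[≠] p, ζ ∉ zerosPoles α := by
    have : (zerosPoles α \ {p})ᶜ ∈ 𝓝 p :=
      ((finite_zerosPoles α).subset sdiff_subset).isClosed.isOpen_compl.mem_nhds (by simp)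
    filter_upwards [mem_nhdsWithin_of_mem_nhds this, self_mem_nhdsWithin] with ζ h1 h2 h3
    exact h1 ⟨h3, h2⟩
  rcases han.eventually_eq_zero_or_eventually_ne_zero with h0 | h0
  · exfalso
    have hcirc : Tendsto (fun θ : ℝ => p * exp (I * θ)) (𝓝[≠] 0) (𝓝[≠] p) := by
      have hd : HasDerivAt (fun θ : ℝ => p * exp (I * θ)) (p * (exp (I * (0 : ℝ)) * I)) 0 :=
        (hasDerivAt_exp_mul I 0).const_mul p
      have := hd.tendsto_nhdsNE (by
        have : p ≠ 0 := by rintro rfl; simp [openQuadrants] at hpQ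
        simpa [I_ne_zero] using this)
      simpa using this
    have e1 := hcirc.eventually hfin
    have e2 := hcirc.eventually (mem_nhdsWithin_of_mem_nhds (isOpen_openQuadrants.mem_nhds hpQ))
    have e3 := hcirc.eventually (mem_nhdsWithin_of_mem_nhds h0)
    obtain ⟨θ, h1, h2, h3⟩ := (e1.and (e2.and e3)).exists
    have h2' : 0 < (p * exp (I * θ)).re * (p * exp (I * θ)).im := h2
    refine mul_ne_zero (hD _ ⟨h2'.le, Or.inr ?_⟩ ?_ h1) ((nDen_ne_zero h1).resolve_left hc)
      ((hgD _ h1).symm.trans h3)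
    · rw [norm_mul, norm_exp_I_mul_real, mul_one, norm_of_mem_zerosPoles hp]
    · intro h; rw [h] at h2'; simp at h2'
  · rw [eventually_nhdsWithin_iff] at h0
    filter_upwards [h0] with ζ h1 h2 h3
    exact h1 (fun h => h2 (h ▸ hp)) (by rw [hgD ζ h2, h3, zero_mul])

/-- `P` is finite, so local conditions at its points suffice: they lie off the axes, `a` does not
vanish there and is continuous, and the zeros of `𝒟` cannot accumulate there. -/
theorem exists_admissible {α : ℝ} {a b : ℂ → ℂ} (ha : DifferentiableOn ℂ a openQuadrants)
    (hb : DifferentiableOn ℂ b openQuadrants) (hA : ∀ ζ ∈ contour, a ζ ≠ 0)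
    (hD : ∀ ζ ∈ contour, ζ ≠ 0 → ζ ∉ zerosPoles α → calD α a b ζ ≠ 0) :
    ∃ ε₀ > 0, ∀ ε, 0 < ε → ε < ε₀ → IsAdmissible α ε a b := by
  have key : ∀ p ∈ zerosPoles α, ∀ᶠ ε in 𝓝[>] (0 : ℝ), ∀ ζ, dist ζ p ≤ ε →
      ζ.re * ζ.im ≠ 0 ∧ (ζ ∈ openQuadrants → a ζ ≠ 0 ∧
        (ζ ∉ zerosPoles α → calD α a b ζ ≠ 0)) := by
    intro p hp
    have hev : ∀ᶠ ζ in 𝓝 p, ζ.re * ζ.im ≠ 0 ∧ (ζ ∈ openQuadrants → a ζ ≠ 0 ∧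
        (ζ ∉ zerosPoles α → calD α a b ζ ≠ 0)) := by
      have h1 : ∀ᶠ ζ in 𝓝 p, ζ.re * ζ.im ≠ 0 :=
        (continuous_re.mul continuous_im).continuousAt.eventually_ne (zerosPoles_off_axes hp)
      by_cases hpQ : p ∈ openQuadrants
      · have hn := isOpen_openQuadrants.mem_nhds hpQ
        have h2 : a p ≠ 0 := hA p ⟨openQuadrants_subset hpQ, Or.inr (norm_of_mem_zerosPoles hp)⟩
        filter_upwards [h1, (ha.differentiableAt hn).continuousAt.eventually_ne h2,
          eventually_calD_ne_zero ha hb hD hp hpQ] with ζ k1 k2 k3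
        exact ⟨k1, fun _ => ⟨k2, k3⟩⟩
      · have h2 : p ∉ closedQuadrants := fun h => hpQ
          (lt_of_le_of_ne h (Ne.symm (zerosPoles_off_axes hp)))
        filter_upwards [h1, isClosed_closedQuadrants.isOpen_compl.mem_nhds h2] with ζ k1 k2
        exact ⟨k1, fun h => (k2 (openQuadrants_subset h)).elim⟩
    obtain ⟨δ, hδ, hb⟩ := Metric.nhds_basis_closedBall.eventually_iff.1 hev
    filter_upwards [Ioc_mem_nhdsGT hδ] with ε hε ζ hζ
    exact hb (Metric.mem_closedBall.2 (hζ.trans hε.2))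
  have := (finite_zerosPoles α).eventually_all.2 key
  obtain ⟨ε₀, h0, hε⟩ := (mem_nhdsGT_iff_exists_Ioo_subset).1 this
  refine ⟨ε₀, h0, fun ε h1 h2 => ?_⟩
  have hε' := hε ⟨h1, h2⟩
  exact ⟨h1, fun p hp ζ hζ => (hε' p hp ζ hζ).1, fun p hp ζ hζ hQ => ((hε' p hp ζ hζ).2 hQ).1,
    fun p hp ζ hζ hQ hP => ((hε' p hp ζ hζ).2 hQ).2 hP⟩

/-! ### Closures of the regions -/

lemma conj_mem_region {α ε : ℝ} {ζ : ℂ} :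
    (ζ ∈ region α ε 2 ↔ conj ζ ∈ region α ε 1) ∧ (ζ ∈ region α ε 3 ↔ conj ζ ∈ region α ε 0) := by
  have hd : ∀ p, dist (conj ζ) p = dist ζ (conj p) := fun p => by
    rw [← dist_conj_conj, Complex.conj_conj]
  have e : (conj ζ).re * (conj ζ).im = -(ζ.re * ζ.im) := by simp
  simp only [region, mem_ofPred_eq, e, RCLike.norm_conj, hd, neg_pos]
  refine ⟨and_congr_right' (and_congr_right' ⟨fun h p hp => h _ (conj_mem_zerosPoles hp),
    fun h p hp => ?_⟩), and_congr_right' (or_congr_right ⟨?_, ?_⟩)⟩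
  · simpa using h _ (conj_mem_zerosPoles hp)
  · rintro ⟨p, hp, h⟩
    exact ⟨conj p, conj_mem_zerosPoles hp, by simpa using h⟩
  · rintro ⟨p, hp, h⟩
    exact ⟨conj p, conj_mem_zerosPoles hp, h⟩

lemma isOpen_region_zero (α ε : ℝ) : IsOpen (region α ε 0) := by
  have h1 : IsOpen {ζ : ℂ | 1 / √2 < ‖ζ‖} := isOpen_lt continuous_const continuous_norm
  have h2 : IsOpen (⋃ p ∈ zerosPoles α, Metric.ball p ε) :=
    isOpen_biUnion fun p _ => Metric.isOpen_ball
  convert isOpen_openQuadrants.inter (h1.union h2) using 1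
  ext ζ
  simp [region, openQuadrants]

lemma isOpen_region_one (α ε : ℝ) : IsOpen (region α ε 1) := by
  have h1 : IsOpen {ζ : ℂ | ‖ζ‖ < 1 / √2} := isOpen_lt continuous_norm continuous_const
  have h2 : IsOpen (⋂ p ∈ zerosPoles α, {ζ : ℂ | ε < dist ζ p}) :=
    (finite_zerosPoles α).isOpen_biInter fun p _ =>
      isOpen_lt continuous_const (continuous_id.dist continuous_const)
  convert isOpen_openQuadrants.inter (h1.inter h2) using 1
  ext ζ
  simp [region, openQuadrants]

lemma closure_region_zero {α ε : ℝ} {ζ : ℂ} (h : ζ ∈ closure (region α ε 0)) :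
    ζ ∈ closedQuadrants ∧ (1 / √2 ≤ ‖ζ‖ ∨ ∃ p ∈ zerosPoles α, dist ζ p ≤ ε) := by
  have h1 : IsClosed {ζ : ℂ | 1 / √2 ≤ ‖ζ‖} := isClosed_le continuous_const continuous_norm
  have h2 : IsClosed (⋃ p ∈ zerosPoles α, Metric.closedBall p ε) :=
    (finite_zerosPoles α).isClosed_biUnion fun p _ => Metric.isClosed_closedBall
  have := closure_minimal (s := region α ε 0) (t := closedQuadrants ∩ ({ζ : ℂ | 1 / √2 ≤ ‖ζ‖} ∪
    ⋃ p ∈ zerosPoles α, Metric.closedBall p ε)) ?_ (isClosed_closedQuadrants.inter (h1.union h2)) h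
  · simpa using this
  · rintro ζ ⟨k1, k2⟩
    refine ⟨k1.le, k2.imp (fun h => h.le) ?_⟩
    rintro ⟨p, hp, h⟩
    exact mem_biUnion hp (Metric.mem_closedBall.2 h.le)

lemma closure_region_one {α ε : ℝ} {ζ : ℂ} (h : ζ ∈ closure (region α ε 1)) :
    ζ ∈ closedQuadrants ∧ ‖ζ‖ ≤ 1 / √2 ∧ ∀ p ∈ zerosPoles α, ε ≤ dist ζ p := by
  have h1 : IsClosed {ζ : ℂ | ‖ζ‖ ≤ 1 / √2} := isClosed_le continuous_norm continuous_const
  have h2 : IsClosed (⋂ p ∈ zerosPoles α, {ζ : ℂ | ε ≤ dist ζ p}) :=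
    isClosed_biInter fun p _ => isClosed_le continuous_const (continuous_id.dist continuous_const)
  have := closure_minimal (s := region α ε 1) (t := closedQuadrants ∩ ({ζ : ℂ | ‖ζ‖ ≤ 1 / √2} ∩
    ⋂ p ∈ zerosPoles α, {ζ : ℂ | ε ≤ dist ζ p})) ?_ (isClosed_closedQuadrants.inter (h1.inter h2)) h
  · simpa using this
  · rintro ζ ⟨k1, k2, k3⟩
    exact ⟨k1.le, k2.le, mem_iInter₂.2 fun p hp => (k3 p hp).le⟩

lemma conj_mem_closure {S S' : Set ℂ} (h : ∀ ζ, ζ ∈ S ↔ conj ζ ∈ S') (ζ : ℂ) :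
    ζ ∈ closure S ↔ conj ζ ∈ closure S' := by
  have e : S = conjCLE.toHomeomorph ⁻¹' S' := by
    ext ζ; exact h ζ
  rw [e, ← Homeomorph.preimage_closure]
  rfl

lemma conj_mem_closure_region {α ε : ℝ} {ζ : ℂ} :
    (ζ ∈ closure (region α ε 2) ↔ conj ζ ∈ closure (region α ε 1)) ∧
      (ζ ∈ closure (region α ε 3) ↔ conj ζ ∈ closure (region α ε 0)) :=
  ⟨conj_mem_closure (fun _ => conj_mem_region.1) ζ, conj_mem_closure (fun _ => conj_mem_region.2) ζ⟩

/-! ### Transport from the origin to the point `(x, t)` -/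

/-- `U` transports initial values of the Lax pair from `(0, 0)` to `(x, t)`, and `V` is the first
column at `(x, t)` which satisfies the boundary condition. -/
structure IsTransport (α : ℝ) (u : ℝ → ℝ → ℂ) (x t : ℝ) (U : ℂ → Matrix (Fin 2) (Fin 2) ℂ)
    (V : ℂ → Fin 2 → ℂ) : Prop where
  map_column : ∀ ζ ∈ closedQuadrants, ζ ≠ 0 →
    U ζ *ᵥ column u 0 0 ζ = exp (2 * I * theta x t ζ) • column u x t ζ
  symm : ∀ ζ, ζ ≠ 0 → ∀ (c : Fin 2 → ℂ) (i : Fin 2), conj ((U (conj ζ) *ᵥ c) (1 - i)) =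
    exp (-(2 * I * theta x t ζ)) * (U ζ *ᵥ ![conj (c 1), conj (c 0)]) i
  map_boundary : ∀ ζ ∈ closedQuadrants, ζ ≠ 0 → Real.cos α = 0 ∨ nDen α ζ ≠ 0 →
    V ζ = U ζ *ᵥ boundaryColumn α u 0 ζ
  diff : ∀ i j, DifferentiableOn ℂ (fun ζ => U ζ i j) {0}ᶜ
  V_zero : V 0 = ![1, 0]
  V_tendsto : Tendsto V (𝓝[closedQuadrants \ {0}] 0) (𝓝 ![1, 0])
  asymptotics : ∃ K R, ∀ ζ ∈ closedQuadrants, R ≤ ‖ζ‖ →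
    ‖U ζ 0 0 - exp (I * phase (fun y => dx u y t) x)‖ ≤ K * (1 / ‖ζ‖ ^ 2) ∧
    ‖ζ * U ζ 1 0 - I / 2 * conj (dx u x t) * U ζ 0 0‖ ≤
      K * ‖exp (2 * I * ζ ^ 2 * x)‖ + K * (1 / ‖ζ‖ ^ 2)

lemma conj_mul_exp (z : ℂ) : exp z * exp (-z) = 1 := by rw [← exp_add, add_neg_cancel, exp_zero]

lemma nDen_zero (α : ℝ) : nDen α 0 ≠ 0 := by simp [nDen]

lemma inv_norm_refl {ζ : ℂ} (h0 : ζ ≠ 0) : 1 / ‖refl ζ‖ ^ 2 = 4 * ‖ζ‖ ^ 2 := by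
  rw [norm_refl]; have : ‖ζ‖ ≠ 0 := norm_ne_zero_iff.2 h0
  field_simp; norm_num

namespace IsHalfLineSolution

variable {α : ℝ} {T : EReal} {u : ℝ → ℝ → ℂ}

/-- The behaviour of the boundary column at the origin. -/
lemma tendsto_boundaryColumn (h : IsHalfLineSolution α T u) {t : ℝ} (ht : t ∈ timeInterval T) :
    Tendsto (boundaryColumn α u t) (𝓝[closedQuadrants \ {0}] 0) (𝓝 ![1, 0]) := by
  obtain ⟨K, hK⟩ := h.column_asymptotics ht
  have hsmall : ∀ᶠ ζ in 𝓝[closedQuadrants \ {0}] (0 : ℂ), ζ ∈ closedQuadrants ∧ ζ ≠ 0 ∧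
      1 ≤ ‖refl ζ‖ := by
    filter_upwards [self_mem_nhdsWithin, mem_nhdsWithin_of_mem_nhds (Metric.ball_mem_nhds (0 : ℂ)
      (show (0 : ℝ) < 1 / 2 by norm_num))] with ζ h1 h2
    refine ⟨h1.1, h1.2, ?_⟩
    have : 0 < ‖ζ‖ := norm_pos_iff.2 h1.2
    rw [mem_ball_zero_iff] at h2
    rw [norm_refl, le_div_iff₀ (by positivity)]; linarith
  have hn : Tendsto (fun ζ : ℂ => ‖ζ‖) (𝓝[closedQuadrants \ {0}] 0) (𝓝 0) :=
    (continuous_norm.tendsto' (0 : ℂ) 0 norm_zero).mono_left nhdsWithin_le_nhds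
  -- As `ζ → 0`, the reflected point goes to infinity, and the expansion of the column at infinity
  -- becomes one at the origin.
  have l1 : Tendsto (fun ζ => column u 0 t (refl ζ) 1) (𝓝[closedQuadrants \ {0}] 0) (𝓝 1) := by
    rw [tendsto_iff_norm_sub_tendsto_zero]
    have hb : Tendsto (fun ζ : ℂ => K * (4 * ‖ζ‖ ^ 2)) (𝓝[closedQuadrants \ {0}] 0) (𝓝 0) := by
      simpa using ((hn.pow 2).const_mul 4).const_mul K
    refine squeeze_zero' (Eventually.of_forall fun _ => norm_nonneg _) ?_ hb
    filter_upwards [hsmall] with ζ hζ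
    have := (hK _ (refl_mem_closedQuadrants hζ.1) hζ.2.2 0 le_rfl).1
    rw [phase_zero, ofReal_zero, mul_zero, exp_zero, div_eq_mul_one_div, inv_norm_refl hζ.2.1] at this
    exact this
  have l0 : Tendsto (fun ζ => column u 0 t (refl ζ) 0) (𝓝[closedQuadrants \ {0}] 0) (𝓝 0) := by
    have hb : Tendsto (fun ζ : ℂ => 2 * ‖ζ‖ * (K * (4 * ‖ζ‖ ^ 2) +
        ‖dx u 0 t‖ * ‖column u 0 t (refl ζ) 1‖)) (𝓝[closedQuadrants \ {0}] 0) (𝓝 0) := by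
      have := (hn.const_mul 2).mul ((((hn.pow 2).const_mul 4).const_mul K).add
        (l1.norm.const_mul ‖dx u 0 t‖))
      simpa using this
    refine squeeze_zero_norm' ?_ hb
    filter_upwards [hsmall] with ζ hζ
    have h2 := (hK _ (refl_mem_closedQuadrants hζ.1) hζ.2.2 0 le_rfl).2
    rw [div_eq_mul_one_div K, inv_norm_refl hζ.2.1] at h2
    have h3 : ‖refl ζ * column u 0 t (refl ζ) 0‖ ≤ K * (4 * ‖ζ‖ ^ 2) +
        ‖dx u 0 t‖ * ‖column u 0 t (refl ζ) 1‖ := by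
      have e : refl ζ * column u 0 t (refl ζ) 0 = (refl ζ * column u 0 t (refl ζ) 0 +
        I / 2 * dx u 0 t * column u 0 t (refl ζ) 1) -
        I / 2 * dx u 0 t * column u 0 t (refl ζ) 1 := by ring
      rw [e]
      refine (norm_sub_le _ _).trans (add_le_add h2 ?_)
      rw [norm_mul, norm_mul]
      have : ‖I / 2‖ = 1 / 2 := by simp
      rw [this]
      have := mul_nonneg (norm_nonneg (dx u 0 t)) (norm_nonneg (column u 0 t (refl ζ) 1))
      linarith
    rw [norm_mul, norm_refl] at h3
    have hp : 0 < ‖ζ‖ := norm_pos_iff.2 hζ.2.1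
    have e2 : ‖column u 0 t (refl ζ) 0‖ =
        2 * ‖ζ‖ * (1 / (2 * ‖ζ‖) * ‖column u 0 t (refl ζ) 0‖) := by field_simp
    rw [e2]
    exact mul_le_mul_of_nonneg_left h3 (by positivity)
  have ln : Tendsto (nFun α) (𝓝[closedQuadrants \ {0}] 0) (𝓝 (nFun α 0)) :=
    ((differentiableAt_nFun (Or.inr (nDen_zero α))).continuousAt.tendsto).mono_left
      nhdsWithin_le_nhds
  have c1 := (continuous_conj.tendsto _).comp l1
  have c0 := ln.mul ((continuous_conj.tendsto _).comp l0)
  rw [tendsto_pi_nhds]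
  intro i
  fin_cases i
  · simpa [boundaryColumn, Function.comp_def] using c1
  · simpa [boundaryColumn, Function.comp_def] using c0

/-- The path runs along `x = 0` up to time `t` and then in space. `V` is formed from the boundary
column at time `t` rather than as `U` times the one at time zero. The two agree off `ζ = 0`, but
only the first form has a visible limit at the origin: there the space transport `Ψ` is entire and
equal to the identity, whereas `Φ` is defined only off the origin. -/
theorem exists_transport (h : IsHalfLineSolution α T u) {x t : ℝ} (hx : 0 ≤ x)
    (ht : t ∈ timeInterval T) : ∃ U V, IsTransport α u x t U V := by
  have cw : Continuous fun s => dx u 0 s :=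
    h.smooth_dx.continuous.comp (f := fun s : ℝ => ((0 : ℝ), s)) (by fun_prop)
  have cv : Continuous fun s => u 0 s :=
    h.reg.smooth.continuous.comp (f := fun s : ℝ => ((0 : ℝ), s)) (by fun_prop)
  obtain ⟨Φ, hΦ⟩ := (isLaxFamily_time cw cv t).exists_transition ht.1
  obtain ⟨Ψ, hΨ⟩ := (isLaxFamily_space (continuous_slice h.smooth_dx t) x).exists_transition hx
  have hθ : ∀ ζ, 2 * I * theta x t ζ = 2 * I * ζ ^ 2 * x + 2 * I * eta ζ ^ 2 * t := fun ζ => by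
    rw [theta]; ring
  refine ⟨fun ζ => Ψ ζ * Φ ζ, fun ζ => if ζ = 0 then ![1, 0] else Ψ ζ *ᵥ boundaryColumn α u t ζ,
    fun ζ hζ h0 => ?_, fun ζ h0 c i => ?_, fun ζ hζ h0 hn => ?_, fun i j => ?_, if_pos rfl, ?_, ?_⟩
  · have e1 := hΦ.map ζ h0 _ (h.column_isSol_time ht hζ h0)
    have e2 := hΨ.map ζ (mem_univ _) _ (h.column_isSol_space ht hζ x)
    simp only [ofReal_zero, mul_zero, exp_zero, one_smul] at e1 e2
    rw [← Matrix.mulVec_mulVec, ← e1, Matrix.mulVec_smul, ← e2, smul_smul, hθ, exp_add, mul_comm]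
  · have e1 := hΦ.symm ζ h0 c
    have e2 := hΨ.symm ζ (mem_univ _) (Φ (conj ζ) *ᵥ c) i
    have a0 := e1 0
    have a1 := e1 1
    simp only [sub_zero, sub_self] at a0 a1
    have e3 : ![conj ((Φ (conj ζ) *ᵥ c) 1), conj ((Φ (conj ζ) *ᵥ c) 0)] =
        exp (-(2 * I * eta ζ ^ 2 * t)) • (Φ ζ *ᵥ ![conj (c 1), conj (c 0)]) := by
      ext i; fin_cases i
      · exact a0
      · exact a1
    rw [← Matrix.mulVec_mulVec, ← Matrix.mulVec_mulVec, e2, e3, Matrix.mulVec_smul, Pi.smul_apply,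
      smul_eq_mul, ← mul_assoc, ← exp_add, hθ]
    congr 2; ring
  · have e1 := hΦ.map ζ h0 _ (h.boundaryColumn_isSol ht hζ h0 hn)
    simp only [if_neg h0]
    rw [e1, Matrix.mulVec_mulVec]
  · simp only [Matrix.mul_apply, Fin.sum_univ_two]
    have k1 := fun i j => (hΨ.diff i j).mono (subset_univ ({0}ᶜ : Set ℂ))
    exact ((k1 _ _).mul (hΦ.diff _ _)).add ((k1 _ _).mul (hΦ.diff _ _))
  · have hΨ0 : ∀ c, Ψ 0 *ᵥ c = c := by
      intro c
      have := hΨ.map 0 (mem_univ _) (fun _ => c) ⟨continuousOn_const, fun s _ => by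
        have : spaceFamily (fun y => dx u y t) 0 s = 0 := by
          ext i j; fin_cases i <;> fin_cases j <;> simp [spaceFamily]
        rw [this, Matrix.zero_mulVec]; exact hasDerivAt_const _ _⟩
      exact this.symm
    have l1 := h.tendsto_boundaryColumn ht
    have l2 : ∀ i j, Tendsto (fun ζ => Ψ ζ i j) (𝓝[closedQuadrants \ {0}] 0) (𝓝 (Ψ 0 i j)) :=
      fun i j => (((hΨ.diff i j) 0 (mem_univ _)).differentiableAt
        univ_mem).continuousAt.tendsto.mono_left nhdsWithin_le_nhds
    have l3 := fun i => tendsto_pi_nhds.1 l1 i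
    have l4 : Tendsto (fun ζ => Ψ ζ *ᵥ boundaryColumn α u t ζ) (𝓝[closedQuadrants \ {0}] 0)
        (𝓝 ![1, 0]) := by
      rw [← hΨ0 ![1, 0], tendsto_pi_nhds]
      refine Fin.forall_fin_two.2 ⟨?_, ?_⟩
      · simp only [mulVec_zero_apply]
        exact ((l2 _ _).mul (l3 0)).add ((l2 _ _).mul (l3 1))
      · simp only [mulVec_one_apply]
        exact ((l2 _ _).mul (l3 0)).add ((l2 _ _).mul (l3 1))
    refine l4.congr' ?_
    filter_upwards [self_mem_nhdsWithin] with ζ hζ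
    exact (if_neg (show ζ ≠ 0 from hζ.2)).symm
  · obtain ⟨K₁, hK₁⟩ := h.time_asymptotics ht hΦ
    set B := |K₁| + 1 with hB
    obtain ⟨K₂, hK₂⟩ := h.space_asymptotics hx hΨ B
    refine ⟨|K₂| + |K₁| + B, 2, fun ζ hζ h2 => ?_⟩
    obtain ⟨t1, t2⟩ := hK₁ ζ hζ h2
    have hz : 1 / ‖ζ‖ ^ 2 ≤ 1 := (div_le_one (by positivity)).2 (one_le_pow₀ (by linarith))
    have hz0 : 0 ≤ 1 / ‖ζ‖ ^ 2 := by positivity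
    have t3 : ‖Φ ζ 0 0‖ ≤ B := by
      have e : Φ ζ 0 0 = (Φ ζ 0 0 - 1) + 1 := by ring
      rw [e]
      refine (norm_add_le _ _).trans (add_le_add (t1.trans ?_) (le_of_eq norm_one))
      exact (mul_le_mul_of_nonneg_right (le_abs_self K₁) hz0).trans
        (mul_le_of_le_one_right (abs_nonneg _) hz)
    obtain ⟨s1, s2⟩ := hK₂ ζ hζ (by linarith) (fun i => Φ ζ i 0) t3
      (t2.trans ((le_abs_self _).trans (by rw [hB]; linarith)))
    have e : ∀ i, (Ψ ζ * Φ ζ) i 0 = (Ψ ζ *ᵥ fun i => Φ ζ i 0) i := fun i => rfl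
    rw [e, e]
    have k2 := mul_le_mul_of_nonneg_right (le_abs_self K₂) hz0
    have k1 := mul_le_mul_of_nonneg_right (le_abs_self K₁) hz0
    have k3 : 0 ≤ B * (1 / ‖ζ‖ ^ 2) := by positivity
    have k4 : 0 ≤ |K₁| * (1 / ‖ζ‖ ^ 2) := by positivity
    have k5 : 0 ≤ (|K₂| + |K₁|) * ‖exp (2 * I * ζ ^ 2 * x)‖ := by positivity
    constructor
    · have e2 : (Ψ ζ *ᵥ fun i => Φ ζ i 0) 0 - exp (I * phase (fun y => dx u y t) x) =
          ((Ψ ζ *ᵥ fun i => Φ ζ i 0) 0 - exp (I * phase (fun y => dx u y t) x) * Φ ζ 0 0) +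
          exp (I * phase (fun y => dx u y t) x) * (Φ ζ 0 0 - 1) := by ring
      rw [e2]
      refine (norm_add_le _ _).trans ?_
      rw [norm_mul, norm_exp_I_mul_real, one_mul]
      linarith
    · linarith

end IsHalfLineSolution

/-! ### Conjugation -/

/-- The matrix function `σ conj(N(conj ζ)) σ`, where `σ` exchanges the coordinates. -/
noncomputable def conjSwap (N : ℂ → Matrix (Fin 2) (Fin 2) ℂ) (ζ : ℂ) : Matrix (Fin 2) (Fin 2) ℂ :=
  Matrix.of fun i j => conj (N (conj ζ) (1 - i) (1 - j))

lemma conjSwap_apply (N : ℂ → Matrix (Fin 2) (Fin 2) ℂ) (ζ : ℂ) (i j : Fin 2) :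
    conjSwap N ζ i j = conj (N (conj ζ) (1 - i) (1 - j)) := rfl

lemma HasSimpleResidue.conj_conj {f : ℂ → ℂ} {p r : ℂ} (h : HasSimpleResidue f p r) :
    HasSimpleResidue (fun ζ => conj (f (conj ζ))) (conj p) (conj r) := by
  have h1 : Tendsto (fun ζ : ℂ => conj ζ) (𝓝[≠] (conj p)) (𝓝[≠] p) := by
    refine tendsto_nhdsWithin_iff.2 ⟨?_, ?_⟩
    · have := (continuous_conj.tendsto (conj p)).mono_left (nhdsWithin_le_nhds (s := {conj p}ᶜ))
      rwa [Complex.conj_conj] at this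
    · filter_upwards [self_mem_nhdsWithin] with ζ hζ h2
      exact hζ (by rw [← (show conj ζ = p from h2), Complex.conj_conj]; rfl)
  refine ((continuous_conj.tendsto r).comp (h.comp h1)).congr fun ζ => ?_
  simp

lemma hasSimpleResidue_div {f g : ℂ → ℂ} {p : ℂ} (hf : ContinuousAt f p)
    (hg : DifferentiableAt ℂ g p) (h0 : g p = 0) (h1 : deriv g p ≠ 0) :
    HasSimpleResidue (fun ζ => f ζ / g ζ) p (f p / deriv g p) := by
  have hs := hasDerivAt_iff_tendsto_slope.1 hg.hasDerivAt
  have := (hf.tendsto.mono_left (nhdsWithin_le_nhds (s := {p}ᶜ))).mul (hs.inv₀ h1)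
  refine (this.congr' ?_)
  filter_upwards [self_mem_nhdsWithin] with ζ hζ
  rw [slope_def_field, h0, sub_zero, inv_div]; ring

lemma HasSimpleResidue.const_mul {f : ℂ → ℂ} {p r : ℂ} (c : ℂ) (h : HasSimpleResidue f p r) :
    HasSimpleResidue (fun ζ => c * f ζ) p (c * r) := by
  refine (Tendsto.const_mul c h).congr fun ζ => ?_
  ring

lemma conj_theta (x t : ℝ) (ζ : ℂ) : conj (theta x t (conj ζ)) = theta x t ζ := by
  simp [theta, conj_eta]

lemma conj_exp_theta (x t : ℝ) (ζ : ℂ) :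
    conj (exp (2 * I * theta x t (conj ζ))) = exp (-2 * I * theta x t ζ) := by
  rw [← exp_conj]
  simp only [map_mul, conj_theta, conj_I, map_ofNat]
  congr 1; ring

lemma conj_exp_neg_theta (x t : ℝ) (ζ : ℂ) :
    conj (exp (-2 * I * theta x t (conj ζ))) = exp (2 * I * theta x t ζ) := by
  rw [← exp_conj]
  simp only [map_mul, conj_theta, conj_I, map_ofNat, map_neg]
  congr 1; ring

lemma exp_theta_mul (x t : ℝ) (ζ : ℂ) :
    exp (2 * I * theta x t ζ) * exp (-2 * I * theta x t ζ) = 1 := by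
  rw [← exp_add, ← exp_zero]; congr 1; ring

/-- Conjugation exchanges the first and the third jump. -/
lemma conjSwap_jump {N₀ N₁ : ℂ → Matrix (Fin 2) (Fin 2) ℂ} {Γ : ℂ → ℂ} {x t : ℝ} {ζ : ℂ}
    (h : N₁ (conj ζ) = N₀ (conj ζ) * J1 Γ x t (conj ζ)) :
    conjSwap N₀ ζ = conjSwap N₁ ζ * J3 Γ x t ζ := by
  have h' : ∀ i j, N₁ (conj ζ) i j = (N₀ (conj ζ) * J1 Γ x t (conj ζ)) i j := fun i j => by rw [h]
  have e := conj_exp_theta x t ζ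
  ext i j
  rw [Matrix.mul_apply, Fin.sum_univ_two]
  simp only [conjSwap_apply, h', Matrix.mul_apply, Fin.sum_univ_two, J1, J3, Matrix.of_apply,
    Matrix.cons_val', Matrix.cons_val_zero, Matrix.cons_val_one, Matrix.cons_val_fin_one, map_add,
    map_mul, map_one, map_zero, sub_zero, sub_self]
  fin_cases j
  · simp
  · simp
    rw [show (2 : ℂ) * I * theta x t (conj ζ) = 2 * I * theta x t (conj ζ) from rfl] at e
    rw [← exp_conj] at e
    simp [map_ofNat] at e
    rw [← exp_conj]
    simp [map_ofNat, e]

lemma det_J4 {a b : ℂ → ℂ} {x t : ℝ} {ζ : ℂ} (h1 : a ζ ≠ 0) (h2 : conj (a (conj ζ)) ≠ 0)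
    (h : conj (a (conj ζ)) * a ζ - conj (b (conj ζ)) * b ζ = 1) : (J4 a b x t ζ).det = 1 := by
  have e := conj_mul_exp (2 * I * theta x t ζ)
  rw [J4, Matrix.det_fin_two_of]
  field_simp
  linear_combination b ζ * conj (b (conj ζ)) * e - h

/-! ### The spectral data of a solution -/

/-- The spectral functions of a solution under the assumptions on their zeros. -/
structure IsSpectralData (α : ℝ) (T : EReal) (u : ℝ → ℝ → ℂ) (a b : ℂ → ℂ) : Prop where
  sol : IsHalfLineSolution α T u
  a_eq : ∀ ζ ∈ closedQuadrants, a ζ = column u 0 0 ζ 1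
  b_eq : ∀ ζ ∈ closedQuadrants, b ζ = column u 0 0 ζ 0
  a_contour : ∀ ζ ∈ contour, a ζ ≠ 0
  d_contour : ∀ ζ ∈ contour, ζ ≠ 0 → ζ ∉ zerosPoles α → calD α a b ζ ≠ 0
  a_simple : ∀ ζ ∈ D 0 ∪ D 1, a ζ = 0 → deriv a ζ ≠ 0
  d_simple : ∀ ζ ∈ D 1, calD α a b ζ = 0 → deriv (calD α a b) ζ ≠ 0
  disjoint : ∀ ζ ∈ D 1, a ζ = 0 → calD α a b ζ ≠ 0

lemma continuousOn_column {α : ℝ} {T : EReal} {u : ℝ → ℝ → ℂ} (h : IsHalfLineSolution α T u)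
    {x t : ℝ} (hx : 0 ≤ x) (ht : t ∈ timeInterval T) (i : Fin 2) :
    ContinuousOn (fun ζ => column u x t ζ i) closedQuadrants := by
  obtain ⟨C, hC⟩ := h.potential ht
  exact continuousOn_const.mul (continuousOn_pi.1 (continuousOn_jost hC hx) i)

lemma differentiableOn_column {α : ℝ} {T : EReal} {u : ℝ → ℝ → ℂ} (h : IsHalfLineSolution α T u)
    {x t : ℝ} (hx : 0 ≤ x) (ht : t ∈ timeInterval T) (i : Fin 2) :
    DifferentiableOn ℂ (fun ζ => column u x t ζ i) openQuadrants := by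
  obtain ⟨C, hC⟩ := h.potential ht
  exact (differentiableOn_pi.1 (differentiableOn_jost hC hx) i).const_mul _

namespace IsSpectralData

variable {α ε : ℝ} {T : EReal} {u : ℝ → ℝ → ℂ} {a b : ℂ → ℂ}

lemma a_cont (h : IsSpectralData α T u a b) : ContinuousOn a closedQuadrants :=
  (continuousOn_column h.sol le_rfl h.sol.zero_mem 1).congr h.a_eq

lemma b_cont (h : IsSpectralData α T u a b) : ContinuousOn b closedQuadrants :=
  (continuousOn_column h.sol le_rfl h.sol.zero_mem 0).congr h.b_eq

lemma a_diff (h : IsSpectralData α T u a b) : DifferentiableOn ℂ a openQuadrants :=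
  (differentiableOn_column h.sol le_rfl h.sol.zero_mem 1).congr fun ζ hζ =>
    h.a_eq ζ (openQuadrants_subset hζ)

lemma b_diff (h : IsSpectralData α T u a b) : DifferentiableOn ℂ b openQuadrants :=
  (differentiableOn_column h.sol le_rfl h.sol.zero_mem 0).congr fun ζ hζ =>
    h.b_eq ζ (openQuadrants_subset hζ)

lemma boundary_eq (h : IsSpectralData α T u a b) {ζ : ℂ} (hζ : ζ ∈ closedQuadrants) :
    boundaryColumn α u 0 ζ = ![conj (a (refl ζ)), nFun α ζ * conj (b (refl ζ))] := by
  rw [boundaryColumn, h.a_eq _ (refl_mem_closedQuadrants hζ),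
    h.b_eq _ (refl_mem_closedQuadrants hζ)]

lemma calD_eq (h : IsSpectralData α T u a b) {ζ : ℂ} (hζ : ζ ∈ closedQuadrants) :
    calD α a b ζ = a ζ * boundaryColumn α u 0 ζ 0 - b ζ * boundaryColumn α u 0 ζ 1 := by
  rw [h.boundary_eq hζ, calD]
  simp; ring

lemma gammaTilde_eq (h : IsSpectralData α T u a b) {ζ : ℂ} (hζ : ζ ∈ closedQuadrants) :
    gammaTilde α a b ζ = boundaryColumn α u 0 ζ 1 / (a ζ * calD α a b ζ) := by
  rw [h.boundary_eq hζ, gammaTilde]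
  simp

lemma column_eq_vec (h : IsSpectralData α T u a b) {ζ : ℂ} (hζ : ζ ∈ closedQuadrants) :
    column u 0 0 ζ = ![b ζ, a ζ] := by
  ext i; fin_cases i
  · exact (h.b_eq ζ hζ).symm
  · exact (h.a_eq ζ hζ).symm

/-- The determinant relation on the axes. -/
lemma det_eq_one (h : IsSpectralData α T u a b) {ζ : ℂ} (hζ : ζ.re * ζ.im = 0) :
    conj (a (conj ζ)) * a ζ - conj (b (conj ζ)) * b ζ = 1 := by
  have hQ : ζ ∈ closedQuadrants := hζ.symm.le
  have hQ' : conj ζ ∈ closedQuadrants := by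
    change 0 ≤ (conj ζ).re * (conj ζ).im
    simp [hζ]
  have h0 := h.sol.zero_mem
  obtain ⟨C, hC⟩ := h.sol.potential h0
  -- The left side is the Wronskian of the column at `ζ` with the conjugated and exchanged column at
  -- `conj ζ`. On the axes both columns exist, and the exponentials from the determinant and from
  -- the symmetry of `Ψ` cancel. The Wronskian is therefore independent of `X` and can be evaluated
  -- at infinity.
  have key : ∀ X, 0 ≤ X → conj (a (conj ζ)) * a ζ - conj (b (conj ζ)) * b ζ =
      conj (column u X 0 (conj ζ) 1) * column u X 0 ζ 1 -
        conj (column u X 0 (conj ζ) 0) * column u X 0 ζ 0 := by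
    intro X hX
    obtain ⟨Ψ, hΨ⟩ := (isLaxFamily_space (continuous_slice h.sol.smooth_dx 0) X).exists_transition hX
    have e1 := hΨ.map ζ (mem_univ _) _ (h.sol.column_isSol_space h0 hQ X)
    have e2 := hΨ.map (conj ζ) (mem_univ _) _ (h.sol.column_isSol_space h0 hQ' X)
    simp only [ofReal_zero, mul_zero, exp_zero, one_smul] at e1 e2
    rw [h.column_eq_vec hQ] at e1
    rw [h.column_eq_vec hQ'] at e2
    have s := hΨ.symm ζ (mem_univ _) ![b (conj ζ), a (conj ζ)]
    rw [← e2] at s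
    have hd := hΨ.det ζ (mem_univ _)
    have a0 := congr_fun e1 0
    have a1 := congr_fun e1 1
    have s0 := s 0
    have s1 := s 1
    simp only [mulVec_zero_apply, mulVec_one_apply] at a0 a1 s0 s1
    simp at a0 a1 s0 s1
    have hE : conj (exp (2 * I * conj ζ ^ 2 * X)) = exp (-(2 * I * ζ ^ 2 * X)) := by
      rw [← exp_conj]; simp [map_ofNat]
    have hm : exp (2 * I * ζ ^ 2 * X) * exp (-(2 * I * ζ ^ 2 * X)) = 1 := conj_mul_exp _
    rw [hE] at s0 s1
    have hne := exp_ne_zero (-(2 * I * ζ ^ 2 * X))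
    have s0' := mul_left_cancel₀ hne s0
    have s1' := mul_left_cancel₀ hne s1
    rw [s0', s1']
    have hne' := exp_ne_zero (2 * I * ζ ^ 2 * X)
    apply mul_left_cancel₀ hne'
    linear_combination (Ψ ζ 1 0 * conj (a (conj ζ)) + Ψ ζ 1 1 * conj (b (conj ζ))) * a0 -
      (Ψ ζ 0 0 * conj (a (conj ζ)) + Ψ ζ 0 1 * conj (b (conj ζ))) * a1 -
      (conj (a (conj ζ)) * a ζ - conj (b (conj ζ)) * b ζ) * hd
  have hn : conj (exp (-I * phaseInf (fun y => dx u y 0))) * exp (-I * phaseInf (fun y => dx u y 0))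
      = 1 := by
    rw [mul_comm, conj_mul_eq_norm_sq, norm_exp_neg_I_mul_real]; simp
  have l := fun {ζ} hQ => jost_spec hC (ζ := ζ) hQ
  have c := fun {f : ℝ → ℂ} {z : ℂ} (hf : Tendsto f atTop (𝓝 z)) =>
    (continuous_conj.tendsto z).comp hf
  have lim := ((c ((l hQ').tendsto_snd.const_mul (exp (-I * phaseInf (fun y => dx u y 0))))).mul
      ((l hQ).tendsto_snd.const_mul (exp (-I * phaseInf (fun y => dx u y 0))))).sub
    ((c ((l hQ').tendsto_fst.const_mul (exp (-I * phaseInf (fun y => dx u y 0))))).mul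
      ((l hQ).tendsto_fst.const_mul (exp (-I * phaseInf (fun y => dx u y 0)))))
  simp only [mul_one, mul_zero, map_zero, sub_zero] at lim
  rw [hn] at lim
  refine tendsto_nhds_unique (tendsto_const_nhds.congr' ?_) lim
  filter_upwards [eventually_ge_atTop 0] with X hX
  rw [key X hX]
  rfl

/-- A column that vanishes at `x = 0` vanishes for all `x`, which contradicts its nonzero limit at
infinity. -/
lemma column_zero_ne (h : IsSpectralData α T u a b) {ζ : ℂ} (hζ : ζ ∈ closedQuadrants)
    (ha : a ζ = 0) : b ζ ≠ 0 := by
  intro hb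
  have h0 := h.sol.zero_mem
  obtain ⟨C, hC⟩ := h.sol.potential h0
  have key : ∀ X, 0 ≤ X → column u X 0 ζ 1 = 0 := by
    intro X hX
    obtain ⟨Ψ, hΨ⟩ := (isLaxFamily_space (continuous_slice h.sol.smooth_dx 0) X).exists_transition hX
    have e1 := hΨ.map ζ (mem_univ _) _ (h.sol.column_isSol_space h0 hζ X)
    simp only [ofReal_zero, mul_zero, exp_zero, one_smul] at e1
    rw [h.column_eq_vec hζ, ha, hb] at e1
    have := congr_fun e1 1
    simpa [mulVec_one_apply] using this
  have l := (jost_spec hC hζ).tendsto_snd.const_mul (exp (-I * phaseInf (fun y => dx u y 0)))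
  have : Tendsto (fun X : ℝ => (0 : ℂ)) atTop
      (𝓝 (exp (-I * phaseInf (fun y => dx u y 0)) * 1)) := by
    refine l.congr' ?_
    filter_upwards [eventually_ge_atTop 0] with X hX using key X hX
  have := tendsto_nhds_unique this tendsto_const_nhds
  rw [mul_one] at this
  exact exp_ne_zero _ this

/-! ### Values on the closures of the regions -/

lemma not_mem_zerosPoles (hε : IsAdmissible α ε a b) {ζ : ℂ} (hζ : ζ ∈ closure (region α ε 1)) :
    ζ ∉ zerosPoles α := fun h => by
  have := (closure_region_one hζ).2.2 ζ h
  rw [dist_self] at this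
  exact absurd hε.pos (not_lt.2 this)

lemma ne_zero_of_mem (hε : IsAdmissible α ε a b) {ζ : ℂ} (hζ : ζ ∈ closure (region α ε 0)) :
    ζ ≠ 0 := by
  rintro rfl
  rcases (closure_region_zero hζ).2 with h | ⟨p, hp, h⟩
  · rw [norm_zero] at h
    exact absurd h (not_le.2 (by positivity))
  · exact hε.off_axes p hp 0 h (by simp)

lemma a_ne_zero (h : IsSpectralData α T u a b) (hε : IsAdmissible α ε a b) {ζ : ℂ}
    (hζ : ζ ∈ closure (region α ε 0)) (h' : ¬(ζ ∈ region α ε 0 ∧ a ζ = 0)) : a ζ ≠ 0 := by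
  intro ha
  obtain ⟨hQ, hr⟩ := closure_region_zero hζ
  have hc : ζ ∉ contour := fun hc => h.a_contour ζ hc ha
  have h1 : 0 < ζ.re * ζ.im := lt_of_le_of_ne hQ fun he => hc ⟨hQ, Or.inl he.symm⟩
  rcases hr with hr | ⟨p, hp, hr⟩
  · exact h' ⟨⟨h1, Or.inl (lt_of_le_of_ne hr fun he => hc ⟨hQ, Or.inr he.symm⟩)⟩, ha⟩
  · exact hε.a_ne p hp ζ hr h1 ha

lemma d_ne_zero (h : IsSpectralData α T u a b) (hε : IsAdmissible α ε a b) {ζ : ℂ} (h0 : ζ ≠ 0)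
    (hζ : ζ ∈ closure (region α ε 1)) (h' : ¬(ζ ∈ region α ε 1 ∧ calD α a b ζ = 0)) :
    calD α a b ζ ≠ 0 := by
  intro hd
  obtain ⟨hQ, hr, hp⟩ := closure_region_one hζ
  have hP := not_mem_zerosPoles hε hζ
  have hc : ζ ∉ contour := fun hc => h.d_contour ζ hc h0 hP hd
  have h1 : 0 < ζ.re * ζ.im := lt_of_le_of_ne hQ fun he => hc ⟨hQ, Or.inl he.symm⟩
  refine h' ⟨⟨h1, lt_of_le_of_ne hr fun he => hc ⟨hQ, Or.inr he⟩, fun p hpP =>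
    lt_of_le_of_ne (hp p hpP) fun he => ?_⟩, hd⟩
  exact hε.d_ne p hpP ζ he.symm.le h1 hP hd

lemma mem_D_zero (hε : IsAdmissible α ε a b) {ζ : ℂ} (hζ : ζ ∈ region α ε 0) (ha : a ζ = 0) :
    ζ ∈ D 0 := by
  refine ⟨hζ.1, hζ.2.resolve_right ?_⟩
  rintro ⟨p, hp, h⟩
  exact hε.a_ne p hp ζ h.le hζ.1 ha

lemma mem_D_one {ζ : ℂ} (hζ : ζ ∈ region α ε 1) : ζ ∈ D 1 := ⟨hζ.1, hζ.2.1⟩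

end IsSpectralData

/-! ### The solution of the Riemann-Hilbert problem -/

/-- The diagonal of the gauge transformation. -/
noncomputable def gauge (u : ℝ → ℝ → ℂ) (x t : ℝ) : Fin 2 → ℂ :=
  ![exp (-I * phase (fun y => dx u y t) x), exp (I * phase (fun y => dx u y t) x)]

lemma conj_gauge (u : ℝ → ℝ → ℂ) (x t : ℝ) (i : Fin 2) :
    conj (gauge u x t (1 - i)) = gauge u x t i := by
  fin_cases i <;> simp [gauge, ← exp_conj]

/-- The solution in the outer part of the first and third quadrants. -/
noncomputable def outerSol (u : ℝ → ℝ → ℂ) (a : ℂ → ℂ) (U : ℂ → Matrix (Fin 2) (Fin 2) ℂ) (x t : ℝ)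
    (ζ : ℂ) : Matrix (Fin 2) (Fin 2) ℂ :=
  Matrix.of fun i j => gauge u x t i * ![U ζ i 0 / a ζ, column u x t ζ i] j

/-- The function `calD` with its limit at the origin. -/
noncomputable def calD₀ (α : ℝ) (a b : ℂ → ℂ) (ζ : ℂ) : ℂ :=
  -- Division by zero gives `refl 0 = 0`, so `calD` at zero need not be its limit. The limit is `a
  -- 0`, because the boundary column tends to `(1, 0)`.
  open Classical in if ζ = 0 then a 0 else calD α a b ζ

/-- The solution in the inner part of the first and third quadrants. -/
noncomputable def innerSol (α : ℝ) (u : ℝ → ℝ → ℂ) (a b : ℂ → ℂ) (V : ℂ → Fin 2 → ℂ) (x t : ℝ)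
    (ζ : ℂ) : Matrix (Fin 2) (Fin 2) ℂ :=
  Matrix.of fun i j => gauge u x t i * ![V ζ i / calD₀ α a b ζ, column u x t ζ i] j

/-- The solution of the Riemann-Hilbert problem. -/
noncomputable def rhSol (α : ℝ) (u : ℝ → ℝ → ℂ) (a b : ℂ → ℂ) (U : ℂ → Matrix (Fin 2) (Fin 2) ℂ)
    (V : ℂ → Fin 2 → ℂ) (x t : ℝ) : Fin 4 → ℂ → Matrix (Fin 2) (Fin 2) ℂ
  | 0 => outerSol u a U x t
  | 1 => innerSol α u a b V x t
  | 2 => conjSwap (innerSol α u a b V x t)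
  | 3 => conjSwap (outerSol u a U x t)

section

variable {α ε : ℝ} {T : EReal} {u : ℝ → ℝ → ℂ} {a b : ℂ → ℂ} {x t : ℝ}
  {U : ℂ → Matrix (Fin 2) (Fin 2) ℂ} {V : ℂ → Fin 2 → ℂ}

lemma outerSol_zero (ζ : ℂ) (i : Fin 2) :
    outerSol u a U x t ζ i 0 = gauge u x t i * (U ζ i 0 / a ζ) := rfl

lemma outerSol_one (ζ : ℂ) (i : Fin 2) :
    outerSol u a U x t ζ i 1 = gauge u x t i * column u x t ζ i := rfl

lemma innerSol_zero (ζ : ℂ) (i : Fin 2) :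
    innerSol α u a b V x t ζ i 0 = gauge u x t i * (V ζ i / calD₀ α a b ζ) := rfl

lemma innerSol_one (ζ : ℂ) (i : Fin 2) :
    innerSol α u a b V x t ζ i 1 = gauge u x t i * column u x t ζ i := rfl

lemma mulVec_fin_two (A : Matrix (Fin 2) (Fin 2) ℂ) (v : Fin 2 → ℂ) (i : Fin 2) :
    (A *ᵥ v) i = A i 0 * v 0 + A i 1 * v 1 := by
  simp [Matrix.mulVec, dotProduct, Fin.sum_univ_two]

namespace IsSpectralData

/-- The second column at `(x, t)`. -/
lemma exp_mul_column (h : IsSpectralData α T u a b) (hT : IsTransport α u x t U V) {ζ : ℂ}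
    (hζ : ζ ∈ closedQuadrants) (h0 : ζ ≠ 0) (i : Fin 2) :
    exp (2 * I * theta x t ζ) * column u x t ζ i = U ζ i 0 * b ζ + U ζ i 1 * a ζ := by
  have := congr_fun (hT.map_column ζ hζ h0) i
  rw [h.column_eq_vec hζ, mulVec_fin_two] at this
  exact this.symm

lemma column_eq (h : IsSpectralData α T u a b) (hT : IsTransport α u x t U V) {ζ : ℂ}
    (hζ : ζ ∈ closedQuadrants) (h0 : ζ ≠ 0) (i : Fin 2) :
    column u x t ζ i = exp (-2 * I * theta x t ζ) * (U ζ i 0 * b ζ + U ζ i 1 * a ζ) := by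
  rw [← h.exp_mul_column hT hζ h0, ← mul_assoc, mul_comm (exp (-2 * I * theta x t ζ)),
    exp_theta_mul, one_mul]

lemma V_eq (hT : IsTransport α u x t U V) {ζ : ℂ} (hζ : ζ ∈ closedQuadrants) (h0 : ζ ≠ 0)
    (hn : Real.cos α = 0 ∨ nDen α ζ ≠ 0) (i : Fin 2) :
    V ζ i = U ζ i 0 * boundaryColumn α u 0 ζ 0 + U ζ i 1 * boundaryColumn α u 0 ζ 1 := by
  rw [hT.map_boundary ζ hζ h0 hn, mulVec_fin_two]

/-- The vectors `(1, 0) / a` and `boundaryColumn / 𝒟` both have determinant one with `(b, a)`, so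
they differ by a multiple of `(b, a)`; comparison of second entries shows that the multiple is `Γ̃`.
Transport by `U` preserves the relation. -/
lemma jump_one (h : IsSpectralData α T u a b) (hT : IsTransport α u x t U V) {ζ : ℂ}
    (hζ : ζ ∈ closedQuadrants) (h0 : ζ ≠ 0) (hn : Real.cos α = 0 ∨ nDen α ζ ≠ 0) (ha : a ζ ≠ 0)
    (hd : calD α a b ζ ≠ 0) :
    innerSol α u a b V x t ζ = outerSol u a U x t ζ * J1 (gammaTilde α a b) x t ζ := by
  have hD := h.calD_eq hζ
  ext i j
  have hc := h.exp_mul_column hT hζ h0 i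
  rw [Matrix.mul_apply, Fin.sum_univ_two]
  fin_cases j
  · have : outerSol u a U x t ζ i 0 * J1 (gammaTilde α a b) x t ζ 0 0 +
        outerSol u a U x t ζ i 1 * J1 (gammaTilde α a b) x t ζ 1 0 =
        gauge u x t i * (U ζ i 0 / a ζ + boundaryColumn α u 0 ζ 1 / (a ζ * calD α a b ζ) *
          (exp (2 * I * theta x t ζ) * column u x t ζ i)) := by
      rw [outerSol_zero, outerSol_one, ← h.gammaTilde_eq hζ]
      simp [J1]; ring
    rw [Fin.zero_eta, this, innerSol_zero, V_eq hT hζ h0 hn, hc, calD₀, if_neg h0]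
    field_simp
    linear_combination -gauge u x t i * U ζ i 0 * hD
  · simp [J1, innerSol_one, outerSol_one]

lemma conj_column_eq (h : IsSpectralData α T u a b) (hT : IsTransport α u x t U V) {ζ : ℂ}
    (hζ : conj ζ ∈ closedQuadrants) (h0 : ζ ≠ 0) (i : Fin 2) :
    conj (column u x t (conj ζ) (1 - i)) =
      U ζ i 0 * conj (a (conj ζ)) + U ζ i 1 * conj (b (conj ζ)) := by
  have h0' : conj ζ ≠ 0 := by simpa using h0
  have e1 := h.column_eq hT hζ h0' (1 - i)
  have e2 := hT.symm ζ h0 ![b (conj ζ), a (conj ζ)] i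
  rw [mulVec_fin_two, mulVec_fin_two] at e2
  simp only [Matrix.cons_val_zero, Matrix.cons_val_one] at e2
  rw [e1, map_mul, e2, conj_exp_neg_theta, ← mul_assoc, conj_mul_exp, one_mul]

/-- By the symmetry of `U`, all four columns are images under `U` of explicit vectors in `a` and
`b`, and what remains is `det_eq_one`. The relation holds on both axes off the origin, also inside
the circle, where `outerSol` is not part of the solution; `jump_two` relies on this. -/
lemma jump_four (h : IsSpectralData α T u a b) (hT : IsTransport α u x t U V) {ζ : ℂ}
    (hζ : ζ.re * ζ.im = 0) (h0 : ζ ≠ 0) :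
    conjSwap (outerSol u a U x t) ζ = outerSol u a U x t ζ * J4 a b x t ζ := by
  have hQ : ζ ∈ closedQuadrants := hζ.symm.le
  have hQ' : (conj ζ).re * (conj ζ).im = 0 := by simp [hζ]
  have hQ'' : conj ζ ∈ closedQuadrants := hQ'.symm.le
  have ha : a ζ ≠ 0 := h.a_contour ζ ⟨hQ, Or.inl hζ⟩
  have ha' : conj (a (conj ζ)) ≠ 0 := by
    simpa using h.a_contour (conj ζ) ⟨hQ'', Or.inl hQ'⟩
  have hdet := h.det_eq_one hζ
  have hE := exp_theta_mul x t ζ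
  ext i j
  have hc := h.column_eq hT hQ h0 i
  rw [Matrix.mul_apply, Fin.sum_univ_two, conjSwap_apply]
  have e0 : outerSol u a U x t (conj ζ) (1 - i) 0 =
    gauge u x t (1 - i) * (U (conj ζ) (1 - i) 0 / a (conj ζ)) := rfl
  have e1 : outerSol u a U x t (conj ζ) (1 - i) 1 =
    gauge u x t (1 - i) * column u x t (conj ζ) (1 - i) := rfl
  fin_cases j
  · simp only [Fin.zero_eta, sub_zero]
    rw [e1, map_mul, conj_gauge, h.conj_column_eq hT hQ'' h0, outerSol_zero, outerSol_one]
    simp only [J4, Matrix.of_apply, Matrix.cons_val', Matrix.cons_val_zero, Matrix.cons_val_one,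
      Matrix.cons_val_fin_one]
    rw [hc]
    obtain ⟨E, hE1⟩ : ∃ E, E = exp (2 * I * theta x t ζ) := ⟨_, rfl⟩
    obtain ⟨E', hE2⟩ : ∃ E', E' = exp (-2 * I * theta x t ζ) := ⟨_, rfl⟩
    rw [← hE1, ← hE2] at hE ⊢
    field_simp
    linear_combination gauge u x t i * (U ζ i 0 * hdet) -
      gauge u x t i * ((U ζ i 0 * b ζ + U ζ i 1 * a ζ) * conj (b (conj ζ)) * hE)
  · simp only [Fin.mk_one, sub_self]
    have e2 := hT.symm ζ h0 ![1, 0] i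
    rw [mulVec_fin_two, mulVec_fin_two] at e2
    simp at e2
    rw [e0, map_mul, conj_gauge, map_div₀, e2, outerSol_zero, outerSol_one]
    simp only [J4, Matrix.of_apply, Matrix.cons_val', Matrix.cons_val_zero, Matrix.cons_val_one,
      Matrix.cons_val_fin_one]
    rw [hc, show -(2 * I * theta x t ζ) = -2 * I * theta x t ζ by ring]
    field_simp
    ring

/-- The outer solutions serve as intermediate functions inside the circle: `J1` relates inner to
outer, `J4` crosses the axis, `J3` returns to the inner solution, and `J2` is the resulting product.
-/
lemma jump_two (h : IsSpectralData α T u a b) (hT : IsTransport α u x t U V) {ζ : ℂ}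
    (hζ : ζ.re * ζ.im = 0) (h0 : ζ ≠ 0) (hn : Real.cos α = 0 ∨ nDen α ζ ≠ 0)
    (hn' : Real.cos α = 0 ∨ nDen α (conj ζ) ≠ 0) (hd : calD α a b ζ ≠ 0)
    (hd' : calD α a b (conj ζ) ≠ 0) :
    innerSol α u a b V x t ζ = conjSwap (innerSol α u a b V x t) ζ *
      J2 a b (gammaTilde α a b) x t ζ := by
  have hQ : ζ ∈ closedQuadrants := hζ.symm.le
  have hQ' : (conj ζ).re * (conj ζ).im = 0 := by simp [hζ]
  have hQ'' : conj ζ ∈ closedQuadrants := hQ'.symm.le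
  have ha : a ζ ≠ 0 := h.a_contour ζ ⟨hQ, Or.inl hζ⟩
  have ha' : a (conj ζ) ≠ 0 := h.a_contour (conj ζ) ⟨hQ'', Or.inl hQ'⟩
  have h1 := h.jump_one hT hQ h0 hn ha hd
  have h3 := conjSwap_jump (h.jump_one hT hQ'' (by simpa using h0) hn' ha' hd')
  have h4 := h.jump_four hT hζ h0
  have hdet : IsUnit (J4 a b x t ζ).det := by
    rw [det_J4 ha (by simpa using ha') (h.det_eq_one hζ)]; exact isUnit_one
  rw [J2, ← Matrix.mul_assoc, ← Matrix.mul_assoc, ← h3, h4, Matrix.mul_assoc (outerSol u a U x t ζ),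
    Matrix.mul_nonsing_inv _ hdet, Matrix.mul_one, h1]

/-! ### Regularity -/

lemma U_differentiableAt (hT : IsTransport α u x t U V) {ζ : ℂ} (h0 : ζ ≠ 0) (i j : Fin 2) :
    DifferentiableAt ℂ (fun ζ => U ζ i j) ζ :=
  (hT.diff i j).differentiableAt (isOpen_compl_singleton.mem_nhds h0)

lemma ne_zero_of_mem_open {ζ : ℂ} (hζ : ζ ∈ openQuadrants) : ζ ≠ 0 := by
  rintro rfl; simp [openQuadrants] at hζ

lemma boundary_differentiableAt (h : IsSpectralData α T u a b) {ζ : ℂ} (hζ : ζ ∈ openQuadrants)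
    (hn : Real.cos α = 0 ∨ nDen α ζ ≠ 0) (i : Fin 2) :
    DifferentiableAt ℂ (fun ζ => boundaryColumn α u 0 ζ i) ζ := by
  have hc := fun i => differentiableAt_conj_refl
    (differentiableOn_column h.sol le_rfl h.sol.zero_mem i) hζ
  fin_cases i
  · exact hc 1
  · exact (differentiableAt_nFun hn).mul (hc 0)

lemma eventually_nDen {ζ : ℂ} (hn : Real.cos α = 0 ∨ nDen α ζ ≠ 0) :
    ∀ᶠ z in 𝓝 ζ, Real.cos α = 0 ∨ nDen α z ≠ 0 := by
  rcases hn with hn | hn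
  · exact Eventually.of_forall fun _ => Or.inl hn
  · have : Continuous (nDen α) := by unfold nDen; fun_prop
    filter_upwards [this.continuousAt.eventually_ne hn] with z hz using Or.inr hz

lemma V_differentiableAt (h : IsSpectralData α T u a b) (hT : IsTransport α u x t U V) {ζ : ℂ}
    (hζ : ζ ∈ openQuadrants) (hn : Real.cos α = 0 ∨ nDen α ζ ≠ 0) (i : Fin 2) :
    DifferentiableAt ℂ (fun ζ => V ζ i) ζ := by
  have h0 := ne_zero_of_mem_open hζ
  refine (((U_differentiableAt hT h0 i 0).mul (h.boundary_differentiableAt hζ hn 0)).add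
    ((U_differentiableAt hT h0 i 1).mul (h.boundary_differentiableAt hζ hn 1))).congr_of_eventuallyEq
    ?_
  filter_upwards [isOpen_openQuadrants.mem_nhds hζ, eventually_nDen hn] with z hz hzn
  exact V_eq hT (openQuadrants_subset hz) (ne_zero_of_mem_open hz) hzn i

lemma boundary_continuousWithinAt (h : IsSpectralData α T u a b) {ζ : ℂ} (hζ : ζ ∈ closedQuadrants)
    (h0 : ζ ≠ 0) (hn : Real.cos α = 0 ∨ nDen α ζ ≠ 0) (i : Fin 2) :
    ContinuousWithinAt (fun ζ => boundaryColumn α u 0 ζ i) closedQuadrants ζ := by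
  have hr : ContinuousWithinAt refl closedQuadrants ζ := by
    refine ContinuousAt.continuousWithinAt ?_
    unfold refl
    exact ContinuousAt.div (by fun_prop) (by fun_prop) (by simpa using h0)
  have hc : ∀ i, ContinuousWithinAt (fun ζ => conj (column u 0 0 (refl ζ) i)) closedQuadrants ζ :=
    fun i => continuous_conj.continuousAt.comp_continuousWithinAt
      (((continuousOn_column h.sol le_rfl h.sol.zero_mem i) (refl ζ)
        (refl_mem_closedQuadrants hζ)).comp hr fun z hz => refl_mem_closedQuadrants hz)
  fin_cases i
  · exact hc 1
  · exact (differentiableAt_nFun hn).continuousAt.continuousWithinAt.mul (hc 0)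

lemma V_continuousWithinAt (h : IsSpectralData α T u a b) (hT : IsTransport α u x t U V) {ζ : ℂ}
    (hζ : ζ ∈ closedQuadrants) (hn : Real.cos α = 0 ∨ nDen α ζ ≠ 0) (i : Fin 2) :
    ContinuousWithinAt (fun ζ => V ζ i) closedQuadrants ζ := by
  rcases eq_or_ne ζ 0 with rfl | h0
  · rw [← continuousWithinAt_sdiff_self]
    have := tendsto_pi_nhds.1 hT.V_tendsto i
    rwa [← hT.V_zero] at this
  · have hU := fun i j => (U_differentiableAt hT h0 i j).continuousAt.continuousWithinAt
      (s := closedQuadrants)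
    refine (((hU i 0).mul (h.boundary_continuousWithinAt hζ h0 hn 0)).add
      ((hU i 1).mul (h.boundary_continuousWithinAt hζ h0 hn 1))).congr_of_eventuallyEq ?_
      (V_eq hT hζ h0 hn i)
    filter_upwards [self_mem_nhdsWithin, mem_nhdsWithin_of_mem_nhds
      (isOpen_compl_singleton.mem_nhds h0), mem_nhdsWithin_of_mem_nhds (eventually_nDen hn)]
      with z hz hz0 hzn
    exact V_eq hT hz hz0 hzn i

lemma calD₀_continuousWithinAt (h : IsSpectralData α T u a b) {ζ : ℂ} (hζ : ζ ∈ closedQuadrants)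
    (hn : Real.cos α = 0 ∨ nDen α ζ ≠ 0) :
    ContinuousWithinAt (calD₀ α a b) closedQuadrants ζ := by
  have hD : ∀ z ∈ closedQuadrants, z ≠ 0 → calD₀ α a b z =
      a z * boundaryColumn α u 0 z 0 - b z * boundaryColumn α u 0 z 1 := fun z hz hz0 => by
    rw [calD₀, if_neg hz0, h.calD_eq hz]
  rcases eq_or_ne ζ 0 with rfl | h0
  · rw [← continuousWithinAt_sdiff_self]
    have l := fun i => tendsto_pi_nhds.1 (h.sol.tendsto_boundaryColumn h.sol.zero_mem) i
    have ha : Tendsto a (𝓝[closedQuadrants \ {0}] 0) (𝓝 (a 0)) :=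
      (h.a_cont 0 hζ).mono_left (nhdsWithin_mono _ sdiff_subset)
    have hb : Tendsto b (𝓝[closedQuadrants \ {0}] 0) (𝓝 (b 0)) :=
      (h.b_cont 0 hζ).mono_left (nhdsWithin_mono _ sdiff_subset)
    have := (ha.mul (l 0)).sub (hb.mul (l 1))
    simp only [Matrix.cons_val_zero, Matrix.cons_val_one, mul_one, mul_zero, sub_zero] at this
    have e : calD₀ α a b 0 = a 0 := if_pos rfl
    rw [ContinuousWithinAt, e]
    refine this.congr' ?_
    filter_upwards [self_mem_nhdsWithin] with z hz using (hD z hz.1 hz.2).symm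
  · refine (((h.a_cont ζ hζ).mul (h.boundary_continuousWithinAt hζ h0 hn 0)).sub
      ((h.b_cont ζ hζ).mul (h.boundary_continuousWithinAt hζ h0 hn 1))).congr_of_eventuallyEq ?_
      (hD ζ hζ h0)
    filter_upwards [self_mem_nhdsWithin, mem_nhdsWithin_of_mem_nhds
      (isOpen_compl_singleton.mem_nhds h0)] with z hz hz0
    exact hD z hz hz0

lemma calD₀_ne_zero (h : IsSpectralData α T u a b) (hε : IsAdmissible α ε a b) {ζ : ℂ}
    (hζ : ζ ∈ closure (region α ε 1)) (h' : ¬(ζ ∈ region α ε 1 ∧ calD α a b ζ = 0)) :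
    calD₀ α a b ζ ≠ 0 := by
  rw [calD₀]
  split_ifs with h0
  · exact h.a_contour 0 ⟨by simp, Or.inl (by simp)⟩
  · exact h.d_ne_zero hε h0 hζ h'

end IsSpectralData

end

lemma disjoint_region {α ε : ℝ} : Disjoint (region α ε 0) (region α ε 1) := by
  rw [Set.disjoint_left]
  rintro ζ ⟨-, h | ⟨p, hp, h⟩⟩ ⟨-, h1, h2⟩
  · exact absurd h h1.not_gt
  · exact absurd h (h2 p hp).not_gt

lemma re_mul_im_conj (ζ : ℂ) : (conj ζ).re * (conj ζ).im = -(ζ.re * ζ.im) := by simp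

lemma continuousWithinAt_conj_conj {f : ℂ → ℂ} {S S' : Set ℂ} {ζ : ℂ}
    (h : ContinuousWithinAt f S (conj ζ)) (hS : ∀ z ∈ S', conj z ∈ S) :
    ContinuousWithinAt (fun z => conj (f (conj z))) S' ζ :=
  continuous_conj.continuousAt.comp_continuousWithinAt
    (ContinuousWithinAt.comp h continuous_conj.continuousWithinAt hS)

namespace IsSpectralData

variable {α ε : ℝ} {T : EReal} {u : ℝ → ℝ → ℂ} {a b : ℂ → ℂ} {x t : ℝ}
  {U : ℂ → Matrix (Fin 2) (Fin 2) ℂ} {V : ℂ → Fin 2 → ℂ}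

lemma outerSol_differentiableAt (h : IsSpectralData α T u a b) (hT : IsTransport α u x t U V)
    (hx : 0 ≤ x) (ht : t ∈ timeInterval T) {ζ : ℂ} (hζ : ζ ∈ openQuadrants) (i c : Fin 2)
    (h' : c = 0 → a ζ ≠ 0) : DifferentiableAt ℂ (fun ζ => outerSol u a U x t ζ i c) ζ := by
  have hn := isOpen_openQuadrants.mem_nhds hζ
  fin_cases c
  · exact ((U_differentiableAt hT (ne_zero_of_mem_open hζ) i 0).div (h.a_diff.differentiableAt hn)
      (h' rfl)).const_mul _
  · exact ((differentiableOn_column h.sol hx ht i).differentiableAt hn).const_mul _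

lemma calD₀_eventuallyEq {ζ : ℂ} (h0 : ζ ≠ 0) : calD₀ α a b =ᶠ[𝓝 ζ] calD α a b := by
  filter_upwards [isOpen_compl_singleton.mem_nhds h0] with z hz using if_neg hz

lemma innerSol_differentiableAt (h : IsSpectralData α T u a b) (hT : IsTransport α u x t U V)
    (hx : 0 ≤ x) (ht : t ∈ timeInterval T) {ζ : ℂ} (hζ : ζ ∈ openQuadrants)
    (hn : Real.cos α = 0 ∨ nDen α ζ ≠ 0) (i c : Fin 2)
    (h' : c = 0 → calD α a b ζ ≠ 0) :
    DifferentiableAt ℂ (fun ζ => innerSol α u a b V x t ζ i c) ζ := by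
  have h0 := ne_zero_of_mem_open hζ
  fin_cases c
  · refine ((h.V_differentiableAt hT hζ hn i).div
      ((differentiableAt_calD h.a_diff h.b_diff hζ hn).congr_of_eventuallyEq (calD₀_eventuallyEq h0))
      ?_).const_mul _
    rw [calD₀, if_neg h0]
    exact h' rfl
  · exact ((differentiableOn_column h.sol hx ht i).differentiableAt
      (isOpen_openQuadrants.mem_nhds hζ)).const_mul _

lemma outerSol_continuousWithinAt (h : IsSpectralData α T u a b) (hT : IsTransport α u x t U V)
    (hx : 0 ≤ x) (ht : t ∈ timeInterval T) {ζ : ℂ} (hζ : ζ ∈ closedQuadrants) (h0 : ζ ≠ 0)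
    (i c : Fin 2) (h' : c = 0 → a ζ ≠ 0) :
    ContinuousWithinAt (fun ζ => outerSol u a U x t ζ i c) closedQuadrants ζ := by
  fin_cases c
  · exact continuousWithinAt_const.mul
      ((U_differentiableAt hT h0 i 0).continuousAt.continuousWithinAt.div (h.a_cont ζ hζ) (h' rfl))
  · exact continuousWithinAt_const.mul (continuousOn_column h.sol hx ht i ζ hζ)

lemma innerSol_continuousWithinAt (h : IsSpectralData α T u a b) (hT : IsTransport α u x t U V)
    (hx : 0 ≤ x) (ht : t ∈ timeInterval T) {ζ : ℂ} (hζ : ζ ∈ closedQuadrants)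
    (hn : Real.cos α = 0 ∨ nDen α ζ ≠ 0) (i c : Fin 2) (h' : c = 0 → calD₀ α a b ζ ≠ 0) :
    ContinuousWithinAt (fun ζ => innerSol α u a b V x t ζ i c) closedQuadrants ζ := by
  fin_cases c
  · exact continuousWithinAt_const.mul
      ((h.V_continuousWithinAt hT hζ hn i).div (h.calD₀_continuousWithinAt hζ hn) (h' rfl))
  · exact continuousWithinAt_const.mul (continuousOn_column h.sol hx ht i ζ hζ)

lemma holomorphic (h : IsSpectralData α T u a b) (hε : IsAdmissible α ε a b)
    (hT : IsTransport α u x t U V) (hx : 0 ≤ x) (ht : t ∈ timeInterval T) (j : Fin 4) (i c : Fin 2) :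
    DifferentiableOn ℂ (fun ζ => rhSol α u a b U V x t j ζ i c)
      (region α ε j \ poles (region α ε) a (calD α a b) j c) := by
  intro ζ hζ
  refine DifferentiableAt.differentiableWithinAt ?_
  have key0 : ∀ ζ ∈ region α ε 0, ∀ i c, (c = 0 → a ζ ≠ 0) →
      DifferentiableAt ℂ (fun ζ => outerSol u a U x t ζ i c) ζ := fun ζ hζ i c h' =>
    h.outerSol_differentiableAt hT hx ht hζ.1 i c h'
  have key1 : ∀ ζ ∈ region α ε 1, ∀ i c, (c = 0 → calD α a b ζ ≠ 0) →
      DifferentiableAt ℂ (fun ζ => innerSol α u a b V x t ζ i c) ζ := fun ζ hζ i c h' =>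
    h.innerSol_differentiableAt hT hx ht hζ.1
      (nDen_ne_zero (not_mem_zerosPoles hε (subset_closure hζ))) i c h'
  obtain ⟨hζ, hp⟩ := hζ
  fin_cases j
  · exact key0 ζ hζ i c fun hc ha => hp (by subst hc; exact ⟨hζ, ha⟩)
  · exact key1 ζ hζ i c fun hc ha => hp (by subst hc; exact ⟨hζ, ha⟩)
  · have hζ' := conj_mem_region.1.1 hζ
    have := (key1 (conj ζ) hζ' (1 - i) (1 - c) fun hc ha =>
      hp (by obtain rfl : c = 1 := (sub_eq_zero.1 hc).symm
             exact ⟨hζ', ha⟩)).conj_conj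
    rwa [Complex.conj_conj] at this
  · have hζ' := conj_mem_region.2.1 hζ
    have := (key0 (conj ζ) hζ' (1 - i) (1 - c) fun hc ha =>
      hp (by obtain rfl : c = 1 := (sub_eq_zero.1 hc).symm
             exact ⟨hζ', ha⟩)).conj_conj
    rwa [Complex.conj_conj] at this

lemma continuous (h : IsSpectralData α T u a b) (hε : IsAdmissible α ε a b)
    (hT : IsTransport α u x t U V) (hx : 0 ≤ x) (ht : t ∈ timeInterval T) (j : Fin 4) (i c : Fin 2) :
    ContinuousOn (fun ζ => rhSol α u a b U V x t j ζ i c)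
      (closure (region α ε j) \ poles (region α ε) a (calD α a b) j c) := by
  intro ζ hζ
  refine ContinuousWithinAt.mono (t := closure (region α ε j)) ?_ sdiff_subset
  have key0 : ∀ ζ ∈ closure (region α ε 0), ∀ i c, (c = 0 → ¬ (ζ ∈ region α ε 0 ∧ a ζ = 0)) →
      ContinuousWithinAt (fun ζ => outerSol u a U x t ζ i c) (closure (region α ε 0)) ζ :=
    fun ζ hζ i c h' => (h.outerSol_continuousWithinAt hT hx ht (closure_region_zero hζ).1
      (ne_zero_of_mem hε hζ) i c fun hc => h.a_ne_zero hε hζ (h' hc)).mono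
        fun z hz => (closure_region_zero hz).1
  have key1 : ∀ ζ ∈ closure (region α ε 1), ∀ i c,
      (c = 0 → ¬ (ζ ∈ region α ε 1 ∧ calD α a b ζ = 0)) →
      ContinuousWithinAt (fun ζ => innerSol α u a b V x t ζ i c) (closure (region α ε 1)) ζ :=
    fun ζ hζ i c h' => (h.innerSol_continuousWithinAt hT hx ht (closure_region_one hζ).1
      (nDen_ne_zero (not_mem_zerosPoles hε hζ)) i c fun hc => h.calD₀_ne_zero hε hζ (h' hc)).mono
        fun z hz => (closure_region_one hz).1
  obtain ⟨hζ, hp⟩ := hζ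
  fin_cases j
  · exact key0 ζ hζ i c fun hc ha => hp (by subst hc; exact ha)
  · exact key1 ζ hζ i c fun hc ha => hp (by subst hc; exact ha)
  · exact continuousWithinAt_conj_conj (key1 (conj ζ) (conj_mem_closure_region.1.1 hζ) (1 - i) (1 - c) fun hc ha =>
      hp (by obtain rfl : c = 1 := (sub_eq_zero.1 hc).symm
             exact ha)) fun z hz => conj_mem_closure_region.1.1 hz
  · exact continuousWithinAt_conj_conj (key0 (conj ζ) (conj_mem_closure_region.2.1 hζ) (1 - i) (1 - c) fun hc ha =>
      hp (by obtain rfl : c = 1 := (sub_eq_zero.1 hc).symm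
             exact ha)) fun z hz => conj_mem_closure_region.2.1 hz

/-! ### Jumps -/

/-- A point common to both closures lies in neither open region, so it is none of the admitted zeros
of `a` or `𝒟`. -/
lemma jump_outer_inner (h : IsSpectralData α T u a b) (hε : IsAdmissible α ε a b)
    (hT : IsTransport α u x t U V) {ζ : ℂ} (h0 : ζ ∈ closure (region α ε 0))
    (h1 : ζ ∈ closure (region α ε 1)) :
    innerSol α u a b V x t ζ = outerSol u a U x t ζ * J1 (gammaTilde α a b) x t ζ := by
  have hne := ne_zero_of_mem hε h0
  have n0 : ζ ∉ region α ε 0 := fun hm => Set.disjoint_left.1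
    (disjoint_region.closure_right (isOpen_region_zero α ε)) hm h1
  have n1 : ζ ∉ region α ε 1 := fun hm => Set.disjoint_left.1
    (disjoint_region.closure_left (isOpen_region_one α ε)) h0 hm
  exact h.jump_one hT (closure_region_zero h0).1 hne (nDen_ne_zero (not_mem_zerosPoles hε h1))
    (h.a_ne_zero hε h0 fun hm => n0 hm.1) (h.d_ne_zero hε hne h1 fun hm => n1 hm.1)

lemma mem_axes {ζ : ℂ} (h : ζ ∈ closedQuadrants) (h' : conj ζ ∈ closedQuadrants) :
    ζ.re * ζ.im = 0 := by
  have h1 : 0 ≤ ζ.re * ζ.im := h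
  have h2 : 0 ≤ (conj ζ).re * (conj ζ).im := h'
  rw [re_mul_im_conj] at h2
  linarith

lemma jump_inner (h : IsSpectralData α T u a b) (hε : IsAdmissible α ε a b)
    (hT : IsTransport α u x t U V) {ζ : ℂ} (h1 : ζ ∈ closure (region α ε 1))
    (h2 : ζ ∈ closure (region α ε 2)) (h0 : ζ ≠ 0) :
    innerSol α u a b V x t ζ = conjSwap (innerSol α u a b V x t) ζ *
      J2 a b (gammaTilde α a b) x t ζ := by
  have h2' := conj_mem_closure_region.1.1 h2
  have hax := mem_axes (closure_region_one h1).1 (closure_region_one h2').1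
  have hax' : (conj ζ).re * (conj ζ).im = 0 := by rw [re_mul_im_conj, hax, neg_zero]
  have n1 := not_mem_zerosPoles hε h1
  have n2 := not_mem_zerosPoles hε h2'
  exact h.jump_two hT hax h0 (nDen_ne_zero n1) (nDen_ne_zero n2)
    (h.d_contour ζ ⟨hax.symm.le, Or.inl hax⟩ h0 n1)
    (h.d_contour _ ⟨hax'.symm.le, Or.inl hax'⟩ (by simpa using h0) n2)

/-! ### Residues -/

/-- Where `a` vanishes, the second column starts from `b (1, 0)`, so it is parallel to the numerator
of the first one, with a nonzero ratio. -/
lemma residue_outer (h : IsSpectralData α T u a b) (hε : IsAdmissible α ε a b)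
    (hT : IsTransport α u x t U V) {p : ℂ} (hp : p ∈ region α ε 0) (ha : a p = 0) (i : Fin 2) :
    HasSimpleResidue (fun ζ => outerSol u a U x t ζ i 0) p
      (1 / (deriv a p * b p) * exp (2 * I * theta x t p) * outerSol u a U x t p i 1) := by
  have hQ := openQuadrants_subset hp.1
  have h0 := ne_zero_of_mem_open hp.1
  have hb := h.column_zero_ne hQ ha
  have hd := h.a_simple p (Or.inl (mem_D_zero hε hp ha)) ha
  have hc := h.exp_mul_column hT hQ h0 i
  have := (hasSimpleResidue_div (U_differentiableAt hT h0 i 0).continuousAt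
    (h.a_diff.differentiableAt (isOpen_openQuadrants.mem_nhds hp.1)) ha hd).const_mul (gauge u x t i)
  convert! this using 1
  rw [outerSol_one, show 1 / (deriv a p * b p) * exp (2 * I * theta x t p) *
    (gauge u x t i * column u x t p i) = gauge u x t i / (deriv a p * b p) *
      (exp (2 * I * theta x t p) * column u x t p i) by ring, hc, ha]
  field_simp
  ring

/-- A zero of `𝒟` is a point where the boundary column is parallel to `(b, a)`. The ratio is read
off from the second entries, which requires that `a` and `𝒟` have no common zero. -/
lemma residue_inner (h : IsSpectralData α T u a b) (hε : IsAdmissible α ε a b)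
    (hT : IsTransport α u x t U V) {p : ℂ} (hp : p ∈ region α ε 1) (hd : calD α a b p = 0) :
    ∃ r, HasSimpleResidue (gammaTilde α a b) p r ∧
      ∀ i, HasSimpleResidue (fun ζ => innerSol α u a b V x t ζ i 0) p
        (r * exp (2 * I * theta x t p) * innerSol α u a b V x t p i 1) := by
  have hQ := openQuadrants_subset hp.1
  have h0 := ne_zero_of_mem_open hp.1
  have hn := nDen_ne_zero (not_mem_zerosPoles hε (subset_closure hp))
  have ha : a p ≠ 0 := fun ha => h.disjoint p (mem_D_one hp) ha hd
  have hdd := h.d_simple p (mem_D_one hp) hd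
  have hdiff := differentiableAt_calD h.a_diff h.b_diff hp.1 hn
  have hdiffa := h.a_diff.differentiableAt (isOpen_openQuadrants.mem_nhds hp.1)
  have hB := fun i => h.boundary_differentiableAt hp.1 hn i
  refine ⟨boundaryColumn α u 0 p 1 / a p / deriv (calD α a b) p, ?_, fun i => ?_⟩
  · refine (hasSimpleResidue_div ((hB 1).div hdiffa ha).continuousAt hdiff hd hdd).congr' ?_
    filter_upwards [mem_nhdsWithin_of_mem_nhds (isOpen_openQuadrants.mem_nhds hp.1)] with z hz
    rw [h.gammaTilde_eq (openQuadrants_subset hz), Pi.div_apply, div_div]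
  · have := (hasSimpleResidue_div (h.V_differentiableAt hT hp.1 hn i).continuousAt
      hdiff hd hdd).const_mul (gauge u x t i)
    have e := V_eq hT hQ h0 hn i
    have hc := h.exp_mul_column hT hQ h0 i
    have hD := h.calD_eq hQ
    rw [hd] at hD
    rw [show boundaryColumn α u 0 p 1 / a p / deriv (calD α a b) p * exp (2 * I * theta x t p) *
      innerSol α u a b V x t p i 1 = gauge u x t i * (V p i / deriv (calD α a b) p) by
        rw [innerSol_one, show boundaryColumn α u 0 p 1 / a p / deriv (calD α a b) p *
          exp (2 * I * theta x t p) * (gauge u x t i * column u x t p i) =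
          boundaryColumn α u 0 p 1 / a p / deriv (calD α a b) p * gauge u x t i *
          (exp (2 * I * theta x t p) * column u x t p i) by ring, hc, e]
        field_simp
        linear_combination gauge u x t i * U p i 0 * hD]
    refine this.congr' ?_
    filter_upwards [mem_nhdsWithin_of_mem_nhds (calD₀_eventuallyEq (a := a) (b := b) (α := α) h0)]
      with z hz
    rw [innerSol_zero, hz]

end IsSpectralData

/-! ### Behaviour at infinity -/

lemma isBigO_inv_of_norm_mul_le {f : ℂ → ℂ} {l : Filter ℂ} {C : ℝ} (hl : l ≤ cobounded ℂ)
    (h : ∀ᶠ ζ in l, ‖ζ * f ζ‖ ≤ C) : f =O[l] fun ζ => ζ⁻¹ := by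
  refine Asymptotics.IsBigO.of_bound C ?_
  filter_upwards [h, (eventually_cobounded_le_norm (1 : ℝ)).filter_mono hl] with ζ hζ h1
  have h0 : 0 < ‖ζ‖ := by linarith
  rw [norm_inv, ← div_eq_mul_inv, le_div_iff₀ h0, mul_comm, ← norm_mul]
  exact hζ

lemma isBigO_inv_of_norm_le {f : ℂ → ℂ} {l : Filter ℂ} {C : ℝ} (hl : l ≤ cobounded ℂ)
    (h : ∀ᶠ ζ in l, ‖f ζ‖ ≤ C * (1 / ‖ζ‖ ^ 2)) : f =O[l] fun ζ => ζ⁻¹ := by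
  refine isBigO_inv_of_norm_mul_le (C := C) hl ?_
  filter_upwards [h, (eventually_cobounded_le_norm (1 : ℝ)).filter_mono hl] with ζ hζ h1
  have h0 : 0 < ‖ζ‖ := by linarith
  have hC : 0 ≤ C := nonneg_of_mul_nonneg_left ((norm_nonneg _).trans hζ) (by positivity)
  calc ‖ζ * f ζ‖ ≤ ‖ζ‖ * (C * (1 / ‖ζ‖ ^ 2)) := by rw [norm_mul]; gcongr
    _ = C / ‖ζ‖ := by field_simp
    _ ≤ C := div_le_self hC h1

lemma tendsto_inv_cobounded {l : Filter ℂ} (hl : l ≤ cobounded ℂ) :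
    Tendsto (fun ζ : ℂ => ζ⁻¹) l (𝓝 0) := (tendsto_inv₀_cobounded (α := ℂ)).mono_left hl

lemma tendsto_const_div_norm_sq {l : Filter ℂ} (hl : l ≤ cobounded ℂ) (K : ℝ) :
    Tendsto (fun ζ : ℂ => K * (1 / ‖ζ‖ ^ 2)) l (𝓝 0) := by
  have := ((tendsto_inv_cobounded hl).norm.pow 2).const_mul K
  simpa using this

lemma norm_exp_sq_mul (ζ : ℂ) (x : ℝ) :
    ‖exp (2 * I * ζ ^ 2 * x)‖ = Real.exp (-(4 * (ζ.re * ζ.im)) * x) := by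
  rw [norm_exp, re_mul_ofReal, re_two_I_mul_sq, neg_mul]

/-- The coefficient at infinity. -/
noncomputable def coefficient (u : ℝ → ℝ → ℂ) (x t : ℝ) : ℂ :=
  -(I / 2 * dx u x t * exp (-(2 * I * phase (fun y => dx u y t) x)))

namespace IsSpectralData

variable {α ε : ℝ} {T : EReal} {u : ℝ → ℝ → ℂ} {a b : ℂ → ℂ} {x t : ℝ}
  {U : ℂ → Matrix (Fin 2) (Fin 2) ℂ} {V : ℂ → Fin 2 → ℂ} {l : Filter ℂ}

lemma column_one_isBigO (h : IsSpectralData α T u a b) (hx : 0 ≤ x) (ht : t ∈ timeInterval T)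
    (hl : l ≤ cobounded ℂ) (hQ : ∀ᶠ ζ in l, ζ ∈ closedQuadrants) :
    (fun ζ => column u x t ζ 1 - exp (-I * phase (fun y => dx u y t) x)) =O[l] fun ζ => ζ⁻¹ := by
  obtain ⟨K, hK⟩ := h.sol.column_asymptotics ht
  refine isBigO_inv_of_norm_le (C := K) hl ?_
  filter_upwards [hQ, (eventually_cobounded_le_norm (1 : ℝ)).filter_mono hl] with ζ hζ h1
  rw [mul_one_div]
  exact (hK ζ hζ h1 x hx).1

lemma tendsto_column_one (h : IsSpectralData α T u a b) (hx : 0 ≤ x) (ht : t ∈ timeInterval T)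
    (hl : l ≤ cobounded ℂ) (hQ : ∀ᶠ ζ in l, ζ ∈ closedQuadrants) :
    Tendsto (fun ζ => column u x t ζ 1) l (𝓝 (exp (-I * phase (fun y => dx u y t) x))) :=
  tendsto_sub_nhds_zero_iff.1
    ((h.column_one_isBigO hx ht hl hQ).trans_tendsto (tendsto_inv_cobounded hl))

lemma tendsto_mul_column_zero (h : IsSpectralData α T u a b) (hx : 0 ≤ x) (ht : t ∈ timeInterval T)
    (hl : l ≤ cobounded ℂ) (hQ : ∀ᶠ ζ in l, ζ ∈ closedQuadrants) :
    Tendsto (fun ζ => ζ * column u x t ζ 0) l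
      (𝓝 (-(I / 2 * dx u x t * exp (-I * phase (fun y => dx u y t) x)))) := by
  obtain ⟨K, hK⟩ := h.sol.column_asymptotics ht
  have h1 : Tendsto (fun ζ => ζ * column u x t ζ 0 + I / 2 * dx u x t * column u x t ζ 1) l
      (𝓝 0) := by
    refine squeeze_zero_norm' ?_ (tendsto_const_div_norm_sq hl K)
    filter_upwards [hQ, (eventually_cobounded_le_norm (1 : ℝ)).filter_mono hl] with ζ hζ h1
    rw [mul_one_div]
    exact (hK ζ hζ h1 x hx).2
  have := h1.sub ((h.tendsto_column_one hx ht hl hQ).const_mul (I / 2 * dx u x t))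
  simpa using this

lemma a_sub_one_isBigO (h : IsSpectralData α T u a b) 
    (hl : l ≤ cobounded ℂ) (hQ : ∀ᶠ ζ in l, ζ ∈ closedQuadrants) :
    (fun ζ => a ζ - 1) =O[l] fun ζ => ζ⁻¹ := by
  refine (h.column_one_isBigO le_rfl h.sol.zero_mem hl hQ).congr' ?_ EventuallyEq.rfl
  filter_upwards [hQ] with ζ hζ
  rw [h.a_eq ζ hζ, phase_zero]
  simp

lemma tendsto_a (h : IsSpectralData α T u a b)
    (hl : l ≤ cobounded ℂ) (hQ : ∀ᶠ ζ in l, ζ ∈ closedQuadrants) : Tendsto a l (𝓝 1) :=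
  tendsto_sub_nhds_zero_iff.1 ((h.a_sub_one_isBigO hl hQ).trans_tendsto (tendsto_inv_cobounded hl))

lemma U_zero_isBigO (hT : IsTransport α u x t U V)
    (hl : l ≤ cobounded ℂ) (hQ : ∀ᶠ ζ in l, ζ ∈ closedQuadrants) :
    (fun ζ => U ζ 0 0 - exp (I * phase (fun y => dx u y t) x)) =O[l] fun ζ => ζ⁻¹ := by
  obtain ⟨K, R, hK⟩ := hT.asymptotics
  refine isBigO_inv_of_norm_le (C := K) hl ?_
  filter_upwards [hQ, (eventually_cobounded_le_norm R).filter_mono hl] with ζ hζ h1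
  exact (hK ζ hζ h1).1

lemma tendsto_U_zero (hT : IsTransport α u x t U V)
    (hl : l ≤ cobounded ℂ) (hQ : ∀ᶠ ζ in l, ζ ∈ closedQuadrants) :
    Tendsto (fun ζ => U ζ 0 0) l (𝓝 (exp (I * phase (fun y => dx u y t) x))) :=
  tendsto_sub_nhds_zero_iff.1 ((U_zero_isBigO hT hl hQ).trans_tendsto (tendsto_inv_cobounded hl))

lemma U_one_isBigO (hT : IsTransport α u x t U V) (hx : 0 ≤ x)
    (hl : l ≤ cobounded ℂ) (hQ : ∀ᶠ ζ in l, ζ ∈ closedQuadrants) :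
    (fun ζ => U ζ 1 0) =O[l] fun ζ => ζ⁻¹ := by
  obtain ⟨K, R, hK⟩ := hT.asymptotics
  have hb := ((tendsto_U_zero hT hl hQ).norm.eventually_le_const
    (lt_add_one ‖exp (I * phase (fun y => dx u y t) x)‖))
  rw [norm_exp_I_mul_real] at hb
  refine isBigO_inv_of_norm_mul_le (C := |K| * 1 + |K| * 1 + ‖I / 2 * conj (dx u x t)‖ * (1 + 1)) hl ?_
  filter_upwards [hQ, (eventually_cobounded_le_norm R).filter_mono hl, hb,
    (eventually_cobounded_le_norm (1 : ℝ)).filter_mono hl] with ζ hζ h1 h2 h3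
  have h4 := (hK ζ hζ h1).2
  have h5 : ‖exp (2 * I * ζ ^ 2 * x)‖ ≤ 1 := by
    rw [norm_exp_sq_mul]
    have : (0 : ℝ) ≤ ζ.re * ζ.im := hζ
    exact Real.exp_le_one_iff.2 (by nlinarith [mul_nonneg this hx])
  have h6 : 1 / ‖ζ‖ ^ 2 ≤ 1 := by
    rw [div_le_one (by positivity)]; nlinarith
  calc ‖ζ * U ζ 1 0‖ = ‖(ζ * U ζ 1 0 - I / 2 * conj (dx u x t) * U ζ 0 0) +
        I / 2 * conj (dx u x t) * U ζ 0 0‖ := by rw [sub_add_cancel]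
    _ ≤ (|K| * 1 + |K| * 1) + ‖I / 2 * conj (dx u x t)‖ * (1 + 1) := by
      refine (norm_add_le _ _).trans (add_le_add (h4.trans ?_) ?_)
      · gcongr <;> exact le_abs_self K
      · rw [norm_mul]; gcongr

/-- Without `he` the exponential remainder in the expansion of `U` is merely bounded, which is
enough for the normalisation but not for a limit. -/
lemma tendsto_mul_U_one (hT : IsTransport α u x t U V)
    (hl : l ≤ cobounded ℂ) (hQ : ∀ᶠ ζ in l, ζ ∈ closedQuadrants)
    (he : Tendsto (fun ζ => ‖exp (2 * I * ζ ^ 2 * x)‖) l (𝓝 0)) :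
    Tendsto (fun ζ => ζ * U ζ 1 0) l
      (𝓝 (I / 2 * conj (dx u x t) * exp (I * phase (fun y => dx u y t) x))) := by
  obtain ⟨K, R, hK⟩ := hT.asymptotics
  have h1 : Tendsto (fun ζ => ζ * U ζ 1 0 - I / 2 * conj (dx u x t) * U ζ 0 0) l (𝓝 0) := by
    have := (he.const_mul K).add (tendsto_const_div_norm_sq hl K)
    rw [mul_zero, add_zero] at this
    refine squeeze_zero_norm' ?_ this
    filter_upwards [hQ, (eventually_cobounded_le_norm R).filter_mono hl] with ζ hζ h1
    exact (hK ζ hζ h1).2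
  have := h1.add ((tendsto_U_zero hT hl hQ).const_mul (I / 2 * conj (dx u x t)))
  simpa using this

lemma outerSol_isBigO (h : IsSpectralData α T u a b) (hT : IsTransport α u x t U V) (hx : 0 ≤ x)
    (ht : t ∈ timeInterval T) (hl : l ≤ cobounded ℂ) (hQ : ∀ᶠ ζ in l, ζ ∈ closedQuadrants)
    (i c : Fin 2) :
    (fun ζ => outerSol u a U x t ζ i c - (1 : Matrix (Fin 2) (Fin 2) ℂ) i c) =O[l]
      fun ζ => ζ⁻¹ := by
  have ha := h.tendsto_a hl hQ
  have ha1 : (fun ζ => (a ζ)⁻¹) =O[l] fun _ => (1 : ℂ) := (ha.inv₀ one_ne_zero).isBigO_one ℂ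
  have hdiv : ∀ {f : ℂ → ℂ}, f =O[l] (fun ζ => ζ⁻¹) → (fun ζ => f ζ / a ζ) =O[l] fun ζ => ζ⁻¹ :=
    fun hf => by simpa [div_eq_mul_inv] using hf.mul ha1
  have hphase : ∀ z : ℂ, exp (-I * z) * exp (I * z) = 1 := fun z => by
    rw [← exp_add, ← exp_zero]; congr 1; ring
  have hcol : (fun ζ => column u x t ζ 0) =O[l] fun ζ => ζ⁻¹ := by
    refine isBigO_inv_of_norm_mul_le hl
      ((h.tendsto_mul_column_zero hx ht hl hQ).norm.eventually_le_const (lt_add_one _))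
  fin_cases c <;> fin_cases i
  · refine (hdiv (((U_zero_isBigO hT hl hQ).const_mul_left (gauge u x t 0)).sub
      (h.a_sub_one_isBigO hl hQ))).congr' ?_ EventuallyEq.rfl
    filter_upwards [ha.eventually_ne one_ne_zero] with ζ hζ
    change _ = gauge u x t 0 * (U ζ 0 0 / a ζ) - 1
    have := hphase (phase (fun y => dx u y t) x)
    rw [eq_sub_iff_add_eq, ← mul_div_assoc, div_add_one hζ]
    congr 1
    simp only [gauge, Matrix.cons_val_zero]
    linear_combination -this
  · refine ((hdiv (U_one_isBigO hT hx hl hQ)).const_mul_left (gauge u x t 1)).congr_left fun ζ => ?_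
    change _ = gauge u x t 1 * (U ζ 1 0 / a ζ) - 0
    rw [sub_zero]
  · refine (hcol.const_mul_left (gauge u x t 0)).congr_left fun ζ => ?_
    change _ = gauge u x t 0 * column u x t ζ 0 - 0
    rw [sub_zero]
  · refine ((h.column_one_isBigO hx ht hl hQ).const_mul_left (gauge u x t 1)).congr_left fun ζ => ?_
    change _ = gauge u x t 1 * column u x t ζ 1 - 1
    have := hphase (phase (fun y => dx u y t) x)
    simp only [gauge, Matrix.cons_val_one, Matrix.cons_val_fin_one]
    linear_combination -this

lemma conj_isBigO {f : ℂ → ℂ} (c : ℂ) {S S' : Set ℂ} (hS : ∀ z ∈ S', conj z ∈ S)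
    (hf : (fun ζ => f ζ - c) =O[cobounded ℂ ⊓ 𝓟 S] fun ζ => ζ⁻¹) :
    (fun ζ => conj (f (conj ζ)) - conj c) =O[cobounded ℂ ⊓ 𝓟 S'] fun ζ => ζ⁻¹ := by
  have ht : Tendsto (fun ζ : ℂ => conj ζ) (cobounded ℂ ⊓ 𝓟 S') (cobounded ℂ ⊓ 𝓟 S) := by
    refine tendsto_inf.2 ⟨?_, tendsto_principal.2 (by
      filter_upwards [mem_inf_of_right (mem_principal_self S')] with z hz using hS z hz)⟩
    refine Tendsto.mono_left ?_ inf_le_left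
    rw [← tendsto_norm_atTop_iff_cobounded]
    simpa using tendsto_norm_cobounded_atTop (E := ℂ)
  have := hf.comp_tendsto ht
  refine (this.norm_norm.congr (fun ζ => ?_) fun ζ => ?_).of_norm_norm
  · rw [Function.comp_apply, ← map_sub, norm_conj]
  · simp

lemma normalization (h : IsSpectralData α T u a b) (hT : IsTransport α u x t U V) (hx : 0 ≤ x)
    (ht : t ∈ timeInterval T) (j : Fin 4) (i c : Fin 2) :
    (fun ζ => rhSol α u a b U V x t j ζ i c - (1 : Matrix (Fin 2) (Fin 2) ℂ) i c)
      =O[cobounded ℂ ⊓ 𝓟 (region α ε j)] fun ζ => ζ⁻¹ := by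
  have key0 := fun i c => h.outerSol_isBigO hT hx ht (l := cobounded ℂ ⊓ 𝓟 (region α ε 0)) inf_le_left
    (by filter_upwards [mem_inf_of_right (mem_principal_self _)] with z hz
        exact openQuadrants_subset hz.1) i c
  -- The inner regions are bounded, so for them the condition at infinity is vacuous.
  have hbot : ∀ {S : Set ℂ}, (∀ z ∈ S, ‖z‖ < 1 / √2) → cobounded ℂ ⊓ 𝓟 S = ⊥ := fun {S} hS => by
    rw [← Filter.empty_mem_iff_bot]
    filter_upwards [(eventually_cobounded_le_norm (1 / √2)).filter_mono inf_le_left,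
      mem_inf_of_right (mem_principal_self S)] with z h1 h2
    exact absurd (hS z h2) h1.not_gt
  have hone : ∀ i c : Fin 2, conj ((1 : Matrix (Fin 2) (Fin 2) ℂ) (1 - i) (1 - c)) =
      (1 : Matrix (Fin 2) (Fin 2) ℂ) i c := fun i c => by
    fin_cases i <;> fin_cases c <;> simp
  fin_cases j
  · exact key0 i c
  · change _ =O[cobounded ℂ ⊓ 𝓟 (region α ε 1)] _
    rw [hbot (S := region α ε 1) fun z hz => hz.2.1]
    exact Asymptotics.isBigO_bot _ _
  · change _ =O[cobounded ℂ ⊓ 𝓟 (region α ε 2)] _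
    rw [hbot (S := region α ε 2) fun z hz => hz.2.1]
    exact Asymptotics.isBigO_bot _ _
  · have := conj_isBigO (S' := region α ε 3) _ (fun z hz => conj_mem_region.2.1 hz) (key0 (1 - i) (1 - c))
    rw [hone] at this
    exact this

/-! ### Existence -/

theorem isRHSolution (h : IsSpectralData α T u a b) (hε : IsAdmissible α ε a b)
    (hT : IsTransport α u x t U V) (hx : 0 ≤ x) (ht : t ∈ timeInterval T) :
    IsRHSolution (region α ε) a b (calD α a b) (gammaTilde α a b) x t (rhSol α u a b U V x t) where
  holomorphic := h.holomorphic hε hT hx ht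
  continuous := h.continuous hε hT hx ht
  jump1 ζ hζ := h.jump_outer_inner hε hT hζ.1 hζ.2
  jump2 ζ hζ h0 := h.jump_inner hε hT hζ.1 hζ.2 h0
  jump3 ζ hζ := conjSwap_jump (h.jump_outer_inner hε hT (conj_mem_closure_region.2.1 hζ.2)
    (conj_mem_closure_region.1.1 hζ.1))
  jump4 ζ hζ := h.jump_four hT (mem_axes (closure_region_zero hζ.2).1
    (closure_region_zero (conj_mem_closure_region.2.1 hζ.1)).1) (ne_zero_of_mem hε hζ.2)
  normalization := h.normalization hT hx ht
  residue1 p hp ha i := h.residue_outer hε hT hp ha i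
  residue2 p hp ha i := by
    have := (h.residue_outer hε hT hp ha (1 - i)).conj_conj
    convert! this using 1
    have e := conj_exp_theta x t (conj p)
    rw [Complex.conj_conj] at e
    have e2 : rhSol α u a b U V x t 3 (conj p) i 0 =
      conj (outerSol u a U x t (conj (conj p)) (1 - i) 1) := rfl
    rw [e2]
    simp only [map_mul, map_div₀, map_one, Complex.conj_conj, e]
  residue3 p hp hd := h.residue_inner hε hT hp hd
  residue4 p hp hd := by
    obtain ⟨r, hr, hr'⟩ := h.residue_inner hε hT hp hd
    refine ⟨conj r, hr.conj_conj, fun i => ?_⟩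
    have := (hr' (1 - i)).conj_conj
    convert! this using 1
    have e := conj_exp_theta x t (conj p)
    rw [Complex.conj_conj] at e
    have e2 : rhSol α u a b U V x t 2 (conj p) i 0 =
      conj (innerSol α u a b V x t (conj (conj p)) (1 - i) 1) := rfl
    rw [e2]
    simp only [map_mul, Complex.conj_conj, e]

theorem isCoefficientAtInfinity (h : IsSpectralData α T u a b)
    (hT : IsTransport α u x t U V) (hx : 0 ≤ x) (ht : t ∈ timeInterval T) :
    IsCoefficientAtInfinity (region α ε) x (rhSol α u a b U V x t) (coefficient u x t) := by
  have hexp : ∀ z : ℂ, exp (-(2 * I * z)) = exp (-I * z) * exp (-I * z) := fun z => by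
    rw [← exp_add]; congr 1; ring
  constructor
  · have := (h.tendsto_mul_column_zero hx ht (l := cobounded ℂ ⊓ 𝓟 (closure (region α ε 0)))
      inf_le_left (by
        filter_upwards [mem_inf_of_right (mem_principal_self _)] with z hz
        exact (closure_region_zero hz).1)).const_mul (gauge u x t 0)
    have e : coefficient u x t = gauge u x t 0 *
        -(I / 2 * dx u x t * exp (-I * phase (fun y => dx u y t) x)) := by
      rw [coefficient, hexp]; simp only [gauge, Matrix.cons_val_zero]; ring
    rw [e]
    refine this.congr fun ζ => ?_
    change _ = ζ * (gauge u x t 0 * column u x t ζ 0)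
    ring
  -- Here the entry is the conjugate of the `(2, 1)` entry of `outerSol` at `conj ζ`. In the sector
  -- `re ζ · im ζ` is comparable to `|ζ|²` in size, so for `x > 0` the exponential remainder of the
  -- first column decays.
  · intro hx0 δ hδ
    set S : Set ℂ := {ζ | ζ ∈ region α ε 3 ∧ δ * ‖ζ‖ ^ 2 ≤ -(ζ.re * ζ.im)} with hS
    set l : Filter ℂ := map (fun ζ : ℂ => conj ζ) (cobounded ℂ ⊓ 𝓟 S) with hlS
    have hl : l ≤ cobounded ℂ := by
      refine Tendsto.mono_left ?_ inf_le_left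
      rw [← tendsto_norm_atTop_iff_cobounded]
      simpa using tendsto_norm_cobounded_atTop (E := ℂ)
    have hlS : ∀ᶠ ζ in l, ζ ∈ closedQuadrants ∧ δ * ‖ζ‖ ^ 2 ≤ ζ.re * ζ.im := by
      rw [hlS, eventually_map]
      filter_upwards [mem_inf_of_right (mem_principal_self _)] with z hz
      refine ⟨openQuadrants_subset (conj_mem_region.2.1 hz.1).1, ?_⟩
      rw [re_mul_im_conj, norm_conj]
      exact hz.2
    have hQ := hlS.mono fun _ h => h.1
    have he : Tendsto (fun ζ => ‖exp (2 * I * ζ ^ 2 * x)‖) l (𝓝 0) := by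
      have h1 : Tendsto (fun ζ : ℂ => 4 * δ * x * ‖ζ‖ ^ 2) l atTop :=
        (Tendsto.const_mul_atTop (by positivity) ((tendsto_pow_atTop two_ne_zero).comp
          (tendsto_norm_cobounded_atTop (E := ℂ)))).mono_left hl
      refine squeeze_zero' (Eventually.of_forall fun _ => norm_nonneg _) ?_
        (Real.tendsto_exp_neg_atTop_nhds_zero.comp h1)
      filter_upwards [hlS] with ζ hζ
      rw [norm_exp_sq_mul]
      exact Real.exp_le_exp.2 (by nlinarith [mul_le_mul_of_nonneg_left hζ.2 hx])
    have h1 := (((tendsto_mul_U_one hT hl hQ he).div (h.tendsto_a hl hQ) one_ne_zero).const_mul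
      (gauge u x t 1))
    have h2 := (continuous_conj.tendsto _).comp (tendsto_map'_iff.1 h1)
    have e : coefficient u x t = conj (gauge u x t 1 *
        (I / 2 * conj (dx u x t) * exp (I * phase (fun y => dx u y t) x) / 1)) := by
      have hg : conj (gauge u x t 1) = gauge u x t 0 := conj_gauge u x t 0
      rw [map_mul, hg, coefficient, hexp]
      simp only [gauge, Matrix.cons_val_zero, div_one, map_mul, map_div₀, conj_I, Complex.conj_conj,
        ← exp_conj, conj_ofReal, map_ofNat]
      ring
    rw [e]
    refine h2.congr fun ζ => ?_
    change conj (gauge u x t 1 * (conj ζ * U (conj ζ) 1 0 / a (conj ζ))) =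
      ζ * conj (gauge u x t 1 * (U (conj ζ) 1 0 / a (conj ζ)))
    rw [mul_div_assoc, map_mul, map_mul, Complex.conj_conj, map_mul]
    ring

end IsSpectralData

/-! ### Removable sets for continuous functions -/

/-- A closed set across which continuous functions that are holomorphic off the set are
holomorphic. -/
def IsRemovable (S : Set ℂ) : Prop :=
  IsClosed S ∧ ∀ (W : Set ℂ) (f : ℂ → ℂ), IsOpen W → ContinuousOn f W →
    DifferentiableOn ℂ f (W \ S) → DifferentiableOn ℂ f W

lemma IsRemovable.union {S S' : Set ℂ} (h : IsRemovable S) (h' : IsRemovable S') :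
    IsRemovable (S ∪ S') := by
  refine ⟨h.1.union h'.1, fun W f hW hc hd => h.2 W f hW hc ?_⟩
  refine h'.2 (W \ S) f (hW.sdiff h.1) (hc.mono sdiff_subset) ?_
  rwa [Set.sdiff_sdiff]

lemma isRemovable_empty : IsRemovable ∅ := ⟨isClosed_empty, fun W f _ _ hd => by simpa using hd⟩

lemma IsRemovable.biUnion {ι : Type*} {s : Set ι} (hs : s.Finite) {S : ι → Set ℂ}
    (h : ∀ i ∈ s, IsRemovable (S i)) : IsRemovable (⋃ i ∈ s, S i) := by
  induction s, hs using Set.Finite.induction_on with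
  | empty => simpa using isRemovable_empty
  | insert ha hs ih =>
    rw [biUnion_insert]
    exact (h _ (mem_insert _ _)).union (ih fun i hi => h i (mem_insert_of_mem _ hi))

/-- Both horizontal sides are joined to the real axis by rectangles with an edge on it. On each of
these `f` is continuous, and holomorphic inside, so Cauchy's theorem applies, and the two integrals
along the axis cancel. As the centre `p` is real, moving towards the axis does not leave the disc.
-/
lemma integral_rect_eq_zero {f : ℂ → ℂ} {p z w : ℂ} {r : ℝ} (hp : p.im = 0)
    (hc : ContinuousOn f (Metric.ball p r))
    (hd : DifferentiableOn ℂ f (Metric.ball p r \ {ζ | ζ.im = 0}))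
    (hR : Rectangle z w ⊆ Metric.ball p r) :
    (∫ x : ℝ in z.re..w.re, f (x + z.im * I)) - (∫ x : ℝ in z.re..w.re, f (x + w.im * I)) +
      I • (∫ y : ℝ in z.im..w.im, f (re w + y * I)) -
      I • (∫ y : ℝ in z.im..w.im, f (re z + y * I)) = 0 := by
  have hmem : ∀ y ∈ uIcc z.im w.im, ∀ s ∈ uIcc z.re w.re, ∀ τ : ℝ, |τ| ≤ |y| →
      (⟨s, τ⟩ : ℂ) ∈ Metric.ball p r := fun y hy s hs τ hτ => by
    have h1 : (⟨s, y⟩ : ℂ) ∈ Metric.ball p r := hR ⟨hs, hy⟩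
    refine lt_of_le_of_lt ?_ (Metric.mem_ball.1 h1)
    rw [dist_eq_re_im, dist_eq_re_im]
    refine Real.sqrt_le_sqrt (by simpa [hp] using sq_le_sq.2 hτ)
  have hsub : ∀ y ∈ uIcc z.im w.im, ∀ τ ∈ uIcc y 0, |τ| ≤ |y| := fun y _ τ hτ => by
    have := abs_sub_right_of_mem_uIcc hτ
    simpa using this
  have key : ∀ y ∈ uIcc z.im w.im,
      (∫ x : ℝ in z.re..w.re, f (x + y * I)) - (∫ x : ℝ in z.re..w.re, f (x + (0 : ℝ) * I)) +
      I • (∫ τ : ℝ in y..0, f (re w + τ * I)) -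
      I • (∫ τ : ℝ in y..0, f (re z + τ * I)) = 0 := fun y hy => by
    refine integral_boundary_rect_eq_zero_of_continuousOn_of_differentiableOn f ⟨z.re, y⟩ ⟨w.re, 0⟩
      (hc.mono fun v hv => ?_) (hd.mono fun v hv => ⟨?_, ?_⟩)
    · exact hmem y hy v.re hv.1 v.im (hsub y hy _ hv.2)
    · exact hmem y hy v.re (Ioo_subset_Icc_self hv.1) v.im (hsub y hy _ (Ioo_subset_Icc_self hv.2))
    · intro h0
      have h2 := hv.2
      change v.im = 0 at h0
      simp only [mem_preimage, h0, mem_Ioo, min_lt_iff, lt_max_iff, lt_irrefl, or_false] at h2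
      exact lt_asymm h2.1 h2.2
  have hint : ∀ y ∈ uIcc z.im w.im, ∀ s ∈ uIcc z.re w.re,
      IntervalIntegrable (fun τ : ℝ => f (s + τ * I)) volume y 0 := fun y hy s hs => by
    refine ContinuousOn.intervalIntegrable (hc.comp (by fun_prop) fun τ hτ => ?_)
    have := hmem y hy s hs τ (hsub y hy τ hτ)
    rwa [mk_eq_add_mul_I] at this
  have k1 := key z.im left_mem_uIcc
  have k2 := key w.im right_mem_uIcc
  have e : ∀ s ∈ uIcc z.re w.re, (∫ τ : ℝ in z.im..w.im, f (s + τ * I)) =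
      (∫ τ : ℝ in z.im..0, f (s + τ * I)) - ∫ τ : ℝ in w.im..0, f (s + τ * I) := fun s hs => by
    rw [← intervalIntegral.integral_add_adjacent_intervals (hint _ left_mem_uIcc s hs)
      (hint _ right_mem_uIcc s hs).symm, intervalIntegral.integral_symm w.im 0, sub_eq_add_neg]
  rw [e _ left_mem_uIcc, e _ right_mem_uIcc]
  simp only [smul_eq_mul] at k1 k2 ⊢
  linear_combination k1 - k2

/-- The real axis is removable. -/
lemma isRemovable_real : IsRemovable {ζ | ζ.im = 0} := by
  refine ⟨isClosed_eq continuous_im continuous_const, fun W f hW hc hd p hp => ?_⟩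
  refine DifferentiableAt.differentiableWithinAt ?_
  by_cases h0 : p.im = 0
  · obtain ⟨r, hr, hB⟩ := Metric.isOpen_iff.1 hW p hp
    refine DifferentiableOn.differentiableAt (s := Metric.ball p r) ?_ (Metric.ball_mem_nhds p hr)
    -- Morera's theorem.
    refine (isConservativeOn_and_continuousOn_iff_isDifferentiableOn Metric.isOpen_ball).1
      ⟨fun z w hR => ?_, hc.mono hB⟩
    rw [eq_neg_iff_add_eq_zero, wedgeIntegral_add_wedgeIntegral_eq]
    exact integral_rect_eq_zero h0 (hc.mono hB) (hd.mono fun z hz => ⟨hB hz.1, hz.2⟩) hR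
  · exact hd.differentiableAt ((hW.sdiff (isClosed_eq continuous_im continuous_const)).mem_nhds ⟨hp, h0⟩)

/-- A curve that is locally the image of a subset of the real axis under a holomorphic chart is
removable. -/
lemma IsRemovable.of_chart {S : Set ℂ} (hS : IsClosed S)
    (h : ∀ p ∈ S, ∃ (e : ℂ → ℂ) (w : ℂ), Differentiable ℂ e ∧ e w = p ∧ deriv e w ≠ 0 ∧
      ∀ z, e z ∈ S → z.im = 0) : IsRemovable S := by
  refine ⟨hS, fun W f hW hc hd p hp => DifferentiableAt.differentiableWithinAt ?_⟩
  by_cases h0 : p ∈ S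
  · obtain ⟨e, w, he, rfl, hw, hz⟩ := h p h0
    have hs : HasStrictDerivAt e (deriv e w) w :=
      (he.contDiff (n := 1)).contDiffAt.hasStrictDerivAt one_ne_zero
    have h1 : DifferentiableAt ℂ (f ∘ e) w := by
      refine (isRemovable_real.2 (e ⁻¹' W) (f ∘ e) (hW.preimage he.continuous)
        (hc.comp he.continuous.continuousOn fun _ h => h) fun z hz' => ?_).differentiableAt
        ((hW.preimage he.continuous).mem_nhds hp)
      refine DifferentiableAt.differentiableWithinAt (DifferentiableAt.comp z ?_ he.differentiableAt)
      exact hd.differentiableAt ((hW.sdiff hS).mem_nhds ⟨hz'.1, fun h => hz'.2 (hz z h)⟩)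
    have hg := hs.to_localInverse hw
    have hgp : hs.localInverse e (deriv e w) w hw (e w) = w :=
      HasStrictFDerivAt.localInverse_apply_image _
    have h2 : DifferentiableAt ℂ (f ∘ e ∘ hs.localInverse e (deriv e w) w hw) (e w) :=
      DifferentiableAt.comp (g := f ∘ e) _ (by rwa [hgp]) hg.hasDerivAt.differentiableAt
    refine h2.congr_of_eventuallyEq ?_
    have := HasStrictFDerivAt.eventually_right_inverse
      (hs.hasStrictFDerivAt_equiv hw)
    filter_upwards [this] with z hz
    exact congrArg f hz.symm
  · exact hd.differentiableAt ((hW.sdiff hS).mem_nhds ⟨hp, h0⟩)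

lemma isRemovable_imaginary : IsRemovable {ζ | ζ.re = 0} := by
  refine .of_chart (isClosed_eq continuous_re continuous_const) fun p hp =>
    ⟨fun z => I * z, -I * p, by fun_prop, ?_, ?_, fun z hz => ?_⟩
  · linear_combination -p * I_sq
  · rw [deriv_const_mul_id']; exact I_ne_zero
  · simpa using hz

lemma isRemovable_sphere (c : ℂ) {r : ℝ} (hr : 0 < r) : IsRemovable (Metric.sphere c r) := by
  have hr' : (r : ℂ) ≠ 0 := by exact_mod_cast hr.ne'
  refine .of_chart Metric.isClosed_sphere fun p hp => ?_
  have hpc : (p - c) / r ≠ 0 := by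
    refine div_ne_zero (sub_ne_zero.2 ?_) hr'
    rintro rfl
    simp [hr.ne] at hp
  have hd : ∀ z, HasDerivAt (fun z => c + r * exp (I * z)) (r * (exp (I * z) * I)) z := fun z => by
    have := (((hasDerivAt_id z).const_mul I).cexp.const_mul (r : ℂ)).const_add c
    simpa using this
  refine ⟨fun z => c + r * exp (I * z), -I * log ((p - c) / r), fun z => (hd z).differentiableAt,
    ?_, ?_, fun z hz => ?_⟩
  · beta_reduce
    rw [show I * (-I * log ((p - c) / r)) = log ((p - c) / r) by
      linear_combination -log ((p - c) / r) * I_sq, exp_log hpc]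
    field_simp
    ring
  · rw [(hd _).deriv]
    exact mul_ne_zero hr' (mul_ne_zero (exp_ne_zero _) I_ne_zero)
  · rw [mem_sphere_iff_norm, add_sub_cancel_left, norm_mul, norm_real, Real.norm_eq_abs,
      abs_of_pos hr, mul_eq_left₀ hr.ne', norm_exp] at hz
    simpa using hz

/-! ### A gluing form of Liouville's theorem -/

/-- Riemann's theorem removes every point of `Z`, since `g` grows more slowly there than a simple
pole; the extension is entire with limit `c` at infinity, hence constant by Liouville. -/
lemma eq_of_removable_singularities {g : ℂ → ℂ} {Z : Set ℂ} {c : ℂ} (hZ : IsClosed Z)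
    (hiso : ∀ p ∈ Z, ∀ᶠ z in 𝓝[≠] p, z ∉ Z) (hd : DifferentiableOn ℂ g Zᶜ)
    (hp : ∀ p ∈ Z, Tendsto (fun z => (z - p) * g z) (𝓝[≠] p) (𝓝 0))
    (hb : ∀ᶠ z in cobounded ℂ, z ∉ Z) (hc : Tendsto g (cobounded ℂ) (𝓝 c)) {ζ : ℂ} (hζ : ζ ∉ Z) :
    g ζ = c := by
  classical
  set G : ℂ → ℂ := fun z => if z ∈ Z then limUnder (𝓝[≠] z) g else g z with hG
  have hGd : Differentiable ℂ G := fun p => by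
    by_cases hpZ : p ∈ Z
    · obtain ⟨s, hs, hs'⟩ := mem_nhdsWithin_iff_exists_mem_nhds_inter.1 (hiso p hpZ)
      have hlit : (fun z => g z - g p) =o[𝓝[≠] p] fun z => (z - p)⁻¹ := by
        rw [Asymptotics.isLittleO_iff_tendsto']
        · have h1 := hp p hpZ
          have h2 : Tendsto (fun z : ℂ => (z - p) * g p) (𝓝[≠] p) (𝓝 0) := by
            have : Continuous fun z : ℂ => (z - p) * g p := by fun_prop
            simpa using (this.tendsto p).mono_left nhdsWithin_le_nhds
          have := h1.sub h2
          rw [sub_zero] at this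
          refine this.congr fun z => ?_
          rw [div_inv_eq_mul]; ring
        · filter_upwards [self_mem_nhdsWithin] with z hz h0
          exact absurd (sub_eq_zero.1 (inv_eq_zero.1 h0)) hz
      have := differentiableOn_update_limUnder_of_isLittleO hs
        (hd.mono fun z hz => hs' hz) hlit
      refine (this.differentiableAt hs).congr_of_eventuallyEq ?_
      filter_upwards [hs] with z hz
      by_cases hzp : z = p
      · subst hzp; simp [hG, hpZ]
      · have : z ∉ Z := hs' ⟨hz, hzp⟩
        simp [hG, this, hzp]
    · refine (hd.differentiableAt (hZ.isOpen_compl.mem_nhds hpZ)).congr_of_eventuallyEq ?_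
      filter_upwards [hZ.isOpen_compl.mem_nhds hpZ] with z hz using if_neg hz
  have hGc : Tendsto G (cocompact ℂ) (𝓝 c) := by
    rw [← Metric.cobounded_eq_cocompact]
    refine hc.congr' ?_
    filter_upwards [hb] with z hz using (if_neg hz).symm
  have := hGd.apply_eq_of_tendsto_cocompact ζ hGc
  simpa [hG, hζ] using this

/-- If `S` had interior points, complex conjugation, which is continuous and on that interior
vacuously holomorphic off `S`, would be holomorphic there. -/
lemma IsRemovable.dense_compl {S : Set ℂ} (h : IsRemovable S) : Dense Sᶜ := by
  rw [← interior_eq_empty_iff_dense_compl, eq_empty_iff_forall_notMem]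
  intro p hp
  have hd := (h.2 (interior S) (fun z => conj z) isOpen_interior continuous_conj.continuousOn
    fun z hz => absurd (interior_subset hz.1) hz.2).differentiableAt (isOpen_interior.mem_nhds hp)
  have h1 := hd.hasDerivAt
  set d := deriv (fun z : ℂ => conj z) p
  have e1 : HasDerivAt (fun s : ℝ => conj (p + s)) d 0 := by
    have h2 : HasDerivAt (fun s : ℝ => p + (s : ℂ)) 1 0 :=
      (ofRealCLM.hasDerivAt (x := (0 : ℝ))).const_add p
    have h3 : HasDerivAt (fun z : ℂ => conj z) d (p + ((0 : ℝ) : ℂ)) := by simpa using h1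
    have h4 := h3.comp (0 : ℝ) h2
    rwa [mul_one] at h4
  have e2 : HasDerivAt (fun s : ℝ => conj (p + s * I)) (d * I) 0 := by
    have h2 : HasDerivAt (fun s : ℝ => p + (s : ℂ) * I) I 0 := by
      simpa using ((ofRealCLM.hasDerivAt (x := (0 : ℝ))).mul_const I).const_add p
    have h3 : HasDerivAt (fun z : ℂ => conj z) d (p + ((0 : ℝ) : ℂ) * I) := by simpa using h1
    exact h3.comp (0 : ℝ) h2
  have f1 : HasDerivAt (fun s : ℝ => conj (p + s)) 1 0 := by
    simpa using (ofRealCLM.hasDerivAt (x := (0 : ℝ))).const_add (conj p)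
  have f2 : HasDerivAt (fun s : ℝ => conj (p + s * I)) (-I) 0 := by
    simpa using ((ofRealCLM.hasDerivAt (x := (0 : ℝ))).mul_const (-I)).const_add (conj p)
  have k1 := e1.unique f1
  have k2 := e2.unique f2
  rw [k1, one_mul] at k2
  have k3 := congrArg Complex.im k2
  norm_num at k3

/-- Off `F` the pieces agree where closures meet and glue to a function that is continuous off `F`
and the `E j`; removability of `S` makes it holomorphic there. The points of the `E j` are removable
by `hp`. Those of `F`, where no compatibility is assumed, are removable because finitely many
branches, each continuous, keep the function bounded. Liouville's theorem concludes. -/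
theorem eq_const_of_glue {ι : Type*} [Finite ι] [LinearOrder ι] {Ω E : ι → Set ℂ} {F S : Set ℂ}
    {y : ι → ℂ → ℂ} {c : ℂ} (hΩ : ∀ j, IsOpen (Ω j))
    (hdisj : ∀ j k, j ≠ k → Disjoint (Ω j) (Ω k)) (hS : IsRemovable S)
    (hcover : ∀ ζ ∉ S, ∃ j, ζ ∈ Ω j)
    (hE : ∀ j, IsClosed (E j)) (hEΩ : ∀ j, E j ⊆ Ω j) (hEb : ∀ j, ∀ᶠ z in cobounded ℂ, z ∉ E j)
    (hEi : ∀ j, ∀ p ∈ E j, ∀ᶠ z in 𝓝[≠] p, z ∉ E j) (hF : F.Finite) (hFΩ : ∀ p ∈ F, ∀ j, p ∉ Ω j)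
    (hd : ∀ j, DifferentiableOn ℂ (y j) (Ω j \ E j))
    (hcont : ∀ j, ContinuousOn (y j) (closure (Ω j) \ E j))
    (hp : ∀ j, ∀ p ∈ E j, Tendsto (fun z => (z - p) * y j z) (𝓝[≠] p) (𝓝 0))
    (hcompat : ∀ j k, j < k → ∀ ζ ∈ closure (Ω j) ∩ closure (Ω k), ζ ∉ F → y j ζ = y k ζ)
    (hinf : ∀ j, Tendsto (y j) (cobounded ℂ ⊓ 𝓟 (Ω j)) (𝓝 c)) :
    ∀ j, ∀ ζ ∈ closure (Ω j) \ E j, y j ζ = c := by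
  have hdc : ∀ j k, j ≠ k → ∀ ζ ∈ Ω j, ζ ∉ closure (Ω k) := fun j k hjk ζ h1 h2 =>
    Set.disjoint_left.1 ((hdisj j k hjk).closure_right (hΩ j)) h1 h2
  have hcl : ∀ ζ, ∃ j, ζ ∈ closure (Ω j) := fun ζ => by
    have h1 : ζ ∈ closure (⋃ j, Ω j) := closure_mono (fun z hz => mem_iUnion.2 (hcover z hz))
      (hS.dense_compl ζ)
    rwa [closure_iUnion_of_finite, mem_iUnion] at h1
  have hcompat' : ∀ j k, ∀ ζ ∈ closure (Ω j) ∩ closure (Ω k), ζ ∉ F → y j ζ = y k ζ :=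
    fun j k ζ hζ hn => by
      rcases lt_trichotomy j k with h | rfl | h
      · exact hcompat j k h ζ hζ hn
      · rfl
      · exact (hcompat k j h ζ hζ.symm hn).symm
  have hbranch : ∀ j, ∀ ζ ∈ closure (Ω j) \ E j, Tendsto (y j) (𝓝[Ω j] ζ) (𝓝 (y j ζ)) :=
    fun j ζ hζ => by
      refine (hcont j ζ hζ).mono_left ?_
      rw [nhdsWithin_le_iff]
      filter_upwards [self_mem_nhdsWithin, mem_nhdsWithin_of_mem_nhds
        ((hE j).isOpen_compl.mem_nhds hζ.2)] with z h1 h2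
      exact ⟨subset_closure h1, h2⟩
  -- At a point in several closures the choice of the branch is arbitrary; by `hcompat'` it matters
  -- only on `F`.
  choose J hJ using hcl
  set g : ℂ → ℂ := fun ζ => y (J ζ) ζ with hg
  set Z : Set ℂ := F ∪ ⋃ j, E j with hZ
  have hZc : IsClosed Z := hF.isClosed.union (isClosed_iUnion_of_finite hE)
  have hgy : ∀ j, ∀ ζ ∈ closure (Ω j), ζ ∉ F → g ζ = y j ζ := fun j ζ hζ hn =>
    hcompat' _ _ ζ ⟨hJ ζ, hζ⟩ hn
  have hEcl : ∀ j k, ∀ ζ ∈ closure (Ω j), ζ ∈ E k → j = k := fun j k ζ h1 h2 => by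
    by_contra hne
    exact hdc k j (Ne.symm hne) ζ (hEΩ k h2) h1
  have huniv : ⋃ j, closure (Ω j) = univ := eq_univ_of_forall fun ζ => mem_iUnion.2 ⟨_, hJ ζ⟩
  have hgcont : ContinuousOn g Zᶜ := fun ζ hζ => by
    refine ContinuousAt.continuousWithinAt ?_
    rw [ContinuousAt, ← nhdsWithin_univ, ← huniv, nhdsWithin_iUnion, tendsto_iSup]
    intro j
    by_cases hj : ζ ∈ closure (Ω j)
    · have hζE : ζ ∉ E j := fun h => hζ (Or.inr (mem_iUnion.2 ⟨j, h⟩))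
      have hζF : ζ ∉ F := fun h => hζ (Or.inl h)
      rw [hgy j ζ hj hζF]
      have h1 : Tendsto (y j) (𝓝[closure (Ω j)] ζ) (𝓝 (y j ζ)) := by
        refine (hcont j ζ ⟨hj, hζE⟩).mono_left ?_
        rw [nhdsWithin_le_iff]
        filter_upwards [self_mem_nhdsWithin, mem_nhdsWithin_of_mem_nhds
          ((hE j).isOpen_compl.mem_nhds hζE)] with z h1 h2
        exact ⟨h1, h2⟩
      refine h1.congr' ?_
      filter_upwards [self_mem_nhdsWithin, mem_nhdsWithin_of_mem_nhds
        (hF.isClosed.isOpen_compl.mem_nhds hζF)] with z h1 h2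
      exact (hgy j z h1 h2).symm
    · rw [show 𝓝[closure (Ω j)] ζ = ⊥ by
        rw [← notMem_closure_iff_nhdsWithin_eq_bot, closure_closure]; exact hj]
      exact tendsto_bot
  have hgd : DifferentiableOn ℂ g Zᶜ := by
    refine hS.2 _ g hZc.isOpen_compl hgcont fun ζ hζ => DifferentiableAt.differentiableWithinAt ?_
    obtain ⟨j, hj⟩ := hcover ζ hζ.2
    have hζE : ζ ∉ E j := fun h => hζ.1 (Or.inr (mem_iUnion.2 ⟨j, h⟩))
    have hζF : ζ ∉ F := fun h => hζ.1 (Or.inl h)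
    refine ((hd j).differentiableAt (((hΩ j).sdiff (hE j)).mem_nhds
      ⟨hj, hζE⟩)).congr_of_eventuallyEq ?_
    filter_upwards [(hΩ j).mem_nhds hj, hF.isClosed.isOpen_compl.mem_nhds hζF] with z h1 h2
    exact hgy j z (subset_closure h1) h2
  have hFiso : ∀ p, ∀ᶠ z in 𝓝[≠] p, z ∉ F := fun p => by
    have : (F \ {p})ᶜ ∈ 𝓝 p := (hF.sdiff).isClosed.isOpen_compl.mem_nhds fun h => h.2 rfl
    filter_upwards [self_mem_nhdsWithin, mem_nhdsWithin_of_mem_nhds this] with z h1 h2 h3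
    exact h2 ⟨h3, h1⟩
  have hEiso : ∀ p j, ∀ᶠ z in 𝓝[≠] p, z ∉ E j := fun p j => by
    by_cases hpj : p ∈ E j
    · exact hEi j p hpj
    · exact mem_nhdsWithin_of_mem_nhds ((hE j).isOpen_compl.mem_nhds hpj)
  have hziso : ∀ p, ∀ᶠ z in 𝓝[≠] p, z ∉ Z := fun p => by
    filter_upwards [hFiso p, eventually_all.2 (hEiso p)] with z h1 h2
    rintro (h | h)
    · exact h1 h
    · obtain ⟨j, hj⟩ := mem_iUnion.1 h; exact h2 j hj
  have hzp : ∀ p ∈ Z, Tendsto (fun z => (z - p) * g z) (𝓝[≠] p) (𝓝 0) := by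
    rintro p (hpF | hpE)
    · have hsplit : 𝓝[≠] p ≤ ⨆ j, 𝓝[closure (Ω j) ∩ {p}ᶜ] p := by
        rw [← nhdsWithin_iUnion, ← iUnion_inter, huniv, univ_inter]
      refine Tendsto.mono_left ?_ hsplit
      rw [tendsto_iSup]
      intro j
      by_cases hj : p ∈ closure (Ω j)
      · have hpE : p ∉ E j := fun h => hFΩ p hpF j (hEΩ j h)
        have h1 : Tendsto (y j) (𝓝[closure (Ω j) ∩ {p}ᶜ] p) (𝓝 (y j p)) := by
          refine (hcont j p ⟨hj, hpE⟩).mono_left ?_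
          rw [nhdsWithin_le_iff]
          filter_upwards [self_mem_nhdsWithin, mem_nhdsWithin_of_mem_nhds
            ((hE j).isOpen_compl.mem_nhds hpE)] with z h1 h2
          exact ⟨h1.1, h2⟩
        have h2 : Tendsto (fun z : ℂ => z - p) (𝓝[closure (Ω j) ∩ {p}ᶜ] p) (𝓝 0) := by
          have : Continuous fun z : ℂ => z - p := by fun_prop
          simpa using (this.tendsto p).mono_left nhdsWithin_le_nhds
        have h3 := h2.mul h1
        rw [zero_mul] at h3
        refine h3.congr' ?_
        filter_upwards [self_mem_nhdsWithin, nhdsWithin_mono p inter_subset_right (hFiso p)]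
          with z h1 h2
        rw [hgy j z h1.1 h2]
      · rw [show 𝓝[closure (Ω j) ∩ {p}ᶜ] p = ⊥ by
          rw [← notMem_closure_iff_nhdsWithin_eq_bot]
          exact fun h => hj (by simpa using closure_mono inter_subset_left h)]
        exact tendsto_bot
    · obtain ⟨j, hj⟩ := mem_iUnion.1 hpE
      refine (hp j p hj).congr' ?_
      filter_upwards [hFiso p, mem_nhdsWithin_of_mem_nhds ((hΩ j).mem_nhds (hEΩ j hj))] with z h1 h2
      rw [hgy j z (subset_closure h2) h1]
  have hzb : ∀ᶠ z in cobounded ℂ, z ∉ Z := by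
    have hFb : ∀ᶠ z in cobounded ℂ, z ∉ F := hF.isBounded
    filter_upwards [hFb, eventually_all.2 hEb] with z h1 h2
    rintro (h | h)
    · exact h1 h
    · obtain ⟨j, hj⟩ := mem_iUnion.1 h; exact h2 j hj
  -- `hinf` controls the branches only on the open regions. Contour points are limits of such points
  -- of almost the same modulus, so the estimate passes to them as a non-strict one, which is why it
  -- is taken with `δ / 2` and beyond `R + 1`.
  have hgc : Tendsto g (cobounded ℂ) (𝓝 c) := by
    rw [Metric.tendsto_nhds]
    intro δ hδ
    have h1 : ∀ j, ∀ᶠ z in cobounded ℂ, z ∈ Ω j → dist (y j z) c ≤ δ / 2 := fun j => by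
      have := (Metric.tendsto_nhds.1 (hinf j)) (δ / 2) (by positivity)
      rw [eventually_inf_principal] at this
      exact this.mono fun z h hz => (h hz).le
    obtain ⟨R, hR⟩ := (Filter.HasBasis.eventually_iff
      (hasBasis_cobounded_norm (E := ℂ))).1 (eventually_all.2 h1)
    have hR' := hR.2
    filter_upwards [hzb, (eventually_cobounded_le_norm (R + 1))] with z hz h2
    have hcz : z ∈ closure (Ω (J z)) \ E (J z) := ⟨hJ z, fun h => hz (Or.inr (mem_iUnion.2 ⟨_, h⟩))⟩
    have : (𝓝[Ω (J z)] z).NeBot := mem_closure_iff_nhdsWithin_neBot.1 (hJ z)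
    have h3 : dist (y (J z) z) c ≤ δ / 2 := by
      refine le_of_tendsto ((hbranch _ z hcz).dist tendsto_const_nhds) ?_
      have h4 : ∀ᶠ w in 𝓝 z, R < ‖w‖ :=
        continuous_norm.continuousAt.eventually (lt_mem_nhds (by linarith))
      filter_upwards [self_mem_nhdsWithin, mem_nhdsWithin_of_mem_nhds h4] with w hw hw'
      exact hR' hw'.le (J z) hw
    exact lt_of_le_of_lt h3 (by linarith)
  have hfin : ∀ ζ ∉ Z, g ζ = c := fun ζ hζ => 
    eq_of_removable_singularities hZc (fun p _ => hziso p) hgd hzp hzb hgc hζ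
  intro j ζ hζ
  have : (𝓝[Ω j] ζ).NeBot := mem_closure_iff_nhdsWithin_neBot.1 hζ.1
  refine tendsto_nhds_unique (hbranch j ζ hζ) (tendsto_const_nhds.congr' ?_)
  filter_upwards [self_mem_nhdsWithin, mem_nhdsWithin_of_mem_nhds
    ((hE j).isOpen_compl.mem_nhds hζ.2)] with z h1 h2
  have hzF : z ∉ F := fun h => hFΩ z h j h1
  rw [← hgy j z (subset_closure h1) hzF, hfin]
  rintro (h | h)
  · exact hzF h
  · obtain ⟨k, hk⟩ := mem_iUnion.1 h
    obtain rfl := hEcl j k z (subset_closure h1) hk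
    exact h2 hk

/-! ### The geometry of the deformed contour -/

lemma region_two (α ε : ℝ) : region α ε 2 = (fun ζ : ℂ => conj ζ) ⁻¹' region α ε 1 :=
  Set.ext fun _ => conj_mem_region.1

lemma region_three (α ε : ℝ) : region α ε 3 = (fun ζ : ℂ => conj ζ) ⁻¹' region α ε 0 :=
  Set.ext fun _ => conj_mem_region.2

lemma isOpen_region (α ε : ℝ) (j : Fin 4) : IsOpen (region α ε j) := by
  fin_cases j
  · exact isOpen_region_zero α ε
  · exact isOpen_region_one α ε
  · exact (region_two α ε).symm ▸ (isOpen_region_one α ε).preimage continuous_conj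
  · exact (region_three α ε).symm ▸ (isOpen_region_zero α ε).preimage continuous_conj

lemma disjoint_regions {α ε : ℝ} (j k : Fin 4) (h : j ≠ k) :
    Disjoint (region α ε j) (region α ε k) := by
  have h01 : Disjoint (region α ε 0) (region α ε 1) := disjoint_region
  have h23 : Disjoint (region α ε 2) (region α ε 3) := by
    rw [region_two, region_three]
    exact disjoint_region.symm.preimage _
  have hs : ∀ {S S' : Set ℂ}, (∀ z ∈ S, 0 < z.re * z.im) → (∀ z ∈ S', z.re * z.im < 0) →
      Disjoint S S' := fun h h' => Set.disjoint_left.2 fun z h1 h2 => lt_asymm (h z h1) (h' z h2)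
  have h02 : Disjoint (region α ε 0) (region α ε 2) := hs (fun z hz => hz.1) fun z hz => hz.1
  have h03 : Disjoint (region α ε 0) (region α ε 3) := hs (fun z hz => hz.1) fun z hz => hz.1
  have h12 : Disjoint (region α ε 1) (region α ε 2) := hs (fun z hz => hz.1) fun z hz => hz.1
  have h13 : Disjoint (region α ε 1) (region α ε 3) := hs (fun z hz => hz.1) fun z hz => hz.1
  fin_cases j <;> fin_cases k <;>
    first
    | exact absurd rfl h
    | assumption
    | (apply Disjoint.symm; assumption)

/-- A union of lines and circles that contains the deformed contour. -/
def contourHull (α ε : ℝ) : Set ℂ :=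
  (({ζ | ζ.im = 0} ∪ {ζ | ζ.re = 0}) ∪ Metric.sphere 0 (1 / √2)) ∪
    ⋃ p ∈ zerosPoles α, Metric.sphere p ε

lemma isRemovable_contourHull (α : ℝ) {ε : ℝ} (hε : 0 < ε) : IsRemovable (contourHull α ε) :=
  ((isRemovable_real.union isRemovable_imaginary).union
    (isRemovable_sphere 0 (by positivity))).union
      (.biUnion (finite_zerosPoles α) fun p _ => isRemovable_sphere p hε)

lemma exists_mem_region {α ε : ℝ} {ζ : ℂ} (h : ζ ∉ contourHull α ε) : ∃ j, ζ ∈ region α ε j := by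
  simp only [contourHull, mem_union, not_or, mem_ofPred_eq, mem_sphere_iff_norm, sub_zero,
    mem_iUnion, not_exists] at h
  obtain ⟨⟨⟨h1, h2⟩, h3⟩, h4⟩ := h
  have hp : ∀ p ∈ zerosPoles α, dist ζ p ≠ ε := fun p hp => by rw [dist_eq]; exact h4 p hp
  have key : (1 / √2 < ‖ζ‖ ∨ ∃ p ∈ zerosPoles α, dist ζ p < ε) ∨
      (‖ζ‖ < 1 / √2 ∧ ∀ p ∈ zerosPoles α, ε < dist ζ p) := by
    rcases lt_or_gt_of_ne h3 with h | h
    · by_cases hq : ∃ p ∈ zerosPoles α, dist ζ p < ε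
      · exact Or.inl (Or.inr hq)
      · push Not at hq
        exact Or.inr ⟨h, fun p h' => lt_of_le_of_ne (hq p h') (hp p h').symm⟩
    · exact Or.inl (Or.inl h)
  rcases lt_or_gt_of_ne (mul_ne_zero h2 h1) with h | h <;> rcases key with k | k
  · exact ⟨3, h, k⟩
  · exact ⟨2, h, k⟩
  · exact ⟨0, h, k⟩
  · exact ⟨1, h, k⟩

/-- The origin and the points where the axes meet the circle. -/
def corners : Set ℂ := {ζ | ζ.re * ζ.im = 0 ∧ (ζ = 0 ∨ ‖ζ‖ = 1 / √2)}

lemma finite_corners : corners.Finite := by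
  refine (Set.toFinite {0, ((1 / √2 : ℝ) : ℂ), ((-(1 / √2) : ℝ) : ℂ), ((1 / √2 : ℝ) : ℂ) * I,
    ((-(1 / √2) : ℝ) : ℂ) * I}).subset ?_
  rintro ζ ⟨h, rfl | h1⟩
  · simp
  · rcases mul_eq_zero.1 h with h0 | h0
    · have e : ζ = (ζ.im : ℂ) * I := by apply Complex.ext <;> simp [h0]
      rw [e, norm_mul, norm_I, mul_one, norm_real, Real.norm_eq_abs] at h1
      rw [e]
      rcases eq_or_eq_neg_of_abs_eq h1 with h2 | h2 <;> rw [h2] <;> simp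
    · have e : ζ = (ζ.re : ℂ) := by apply Complex.ext <;> simp [h0]
      rw [e, norm_real, Real.norm_eq_abs] at h1
      rw [e]
      rcases eq_or_eq_neg_of_abs_eq h1 with h2 | h2 <;> rw [h2] <;> simp

lemma not_mem_region_of_axes {α ε : ℝ} {ζ : ℂ} (h : ζ.re * ζ.im = 0) (j : Fin 4) :
    ζ ∉ region α ε j := by
  intro hj
  fin_cases j
  · exact hj.1.ne' h
  · exact hj.1.ne' h
  · exact hj.1.ne h
  · exact hj.1.ne h

/-- The points at which some column may have a pole. -/
def poleSet (Ω : Fin 4 → Set ℂ) (a d : ℂ → ℂ) (j : Fin 4) : Set ℂ :=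
  poles Ω a d j 0 ∪ poles Ω a d j 1

lemma poles_subset (Ω : Fin 4 → Set ℂ) (a d : ℂ → ℂ) (j : Fin 4) (c : Fin 2) :
    poles Ω a d j c ⊆ poleSet Ω a d j := by
  fin_cases c
  · exact subset_union_left
  · exact subset_union_right

lemma poleSet_zero (Ω : Fin 4 → Set ℂ) (a d : ℂ → ℂ) : poleSet Ω a d 0 = {ζ | ζ ∈ Ω 0 ∧ a ζ = 0} :=
  union_empty _

lemma poleSet_one (Ω : Fin 4 → Set ℂ) (a d : ℂ → ℂ) : poleSet Ω a d 1 = {ζ | ζ ∈ Ω 1 ∧ d ζ = 0} :=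
  union_empty _

lemma poleSet_two (Ω : Fin 4 → Set ℂ) (a d : ℂ → ℂ) :
    poleSet Ω a d 2 = (fun ζ : ℂ => conj ζ) ⁻¹' poleSet Ω a d 1 := by
  rw [poleSet_one]; exact empty_union _

lemma poleSet_three (Ω : Fin 4 → Set ℂ) (a d : ℂ → ℂ) :
    poleSet Ω a d 3 = (fun ζ : ℂ => conj ζ) ⁻¹' poleSet Ω a d 0 := by
  rw [poleSet_zero]; exact empty_union _

lemma tendsto_conj_cobounded : Tendsto (fun ζ : ℂ => conj ζ) (cobounded ℂ) (cobounded ℂ) := by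
  rw [← tendsto_norm_atTop_iff_cobounded]
  simpa using tendsto_norm_cobounded_atTop (E := ℂ)

lemma tendsto_conj_punctured (p : ℂ) :
    Tendsto (fun ζ : ℂ => conj ζ) (𝓝[≠] p) (𝓝[≠] (conj p)) := by
  refine tendsto_nhdsWithin_iff.2
    ⟨(continuous_conj.tendsto p).mono_left nhdsWithin_le_nhds, ?_⟩
  filter_upwards [self_mem_nhdsWithin] with z hz h
  exact hz ((starRingEnd ℂ).injective h)

/-! ### The Wronskian of rows of two solutions -/

/-- The bilinear form `v₀ w₁ - v₁ w₀` of the row `i` of `N` and the row `l` of `M`. -/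
def wronskian (N M : Matrix (Fin 2) (Fin 2) ℂ) (i l : Fin 2) : ℂ := N i 0 * M l 1 - N i 1 * M l 0

lemma wronskian_mul (N M A : Matrix (Fin 2) (Fin 2) ℂ) (hA : A.det = 1) (i l : Fin 2) :
    wronskian (N * A) (M * A) i l = wronskian N M i l := by
  rw [Matrix.det_fin_two] at hA
  simp only [wronskian, Matrix.mul_apply, Fin.sum_univ_two]
  linear_combination (N i 0 * M l 1 - N i 1 * M l 0) * hA

/-- By `h'` the determinant of `M` is one, so a row of `N` is a combination of the rows of `M` whose
coefficients are its Wronskians with them. By `h` these are the same as for the corresponding row of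
`M`. -/
lemma eq_of_wronskian {N M : Matrix (Fin 2) (Fin 2) ℂ}
    (h : ∀ i l, wronskian N M i l = wronskian 1 1 i l)
    (h' : ∀ i l, wronskian M M i l = wronskian 1 1 i l) : N = M := by
  have hM := h' 0 1
  have h00 := h 0 0
  have h01 := h 0 1
  have h10 := h 1 0
  have h11 := h 1 1
  simp [wronskian] at hM h00 h01 h10 h11
  ext i c
  fin_cases i <;> fin_cases c <;> simp
  · linear_combination M 0 0 * h01 - M 1 0 * h00 - N 0 0 * hM
  · linear_combination M 0 1 * h01 - M 1 1 * h00 - N 0 1 * hM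
  · linear_combination M 0 0 * h11 - M 1 0 * h10 - N 1 0 * hM
  · linear_combination M 0 1 * h11 - M 1 1 * h10 - N 1 1 * hM

/-- Both residues are the same multiple `c` of the other column, so the simple poles cancel in the
antisymmetric expression. -/
lemma tendsto_of_residues {f₀ f₁ g₀ g₁ : ℂ → ℂ} {p c : ℂ} (hf : HasSimpleResidue f₀ p (c * f₁ p))
    (hg : HasSimpleResidue g₀ p (c * g₁ p)) (hf₁ : ContinuousAt f₁ p) (hg₁ : ContinuousAt g₁ p) :
    Tendsto (fun z => (z - p) * (f₀ z * g₁ z - f₁ z * g₀ z)) (𝓝[≠] p) (𝓝 0) := by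
  have h1 := hf.mul (hg₁.tendsto.mono_left (nhdsWithin_le_nhds (s := {p}ᶜ)))
  have h2 := (hf₁.tendsto.mono_left (nhdsWithin_le_nhds (s := {p}ᶜ))).mul hg
  have h3 := h1.sub h2
  rw [show c * f₁ p * g₁ p - f₁ p * (c * g₁ p) = 0 by ring] at h3
  exact h3.congr fun z => by ring

namespace IsRHSolution

variable {Ω : Fin 4 → Set ℂ} {a b d Γ : ℂ → ℂ} {x t : ℝ} {M N : Fin 4 → ℂ → Matrix (Fin 2) (Fin 2) ℂ}

lemma continuousAt (h : IsRHSolution Ω a b d Γ x t M) {j : Fin 4} {c : Fin 2} (hΩ : IsOpen (Ω j))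
    (hp : poles Ω a d j c = ∅) {p : ℂ} (hpΩ : p ∈ Ω j) (i : Fin 2) :
    ContinuousAt (fun ζ => M j ζ i c) p := by
  have := h.holomorphic j i c
  rw [hp, sdiff_empty] at this
  exact (this.differentiableAt (hΩ.mem_nhds hpΩ)).continuousAt

lemma tendsto_wronskian_pole (hM : IsRHSolution Ω a b d Γ x t M) (hN : IsRHSolution Ω a b d Γ x t N)
    (hΩ : ∀ j, IsOpen (Ω j)) (hΩ2 : ∀ z, z ∈ Ω 2 ↔ conj z ∈ Ω 1) (hΩ3 : ∀ z, z ∈ Ω 3 ↔ conj z ∈ Ω 0)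
    (i l : Fin 2) (j : Fin 4) {p : ℂ}
    (hp : p ∈ poleSet Ω a d j) :
    Tendsto (fun z => (z - p) * wronskian (N j z) (M j z) i l) (𝓝[≠] p) (𝓝 0) := by
  fin_cases j
  · obtain ⟨h1, h2⟩ : p ∈ Ω 0 ∧ a p = 0 := by simpa [poleSet_zero] using hp
    exact tendsto_of_residues (f₀ := fun z => N 0 z i 0) (f₁ := fun z => N 0 z i 1)
      (g₀ := fun z => M 0 z l 0) (g₁ := fun z => M 0 z l 1)
      (hN.residue1 p h1 h2 i) (hM.residue1 p h1 h2 l)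
      (hN.continuousAt (hΩ 0) rfl h1 i) (hM.continuousAt (hΩ 0) rfl h1 l)
  · obtain ⟨h1, h2⟩ : p ∈ Ω 1 ∧ d p = 0 := by simpa [poleSet_one] using hp
    obtain ⟨r, hr, hr'⟩ := hN.residue3 p h1 h2
    obtain ⟨s, hs, hs'⟩ := hM.residue3 p h1 h2
    obtain rfl : r = s := tendsto_nhds_unique hr hs
    exact tendsto_of_residues (f₀ := fun z => N 1 z i 0) (f₁ := fun z => N 1 z i 1)
      (g₀ := fun z => M 1 z l 0) (g₁ := fun z => M 1 z l 1) (hr' i) (hs' l)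
      (hN.continuousAt (hΩ 1) rfl h1 i) (hM.continuousAt (hΩ 1) rfl h1 l)
  · obtain ⟨h1, h2⟩ : conj p ∈ Ω 1 ∧ d (conj p) = 0 := by
      simpa [poleSet_two, poleSet_one] using hp
    obtain ⟨r, hr, hr'⟩ := hN.residue4 _ h1 h2
    obtain ⟨s, hs, hs'⟩ := hM.residue4 _ h1 h2
    obtain rfl : r = s := tendsto_nhds_unique hr hs
    rw [Complex.conj_conj] at hr' hs'
    have hpΩ := (hΩ2 p).2 h1
    have := (tendsto_of_residues (f₀ := fun z => N 2 z i 1) (f₁ := fun z => N 2 z i 0)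
      (g₀ := fun z => M 2 z l 1) (g₁ := fun z => M 2 z l 0) (hr' i) (hs' l)
      (hN.continuousAt (hΩ 2) rfl hpΩ i) (hM.continuousAt (hΩ 2) rfl hpΩ l)).neg
    rw [neg_zero] at this
    change Tendsto (fun z => (z - p) * wronskian (N 2 z) (M 2 z) i l) _ _
    exact this.congr fun z => by simp only [wronskian]; ring
  · obtain ⟨h1, h2⟩ : conj p ∈ Ω 0 ∧ a (conj p) = 0 := by
      simpa [poleSet_three, poleSet_zero] using hp
    have r1 := hN.residue2 _ h1 h2 i
    have r2 := hM.residue2 _ h1 h2 l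
    rw [Complex.conj_conj] at r1 r2
    have hpΩ := (hΩ3 p).2 h1
    have := (tendsto_of_residues (f₀ := fun z => N 3 z i 1) (f₁ := fun z => N 3 z i 0)
      (g₀ := fun z => M 3 z l 1) (g₁ := fun z => M 3 z l 0) r1 r2
      (hN.continuousAt (hΩ 3) rfl hpΩ i) (hM.continuousAt (hΩ 3) rfl hpΩ l)).neg
    rw [neg_zero] at this
    change Tendsto (fun z => (z - p) * wronskian (N 3 z) (M 3 z) i l) _ _
    exact this.congr fun z => by simp only [wronskian]; ring

lemma tendsto_entry (h : IsRHSolution Ω a b d Γ x t M) (j : Fin 4) (i c : Fin 2) :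
    Tendsto (fun ζ => M j ζ i c) (cobounded ℂ ⊓ 𝓟 (Ω j))
      (𝓝 ((1 : Matrix (Fin 2) (Fin 2) ℂ) i c)) :=
  tendsto_sub_nhds_zero_iff.1
    ((h.normalization j i c).trans_tendsto (tendsto_inv_cobounded inf_le_left))

end IsRHSolution

namespace IsSpectralData

variable {α ε : ℝ} {T : EReal} {u : ℝ → ℝ → ℂ} {a b : ℂ → ℂ} {x t : ℝ}
  {M N : Fin 4 → ℂ → Matrix (Fin 2) (Fin 2) ℂ}

/-- The poles are zeros of `a` or `calD₀`, which are continuous on the closed region without zeros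
on its boundary: the set is closed. Simplicity of the zeros makes it discrete, and it avoids
infinity because `a → 1` there while the inner regions are bounded. -/
lemma poleSet_props (h : IsSpectralData α T u a b) (hε : IsAdmissible α ε a b) (j : Fin 4) :
    IsClosed (poleSet (region α ε) a (calD α a b) j) ∧
    poleSet (region α ε) a (calD α a b) j ⊆ region α ε j ∧
    (∀ᶠ z in cobounded ℂ, z ∉ poleSet (region α ε) a (calD α a b) j) ∧
    ∀ p ∈ poleSet (region α ε) a (calD α a b) j, ∀ᶠ z in 𝓝[≠] p,
      z ∉ poleSet (region α ε) a (calD α a b) j := by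
  have h0 : IsClosed (poleSet (region α ε) a (calD α a b) 0) := by
    have : poleSet (region α ε) a (calD α a b) 0 = closure (region α ε 0) ∩ a ⁻¹' {0} := by
      rw [poleSet_zero]
      ext ζ
      refine ⟨fun hz => ⟨subset_closure hz.1, hz.2⟩, fun hz => ?_⟩
      by_contra hc
      exact h.a_ne_zero hε hz.1 hc hz.2
    rw [this]
    exact (h.a_cont.mono fun z hz => (closure_region_zero hz).1).preimage_isClosed_of_isClosed
      isClosed_closure isClosed_singleton
  have h1 : IsClosed (poleSet (region α ε) a (calD α a b) 1) := by
    have : poleSet (region α ε) a (calD α a b) 1 =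
        closure (region α ε 1) ∩ calD₀ α a b ⁻¹' {0} := by
      rw [poleSet_one]
      ext ζ
      refine ⟨fun hz => ⟨subset_closure hz.1, ?_⟩, fun hz => ?_⟩
      · rw [mem_preimage, calD₀, if_neg (ne_zero_of_mem_open hz.1.1)]; exact hz.2
      · by_contra hc
        exact h.calD₀_ne_zero hε hz.1 hc hz.2
    rw [this]
    exact ContinuousOn.preimage_isClosed_of_isClosed (fun z hz =>
      (h.calD₀_continuousWithinAt (closure_region_one hz).1
        (nDen_ne_zero (not_mem_zerosPoles hε hz))).mono fun z hz => (closure_region_one hz).1)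
      isClosed_closure isClosed_singleton
  have b0 : ∀ᶠ z in cobounded ℂ, z ∉ poleSet (region α ε) a (calD α a b) 0 := by
    have := h.tendsto_a (l := cobounded ℂ ⊓ 𝓟 closedQuadrants) inf_le_left
      (mem_inf_of_right (mem_principal_self _))
    have := this.eventually_ne one_ne_zero
    rw [eventually_inf_principal] at this
    filter_upwards [this] with z hz hz'
    rw [poleSet_zero] at hz'
    exact hz (openQuadrants_subset hz'.1.1) hz'.2
  have b1 : ∀ᶠ z in cobounded ℂ, z ∉ poleSet (region α ε) a (calD α a b) 1 := by
    filter_upwards [eventually_cobounded_le_norm (1 / √2)] with z hz hz'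
    rw [poleSet_one] at hz'
    exact absurd hz'.1.2.1 hz.not_gt
  have i0 : ∀ p ∈ poleSet (region α ε) a (calD α a b) 0, ∀ᶠ z in 𝓝[≠] p,
      z ∉ poleSet (region α ε) a (calD α a b) 0 := fun p hp => by
    rw [poleSet_zero] at hp ⊢
    filter_upwards [(h.a_diff.differentiableAt
      (isOpen_openQuadrants.mem_nhds hp.1.1)).hasDerivAt.eventually_ne (c := 0)
      (h.a_simple p (Or.inl (mem_D_zero hε hp.1 hp.2)) hp.2)] with z hz hz'
    exact hz hz'.2
  have i1 : ∀ p ∈ poleSet (region α ε) a (calD α a b) 1, ∀ᶠ z in 𝓝[≠] p,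
      z ∉ poleSet (region α ε) a (calD α a b) 1 := fun p hp => by
    rw [poleSet_one] at hp ⊢
    filter_upwards [(differentiableAt_calD h.a_diff h.b_diff hp.1.1
      (nDen_ne_zero (not_mem_zerosPoles hε (subset_closure hp.1)))).hasDerivAt.eventually_ne (c := 0)
      (h.d_simple p (mem_D_one hp.1) hp.2)] with z hz hz'
    exact hz hz'.2
  have s0 : poleSet (region α ε) a (calD α a b) 0 ⊆ region α ε 0 := by
    rw [poleSet_zero]; exact fun z hz => hz.1
  have s1 : poleSet (region α ε) a (calD α a b) 1 ⊆ region α ε 1 := by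
    rw [poleSet_one]; exact fun z hz => hz.1
  fin_cases j
  · exact ⟨h0, s0, b0, i0⟩
  · exact ⟨h1, s1, b1, i1⟩
  · change IsClosed (poleSet _ _ _ 2) ∧ poleSet _ _ _ 2 ⊆ region _ _ 2 ∧
      (∀ᶠ z in _, z ∉ poleSet _ _ _ 2) ∧ ∀ p ∈ poleSet _ _ _ 2, ∀ᶠ z in _, z ∉ poleSet _ _ _ 2
    rw [poleSet_two, region_two]
    exact ⟨h1.preimage continuous_conj, preimage_mono s1, tendsto_conj_cobounded.eventually b1,
      fun p hp => (tendsto_conj_punctured p).eventually (i1 _ hp)⟩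
  · change IsClosed (poleSet _ _ _ 3) ∧ poleSet _ _ _ 3 ⊆ region _ _ 3 ∧
      (∀ᶠ z in _, z ∉ poleSet _ _ _ 3) ∧ ∀ p ∈ poleSet _ _ _ 3, ∀ᶠ z in _, z ∉ poleSet _ _ _ 3
    rw [poleSet_three, region_three]
    exact ⟨h0.preimage continuous_conj, preimage_mono s0, tendsto_conj_cobounded.eventually b0,
      fun p hp => (tendsto_conj_punctured p).eventually (i0 _ hp)⟩

lemma det_J4_eq_one (h : IsSpectralData α T u a b) {ζ : ℂ} (hζ : ζ.re * ζ.im = 0) :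
    (J4 a b x t ζ).det = 1 := by
  have hζ' : (conj ζ).re * (conj ζ).im = 0 := by rw [re_mul_im_conj, hζ, neg_zero]
  exact det_J4 (h.a_contour ζ ⟨hζ.symm.le, Or.inl hζ⟩)
    (by simpa using h.a_contour _ ⟨hζ'.symm.le, Or.inl hζ'⟩) (h.det_eq_one hζ)

lemma det_J1 (Γ : ℂ → ℂ) (x t : ℝ) (ζ : ℂ) : (J1 Γ x t ζ).det = 1 := by
  simp [J1, Matrix.det_fin_two_of]

lemma det_J3 (Γ : ℂ → ℂ) (x t : ℝ) (ζ : ℂ) : (J3 Γ x t ζ).det = 1 := by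
  simp [J3, Matrix.det_fin_two_of]

lemma det_J2_eq_one (h : IsSpectralData α T u a b) (Γ : ℂ → ℂ) {ζ : ℂ} (hζ : ζ.re * ζ.im = 0) :
    (J2 a b Γ x t ζ).det = 1 := by
  rw [J2, Matrix.det_mul, Matrix.det_mul, det_J1, det_J3, Matrix.det_nonsing_inv,
    h.det_J4_eq_one hζ, Ring.inverse_one, mul_one, mul_one]

/-- No jump is prescribed between an outer region and the opposite inner one; this confines their
contact to the finite set on which compatibility is not required. -/
lemma mem_corners (hε : IsAdmissible α ε a b) {ζ : ℂ} (h0 : ζ ∈ closure (region α ε 0))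
    (h1 : conj ζ ∈ closure (region α ε 1)) : ζ ∈ corners := by
  obtain ⟨q0, h0⟩ := closure_region_zero h0
  obtain ⟨q1, h1, -⟩ := closure_region_one h1
  have hax := mem_axes q0 q1
  rw [norm_conj] at h1
  refine ⟨hax, Or.inr (le_antisymm h1 (h0.resolve_right ?_))⟩
  rintro ⟨p, hp, hd⟩
  exact hε.off_axes p hp ζ hd hax

lemma conj_mem_corners {ζ : ℂ} (h : conj ζ ∈ corners) : ζ ∈ corners := by
  obtain ⟨h1, h2⟩ := h
  rw [re_mul_im_conj, neg_eq_zero] at h1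
  exact ⟨h1, by simpa using h2⟩

lemma wronskian_compat (h : IsSpectralData α T u a b) (hε : IsAdmissible α ε a b)
    (hM : IsRHSolution (region α ε) a b (calD α a b) (gammaTilde α a b) x t M)
    (hN : IsRHSolution (region α ε) a b (calD α a b) (gammaTilde α a b) x t N) (i l : Fin 2)
    (j k : Fin 4) (hjk : j < k) {ζ : ℂ} (hζ : ζ ∈ closure (region α ε j) ∩ closure (region α ε k))
    (hc : ζ ∉ corners) : wronskian (N j ζ) (M j ζ) i l = wronskian (N k ζ) (M k ζ) i l := by
  have hne : ζ ≠ 0 := fun h0 => hc ⟨by simp [h0], Or.inl h0⟩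
  have h01 : ζ ∈ closure (region α ε 0) ∩ closure (region α ε 1) →
      wronskian (N 0 ζ) (M 0 ζ) i l = wronskian (N 1 ζ) (M 1 ζ) i l := fun hζ => by
    rw [hM.jump1 ζ hζ, hN.jump1 ζ hζ, wronskian_mul _ _ _ (det_J1 _ _ _ _)]
  have h02 : ζ ∈ closure (region α ε 0) ∩ closure (region α ε 2) →
      wronskian (N 0 ζ) (M 0 ζ) i l = wronskian (N 2 ζ) (M 2 ζ) i l := fun hζ =>
    absurd (mem_corners hε hζ.1 (conj_mem_closure_region.1.1 hζ.2)) hc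
  have h03 : ζ ∈ closure (region α ε 0) ∩ closure (region α ε 3) →
      wronskian (N 0 ζ) (M 0 ζ) i l = wronskian (N 3 ζ) (M 3 ζ) i l := fun hζ => by
    have hax := mem_axes (closure_region_zero hζ.1).1
      (closure_region_zero (conj_mem_closure_region.2.1 hζ.2)).1
    rw [hM.jump4 ζ hζ.symm, hN.jump4 ζ hζ.symm, wronskian_mul _ _ _ (h.det_J4_eq_one hax)]
  have h12 : ζ ∈ closure (region α ε 1) ∩ closure (region α ε 2) →
      wronskian (N 1 ζ) (M 1 ζ) i l = wronskian (N 2 ζ) (M 2 ζ) i l := fun hζ => by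
    have hax := mem_axes (closure_region_one hζ.1).1
      (closure_region_one (conj_mem_closure_region.1.1 hζ.2)).1
    rw [hM.jump2 ζ hζ hne, hN.jump2 ζ hζ hne, wronskian_mul _ _ _ (h.det_J2_eq_one _ hax)]
  have h13 : ζ ∈ closure (region α ε 1) ∩ closure (region α ε 3) →
      wronskian (N 1 ζ) (M 1 ζ) i l = wronskian (N 3 ζ) (M 3 ζ) i l := fun hζ =>
    absurd (conj_mem_corners (mem_corners hε (conj_mem_closure_region.2.1 hζ.2)
      (by simpa using hζ.1))) hc
  have h23 : ζ ∈ closure (region α ε 2) ∩ closure (region α ε 3) →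
      wronskian (N 2 ζ) (M 2 ζ) i l = wronskian (N 3 ζ) (M 3 ζ) i l := fun hζ => by
    rw [hM.jump3 ζ hζ, hN.jump3 ζ hζ, wronskian_mul _ _ _ (det_J3 _ _ _ _)]
  fin_cases j <;> fin_cases k <;>
    first
    | exact absurd hjk (by decide)
    | exact h01 hζ
    | exact h02 hζ
    | exact h03 hζ
    | exact h12 hζ
    | exact h13 hζ
    | exact h23 hζ

lemma wronskian_eq (h : IsSpectralData α T u a b) (hε : IsAdmissible α ε a b)
    (hM : IsRHSolution (region α ε) a b (calD α a b) (gammaTilde α a b) x t M)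
    (hN : IsRHSolution (region α ε) a b (calD α a b) (gammaTilde α a b) x t N) (i l : Fin 2)
    (j : Fin 4) {ζ : ℂ}
    (hζ : ζ ∈ closure (region α ε j) \ poleSet (region α ε) a (calD α a b) j) :
    wronskian (N j ζ) (M j ζ) i l = wronskian 1 1 i l := by
  have hsub : ∀ (S : Set ℂ) (j : Fin 4) (c : Fin 2),
      S \ poleSet (region α ε) a (calD α a b) j ⊆ S \ poles (region α ε) a (calD α a b) j c :=
    fun S j c => sdiff_subset_sdiff_right (poles_subset _ _ _ j c)
  refine eq_const_of_glue (Ω := region α ε) (E := poleSet (region α ε) a (calD α a b))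
    (F := corners) (y := fun j ζ => wronskian (N j ζ) (M j ζ) i l) (isOpen_region α ε)
    disjoint_regions (isRemovable_contourHull α hε.pos) (fun ζ hζ => exists_mem_region hζ)
    (fun j => (h.poleSet_props hε j).1) (fun j => (h.poleSet_props hε j).2.1)
    (fun j => (h.poleSet_props hε j).2.2.1) (fun j => (h.poleSet_props hε j).2.2.2) finite_corners
    (fun p hp j => not_mem_region_of_axes hp.1 j) (fun j => ?_) (fun j => ?_)
    (fun j p hp => hM.tendsto_wronskian_pole hN (isOpen_region α ε) (fun z => conj_mem_region.1)
      (fun z => conj_mem_region.2) i l j hp)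
    (fun j k hjk ζ hζ hc => h.wronskian_compat hε hM hN i l j k hjk hζ hc) (fun j => ?_) j ζ hζ
  · exact (((hN.holomorphic j i 0).mono (hsub _ j 0)).mul
      ((hM.holomorphic j l 1).mono (hsub _ j 1))).sub
      (((hN.holomorphic j i 1).mono (hsub _ j 1)).mul ((hM.holomorphic j l 0).mono (hsub _ j 0)))
  · exact (((hN.continuous j i 0).mono (hsub _ j 0)).mul
      ((hM.continuous j l 1).mono (hsub _ j 1))).sub
      (((hN.continuous j i 1).mono (hsub _ j 1)).mul ((hM.continuous j l 0).mono (hsub _ j 0)))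
  · exact ((hN.tendsto_entry j i 0).mul (hM.tendsto_entry j l 1)).sub
      ((hN.tendsto_entry j i 1).mul (hM.tendsto_entry j l 0))

theorem rhSolution_unique (h : IsSpectralData α T u a b) (hε : IsAdmissible α ε a b)
    (hM : IsRHSolution (region α ε) a b (calD α a b) (gammaTilde α a b) x t M)
    (hN : IsRHSolution (region α ε) a b (calD α a b) (gammaTilde α a b) x t N) (j : Fin 4)
    (i c : Fin 2) {ζ : ℂ}
    (hζ : ζ ∈ closure (region α ε j) \ poles (region α ε) a (calD α a b) j c) :
    N j ζ i c = M j ζ i c := by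
  have key : ∀ z ∈ closure (region α ε j) \ poleSet (region α ε) a (calD α a b) j, N j z = M j z :=
    fun z hz => eq_of_wronskian (fun i l => h.wronskian_eq hε hM hN i l j hz)
      fun i l => h.wronskian_eq hε hM hM i l j hz
  obtain ⟨-, hsub, -, hiso⟩ := h.poleSet_props hε j
  -- The Wronskian argument yields equality only where both columns are regular. At a pole of the
  -- other column, the regular one is recovered as a limit.
  by_cases hp : ζ ∈ poleSet (region α ε) a (calD α a b) j
  · have hev : ∀ᶠ z in 𝓝[≠] ζ, z ∈ closure (region α ε j) \ poleSet (region α ε) a (calD α a b) j := by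
      filter_upwards [hiso ζ hp, mem_nhdsWithin_of_mem_nhds
        ((isOpen_region α ε j).mem_nhds (hsub hp))] with z h1 h2
      exact ⟨subset_closure h2, h1⟩
    have hle : 𝓝[≠] ζ ≤ 𝓝[closure (region α ε j) \ poles (region α ε) a (calD α a b) j c] ζ := by
      refine le_inf nhdsWithin_le_nhds (le_principal_iff.2 ?_)
      filter_upwards [hev] with z hz
      exact ⟨hz.1, fun hz' => hz.2 (poles_subset _ _ _ j c hz')⟩
    refine tendsto_nhds_unique ((hN.continuous j i c ζ hζ).mono_left hle)
      (((hM.continuous j i c ζ hζ).mono_left hle).congr' ?_)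
    filter_upwards [hev] with z hz
    rw [key z hz]
  · rw [key ζ ⟨hζ.1, hp⟩]

end IsSpectralData

/-! ### Reconstruction -/

lemma norm_coefficient (u : ℝ → ℝ → ℂ) (x t : ℝ) : ‖coefficient u x t‖ ^ 2 = ‖dx u x t‖ ^ 2 / 4 := by
  have h : ‖exp (-(2 * I * phase (fun y => dx u y t) x))‖ = 1 := by
    rw [norm_exp]; simp
  rw [coefficient, norm_neg, norm_mul, norm_mul, h, norm_div, norm_I, Complex.norm_ofNat]
  ring

/-- With this identity the reconstruction formula is the fundamental theorem of calculus for `u` on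
`(x, ∞)`. -/
lemma coefficient_mul_exp (u : ℝ → ℝ → ℂ) (x t : ℝ) :
    2 * I * coefficient u x t * exp (2 * I * phase (fun y => dx u y t) x) = dx u x t := by
  have h := conj_mul_exp (2 * I * phase (fun y => dx u y t) x)
  rw [coefficient]
  linear_combination -I ^ 2 * dx u x t * h - dx u x t * I_sq

/-- The function `φ` is the phase itself: `2|m|² = |u_x|²/2` is its space derivative, and by the
conservation law `-2 ∫_x^∞ (|m|²)_t = (|u_x|² - |u|²)/2` is its time derivative. -/
theorem IsHalfLineSolution.reconstructs {α : ℝ} {T : EReal} {u : ℝ → ℝ → ℂ}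
    (h : IsHalfLineSolution α T u) : Reconstructs T (coefficient u) u := by
  refine ⟨fun x t => phase (fun y => dx u y t) x,
    fun x t => (2 * inner ℝ (dx u x t) (dt (dx u) x t)) / 4, phase_zero _, fun x t hx ht => ?_⟩
  obtain ⟨C, hC⟩ := h.potential ht
  have hd : ∀ y ∈ Ici x, HasDerivAt (fun y => u y t) (dx u y t) y := fun y _ =>
    (contDiff_dx h.reg.smooth).2 y t
  have hint : IntegrableOn (fun y => dx u y t) (Ioi x) := by
    refine Integrable.mono' ((integrable_inv_one_add_sq.const_mul C).integrableOn)
      (continuous_slice h.smooth_dx t).aestronglyMeasurable ?_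
    filter_upwards [ae_restrict_mem measurableSet_Ioi] with y hy
    exact hC.bound y (hx.trans (le_of_lt hy))
  refine ⟨?_, ?_, ?_, ?_, ?_, ?_⟩
  · simp only [norm_coefficient]
    exact ((h.hasDerivAt_norm_sq x t).div_const 4).hasDerivWithinAt
  · exact ((h.flux_integrable ht).mono_set (Ioi_subset_Ioi hx)).div_const 4
  · rw [norm_coefficient]
    exact ((hasDerivAt_phase hC.cont x).congr_deriv (by ring)).hasDerivWithinAt
  · rw [integral_div, h.integral_flux hx ht]
    exact ((h.hasDerivAt_phase_time hx ht).congr_deriv (by ring)).hasDerivWithinAt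
  · simp only [coefficient_mul_exp]
    exact hint
  · simp only [coefficient_mul_exp]
    rw [integral_Ioi_of_hasDerivAt_of_tendsto' hd hint (h.tendsto_zero ht).1]
    ring

end GNLS

/-! ### The theorem. -/

theorem theorem5p1 (α : ℝ) (T : EReal) (hT : 0 < T) (u : ℝ → ℝ → ℂ) (u₀ : ℝ → ℂ)
    (hreg : GNLS.SmoothDecaying T u)
    (heq : GNLS.SolvesEquation T u)
    (hinit : ∀ x : ℝ, 0 < x → u x 0 = u₀ x)
    (hbdry : ∀ t : ℝ, 0 ≤ t → (t : EReal) < T →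
      GNLS.dx u 0 t = Complex.exp (Complex.I * α) * u 0 t)
    (a b : ℂ → ℂ) (ha : a = GNLS.specA u₀) (hb : b = GNLS.specB u₀)
    (ha_simple : ∀ ζ ∈ GNLS.D 0 ∪ GNLS.D 1, a ζ = 0 → deriv a ζ ≠ 0)
    (hD_simple : ∀ ζ ∈ GNLS.D 1, GNLS.calD α a b ζ = 0 → deriv (GNLS.calD α a b) ζ ≠ 0)
    (h_disjoint : ∀ ζ ∈ GNLS.D 1, a ζ = 0 → GNLS.calD α a b ζ ≠ 0)
    (ha_contour : ∀ ζ ∈ GNLS.contour, a ζ ≠ 0)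
    (hD_contour : ∀ ζ ∈ GNLS.contour, ζ ≠ 0 → ζ ∉ GNLS.zerosPoles α →
      GNLS.calD α a b ζ ≠ 0) :
    ∃ ε₀ : ℝ, 0 < ε₀ ∧ ∀ ε : ℝ, 0 < ε → ε < ε₀ →
      ∃ (M : ℝ → ℝ → Fin 4 → ℂ → Matrix (Fin 2) (Fin 2) ℂ) (m : ℝ → ℝ → ℂ),
        (∀ x t : ℝ, 0 ≤ x → t ∈ GNLS.timeInterval T →
          GNLS.IsUniqueRHSolution (GNLS.region α ε) a b (GNLS.calD α a b)
              (GNLS.gammaTilde α a b) x t (M x t) ∧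
            GNLS.IsCoefficientAtInfinity (GNLS.region α ε) x (M x t) (m x t)) ∧
        GNLS.Reconstructs T m u := by
  have hsol := GNLS.isHalfLineSolution hT hreg heq hbdry
  obtain ⟨C, hC⟩ := hsol.potential hsol.zero_mem
  -- The datum agrees with `u` only on the open half-line, so the derivatives are compared only
  -- there; the integrals defining `a` and `b` see nothing else.
  have hu₀ : ∀ x : ℝ, 0 < x → deriv u₀ x = GNLS.dx u x 0 := fun x hx => by
    refine Filter.EventuallyEq.deriv_eq ?_
    filter_upwards [lt_mem_nhds hx] with y hy using (hinit y hy).symm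
  have h : GNLS.IsSpectralData α T u a b :=
    { sol := hsol
      a_eq := fun ζ hζ => by rw [ha, (GNLS.spec_eq_jost hC hu₀ hζ).2, GNLS.column_apply]
      b_eq := fun ζ hζ => by rw [hb, (GNLS.spec_eq_jost hC hu₀ hζ).1, GNLS.column_apply]
      a_contour := ha_contour
      d_contour := hD_contour
      a_simple := ha_simple
      d_simple := hD_simple
      disjoint := h_disjoint }
  obtain ⟨ε₀, h0, hε₀⟩ := GNLS.exists_admissible h.a_diff h.b_diff ha_contour hD_contour
  refine ⟨ε₀, h0, fun ε hε hε' => ?_⟩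
  have hadm := hε₀ ε hε hε'
  -- Dummy values outside the half-strip allow `U` and `V` to be chosen as functions of all real `x`
  -- and `t`.
  have key : ∀ x t : ℝ, ∃ U V, 0 ≤ x → t ∈ GNLS.timeInterval T → GNLS.IsTransport α u x t U V :=
    fun x t => by
      by_cases hxt : 0 ≤ x ∧ t ∈ GNLS.timeInterval T
      · obtain ⟨U, V, hUV⟩ := hsol.exists_transport hxt.1 hxt.2
        exact ⟨U, V, fun _ _ => hUV⟩
      · exact ⟨fun _ => 0, fun _ => 0, fun hx ht => absurd ⟨hx, ht⟩ hxt⟩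
  choose U V hUV using key
  refine ⟨fun x t => GNLS.rhSol α u a b (U x t) (V x t) x t, GNLS.coefficient u,
    fun x t hx ht => ?_, hsol.reconstructs⟩
  have hRH := h.isRHSolution hadm (hUV x t hx ht) hx ht
  exact ⟨⟨hRH, fun N hN j i c ζ hζ => h.rhSolution_unique hadm hRH hN j i c hζ⟩,
    h.isCoefficientAtInfinity (hUV x t hx ht) hx ht⟩
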